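/- **Setting.** Let $x_{t+1}=Ax_t+B(\theta)u_t+w_t$, $x_0=0$, with $x_t\in\mathbb R^{d_x}$, $u_t\in\mathbb R^{d_u}$, $\theta\in\mathbb R^{d_\theta}$, $A$ known and $\operatorname{vec}B(\theta)=L\theta+\operatorname{vec}B_0$. The noise $(w_t)$ is i.i.d. with a density $p\in C^1(\mathbb R^{d_x})$ that is centered and has finite second moments and finite Fisher information $\int\nabla\log p\,(\nabla\log p)^\top p$. Let $Q\succ0$, $R\succ0$, and suppose that the nominal parameter $\theta$ is stabilizable: $\rho(A-B(\theta)F)<1$ for some matrix $F$. A policy $\pi$ chooses $u_t$ as a measurable function of $x_0,\dots,x_t$ and of an auxiliary randomization independent of the noise. Let $V_T^\pi(\theta')=\sum_{t=0}^{T-1}\mathbf E^\pi_{\theta'}[x_t^\top Qx_t+u_t^\top Ru_t]\in[0,\infty]$, and let $R_T^\pi(\theta')=V_T^\pi(\theta')-V_T^*(\theta')$, where $V^*_T(\theta')$ is the cost of the optimal policy of horizon $T$ given by the Riccati recursion. Let $P(\theta')\succeq 0$ be the solution of the algebraic Riccati equation $$P=Q+A^\top PA-A^\top PB(R+B^\top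 PB)^{-1}B^\top PA,\qquad B=B(\theta'),$$ and $K(\theta')=-(R+B^\top PB)^{-1}B^\top PA$ the optimal stationary gain ($u=K(\theta')x$); $\mathsf D_\theta\operatorname{vec}K$ is the Jacobian matrix of $\theta\mapsto\operatorname{vec}K(\theta)$. Let $\mathcal I^{N}(\theta')$ be the Fisher information about the parameter in the observations $(x_0,\dots,x_{N+1},u_0,\dots,u_N)$ under $\pi$ (the expected outer product of the score of the likelihood $\prod_{t=0}^{N}p(x_{t+1}-Ax_t-B(\theta')u_t)$). For a density $\lambda$ let $\mathcal J(\lambda)=\int\nabla\log\lambda\,(\nabla\log\lambda)^\top\lambda$. A subscript $\theta'\sim\lambda$ means that the parameter is drawn from $\lambda$. Put $$A^T_k=\Big\{\sum_{t=k\lceil\sqrt T\rceil}^{(k+1)\lfloor\sqrt T\rfloor}x_tx_t^\top\succeq\sqrt T\,\Gamma\Big\}.$$ **Lemma.** Let $\Gamma\succ0$. There is a constant $C>0$, depending only on the instance $(\theta,A,L,B_0,Q,R,p)$ and on $\Gamma$, such that the following holds for every $\varepsilon>0$, every probability density $\lambda\in C_c^\infty[B(\theta,\varepsilon)]$, every matrix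 $\Psi\succeq0$, every integer $T\ge1$ and every policy $\pi$ with $\mathbf E^\pi_{\theta'\sim\lambda}\|u_t\|^2<\infty$ for all $t$: $$ \begin{aligned} \sup_{\theta'\in B(\theta,\varepsilon)}R_T^\pi(\theta')\ \ge\ \sum_{k=1}^{\lfloor\sqrt{T-1}\rfloor}\big[\mathbf P^\pi_{\theta'\sim\lambda}(A_k^T)\big]^2\operatorname{tr}\Big(&\big(\Gamma\otimes[R+B^\top(\theta)P(\theta)B(\theta)+E_{1,k}]\big)\big(\mathsf D_\theta\operatorname{vec}K(\theta)+E_{2,k}\big)\\ &\times\sqrt T\,\big(\mathbf E^\pi_{\theta'\sim\lambda}\mathcal I^{(k+1)\lfloor\sqrt T\rfloor}(\theta')+\mathcal J(\lambda)+\Psi\big)^{-1}\big(\mathsf D_\theta\operatorname{vec}K(\theta)+E_{2,k}\big)^\top\Big)-C \end{aligned} $$ for some matrices $E_{1,k}$, $E_{2,k}$ that are $O(\varepsilon)$, in the sense that all their entries are at most $C\varepsilon$ in absolute value. -/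

import Mathlib

open MeasureTheory ProbabilityTheory Matrix
open scoped ENNReal Kronecker

noncomputable section

namespace LQR

/-- `n`-dimensional Euclidean space. -/
abbrev Euc (n : ℕ) := EuclideanSpace ℝ (Fin n)

/-- Matrix-vector product, on Euclidean spaces. -/
def mv {m n : ℕ} (M : Matrix (Fin m) (Fin n) ℝ) (v : Euc n) : Euc m :=
  WithLp.toLp 2 (M *ᵥ v.ofLp)

/-- The quadratic form `vᵀ M v`. -/
def quad {n : ℕ} (M : Matrix (Fin n) (Fin n) ℝ) (v : Euc n) : ℝ :=
  v.ofLp ⬝ᵥ (M *ᵥ v.ofLp)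

/-- The Jacobian matrix of `f` at `θ`; the rows are indexed by the components of `f`. -/
def jacobian {n : ℕ} {ι : Type*} (f : Euc n → ι → ℝ) (θ : Euc n) : Matrix ι (Fin n) ℝ :=
  Matrix.of fun i l => fderiv ℝ (fun ϑ => f ϑ i) θ (EuclideanSpace.single l 1)

/-- The location Fisher information `J(q) = ∫ ∇ log q (∇ log q)ᵀ q` of a density `q`. -/
def locationInfo {n : ℕ} (q : Euc n → ℝ) : Matrix (Fin n) (Fin n) ℝ :=
  Matrix.of fun i j => ∫ y, gradient (fun z => Real.log (q z)) y i
    * gradient (fun z => Real.log (q z)) y j * q y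

/-- `lam` is a smooth probability density with compact support inside the open set `U`. -/
structure IsPrior {n : ℕ} (U : Set (Euc n)) (lam : Euc n → ℝ) : Prop where
  smooth : ContDiff ℝ (⊤ : ℕ∞) lam
  compact : HasCompactSupport lam
  support : tsupport lam ⊆ U
  nonneg : ∀ y, 0 ≤ lam y
  mass : ∫ y, lam y = 1

/-- The data of a parametrized linear quadratic regulator, apart from the nominal parameter. -/
structure System (dx du dθ : ℕ) where
  A : Matrix (Fin dx) (Fin dx) ℝ
  L : Matrix (Fin du × Fin dx) (Fin dθ) ℝ
  B₀ : Matrix (Fin dx) (Fin du) ℝ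
  Q : Matrix (Fin dx) (Fin dx) ℝ
  R : Matrix (Fin du) (Fin du) ℝ
  p : Euc dx → ℝ

variable {dx du dθ : ℕ}

/-- The input matrix `B(θ)`, given by `vec B(θ) = L θ + vec B₀` (columns are stacked). -/
def System.B (S : System dx du dθ) (θ : Euc dθ) : Matrix (Fin dx) (Fin du) ℝ :=
  Matrix.of fun i j => (S.L *ᵥ θ.ofLp) (j, i) + S.B₀ i j

theorem System.vec_B (S : System dx du dθ) (θ : Euc dθ) :
    (S.B θ).vec = S.L *ᵥ θ.ofLp + S.B₀.vec := by
  ext ⟨j, i⟩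
  rfl

/-- `p` is a continuously differentiable, centered probability density with finite second
moments and finite Fisher information. -/
structure IsNoiseDensity {n : ℕ} (p : Euc n → ℝ) : Prop where
  contDiff : ContDiff ℝ 1 p
  nonneg : ∀ y, 0 ≤ p y
  mass : ∫ y, p y = 1
  moment : Integrable fun y => ‖y‖ ^ 2 * p y
  centered : ∫ y, p y • y = 0
  info : Integrable fun y => ‖gradient (fun z => Real.log (p z)) y‖ ^ 2 * p y

/-- The spectral radius (over `ℂ`) of a real matrix is smaller than one. -/
def IsStable {n : ℕ} (M : Matrix (Fin n) (Fin n) ℝ) : Prop :=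
  spectralRadius ℂ (M.map (algebraMap ℝ ℂ)) < 1

/-- The standing assumptions at the nominal parameter `θ`: noise density, strongly convex cost,
stabilizability at `θ`. (That `B` is affine in `θ` is built into `System`.) -/
structure System.IsInstance (S : System dx du dθ) (θ : Euc dθ) : Prop where
  noise : IsNoiseDensity S.p
  Q_posDef : S.Q.PosDef
  R_posDef : S.R.PosDef
  stabilizable : ∃ F : Matrix (Fin du) (Fin dx) ℝ, IsStable (S.A - S.B θ * F)

/-- `R + B(θ)ᵀ P B(θ)`. -/
def System.hess (S : System dx du dθ) (θ : Euc dθ) (P : Matrix (Fin dx) (Fin dx) ℝ) :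
    Matrix (Fin du) (Fin du) ℝ :=
  S.R + (S.B θ)ᵀ * P * S.B θ

/-- One step of the Riccati recursion. -/
def System.riccati (S : System dx du dθ) (θ : Euc dθ) (P : Matrix (Fin dx) (Fin dx) ℝ) :
    Matrix (Fin dx) (Fin dx) ℝ :=
  S.Q + S.Aᵀ * P * S.A - S.Aᵀ * P * S.B θ * (S.hess θ P)⁻¹ * (S.B θ)ᵀ * P * S.A

/-- The feedback gain `-(R + Bᵀ P B)⁻¹ Bᵀ P A` that minimizes the one-step cost when the
cost-to-go is the quadratic form of `P`. -/
def System.gain (S : System dx du dθ) (θ : Euc dθ) (P : Matrix (Fin dx) (Fin dx) ℝ) :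
    Matrix (Fin du) (Fin dx) ℝ :=
  -((S.hess θ P)⁻¹ * (S.B θ)ᵀ * P * S.A)

/-- The Riccati recursion started at `0`: `S.riccatiIter θ n` is the quadratic form of the optimal
cost-to-go with `n` stages left. -/
def System.riccatiIter (S : System dx du dθ) (θ : Euc dθ) : ℕ → Matrix (Fin dx) (Fin dx) ℝ
  | 0 => 0
  | n + 1 => S.riccati θ (S.riccatiIter θ n)

open Classical in
/-- `P(θ)`: the positive semidefinite solution of the algebraic Riccati equation (it is unique
when the system is stabilizable at `θ` and `Q`, `R` are positive definite). -/
def System.P (S : System dx du dθ) (θ : Euc dθ) : Matrix (Fin dx) (Fin dx) ℝ :=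
  if h : ∃ P : Matrix (Fin dx) (Fin dx) ℝ, P.PosSemidef ∧ S.riccati θ P = P then h.choose else 0

/-- `K(θ)`: the optimal stationary gain; the optimal stationary policy is `u = K(θ) x`. -/
def System.K (S : System dx du dθ) (θ : Euc dθ) : Matrix (Fin du) (Fin dx) ℝ :=
  S.gain θ (S.P θ)

/-- A policy with auxiliary randomization in `Ξ`: the input at time `t` is a measurable function
of the states `x_0, …, x_t` and of the randomization. -/
structure Policy (dx du : ℕ) (Ξ : Type*) [MeasurableSpace Ξ] where
  act : (t : ℕ) → (Fin (t + 1) → Euc dx) → Ξ → Euc du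
  measurable_act : ∀ t, Measurable fun z : (Fin (t + 1) → Euc dx) × Ξ => act t z.1 z.2

/-- On `(Ω, μ)` the `w t` are independent with common density `p`, and the auxiliary
randomization `ξ` is independent of the noise sequence. -/
structure IsNoise {Ω Ξ : Type*} [MeasurableSpace Ω] [MeasurableSpace Ξ] (μ : Measure Ω)
    (p : Euc dx → ℝ) (w : ℕ → Ω → Euc dx) (ξ : Ω → Ξ) : Prop where
  measurable_w : ∀ t, Measurable (w t)
  measurable_ξ : Measurable ξ
  law : ∀ t, μ.map (w t) = volume.withDensity fun y => ENNReal.ofReal (p y)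
  iIndep : iIndepFun w μ
  indep : IndepFun ξ (fun ω t => w t ω) μ

section Trajectory

variable {Ω Ξ : Type*} [MeasurableSpace Ω] [MeasurableSpace Ξ]

/-- The states `(x_0, …, x_t)` under the parameter `θ` and the policy `π`:
`x_0 = 0`, `x_{t+1} = A x_t + B(θ) u_t + w_t`. -/
def System.history (S : System dx du dθ) (w : ℕ → Ω → Euc dx) (ξ : Ω → Ξ) (π : Policy dx du Ξ)
    (θ : Euc dθ) (ω : Ω) : (t : ℕ) → Fin (t + 1) → Euc dx
  | 0 => fun _ => 0
  | t + 1 =>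
      Fin.snoc (α := fun _ => Euc dx) (S.history w ξ π θ ω t)
        (mv S.A (S.history w ξ π θ ω t (Fin.last t))
          + mv (S.B θ) (π.act t (S.history w ξ π θ ω t) (ξ ω)) + w t ω)

/-- The state `x_t`. -/
def System.state (S : System dx du dθ) (w : ℕ → Ω → Euc dx) (ξ : Ω → Ξ) (π : Policy dx du Ξ)
    (θ : Euc dθ) (t : ℕ) (ω : Ω) : Euc dx :=
  S.history w ξ π θ ω t (Fin.last t)

/-- The input `u_t`. -/
def System.input (S : System dx du dθ) (w : ℕ → Ω → Euc dx) (ξ : Ω → Ξ) (π : Policy dx du Ξ)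
    (θ : Euc dθ) (t : ℕ) (ω : Ω) : Euc du :=
  π.act t (S.history w ξ π θ ω t) (ξ ω)

theorem System.state_zero (S : System dx du dθ) (w : ℕ → Ω → Euc dx) (ξ : Ω → Ξ)
    (π : Policy dx du Ξ) (θ : Euc dθ) (ω : Ω) : S.state w ξ π θ 0 ω = 0 := rfl

theorem System.state_succ (S : System dx du dθ) (w : ℕ → Ω → Euc dx) (ξ : Ω → Ξ)
    (π : Policy dx du Ξ) (θ : Euc dθ) (t : ℕ) (ω : Ω) :
    S.state w ξ π θ (t + 1) ω =
      mv S.A (S.state w ξ π θ t ω) + mv (S.B θ) (S.input w ξ π θ t ω) + w t ω := by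
  simp [System.state, System.input, System.history]

/-- The cumulative cost `V_T^π(θ)`, with values in `[0, ∞]`. -/
def System.cost (S : System dx du dθ) (μ : Measure Ω) (w : ℕ → Ω → Euc dx) (ξ : Ω → Ξ)
    (π : Policy dx du Ξ) (T : ℕ) (θ : Euc dθ) : ℝ≥0∞ :=
  ∑ t ∈ Finset.range T,
    ∫⁻ ω, ENNReal.ofReal (quad S.Q (S.state w ξ π θ t ω) + quad S.R (S.input w ξ π θ t ω)) ∂μ

theorem measurable_mv {m n : ℕ} (M : Matrix (Fin m) (Fin n) ℝ) : Measurable (mv M) := by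
  have h : Continuous (mv M) := by
    unfold mv
    fun_prop
  exact h.measurable

/-- The optimal policy for horizon `T` at the parameter `θ`: with `T - t` stages left the gain is
computed from the cost-to-go with `T - t - 1` stages left. -/
def System.optPolicy (S : System dx du dθ) (Ξ : Type*) [MeasurableSpace Ξ] (T : ℕ) (θ : Euc dθ) :
    Policy dx du Ξ where
  act t x _ := mv (S.gain θ (S.riccatiIter θ (T - t - 1))) (x (Fin.last t))
  measurable_act t :=
    (measurable_mv _).comp ((measurable_pi_apply (Fin.last t)).comp measurable_fst)

/-- The regret `R_T^π(θ)`, with the value `⊤` when the cost of `π` is infinite. -/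
def System.regret (S : System dx du dθ) (μ : Measure Ω) (w : ℕ → Ω → Euc dx) (ξ : Ω → Ξ)
    (π : Policy dx du Ξ) (T : ℕ) (θ : Euc dθ) : EReal :=
  (S.cost μ w ξ π T θ : EReal) - (S.cost μ w ξ (S.optPolicy Ξ T θ) T θ : EReal)

/-- The score at `θ` of the observation `(x_0, …, x_{N+1}, u_0, …, u_N)` generated under `θ`: the
gradient at `ϑ = θ` of the log-likelihood `log ∏_{t ≤ N} p (x_{t+1} - A x_t - B(ϑ) u_t)` (the
factors of the joint law which come from the policy do not depend on the parameter). -/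
def System.score (S : System dx du dθ) (w : ℕ → Ω → Euc dx) (ξ : Ω → Ξ) (π : Policy dx du Ξ)
    (N : ℕ) (θ : Euc dθ) (ω : Ω) : Euc dθ :=
  gradient (fun ϑ => Real.log (∏ t ∈ Finset.range (N + 1),
    S.p (S.state w ξ π θ (t + 1) ω - mv S.A (S.state w ξ π θ t ω)
      - mv (S.B ϑ) (S.input w ξ π θ t ω)))) θ

/-- The Fisher information `I^N(θ)` about the parameter in `(x_0, …, x_{N+1}, u_0, …, u_N)`. -/
def System.fisherInfo (S : System dx du dθ) (μ : Measure Ω) (w : ℕ → Ω → Euc dx) (ξ : Ω → Ξ)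
    (π : Policy dx du Ξ) (N : ℕ) (θ : Euc dθ) : Matrix (Fin dθ) (Fin dθ) ℝ :=
  Matrix.of fun i j => ∫ ω, S.score w ξ π N θ ω i * S.score w ξ π N θ ω j ∂μ

/-- The Fisher information averaged over the prior `lam`. -/
def System.bayesInfo (S : System dx du dθ) (μ : Measure Ω) (w : ℕ → Ω → Euc dx) (ξ : Ω → Ξ)
    (π : Policy dx du Ξ) (lam : Euc dθ → ℝ) (N : ℕ) : Matrix (Fin dθ) (Fin dθ) ℝ :=
  Matrix.of fun i j => ∫ θ, lam θ * S.fisherInfo μ w ξ π N θ i j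

/-- The event that `∑ x_t x_tᵀ - √T Γ` is positive semidefinite, where `t` runs over
`k ⌈√T⌉ ≤ t ≤ (k + 1) ⌊√T⌋`. -/
def System.gramEvent (S : System dx du dθ) (w : ℕ → Ω → Euc dx) (ξ : Ω → Ξ) (π : Policy dx du Ξ)
    (Γ : Matrix (Fin dx) (Fin dx) ℝ) (T k : ℕ) (θ : Euc dθ) : Set Ω :=
  {ω | ((∑ t ∈ Finset.Icc (k * ⌈√(T : ℝ)⌉₊) ((k + 1) * ⌊√(T : ℝ)⌋₊),
      vecMulVec (S.state w ξ π θ t ω).ofLp (S.state w ξ π θ t ω).ofLp)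
        - √(T : ℝ) • Γ).PosSemidef}

/-- The probability of the `k`-th Gramian event when the parameter is drawn from `lam`. -/
def System.bayesProb (S : System dx du dθ) (μ : Measure Ω) (w : ℕ → Ω → Euc dx) (ξ : Ω → Ξ)
    (π : Policy dx du Ξ) (lam : Euc dθ → ℝ) (Γ : Matrix (Fin dx) (Fin dx) ℝ) (T k : ℕ) : ℝ :=
  ∫ θ, lam θ * μ.real (S.gramEvent w ξ π Γ T k θ)

/-- Under the prior `lam` every input is square integrable. -/
def System.FiniteInputs (S : System dx du dθ) (μ : Measure Ω) (w : ℕ → Ω → Euc dx) (ξ : Ω → Ξ)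
    (π : Policy dx du Ξ) (lam : Euc dθ → ℝ) : Prop :=
  ∀ t, ∫⁻ θ, ENNReal.ofReal (lam θ) * ∫⁻ ω, ‖S.input w ξ π θ t ω‖ₑ ^ 2 ∂μ < ⊤

end Trajectory

end LQR

end

/-! Regret is read as an estimation error. Completing the square in the one-step cost
(`one_step_identity`) shows that the regret at `ϑ` is, up to boundary terms, the sum over `t` of the
expected values of `quad H (u_t - K(ϑ) x_t)`, where `H = R + Bᵀ P B`. A policy of small regret
therefore reveals the gain `K(ϑ)`: on a window where `∑ x xᵀ ⪰ √T Γ`, the least squares fit `F` of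
the inputs on the states satisfies `√T vec(F - K)ᵀ (Γ ⊗ H) vec(F - K) ≤ ∑ quad H (u_t - K x_t)`
(`sum_quad_lsFit_le`, `le_sum_quad_mv`). The van Trees inequality (`System.van_trees`), weighted by
the indicator of the Gramian event, bounds the Bayesian mean of the left side from below. The
Jacobian that enters is the average of `DK` over the prior on the event, that is `P(A_k) (DK(θ) +
O(ε))`; this is where the squared probability comes from. Summing over the windows and bounding the
Bayesian average by the supremum gives the inequality (`System.sum_trace_le`).

The constant `C` may depend on neither `T`, `ε` nor the policy. With `M` the supremum of the regret,
all errors are kept below `b (1 + ε M)`. The part `b ε M` is harmless: the averaged Jacobians are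
multiplied by `f` with `f² (1 + b ε) = 1`, an `O(ε)` change absorbed in `E₂`, so that `E₁ = 0`
suffices. For `ε` bounded away from zero, `E₂ = -DK(θ)` makes the whole sum vanish.

The errors to control are these. The optimal gains of a finite horizon are not stationary; the
Riccati recursion converges geometrically, so outside the last `tailLength`, of order `1/ε`, stages
the discrepancy is a relative error `ε` (`sum_deviation_le`). In those last stages the inputs are
replaced by `K(θ) x`, which differs from `K(ϑ) x` by `O(ε²) ‖x‖²` in squared norm. The Hessian at
`ϑ` is compared with the nominal one at relative cost `O(ε)`. Closed windows `[km, (k+1)m]` share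
endpoints, where a deviation must not be charged twice; there the input is replaced by an estimated
gain applied to the state, the estimate coming from the preceding window, and the Lyapunov
contraction across one window decouples the estimation error from the size of the state
(`sum_loss_le`, `sum_virtual_le`). The total error of these estimates is `O(1 + ε M)` because the
noise alone excites the states (`measureReal_gram_failure_le`, `sum_integral_frob_fit_le`).

The window with `k = ⌊√T⌋` may end after the horizon, where the regret controls nothing. Its term is
bounded differently: each of the `⌊√T⌋` estimates available inside the horizon obeys the van Trees
bound with the larger information of that window, so `⌊√T⌋` times its trace is at most the total
estimation error (`trace_terminal_le`).

Around `θ` everything is uniform because `P(ϑ)` depends smoothly on `ϑ`: the derivative of the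
Riccati equation in `P` is a Stein operator with a stable closed loop, hence invertible, and the
implicit function theorem applies (`exists_smooth_solution`, `exists_localBounds`). -/

noncomputable section

namespace LQR

open Filter Topology

set_option linter.unusedSectionVars false

/-! ### Matrices acting on Euclidean spaces, and quadratic forms -/

section LinearAlgebra

variable {m n k : ℕ}

theorem mv_add (M : Matrix (Fin m) (Fin n) ℝ) (v w : Euc n) : mv M (v + w) = mv M v + mv M w := by
  ext i; simp [mv, Matrix.mulVec_add]

theorem mv_sub (M : Matrix (Fin m) (Fin n) ℝ) (v w : Euc n) : mv M (v - w) = mv M v - mv M w := by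
  ext i; simp [mv, Matrix.mulVec_sub]

theorem mv_smul (M : Matrix (Fin m) (Fin n) ℝ) (c : ℝ) (v : Euc n) :
    mv M (c • v) = c • mv M v := by
  ext i; simp [mv, Matrix.mulVec_smul]

theorem add_mv (M N : Matrix (Fin m) (Fin n) ℝ) (v : Euc n) : mv (M + N) v = mv M v + mv N v := by
  ext i; simp [mv, Matrix.add_mulVec]

theorem sub_mv (M N : Matrix (Fin m) (Fin n) ℝ) (v : Euc n) : mv (M - N) v = mv M v - mv N v := by
  ext i; simp [mv, Matrix.sub_mulVec]

theorem neg_mv (M : Matrix (Fin m) (Fin n) ℝ) (v : Euc n) : mv (-M) v = -mv M v := by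
  ext i; simp [mv, Matrix.neg_mulVec]

theorem smul_mv (c : ℝ) (M : Matrix (Fin m) (Fin n) ℝ) (v : Euc n) :
    mv (c • M) v = c • mv M v := by
  ext i; simp [mv, Matrix.smul_mulVec]

theorem mv_mv (M : Matrix (Fin m) (Fin n) ℝ) (N : Matrix (Fin n) (Fin k) ℝ) (v : Euc k) :
    mv M (mv N v) = mv (M * N) v := by
  ext i; simp [mv, Matrix.mulVec_mulVec]

theorem one_mv (v : Euc n) : mv (1 : Matrix (Fin n) (Fin n) ℝ) v = v := by
  ext i; simp [mv]

theorem mv_apply (M : Matrix (Fin m) (Fin n) ℝ) (v : Euc n) (i : Fin m) :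
    mv M v i = ∑ j, M i j * v j := by
  simp [mv, Matrix.mulVec, dotProduct]

theorem continuous_mv (M : Matrix (Fin m) (Fin n) ℝ) : Continuous (mv M) := by
  unfold mv; fun_prop

theorem inner_eq_dotProduct (v w : Euc n) : inner ℝ v w = v.ofLp ⬝ᵥ w.ofLp := by
  simp [PiLp.inner_apply, dotProduct, mul_comm]

theorem quad_eq_inner (M : Matrix (Fin n) (Fin n) ℝ) (v : Euc n) :
    quad M v = inner ℝ v (mv M v) := by
  rw [inner_eq_dotProduct]; rfl

theorem inner_mv_left (M : Matrix (Fin m) (Fin n) ℝ) (v : Euc n) (w : Euc m) :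
    inner ℝ (mv M v) w = inner ℝ v (mv Mᵀ w) := by
  simp only [inner_eq_dotProduct, mv, Matrix.mulVec_transpose]
  rw [dotProduct_comm, Matrix.dotProduct_mulVec, dotProduct_comm]

theorem inner_mv_right (M : Matrix (Fin m) (Fin n) ℝ) (v : Euc n) (w : Euc m) :
    inner ℝ w (mv M v) = inner ℝ (mv Mᵀ w) v := by
  rw [real_inner_comm, inner_mv_left, real_inner_comm]

theorem quad_zero_left (v : Euc n) : quad (0 : Matrix (Fin n) (Fin n) ℝ) v = 0 := by
  simp [quad]

theorem quad_zero_right (M : Matrix (Fin n) (Fin n) ℝ) : quad M 0 = 0 := by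
  simp [quad]

theorem quad_neg_right (M : Matrix (Fin n) (Fin n) ℝ) (v : Euc n) : quad M (-v) = quad M v := by
  simp [quad, Matrix.mulVec_neg]

theorem quad_add_left (M N : Matrix (Fin n) (Fin n) ℝ) (v : Euc n) :
    quad (M + N) v = quad M v + quad N v := by
  simp only [quad_eq_inner, add_mv, inner_add_right]

theorem quad_sub_left (M N : Matrix (Fin n) (Fin n) ℝ) (v : Euc n) :
    quad (M - N) v = quad M v - quad N v := by
  simp only [quad_eq_inner, sub_mv, inner_sub_right]

theorem quad_smul_left (c : ℝ) (M : Matrix (Fin n) (Fin n) ℝ) (v : Euc n) :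
    quad (c • M) v = c * quad M v := by
  simp only [quad_eq_inner, smul_mv, inner_smul_right]

theorem quad_one (v : Euc n) : quad (1 : Matrix (Fin n) (Fin n) ℝ) v = ‖v‖ ^ 2 := by
  rw [quad_eq_inner, one_mv, real_inner_self_eq_norm_sq]

theorem quad_conj (M : Matrix (Fin m) (Fin n) ℝ) (P : Matrix (Fin m) (Fin m) ℝ) (v : Euc n) :
    quad (Mᵀ * P * M) v = quad P (mv M v) := by
  rw [quad_eq_inner, quad_eq_inner, inner_mv_left, mv_mv, mv_mv, Matrix.mul_assoc]

theorem quad_add_right {P : Matrix (Fin n) (Fin n) ℝ} (hP : Pᵀ = P) (v w : Euc n) :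
    quad P (v + w) = quad P v + 2 * inner ℝ v (mv P w) + quad P w := by
  have h : inner ℝ w (mv P v) = inner ℝ v (mv P w) := by
    rw [inner_mv_right, hP, real_inner_comm]
  simp only [quad_eq_inner, mv_add, inner_add_left, inner_add_right, h]
  ring

theorem quad_sub_right {P : Matrix (Fin n) (Fin n) ℝ} (hP : Pᵀ = P) (v w : Euc n) :
    quad P (v - w) = quad P v - 2 * inner ℝ v (mv P w) + quad P w := by
  have h : inner ℝ w (mv P v) = inner ℝ v (mv P w) := by
    rw [inner_mv_right, hP, real_inner_comm]
  simp only [quad_eq_inner, mv_sub, inner_sub_left, inner_sub_right, h]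
  ring

theorem continuous_quad (M : Matrix (Fin n) (Fin n) ℝ) : Continuous (quad M) := by
  unfold quad; fun_prop

theorem measurable_quad (M : Matrix (Fin n) (Fin n) ℝ) : Measurable (quad M) :=
  (continuous_quad M).measurable

theorem _root_.Matrix.PosSemidef.quad_nonneg {M : Matrix (Fin n) (Fin n) ℝ} (hM : M.PosSemidef)
    (v : Euc n) : 0 ≤ quad M v := by
  simpa [quad] using hM.dotProduct_mulVec_nonneg v.ofLp

theorem _root_.Matrix.PosSemidef.transpose_eq {ι : Type*} {M : Matrix ι ι ℝ}
    (hM : M.PosSemidef) : Mᵀ = M := by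
  simpa [conjTranspose_eq_transpose_of_trivial] using hM.isHermitian.eq

theorem posSemidef_of_quad_nonneg {M : Matrix (Fin n) (Fin n) ℝ} (hM : Mᵀ = M)
    (h : ∀ v : Euc n, 0 ≤ quad M v) : M.PosSemidef := by
  refine Matrix.PosSemidef.of_dotProduct_mulVec_nonneg ?_ fun x => ?_
  · rw [Matrix.IsHermitian, conjTranspose_eq_transpose_of_trivial, hM]
  · simpa [quad] using h (WithLp.toLp 2 x)

/-- A bound for the operator norm of a matrix. -/
theorem exists_norm_mv_le (M : Matrix (Fin m) (Fin n) ℝ) (v : Euc n) :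
    ‖mv M v‖ ^ 2 ≤ (∑ i, ∑ j, M i j ^ 2) * ‖v‖ ^ 2 := by
  rw [EuclideanSpace.real_norm_sq_eq, EuclideanSpace.real_norm_sq_eq, Finset.sum_mul]
  refine Finset.sum_le_sum fun i _ => ?_
  rw [mv_apply]
  exact Finset.sum_mul_sq_le_sq_mul_sq _ _ _

theorem quad_le_norm_sq (M : Matrix (Fin n) (Fin n) ℝ) :
    ∃ c, 0 < c ∧ ∀ v : Euc n, |quad M v| ≤ c * ‖v‖ ^ 2 := by
  refine ⟨1 + ∑ i, ∑ j, M i j ^ 2, by positivity, fun v => ?_⟩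
  have h1 := exists_norm_mv_le M v
  have h2 : |quad M v| ≤ ‖v‖ * ‖mv M v‖ := by
    rw [quad_eq_inner]; exact abs_real_inner_le_norm _ _
  nlinarith [sq_nonneg (‖v‖ - ‖mv M v‖)]

/-- Compactness of the unit sphere, followed by scaling. -/
theorem _root_.Matrix.PosDef.exists_norm_sq_le {M : Matrix (Fin n) (Fin n) ℝ} (hM : M.PosDef) :
    ∃ c, 0 < c ∧ ∀ v : Euc n, c * ‖v‖ ^ 2 ≤ quad M v := by
  have hpos : ∀ v : Euc n, v ≠ 0 → 0 < quad M v := fun v hv => by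
    have := hM.dotProduct_mulVec_pos (x := v.ofLp) (by simpa using hv)
    simpa [quad] using this
  -- The sphere is empty exactly in dimension zero, where every vector vanishes.
  rcases (Metric.sphere (0 : Euc n) 1).eq_empty_or_nonempty with he | hne
  · refine ⟨1, one_pos, fun v => ?_⟩
    have hv : v = 0 := by
      by_contra hv
      have : ‖v‖⁻¹ • v ∈ Metric.sphere (0 : Euc n) 1 := by
        simp [norm_smul, inv_mul_cancel₀ (norm_ne_zero_iff.2 hv)]
      rw [he] at this
      exact this
    simp [hv, quad_zero_right]
  · obtain ⟨v₀, hv₀, hmin⟩ := (isCompact_sphere (0 : Euc n) 1).exists_isMinOn hne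
      (continuous_quad M).continuousOn
    refine ⟨quad M v₀, hpos v₀ fun h => by simp [h] at hv₀, fun v => ?_⟩
    rcases eq_or_ne v 0 with rfl | hv
    · simp [quad_zero_right]
    · have h1 := hmin (show ‖v‖⁻¹ • v ∈ Metric.sphere (0 : Euc n) 1 by
        simp [norm_smul, inv_mul_cancel₀ (norm_ne_zero_iff.2 hv)])
      have h2 : quad M (‖v‖⁻¹ • v) = (‖v‖ ^ 2)⁻¹ * quad M v := by
        simp only [quad_eq_inner, mv_smul, inner_smul_left, inner_smul_right]
        simp; ring
      simp only [Set.mem_ofPred_eq, h2] at h1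
      have h3 : 0 < ‖v‖ ^ 2 := by positivity
      rwa [inv_mul_eq_div, le_div_iff₀ h3] at h1

end LinearAlgebra

variable {dx du dθ : ℕ}

namespace System

/-! ### The Riccati map: completing the square, monotonicity, geometric convergence -/

section Riccati

variable (S : System dx du dθ) (θ : Euc dθ)

/-- The closed-loop matrix of the gain of `P`. -/
def closedLoop (P : Matrix (Fin dx) (Fin dx) ℝ) : Matrix (Fin dx) (Fin dx) ℝ :=
  S.A + S.B θ * S.gain θ P

variable {S θ} {P : Matrix (Fin dx) (Fin dx) ℝ}

theorem hess_posDef (hR : S.R.PosDef) (hP : P.PosSemidef) : (S.hess θ P).PosDef := by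
  refine hR.add_posSemidef ?_
  have := hP.conjTranspose_mul_mul_same (S.B θ)
  rwa [conjTranspose_eq_transpose_of_trivial] at this

theorem hess_mul_gain (hR : S.R.PosDef) (hP : P.PosSemidef) :
    S.hess θ P * S.gain θ P = -((S.B θ)ᵀ * P * S.A) := by
  have hu : IsUnit (S.hess θ P).det := (hess_posDef hR hP).isUnit.map Matrix.detMonoidHom
  rw [gain, Matrix.mul_neg]
  simp only [← Matrix.mul_assoc]
  rw [Matrix.mul_nonsing_inv _ hu, Matrix.one_mul]

theorem riccati_eq_closedLoop :
    S.riccati θ P = S.Q + S.Aᵀ * P * S.closedLoop θ P := by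
  simp only [riccati, closedLoop, gain, Matrix.mul_add, Matrix.mul_neg, Matrix.mul_assoc]
  abel

/-- Completing the square in the one-step cost. -/
theorem one_step_identity (hR : S.R.PosDef) (hP : P.PosSemidef) (x : Euc dx) (u : Euc du) :
    quad S.Q x + quad S.R u + quad P (mv S.A x + mv (S.B θ) u)
      = quad (S.riccati θ P) x + quad (S.hess θ P) (u - mv (S.gain θ P) x) := by
  have hH := hess_posDef (θ := θ) hR hP
  set H := S.hess θ P with hHdef
  set g := mv (S.gain θ P) x with hg
  have hHg : mv H g = -mv ((S.B θ)ᵀ * P * S.A) x := by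
    rw [hg, mv_mv, hHdef, hess_mul_gain hR hP, neg_mv]
  have h1 : quad H u = quad S.R u + quad P (mv (S.B θ) u) := by
    rw [hHdef, hess, quad_add_left, quad_conj]
  have h2 : quad (S.riccati θ P) x = quad S.Q x + quad P (mv S.A x) - quad H g := by
    have h3 : quad (S.Aᵀ * P * S.B θ * (S.hess θ P)⁻¹ * (S.B θ)ᵀ * P * S.A) x = quad H g := by
      have h4 : S.Aᵀ * P * S.B θ * (S.hess θ P)⁻¹ * (S.B θ)ᵀ * P * S.A
          = -(((S.B θ)ᵀ * P * S.A)ᵀ * S.gain θ P) := by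
        simp [gain, Matrix.transpose_mul, hP.transpose_eq, Matrix.mul_assoc]
      rw [h4, quad_eq_inner, quad_eq_inner, neg_mv, ← mv_mv, inner_neg_right,
        inner_mv_right, transpose_transpose, hHg, inner_neg_right, real_inner_comm]
    rw [riccati, quad_sub_left, quad_add_left, quad_conj, h3]
  rw [quad_sub_right hH.posSemidef.transpose_eq, quad_add_right hP.transpose_eq, h1, h2, hHg,
    inner_neg_right]
  have h5 : inner ℝ u (mv ((S.B θ)ᵀ * P * S.A) x)
      = inner ℝ (mv S.A x) (mv P (mv (S.B θ) u)) := by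
    rw [inner_mv_right, real_inner_comm, inner_mv_left, mv_mv, mv_mv]
    simp [Matrix.transpose_mul, hP.transpose_eq, Matrix.mul_assoc]
  rw [h5]
  ring

/-- Any input is suboptimal for the one-step problem. Later comparisons come from inserting here the
input that is optimal for another cost-to-go, or the stabilizing one. -/
theorem quad_riccati_le (hR : S.R.PosDef) (hP : P.PosSemidef) (x : Euc dx) (u : Euc du) :
    quad (S.riccati θ P) x
      ≤ quad S.Q x + quad S.R u + quad P (mv S.A x + mv (S.B θ) u) := by
  rw [one_step_identity hR hP]
  have := (hess_posDef (θ := θ) hR hP).posSemidef.quad_nonneg (u - mv (S.gain θ P) x)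
  linarith

theorem quad_riccati_eq (hR : S.R.PosDef) (hP : P.PosSemidef) (x : Euc dx) :
    quad (S.riccati θ P) x = quad S.Q x + quad S.R (mv (S.gain θ P) x)
      + quad P (mv (S.closedLoop θ P) x) := by
  have := one_step_identity (θ := θ) hR hP x (mv (S.gain θ P) x)
  rw [sub_self, quad_zero_right, add_zero] at this
  rw [← this, closedLoop, add_mv, mv_mv]

theorem riccati_transpose (hR : S.R.PosDef) (hQ : S.Q.PosDef) (hP : P.PosSemidef) :
    (S.riccati θ P)ᵀ = S.riccati θ P := by
  have hH := (hess_posDef (θ := θ) hR hP).posSemidef.transpose_eq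
  simp [riccati, Matrix.transpose_mul, Matrix.transpose_nonsing_inv, hH, hP.transpose_eq,
    hQ.posSemidef.transpose_eq, Matrix.mul_assoc]

theorem riccati_posSemidef (hR : S.R.PosDef) (hQ : S.Q.PosDef) (hP : P.PosSemidef) :
    (S.riccati θ P).PosSemidef := by
  refine posSemidef_of_quad_nonneg (riccati_transpose hR hQ hP) fun v => ?_
  rw [quad_riccati_eq hR hP]
  have h1 := hQ.posSemidef.quad_nonneg v
  have h2 := hR.posSemidef.quad_nonneg (mv (S.gain θ P) v)
  have h3 := hP.quad_nonneg (mv (S.closedLoop θ P) v)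
  linarith

theorem quad_Q_le_riccati (hR : S.R.PosDef) (hP : P.PosSemidef) (v : Euc dx) :
    quad S.Q v ≤ quad (S.riccati θ P) v := by
  rw [quad_riccati_eq hR hP]
  have h2 := hR.posSemidef.quad_nonneg (mv (S.gain θ P) v)
  have h3 := hP.quad_nonneg (mv (S.closedLoop θ P) v)
  linarith

/-- The Riccati map is a minimum over inputs of costs that increase with `P`; the minimizer for `P'`
is inserted into the problem for `P`. -/
theorem riccati_mono (hR : S.R.PosDef) {P' : Matrix (Fin dx) (Fin dx) ℝ} (hP : P.PosSemidef)
    (hP' : P'.PosSemidef) (h : ∀ v, quad P v ≤ quad P' v) (v : Euc dx) :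
    quad (S.riccati θ P) v ≤ quad (S.riccati θ P') v := by
  refine (quad_riccati_le hR hP v (mv (S.gain θ P') v)).trans ?_
  rw [quad_riccati_eq hR hP', closedLoop, add_mv, ← mv_mv]
  linarith [h (mv S.A v + mv (S.B θ) (mv (S.gain θ P') v))]

theorem riccatiIter_posSemidef (hR : S.R.PosDef) (hQ : S.Q.PosDef) (j : ℕ) :
    (S.riccatiIter θ j).PosSemidef := by
  induction j with
  | zero => exact Matrix.PosSemidef.zero
  | succ j ih => exact riccati_posSemidef hR hQ ih

theorem riccatiIter_mono (hR : S.R.PosDef) (hQ : S.Q.PosDef) (j : ℕ) (v : Euc dx) :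
    quad (S.riccatiIter θ j) v ≤ quad (S.riccatiIter θ (j + 1)) v := by
  induction j generalizing v with
  | zero =>
      have := (riccatiIter_posSemidef (θ := θ) hR hQ 1).quad_nonneg v
      simpa [riccatiIter, quad_zero_left] using this
  | succ j ih =>
      exact riccati_mono hR (riccatiIter_posSemidef hR hQ j)
        (riccatiIter_posSemidef hR hQ (j + 1)) ih v

theorem riccatiIter_le (hR : S.R.PosDef) (hQ : S.Q.PosDef) (hP : P.PosSemidef)
    (hfix : S.riccati θ P = P) (j : ℕ) (v : Euc dx) :
    quad (S.riccatiIter θ j) v ≤ quad P v := by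
  induction j generalizing v with
  | zero => simpa [riccatiIter, quad_zero_left] using hP.quad_nonneg v
  | succ j ih =>
      have := riccati_mono (θ := θ) hR (riccatiIter_posSemidef hR hQ j) hP ih v
      rwa [hfix] at this

/-- The Riccati recursion converges geometrically. -/
theorem quad_sub_riccatiIter_le (hR : S.R.PosDef) (hQ : S.Q.PosDef) (hP : P.PosSemidef)
    (hfix : S.riccati θ P = P) {q : ℝ} (hq : 0 < q) (hq1 : q < 1)
    (hqP : ∀ v, q * quad P v ≤ quad S.Q v) (j : ℕ) (v : Euc dx) :
    quad P v - quad (S.riccatiIter θ (j + 1)) v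
      ≤ q⁻¹ * (1 - q) ^ j * quad (S.riccatiIter θ (j + 1)) v := by
  have hpsd := riccatiIter_posSemidef (θ := θ) hR hQ
  have hQle : ∀ v, quad S.Q v ≤ quad P v := fun v => by
    have := quad_Q_le_riccati (θ := θ) hR hP v
    rwa [hfix] at this
  induction j generalizing v with
  | zero =>
      have h1 : quad S.Q v ≤ quad (S.riccatiIter θ 1) v := by
        exact quad_Q_le_riccati hR (hpsd 0) v
      have h2 : quad P v ≤ q⁻¹ * quad S.Q v := by
        rw [inv_mul_eq_div, le_div_iff₀ hq]; linarith [hqP v]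
      have h3 := (hpsd 1).quad_nonneg v
      have h4 : q⁻¹ * quad S.Q v ≤ q⁻¹ * quad (S.riccatiIter θ 1) v := by gcongr
      simp only [zero_add, pow_zero, mul_one]
      linarith
  | succ j ih =>
      set N := S.riccatiIter θ (j + 1) with hN
      have hNpsd : N.PosSemidef := hpsd (j + 1)
      change quad P v - quad (S.riccati θ N) v ≤ _ * quad (S.riccati θ N) v
      -- Both forms are evaluated along the gain of `N`: it is optimal for `N` and merely admissible
      -- for `P`, so the gap at `v` is at most the gap at `y`.
      set y := mv (S.closedLoop θ N) v with hy
      have e1 := quad_riccati_eq (θ := θ) hR hNpsd v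
      have e2 := quad_riccati_le (θ := θ) hR hP v (mv (S.gain θ N) v)
      rw [hfix, mv_mv, ← add_mv, ← closedLoop, ← hy] at e2
      rw [← hy] at e1
      have e3 := ih y
      -- The stage cost removes at least `q · quad P v`, and `quad P v` dominates the value of the
      -- next iterate. This is the factor `1 - q` of the geometric rate.
      have e4 : quad N y ≤ (1 - q) * quad (S.riccati θ N) v := by
        have h5 : quad (S.riccati θ N) v ≤ quad P v :=
          riccatiIter_le hR hQ hP hfix (j + 2) v
        have h6 := hqP v
        have h7 := hR.posSemidef.quad_nonneg (mv (S.gain θ N) v)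
        nlinarith
      have e5 : 0 ≤ q⁻¹ * (1 - q) ^ j := by
        have : 0 ≤ 1 - q := by linarith
        positivity
      calc quad P v - quad (S.riccati θ N) v ≤ quad P y - quad N y := by linarith
        _ ≤ q⁻¹ * (1 - q) ^ j * quad N y := e3
        _ ≤ q⁻¹ * (1 - q) ^ j * ((1 - q) * quad (S.riccati θ N) v) := by gcongr
        _ = _ := by ring

end Riccati

end System

variable {dx du dθ : ℕ}

/-! ### Existence of a solution of the Riccati equation -/

section Existence

/-- Gelfand's formula gives `‖M^j‖ ≤ r^j` for large `j` with some `r < 1`; the rate in the statement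
is `r²`, since norms are squared. -/
theorem exists_norm_mv_pow_le {n : ℕ} {M : Matrix (Fin n) (Fin n) ℝ} (hM : IsStable M) :
    ∃ C r : ℝ, 0 ≤ r ∧ r < 1 ∧ ∀ j (v : Euc n), ‖mv (M ^ j) v‖ ^ 2 ≤ C * r ^ j * ‖v‖ ^ 2 := by
  let := @Matrix.linftyOpNormedRing (Fin n) ℂ _ _ _
  let := @Matrix.linftyOpNormedAlgebra ℂ (Fin n) ℂ _ _ _ _ _
  set a : Matrix (Fin n) (Fin n) ℂ := M.map (algebraMap ℝ ℂ) with ha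
  obtain ⟨r, hr, hr1⟩ := ENNReal.lt_iff_exists_nnreal_btwn.1 hM
  have hr1' : (r : ℝ) < 1 := by exact_mod_cast hr1
  have hev := (spectrum.pow_nnnorm_pow_one_div_tendsto_nhds_spectralRadius a).eventually
    (gt_mem_nhds hr)
  obtain ⟨N, hN⟩ := eventually_atTop.1 hev
  have hmap : ∀ j, a ^ j = (M ^ j).map (algebraMap ℝ ℂ) := fun j => by
    rw [ha]
    exact (map_pow (RingHom.mapMatrix (algebraMap ℝ ℂ)) M j).symm
  have hbig : ∀ j, N + 1 ≤ j → ‖a ^ j‖ ≤ (r : ℝ) ^ j := fun j hj => by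
    have h1 := (hN j (by omega)).le
    have hj0 : (0 : ℝ) < j := by exact_mod_cast (by omega : 0 < j)
    have h2 : (‖a ^ j‖₊ : ℝ≥0∞) ≤ (r : ℝ≥0∞) ^ (j : ℝ) := by
      rw [one_div, ENNReal.rpow_inv_le_iff hj0] at h1
      exact h1
    rw [ENNReal.rpow_natCast] at h2
    exact_mod_cast h2
  have hentry : ∀ j i k, |(M ^ j) i k| ≤ ‖a ^ j‖ := fun j i k => by
    have h1 : ‖(a ^ j) i k‖₊ ≤ ‖a ^ j‖₊ := by
      rw [Matrix.linfty_opNNNorm_def]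
      refine le_trans ?_ (Finset.le_sup (f := fun i => ∑ j', ‖(a ^ j) i j'‖₊) (Finset.mem_univ i))
      exact Finset.single_le_sum (f := fun j' => ‖(a ^ j) i j'‖₊) (fun _ _ => zero_le)
        (Finset.mem_univ k)
    have h2 : ‖(a ^ j) i k‖ ≤ ‖a ^ j‖ := h1
    rw [hmap] at h2 ⊢
    simpa using h2
  have hr0 : (0 : ℝ) < r := by
    have : (0 : ℝ≥0∞) < r := lt_of_le_of_lt zero_le hr
    exact_mod_cast this
  -- The finitely many powers not covered by Gelfand's formula are absorbed in `D`.
  set D : ℝ := 1 + ∑ j ∈ Finset.range (N + 1), ‖a ^ j‖ ^ 2 / ((r : ℝ) ^ 2) ^ j with hD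
  have hsum0 : 0 ≤ ∑ j ∈ Finset.range (N + 1), ‖a ^ j‖ ^ 2 / ((r : ℝ) ^ 2) ^ j :=
    Finset.sum_nonneg fun j _ => by positivity
  have hall : ∀ j, ‖a ^ j‖ ^ 2 ≤ D * ((r : ℝ) ^ 2) ^ j := fun j => by
    rcases le_or_gt (N + 1) j with hj | hj
    · calc ‖a ^ j‖ ^ 2 ≤ ((r : ℝ) ^ j) ^ 2 := by gcongr; exact hbig j hj
        _ = 1 * ((r : ℝ) ^ 2) ^ j := by rw [one_mul, ← pow_mul, ← pow_mul, mul_comm]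
        _ ≤ D * ((r : ℝ) ^ 2) ^ j := by gcongr; linarith
    · have h1 := Finset.single_le_sum (f := fun j => ‖a ^ j‖ ^ 2 / ((r : ℝ) ^ 2) ^ j)
        (fun j _ => by positivity) (Finset.mem_range.2 hj)
      rw [← div_le_iff₀ (by positivity)]
      linarith
  refine ⟨n * n * D, (r : ℝ) ^ 2, by positivity, by nlinarith [r.coe_nonneg], fun j v => ?_⟩
  refine (exists_norm_mv_le _ _).trans ?_
  gcongr
  calc ∑ i, ∑ k, (M ^ j) i k ^ 2 ≤ ∑ _i : Fin n, ∑ _k : Fin n, D * ((r : ℝ) ^ 2) ^ j := by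
        gcongr with i _ k _
        refine le_trans ?_ (hall j)
        rw [← sq_abs]
        gcongr
        exact hentry j i k
    _ = n * n * D * ((r : ℝ) ^ 2) ^ j := by simp; ring

theorem _root_.ContinuousAt.matrix_mul {X : Type*} [TopologicalSpace X] {k l m : ℕ}
    {f : X → Matrix (Fin k) (Fin l) ℝ} {g : X → Matrix (Fin l) (Fin m) ℝ} {x : X}
    (hf : ContinuousAt f x) (hg : ContinuousAt g x) : ContinuousAt (fun y => f y * g y) x :=
  ContinuousAt.comp (g := fun z : Matrix (Fin k) (Fin l) ℝ × Matrix (Fin l) (Fin m) ℝ => z.1 * z.2)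
    (continuous_fst.matrix_mul continuous_snd).continuousAt (hf.prodMk hg)

namespace System

variable {S : System dx du dθ} {θ : Euc dθ}

/-- The stabilizing feedback `u = -F x` has a finite noise-free infinite-horizon cost, and the
optimal cost of any finite horizon is below it. -/
theorem exists_riccatiIter_bound (hS : S.IsInstance θ) (v : Euc dx) :
    ∃ b, ∀ j, quad (S.riccatiIter θ j) v ≤ b := by
  obtain ⟨F, hF⟩ := hS.stabilizable
  set M := S.A - S.B θ * F with hM
  obtain ⟨C, r, hr0, hr1, hMr⟩ := exists_norm_mv_pow_le hF
  set f : Euc dx → ℝ := fun v => quad S.Q v + quad S.R (mv F v) with hf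
  have hf0 : ∀ v, 0 ≤ f v := fun v => add_nonneg (hS.Q_posDef.posSemidef.quad_nonneg _)
    (hS.R_posDef.posSemidef.quad_nonneg _)
  obtain ⟨c, hc, hfc⟩ : ∃ c, 0 < c ∧ ∀ v, f v ≤ c * ‖v‖ ^ 2 := by
    obtain ⟨c, hc, h⟩ := quad_le_norm_sq (S.Q + Fᵀ * S.R * F)
    refine ⟨c, hc, fun v => ?_⟩
    have := (le_abs_self _).trans (h v)
    rwa [quad_add_left, quad_conj] at this
  have hsum : ∀ v, Summable fun j => f (mv (M ^ j) v) := fun v => by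
    refine Summable.of_nonneg_of_le (fun j => hf0 _)
      (fun j => (hfc _).trans (mul_le_mul_of_nonneg_left (hMr j v) hc.le)) ?_
    have := ((summable_geometric_of_lt_one hr0 hr1).mul_left (c * C)).mul_right (‖v‖ ^ 2)
    refine this.congr fun j => by ring
  -- One application of `-F` moves `v` to `M v` and splits off the first term of the series.
  have key : ∀ j v, quad (S.riccatiIter θ j) v ≤ ∑' i, f (mv (M ^ i) v) := by
    intro j
    induction j with
    | zero => intro v; simpa [riccatiIter, quad_zero_left] using tsum_nonneg fun i => hf0 _
    | succ j ih =>
        intro v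
        have h1 := quad_riccati_le (θ := θ) hS.R_posDef
          (riccatiIter_posSemidef (θ := θ) hS.R_posDef hS.Q_posDef j) v (-mv F v)
        have h2 : mv S.A v + mv (S.B θ) (-mv F v) = mv M v := by
          rw [hM, sub_mv, ← neg_mv F, mv_mv, Matrix.mul_neg, neg_mv]
          abel
        have h3 : quad S.R (-mv F v) = quad S.R (mv F v) := by
          rw [quad_neg_right]
        rw [h2, h3] at h1
        refine h1.trans ?_
        rw [(hsum v).tsum_eq_zero_add]
        have h4 : ∀ i, mv (M ^ (i + 1)) v = mv (M ^ i) (mv M v) := fun i => by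
          rw [mv_mv, pow_succ]
        simp only [h4, pow_zero, one_mv]
        have := ih (mv M v)
        simp only [hf] at this ⊢
        linarith
  exact ⟨_, fun j => key j v⟩

theorem continuousAt_riccati {P : Matrix (Fin dx) (Fin dx) ℝ}
    (hP : (S.hess θ P).det ≠ 0) :
    ContinuousAt (S.riccati θ) P := by
  have h1 : Continuous fun P => S.hess θ P := by unfold hess; fun_prop
  have h2 : ContinuousAt (fun P => (S.hess θ P)⁻¹) P := by
    refine ContinuousAt.comp (g := Inv.inv) (continuousAt_matrix_inv _ ?_) h1.continuousAt
    simpa [Ring.inverse_eq_inv'] using continuousAt_inv₀ hP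
  unfold riccati
  have h3 : ContinuousAt (fun P : Matrix (Fin dx) (Fin dx) ℝ => P) P := continuousAt_id
  have hc : ∀ {k : ℕ} {l : ℕ} (M : Matrix (Fin k) (Fin l) ℝ),
      ContinuousAt (fun _ : Matrix (Fin dx) (Fin dx) ℝ => M) P := fun _ => continuousAt_const
  exact (continuousAt_const.add (((hc S.Aᵀ).matrix_mul h3).matrix_mul (hc S.A))).sub
    (((((((hc S.Aᵀ).matrix_mul h3).matrix_mul (hc (S.B θ))).matrix_mul h2).matrix_mul
      (hc (S.B θ)ᵀ)).matrix_mul h3).matrix_mul (hc S.A))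

/-- The iterates increase and are bounded as quadratic forms, hence converge entrywise by
polarization; continuity of the Riccati map at the limit makes the limit a fixed point. -/
theorem exists_riccati_fixed (hS : S.IsInstance θ) :
    ∃ P : Matrix (Fin dx) (Fin dx) ℝ, P.PosSemidef ∧ S.riccati θ P = P := by
  have hpsd := riccatiIter_posSemidef (θ := θ) hS.R_posDef hS.Q_posDef
  have hlim : ∀ v : Euc dx, ∃ l, Tendsto (fun j => quad (S.riccatiIter θ j) v) atTop (𝓝 l) := by
    intro v
    obtain ⟨b, hb⟩ := exists_riccatiIter_bound hS v
    exact ⟨_, tendsto_atTop_ciSup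
      (monotone_nat_of_le_succ fun j => riccatiIter_mono hS.R_posDef hS.Q_posDef j v)
      ⟨b, by rintro _ ⟨j, rfl⟩; exact hb j⟩⟩
  choose l hl using hlim
  -- The matrix is recovered by polarization from the pointwise limits of the forms.
  set P : Matrix (Fin dx) (Fin dx) ℝ := Matrix.of fun i k =>
    (l (EuclideanSpace.single i 1 + EuclideanSpace.single k 1)
      - l (EuclideanSpace.single i 1) - l (EuclideanSpace.single k 1)) / 2 with hPdef
  have hconv : Tendsto (S.riccatiIter θ) atTop (𝓝 P) := by
    refine tendsto_pi_nhds.2 fun i => tendsto_pi_nhds.2 fun k => ?_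
    have h1 := (((hl (EuclideanSpace.single i 1 + EuclideanSpace.single k 1)).sub
      (hl (EuclideanSpace.single i 1))).sub (hl (EuclideanSpace.single k 1))).div_const 2
    refine h1.congr fun j => ?_
    rw [quad_add_right (hpsd j).transpose_eq]
    have : inner ℝ (EuclideanSpace.single i (1 : ℝ))
        (mv (S.riccatiIter θ j) (EuclideanSpace.single k 1)) = S.riccatiIter θ j i k := by
      simp [EuclideanSpace.inner_single_left, mv]
    rw [this]
    ring
  have hP : P.PosSemidef := by
    refine posSemidef_of_quad_nonneg ?_ fun v => ?_
    · refine tendsto_nhds_unique ?_ hconv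
      have : Continuous fun M : Matrix (Fin dx) (Fin dx) ℝ => Mᵀ := by fun_prop
      refine ((this.tendsto P).comp hconv).congr fun j => ?_
      exact (hpsd j).transpose_eq
    · have : Continuous fun M : Matrix (Fin dx) (Fin dx) ℝ => quad M v := by
        unfold quad; fun_prop
      exact ge_of_tendsto' ((this.tendsto P).comp hconv) fun j => (hpsd j).quad_nonneg v
  refine ⟨P, hP, ?_⟩
  have hc := continuousAt_riccati (θ := θ) (P := P)
    (hess_posDef hS.R_posDef hP).det_pos.ne'
  have h1 : Tendsto (fun j => S.riccatiIter θ (j + 1)) atTop (𝓝 (S.riccati θ P)) :=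
    hc.tendsto.comp hconv
  exact tendsto_nhds_unique h1 (hconv.comp (tendsto_add_atTop_nat 1))

end System

end Existence

/-! ### Uniqueness of the positive semidefinite solution -/

section Uniqueness

namespace System

variable {S : System dx du dθ} {θ : Euc dθ} {P P' : Matrix (Fin dx) (Fin dx) ℝ}

/-- The first-order optimality condition, written with the closed loop. Only invertibility of the
Hessian is needed, not positivity of `P`. -/
theorem gain_eq_of_isUnit (h : IsUnit (S.hess θ P).det) :
    S.R * S.gain θ P = -((S.B θ)ᵀ * P * S.closedLoop θ P) := by
  have h : S.hess θ P * S.gain θ P = -((S.B θ)ᵀ * P * S.A) := by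
    rw [gain, Matrix.mul_neg]
    simp only [← Matrix.mul_assoc]
    rw [Matrix.mul_nonsing_inv _ h, Matrix.one_mul]
  rw [hess, Matrix.add_mul] at h
  rw [closedLoop, Matrix.mul_add, ← Matrix.mul_assoc ((S.B θ)ᵀ * P), neg_add, ← h]
  abel

/-- The exact difference formula for the Riccati map. -/
theorem riccati_sub_riccati (hR : S.R.PosDef) (hQ : S.Q.PosDef) (hP : P.PosSemidef)
    (h' : IsUnit (S.hess θ P').det) :
    S.riccati θ P' - S.riccati θ P
      = (S.closedLoop θ P)ᵀ * (P' - P) * S.closedLoop θ P' := by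
  have hu : IsUnit (S.hess θ P).det := (hess_posDef hR hP).isUnit.map Matrix.detMonoidHom
  have hRt := hR.posSemidef.transpose_eq
  have e1 := gain_eq_of_isUnit hu
  have e2 := gain_eq_of_isUnit h'
  -- By the optimality condition both triple products contain the same mixed term of the two gains,
  -- which cancels in the difference. Positivity is required of `P` only, so that `P'` may be an
  -- arbitrary, even nonsymmetric, perturbation.
  have e3 : (S.closedLoop θ P)ᵀ * P' * S.closedLoop θ P'
      = S.riccati θ P' - S.Q - (S.gain θ P)ᵀ * S.R * S.gain θ P' := by
    rw [riccati_eq_closedLoop, Matrix.mul_assoc (S.gain θ P)ᵀ, e2]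
    conv_lhs => rw [closedLoop, Matrix.transpose_add, Matrix.transpose_mul]
    simp only [Matrix.add_mul, Matrix.mul_neg, Matrix.mul_assoc]
    abel
  have e4 : (S.closedLoop θ P)ᵀ * P * S.closedLoop θ P'
      = S.riccati θ P - S.Q - (S.gain θ P)ᵀ * S.R * S.gain θ P' := by
    have e5 : (S.closedLoop θ P')ᵀ * P * S.closedLoop θ P
        = S.riccati θ P - S.Q - (S.gain θ P')ᵀ * S.R * S.gain θ P := by
      rw [riccati_eq_closedLoop, Matrix.mul_assoc (S.gain θ P')ᵀ, e1]
      conv_lhs => rw [closedLoop, Matrix.transpose_add, Matrix.transpose_mul]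
      simp only [Matrix.add_mul, Matrix.mul_neg, Matrix.mul_assoc]
      abel
    have := congrArg Matrix.transpose e5
    simpa [Matrix.transpose_mul, Matrix.mul_assoc, hP.transpose_eq, hRt,
      riccati_transpose hR hQ hP, hQ.posSemidef.transpose_eq] using this
  rw [Matrix.mul_sub, Matrix.sub_mul, e3, e4]
  abel

/-- The closed loop of a solution of the Riccati equation is a contraction in its own norm. -/
theorem quad_closedLoop_le (hR : S.R.PosDef) (hP : P.PosSemidef) (hfix : S.riccati θ P = P)
    {q : ℝ} (hqP : ∀ v, q * quad P v ≤ quad S.Q v) (v : Euc dx) :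
    quad P (mv (S.closedLoop θ P) v) ≤ (1 - q) * quad P v := by
  have h1 := quad_riccati_eq (θ := θ) hR hP v
  rw [hfix] at h1
  have h2 := hR.posSemidef.quad_nonneg (mv (S.gain θ P) v)
  linarith [hqP v]

/-- `Q` is bounded below and `P` above by multiples of the squared norm; the minimum with `1 / 2`
keeps the rate below one. -/
theorem exists_rate (hQ : S.Q.PosDef) (P : Matrix (Fin dx) (Fin dx) ℝ) :
    ∃ q, 0 < q ∧ q < 1 ∧ ∀ v, q * quad P v ≤ quad S.Q v := by
  obtain ⟨c, hc, h⟩ := hQ.exists_norm_sq_le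
  obtain ⟨d, hd, h'⟩ := quad_le_norm_sq P
  refine ⟨min (c / d) (1 / 2), by positivity, by linarith [min_le_right (c / d) (1 / 2)],
    fun v => ?_⟩
  have h1 : min (c / d) (1 / 2) ≤ c / d := min_le_left _ _
  have h2 : 0 < min (c / d) (1 / 2) := by positivity
  calc min (c / d) (1 / 2) * quad P v ≤ min (c / d) (1 / 2) * (d * ‖v‖ ^ 2) := by
        gcongr; exact (le_abs_self _).trans (h' v)
    _ ≤ c / d * (d * ‖v‖ ^ 2) := by gcongr
    _ = c * ‖v‖ ^ 2 := by field_simp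
    _ ≤ _ := h v

/-- `P` is a Lyapunov function of its own closed loop: its form contracts by `1 - q` and dominates
that of `Q`, hence the squared norm. -/
theorem tendsto_closedLoop_pow (hR : S.R.PosDef) (hQ : S.Q.PosDef) (hP : P.PosSemidef)
    (hfix : S.riccati θ P = P) (v : Euc dx) :
    Tendsto (fun n => mv (S.closedLoop θ P ^ n) v) atTop (𝓝 0) := by
  obtain ⟨q, hq, hq1, hqP⟩ := exists_rate hQ P
  obtain ⟨c, hc, h⟩ := hQ.exists_norm_sq_le
  have h1 : ∀ n, quad P (mv (S.closedLoop θ P ^ n) v) ≤ (1 - q) ^ n * quad P v := by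
    intro n
    induction n with
    | zero => simp [one_mv]
    | succ n ih =>
        rw [pow_succ', ← mv_mv, pow_succ', mul_assoc]
        exact (quad_closedLoop_le hR hP hfix hqP _).trans
          (mul_le_mul_of_nonneg_left ih (by linarith))
  have h2 : ∀ n, ‖mv (S.closedLoop θ P ^ n) v‖ ^ 2 ≤ c⁻¹ * ((1 - q) ^ n * quad P v) := by
    intro n
    rw [inv_mul_eq_div, le_div_iff₀ hc, mul_comm]
    refine (h _).trans (le_trans ?_ (h1 n))
    have := quad_Q_le_riccati (θ := θ) hR hP (mv (S.closedLoop θ P ^ n) v)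
    rwa [hfix] at this
  have h3 : Tendsto (fun n => c⁻¹ * ((1 - q) ^ n * quad P v)) atTop (𝓝 0) := by
    have := ((tendsto_pow_atTop_nhds_zero_of_lt_one (r := 1 - q) (by linarith)
      (by linarith)).mul_const (quad P v)).const_mul c⁻¹
    simpa using this
  have h4 : Tendsto (fun n => ‖mv (S.closedLoop θ P ^ n) v‖ ^ 2) atTop (𝓝 0) :=
    squeeze_zero (fun n => by positivity) h2 h3
  rw [tendsto_zero_iff_norm_tendsto_zero]
  have := h4.sqrt
  simpa [Real.sqrt_sq] using this

/-- A Lyapunov-type equation with two stable closed loops has only the trivial solution. -/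
theorem eq_zero_of_lyapunov (hR : S.R.PosDef) (hQ : S.Q.PosDef) (hP : P.PosSemidef)
    (hfix : S.riccati θ P = P) (hP' : P'.PosSemidef) (hfix' : S.riccati θ P' = P')
    {X : Matrix (Fin dx) (Fin dx) ℝ}
    (hX : X = (S.closedLoop θ P)ᵀ * X * S.closedLoop θ P') : X = 0 := by
  -- Iterating the equation puts high powers of both stable closed loops on the two sides of `X`.
  have hpow : ∀ n, X = ((S.closedLoop θ P) ^ n)ᵀ * X * S.closedLoop θ P' ^ n := by
    intro n
    induction n with
    | zero => simp
    | succ n ih =>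
        conv_lhs => rw [ih, hX]
        rw [pow_succ' (S.closedLoop θ P), pow_succ' (S.closedLoop θ P'), Matrix.transpose_mul]
        simp only [Matrix.mul_assoc]
  ext i j
  have h1 : ∀ n, X i j = inner ℝ (mv (S.closedLoop θ P ^ n) (EuclideanSpace.single i 1))
      (mv X (mv (S.closedLoop θ P' ^ n) (EuclideanSpace.single j 1))) := by
    intro n
    rw [inner_mv_left, mv_mv, mv_mv, ← hpow n]
    simp [EuclideanSpace.inner_single_left, mv]
  have h2 := (tendsto_closedLoop_pow hR hQ hP hfix (EuclideanSpace.single i 1)).inner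
    (((continuous_mv X).tendsto 0).comp
      (tendsto_closedLoop_pow hR hQ hP' hfix' (EuclideanSpace.single j 1))) (𝕜 := ℝ)
  rw [inner_zero_left] at h2
  exact tendsto_nhds_unique (tendsto_const_nhds.congr h1) h2

/-- By the exact difference formula, the difference of two solutions solves a homogeneous Stein
equation with two stable closed loops. -/
theorem riccati_fixed_unique (hR : S.R.PosDef) (hQ : S.Q.PosDef) (hP : P.PosSemidef)
    (hfix : S.riccati θ P = P) (hP' : P'.PosSemidef) (hfix' : S.riccati θ P' = P') : P' = P := by
  have hu : IsUnit (S.hess θ P').det := (hess_posDef hR hP').isUnit.map Matrix.detMonoidHom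
  have h := riccati_sub_riccati (θ := θ) hR hQ hP hu
  rw [hfix, hfix'] at h
  exact sub_eq_zero.1 (eq_zero_of_lyapunov hR hQ hP hfix hP' hfix' h)

theorem P_eq_of_fixed (hR : S.R.PosDef) (hQ : S.Q.PosDef) (hP : P.PosSemidef)
    (hfix : S.riccati θ P = P) : S.P θ = P := by
  have hex : ∃ P : Matrix (Fin dx) (Fin dx) ℝ, P.PosSemidef ∧ S.riccati θ P = P := ⟨P, hP, hfix⟩
  rw [System.P, dif_pos hex]
  exact riccati_fixed_unique hR hQ hP hfix hex.choose_spec.1 hex.choose_spec.2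

end System

end Uniqueness

/-! ### Smooth dependence of the Riccati solution on the parameter -/

section MatrixCalculus

attribute [local instance] Matrix.normedAddCommGroup Matrix.normedSpace

variable {E : Type*} [NormedAddCommGroup E] [NormedSpace ℝ E] {k l m : ℕ} {N : WithTop ℕ∞} {x : E}

theorem contDiffAt_matrix_iff {f : E → Matrix (Fin k) (Fin l) ℝ} :
    ContDiffAt ℝ N f x ↔ ∀ i j, ContDiffAt ℝ N (fun y => f y i j) x := by
  refine contDiffAt_pi.trans (forall_congr' fun i => ?_)
  exact contDiffAt_pi

theorem _root_.ContDiffAt.matrix_mul {f : E → Matrix (Fin k) (Fin l) ℝ}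
    {g : E → Matrix (Fin l) (Fin m) ℝ} (hf : ContDiffAt ℝ N f x) (hg : ContDiffAt ℝ N g x) :
    ContDiffAt ℝ N (fun y => f y * g y) x := by
  rw [contDiffAt_matrix_iff] at *
  intro i j
  simp only [Matrix.mul_apply]
  exact ContDiffAt.sum fun r _ => (hf i r).mul (hg r j)

theorem _root_.ContDiffAt.matrix_transpose {f : E → Matrix (Fin k) (Fin l) ℝ}
    (hf : ContDiffAt ℝ N f x) : ContDiffAt ℝ N (fun y => (f y)ᵀ) x := by
  rw [contDiffAt_matrix_iff] at *
  exact fun i j => hf j i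

theorem _root_.ContDiffAt.matrix_det {f : E → Matrix (Fin k) (Fin k) ℝ}
    (hf : ContDiffAt ℝ N f x) : ContDiffAt ℝ N (fun y => (f y).det) x := by
  rw [contDiffAt_matrix_iff] at hf
  simp only [Matrix.det_apply]
  refine ContDiffAt.sum fun σ _ => ?_
  simp only [Units.smul_def, zsmul_eq_mul]
  exact contDiffAt_const.mul (contDiffAt_prod fun i _ => hf _ _)

theorem _root_.ContDiffAt.matrix_inv {f : E → Matrix (Fin k) (Fin k) ℝ}
    (hf : ContDiffAt ℝ N f x) (h0 : (f x).det ≠ 0) : ContDiffAt ℝ N (fun y => (f y)⁻¹) x := by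
  rw [contDiffAt_matrix_iff]
  intro i j
  simp only [Matrix.inv_def, Ring.inverse_eq_inv', Matrix.smul_apply, smul_eq_mul,
    Matrix.adjugate_apply]
  refine (hf.matrix_det.inv h0).mul (ContDiffAt.matrix_det ?_)
  rw [contDiffAt_matrix_iff] at hf ⊢
  intro a b
  by_cases hab : a = j
  · subst hab
    simpa using contDiffAt_const
  · simpa [Matrix.updateRow_ne hab] using hf a b

theorem abs_entry_le_norm (A : Matrix (Fin k) (Fin l) ℝ) (i : Fin k) (j : Fin l) :
    |A i j| ≤ ‖A‖ := by
  simpa using Matrix.norm_entry_le_entrywise_sup_norm A (i := i) (j := j)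

theorem norm_mv_sq_le (A : Matrix (Fin k) (Fin l) ℝ) (v : Euc l) :
    ‖mv A v‖ ^ 2 ≤ (k * l) * ‖A‖ ^ 2 * ‖v‖ ^ 2 := by
  refine (exists_norm_mv_le A v).trans ?_
  gcongr
  calc ∑ i, ∑ j, A i j ^ 2 ≤ ∑ _i : Fin k, ∑ _j : Fin l, ‖A‖ ^ 2 := by
        refine Finset.sum_le_sum fun i _ => Finset.sum_le_sum fun j _ => ?_
        refine sq_le_sq.2 ?_
        rw [abs_norm]
        exact abs_entry_le_norm A i j
    _ = _ := by simp; ring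

theorem abs_quad_le (A : Matrix (Fin k) (Fin k) ℝ) (v : Euc k) :
    |quad A v| ≤ k * ‖A‖ * ‖v‖ ^ 2 := by
  have h1 : |quad A v| ≤ ‖v‖ * ‖mv A v‖ := by
    rw [quad_eq_inner]; exact abs_real_inner_le_norm _ _
  have h2 : ‖mv A v‖ ≤ k * ‖A‖ * ‖v‖ := by
    refine abs_le_of_sq_le_sq' ?_ (by positivity) |>.2
    refine (norm_mv_sq_le A v).trans (le_of_eq (by ring))
  calc |quad A v| ≤ ‖v‖ * (k * ‖A‖ * ‖v‖) := h1.trans (by gcongr)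
    _ = _ := by ring

namespace System

variable (S : System dx du dθ)

theorem contDiff_B {N : WithTop ℕ∞} : ContDiff ℝ N S.B := by
  rw [contDiff_iff_contDiffAt]
  intro ϑ
  rw [contDiffAt_matrix_iff]
  intro i j
  simp only [B, Matrix.of_apply, Matrix.mulVec, dotProduct]
  refine (ContDiffAt.sum fun r _ => contDiffAt_const.mul ?_).add contDiffAt_const
  exact (EuclideanSpace.proj (𝕜 := ℝ) r).contDiff.contDiffAt

variable {S} {θ : Euc dθ} {P : Matrix (Fin dx) (Fin dx) ℝ}

theorem contDiffAt_hess {N : WithTop ℕ∞} {f : E → Euc dθ} {g : E → Matrix (Fin dx) (Fin dx) ℝ}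
    (hf : ContDiffAt ℝ N f x) (hg : ContDiffAt ℝ N g x) :
    ContDiffAt ℝ N (fun y => S.hess (f y) (g y)) x := by
  have hB : ContDiffAt ℝ N (fun y => S.B (f y)) x := S.contDiff_B.contDiffAt.comp x hf
  exact contDiffAt_const.add ((hB.matrix_transpose.matrix_mul hg).matrix_mul hB)

theorem contDiffAt_gain {N : WithTop ℕ∞} {f : E → Euc dθ} {g : E → Matrix (Fin dx) (Fin dx) ℝ}
    (hf : ContDiffAt ℝ N f x) (hg : ContDiffAt ℝ N g x) (h0 : (S.hess (f x) (g x)).det ≠ 0) :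
    ContDiffAt ℝ N (fun y => S.gain (f y) (g y)) x := by
  have hB : ContDiffAt ℝ N (fun y => S.B (f y)) x := S.contDiff_B.contDiffAt.comp x hf
  exact (((((contDiffAt_hess hf hg).matrix_inv h0).matrix_mul hB.matrix_transpose).matrix_mul
    hg).matrix_mul contDiffAt_const).neg

theorem contDiffAt_riccati {N : WithTop ℕ∞} {f : E → Euc dθ}
    {g : E → Matrix (Fin dx) (Fin dx) ℝ}
    (hf : ContDiffAt ℝ N f x) (hg : ContDiffAt ℝ N g x) (h0 : (S.hess (f x) (g x)).det ≠ 0) :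
    ContDiffAt ℝ N (fun y => S.riccati (f y) (g y)) x := by
  have hB : ContDiffAt ℝ N (fun y => S.B (f y)) x := S.contDiff_B.contDiffAt.comp x hf
  have hc : ContDiffAt ℝ N (fun y => S.closedLoop (f y) (g y)) x :=
    contDiffAt_const.add (hB.matrix_mul (contDiffAt_gain hf hg h0))
  simp only [riccati_eq_closedLoop]
  exact contDiffAt_const.add ((contDiffAt_const.matrix_mul hg).matrix_mul hc)

/-- The defect of the Riccati equation. -/
def defect (S : System dx du dθ) (z : Euc dθ × Matrix (Fin dx) (Fin dx) ℝ) :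
    Matrix (Fin dx) (Fin dx) ℝ :=
  S.riccati z.1 z.2 - z.2

theorem contDiffAt_defect (hR : S.R.PosDef) (hP : P.PosSemidef) :
    ContDiffAt ℝ 2 S.defect (θ, P) := by
  have h1 : ContDiffAt ℝ 2 (Prod.fst : Euc dθ × Matrix (Fin dx) (Fin dx) ℝ → _) (θ, P) :=
    contDiffAt_fst
  have h2 : ContDiffAt ℝ 2 (Prod.snd : Euc dθ × Matrix (Fin dx) (Fin dx) ℝ → _) (θ, P) :=
    contDiffAt_snd
  have h3 := contDiffAt_riccati (S := S) h1 h2 (hess_posDef (θ := θ) hR hP).det_pos.ne'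
  exact h3.sub h2

/-- The exact difference formula turns the difference quotient along the line `P + s X` into a
continuous function of `s`, so no derivative of an inverse has to be computed. -/
theorem fderiv_defect_inr (hR : S.R.PosDef) (hQ : S.Q.PosDef) (hP : P.PosSemidef)
    (hfix : S.riccati θ P = P) (X : Matrix (Fin dx) (Fin dx) ℝ) :
    fderiv ℝ S.defect (θ, P) (0, X)
      = (S.closedLoop θ P)ᵀ * X * S.closedLoop θ P - X := by
  have hdet := (hess_posDef (θ := θ) hR hP).det_pos.ne'
  have h1 : HasFDerivAt S.defect (fderiv ℝ S.defect (θ, P)) (θ, P) :=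
    ((contDiffAt_defect hR hP).differentiableAt (by norm_num)).hasFDerivAt
  have hline : HasDerivAt (fun s : ℝ => ((θ, P + s • X) : Euc dθ × Matrix (Fin dx) (Fin dx) ℝ))
      (0, X) 0 := by
    refine (hasDerivAt_const _ _).prodMk ?_
    simpa using ((hasDerivAt_id (0 : ℝ)).smul_const X).const_add P
  have h1' : HasFDerivAt S.defect (fderiv ℝ S.defect (θ, P)) (θ, P + (0 : ℝ) • X) := by
    simpa using h1
  have h2 : HasDerivAt (fun s : ℝ => S.defect (θ, P + s • X))
      (fderiv ℝ S.defect (θ, P) (0, X)) 0 :=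
    HasFDerivAt.comp_hasDerivAt (f := fun s : ℝ => (θ, P + s • X)) 0 h1' hline
  have hcont : ContinuousAt (fun s : ℝ => P + s • X) 0 := by fun_prop
  have hP0 : P + (0 : ℝ) • X = P := by simp
  have hcl : ContinuousAt (fun s : ℝ => S.closedLoop θ (P + s • X)) 0 := by
    have h3 : ContDiffAt ℝ 2 (fun s : ℝ => P + s • X) 0 := by fun_prop
    have h4 : ContDiffAt ℝ 2 (fun s : ℝ => S.gain θ (P + s • X)) 0 :=
      contDiffAt_gain contDiffAt_const h3 (by rw [hP0]; exact hdet)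
    have h5 : ContDiffAt ℝ 2 (fun s : ℝ => S.closedLoop θ (P + s • X)) 0 :=
      contDiffAt_const.add (contDiffAt_const.matrix_mul h4)
    exact h5.continuousAt
  have hev : ∀ᶠ s : ℝ in 𝓝 0, (S.hess θ (P + s • X)).det ≠ 0 := by
    have h3 : Continuous fun s : ℝ => (S.hess θ (P + s • X)).det := by
      unfold hess; fun_prop
    exact h3.continuousAt.eventually_ne (by rw [hP0]; exact hdet)
  have h3 : Tendsto (slope (fun s : ℝ => S.defect (θ, P + s • X)) 0) (𝓝[≠] 0)
      (𝓝 ((S.closedLoop θ P)ᵀ * X * S.closedLoop θ P - X)) := by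
    have h4 : ContinuousAt (fun s : ℝ => (S.closedLoop θ P)ᵀ * X * S.closedLoop θ (P + s • X) - X)
        0 := (continuousAt_const.matrix_mul hcl).sub continuousAt_const
    have h5 := h4.tendsto
    rw [hP0] at h5
    refine (h5.mono_left nhdsWithin_le_nhds).congr' ?_
    filter_upwards [nhdsWithin_le_nhds hev, self_mem_nhdsWithin] with s hs hs0
    have h6 := riccati_sub_riccati (θ := θ) hR hQ hP (P' := P + s • X) (Ne.isUnit hs)
    rw [hfix, add_sub_cancel_left, Matrix.mul_smul, Matrix.smul_mul] at h6
    rw [slope_def_module]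
    simp only [defect, sub_zero, zero_smul, add_zero, hfix, sub_self]
    rw [sub_add_eq_sub_sub, h6, ← smul_sub, smul_smul, inv_mul_cancel₀ hs0, one_smul]
  exact tendsto_nhds_unique (hasDerivAt_iff_tendsto_slope.1 h2) h3

/-- The kernel is trivial by the Lyapunov argument, and an injective endomorphism in finite
dimension is invertible. All matrices, not only symmetric ones, are allowed as directions. -/
theorem isInvertible_fderiv_defect (hR : S.R.PosDef) (hQ : S.Q.PosDef) (hP : P.PosSemidef)
    (hfix : S.riccati θ P = P) :
    (fderiv ℝ S.defect (θ, P) ∘L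
      .inr ℝ (Euc dθ) (Matrix (Fin dx) (Fin dx) ℝ)).IsInvertible := by
  set L := fderiv ℝ S.defect (θ, P) ∘L .inr ℝ (Euc dθ) (Matrix (Fin dx) (Fin dx) ℝ) with hL
  have hinj : Function.Injective (L : Matrix (Fin dx) (Fin dx) ℝ →ₗ[ℝ] Matrix (Fin dx) (Fin dx) ℝ) := by
    rw [injective_iff_map_eq_zero]
    intro X hX
    have h1 := fderiv_defect_inr hR hQ hP hfix X
    have h2 : fderiv ℝ S.defect (θ, P) (0, X) = 0 := hX
    rw [h2] at h1
    exact eq_zero_of_lyapunov hR hQ hP hfix hP hfix (sub_eq_zero.1 h1.symm).symm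
  refine ⟨(LinearEquiv.ofInjectiveEndo _ hinj).toContinuousLinearEquiv, ?_⟩
  ext X : 1
  rfl

theorem hess_transpose (hR : S.R.PosDef) (P : Matrix (Fin dx) (Fin dx) ℝ) :
    (S.hess θ P)ᵀ = S.hess θ Pᵀ := by
  simp [hess, Matrix.transpose_mul, hR.posSemidef.transpose_eq, Matrix.mul_assoc]

/-- Without symmetry of `P`: the transpose of a solution is a solution, which makes the implicit
function symmetric by local uniqueness. -/
theorem riccati_transpose_eq (hR : S.R.PosDef) (hQ : S.Q.PosDef)
    (P : Matrix (Fin dx) (Fin dx) ℝ) : (S.riccati θ P)ᵀ = S.riccati θ Pᵀ := by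
  simp [riccati, Matrix.transpose_mul, Matrix.transpose_nonsing_inv, hess_transpose hR,
    hQ.posSemidef.transpose_eq, Matrix.mul_assoc]

/-- Near the nominal parameter, the solution of the Riccati equation is a smooth function. -/
theorem exists_smooth_solution (hS : S.IsInstance θ) :
    ∃ ψ : Euc dθ → Matrix (Fin dx) (Fin dx) ℝ, ContDiffAt ℝ 2 ψ θ ∧
      ∀ᶠ ϑ in 𝓝 θ, (ψ ϑ).PosSemidef ∧ S.riccati ϑ (ψ ϑ) = ψ ϑ ∧ S.P ϑ = ψ ϑ := by
  have hR := hS.R_posDef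
  have hQ := hS.Q_posDef
  obtain ⟨P, hP, hfix⟩ := exists_riccati_fixed hS
  have cdf : ContDiffAt ℝ 2 S.defect (θ, P) := contDiffAt_defect hR hP
  have hinv := isInvertible_fderiv_defect hR hQ hP hfix
  set ψ := cdf.implicitFunction (by norm_num) hinv with hψ
  have hψc : ContDiffAt ℝ 2 ψ θ := cdf.contDiffAt_implicitFunction (by norm_num) hinv
  have hψθ : ψ θ = P := cdf.implicitFunction_apply_self (by norm_num) hinv
  have hd0 : S.defect (θ, P) = 0 := sub_eq_zero.2 hfix
  have h1 : ∀ᶠ ϑ in 𝓝 θ, S.defect (ϑ, ψ ϑ) = 0 := by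
    have := cdf.eventually_apply_implicitFunction (by norm_num) hinv
    rwa [hd0] at this
  have h2 := cdf.eventually_apply_eq_iff_implicitFunction (by norm_num) hinv
  -- Near `(θ, P)` the implicit function is the only zero of the defect, and its transpose is a zero
  -- as well.
  have hsym : ∀ᶠ ϑ in 𝓝 θ, (ψ ϑ)ᵀ = ψ ϑ := by
    have h3 : ContinuousAt (fun ϑ => (ϑ, (ψ ϑ)ᵀ)) θ :=
      continuousAt_id.prodMk hψc.matrix_transpose.continuousAt
    have h4 : Tendsto (fun ϑ => (ϑ, (ψ ϑ)ᵀ)) (𝓝 θ) (𝓝 (θ, P)) := by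
      have := h3.tendsto
      rwa [hψθ, hP.transpose_eq] at this
    filter_upwards [h4.eventually h2, h1] with ϑ h5 h6
    rw [hd0] at h5
    refine (h5.1 ?_).symm
    have h7 : S.riccati ϑ (ψ ϑ) = ψ ϑ := sub_eq_zero.1 h6
    rw [defect, ← riccati_transpose_eq hR hQ, h7, sub_self]
  obtain ⟨c, hc, hcQ⟩ := hQ.exists_norm_sq_le
  have hclose : ∀ᶠ ϑ in 𝓝 θ, dx * ‖ψ ϑ - P‖ < c := by
    have h3 : ContinuousAt (fun ϑ => dx * ‖ψ ϑ - P‖) θ :=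
      continuousAt_const.mul (hψc.continuousAt.sub continuousAt_const).norm
    refine h3.eventually_lt continuousAt_const ?_
    rw [hψθ]; simpa using hc
  refine ⟨ψ, hψc, ?_⟩
  filter_upwards [h1, hsym, hclose] with ϑ h5 h6 h7
  -- At the nominal parameter `P` dominates `Q`, hence `c` times the squared norm; a perturbation
  -- smaller than `c` keeps the form nonnegative.
  have hpsd : (ψ ϑ).PosSemidef := by
    refine posSemidef_of_quad_nonneg h6 fun v => ?_
    have h8 := abs_quad_le (ψ ϑ - P) v
    rw [quad_sub_left, abs_le] at h8
    have h9 := quad_Q_le_riccati (θ := θ) hR hP v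
    rw [hfix] at h9
    nlinarith [hcQ v, h8.1, sq_nonneg ‖v‖]
  exact ⟨hpsd, sub_eq_zero.1 h5, P_eq_of_fixed hR hQ hpsd (sub_eq_zero.1 h5)⟩

end System

end MatrixCalculus

/-- The squared Frobenius norm. -/
def frob {k l : ℕ} (M : Matrix (Fin k) (Fin l) ℝ) : ℝ := ∑ i, ∑ j, M i j ^ 2

theorem frob_nonneg {k l : ℕ} (M : Matrix (Fin k) (Fin l) ℝ) : 0 ≤ frob M :=
  Finset.sum_nonneg fun _ _ => Finset.sum_nonneg fun _ _ => sq_nonneg _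

theorem norm_mv_sq_le_frob {k l : ℕ} (M : Matrix (Fin k) (Fin l) ℝ) (v : Euc l) :
    ‖mv M v‖ ^ 2 ≤ frob M * ‖v‖ ^ 2 := exists_norm_mv_le M v

/-- Uniform bounds for the Riccati solution, the Hessian and the gain on a ball around the nominal
parameter; `Kt` is a smooth global extension of the gain. -/
structure LocalBounds (S : System dx du dθ) (θ : Euc dθ) (ε₀ q c : ℝ)
    (Kt : Euc dθ → Matrix (Fin du) (Fin dx) ℝ) : Prop where
  eps_pos : 0 < ε₀
  q_pos : 0 < q
  q_lt : q < 1
  one_le : 1 ≤ c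
  P_psd : ∀ ϑ ∈ Metric.ball θ ε₀, (S.P ϑ).PosSemidef
  P_fix : ∀ ϑ ∈ Metric.ball θ ε₀, S.riccati ϑ (S.P ϑ) = S.P ϑ
  rate : ∀ ϑ ∈ Metric.ball θ ε₀, ∀ v, q * quad (S.P ϑ) v ≤ quad S.Q v
  P_le : ∀ ϑ ∈ Metric.ball θ ε₀, ∀ v, quad (S.P ϑ) v ≤ c * ‖v‖ ^ 2
  hess_le : ∀ ϑ ∈ Metric.ball θ ε₀, ∀ u, quad (S.hess ϑ (S.P ϑ)) u ≤ c * ‖u‖ ^ 2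
  hess_nominal_le : ∀ ϑ ∈ Metric.ball θ ε₀, ∀ u,
    quad (S.hess θ (S.P θ)) u ≤ (1 + c * dist ϑ θ) * quad (S.hess ϑ (S.P ϑ)) u
  B_le : ∀ ϑ ∈ Metric.ball θ ε₀, ∀ u, ‖mv (S.B ϑ) u‖ ^ 2 ≤ c * ‖u‖ ^ 2
  A_le : ∀ v, ‖mv S.A v‖ ^ 2 ≤ c * ‖v‖ ^ 2
  le_Q : ∀ v, ‖v‖ ^ 2 ≤ c * quad S.Q v
  le_R : ∀ u, ‖u‖ ^ 2 ≤ c * quad S.R u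
  K_eq : ∀ ϑ ∈ Metric.ball θ ε₀, S.K ϑ = Kt ϑ
  K_smooth : ∀ i j, ContDiff ℝ 2 fun ϑ => Kt ϑ i j
  K_lip : ∀ ϑ, frob (Kt ϑ - Kt θ) ≤ c * dist ϑ θ ^ 2
  dK_lip : ∀ ϑ i j l, |fderiv ℝ (fun ϑ => Kt ϑ i j) ϑ (EuclideanSpace.single l 1)
    - fderiv ℝ (fun ϑ => Kt ϑ i j) θ (EuclideanSpace.single l 1)| ≤ c * dist ϑ θ

/-! ### Uniform constants near the nominal parameter -/

section LocalBounds

attribute [local instance] Matrix.normedAddCommGroup Matrix.normedSpace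

theorem exists_lipschitz {f : Euc dθ → ℝ} (hf : ContDiff ℝ 1 f) (hs : HasCompactSupport f) :
    ∃ L : ℝ, 0 ≤ L ∧ ∀ x y, |f x - f y| ≤ L * dist x y := by
  obtain ⟨L, hL⟩ := ContDiff.lipschitzWith_of_hasCompactSupport hs hf (by norm_num)
  exact ⟨L, L.2, fun x y => hL.dist_le_mul x y⟩

/-- Continuity at `θ` of the smooth solution gives all bounds on a small ball. The gain is
multiplied by a bump function, since the van Trees inequality needs a function of the parameter that
is smooth on the whole space; compact support also makes the gain and its derivative globally
Lipschitz. -/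
theorem exists_localBounds {S : System dx du dθ} {θ : Euc dθ} (hS : S.IsInstance θ) :
    ∃ ε₀ q c Kt, LocalBounds S θ ε₀ q c Kt := by
  have hR := hS.R_posDef
  have hQ := hS.Q_posDef
  obtain ⟨ψ, hψ, hev⟩ := S.exists_smooth_solution hS
  have hθ := hev.self_of_nhds
  have hdet : ∀ ϑ, (ψ ϑ).PosSemidef → (S.hess ϑ (ψ ϑ)).det ≠ 0 := fun ϑ h =>
    (System.hess_posDef (θ := ϑ) hR h).det_pos.ne'
  have hH : ContDiffAt ℝ 2 (fun ϑ => S.hess ϑ (ψ ϑ)) θ := System.contDiffAt_hess contDiffAt_id hψ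
  obtain ⟨L, hL⟩ := (hH.differentiableAt (by norm_num)).hasFDerivAt.isBigO_sub.bound
  have hbd : ∀ {k l : ℕ} {f : Euc dθ → Matrix (Fin k) (Fin l) ℝ}, ContinuousAt f θ →
      ∀ᶠ ϑ in 𝓝 θ, ‖f ϑ‖ < ‖f θ‖ + 1 := fun hf =>
    hf.norm.eventually_lt continuousAt_const (by linarith)
  have hB : ContinuousAt S.B θ := (S.contDiff_B (N := 2)).contDiffAt.continuousAt
  obtain ⟨δ, hδ, hball⟩ := Metric.eventually_nhds_iff_ball.1
    (hev.and ((hψ.eventually (by norm_num)).and (hL.and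
      ((hbd hψ.continuousAt).and ((hbd hH.continuousAt).and (hbd hB))))))
  obtain ⟨cR, hcR, hR'⟩ := hR.exists_norm_sq_le
  obtain ⟨cQ, hcQ, hQ'⟩ := hQ.exists_norm_sq_le
  -- The bump equals one on the ball of radius `δ / 2`, which becomes `ε₀`, and vanishes before the
  -- solution ceases to be controlled at radius `δ`.
  let χ : ContDiffBump θ := ⟨δ / 2, 3 * δ / 4, by linarith, by linarith⟩
  set Kt : Euc dθ → Matrix (Fin du) (Fin dx) ℝ := fun ϑ => χ ϑ • S.gain ϑ (ψ ϑ) with hKt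
  have hKsupp : ∀ i j, HasCompactSupport fun ϑ => Kt ϑ i j := fun i j => by
    have := χ.hasCompactSupport.mul_right (f' := fun ϑ => S.gain ϑ (ψ ϑ) i j)
    exact this
  have hKsm : ∀ i j, ContDiff ℝ 2 fun ϑ => Kt ϑ i j := fun i j => by
    rw [contDiff_iff_contDiffAt]
    intro ϑ
    by_cases hϑ : ϑ ∈ Metric.ball θ δ
    · have h1 := System.contDiffAt_gain (S := S) (f := id) contDiffAt_id (hball ϑ hϑ).2.1
        (hdet ϑ (hball ϑ hϑ).1.1)
      exact χ.contDiff.contDiffAt.mul (contDiffAt_matrix_iff.1 h1 i j)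
    · have h1 : ϑ ∉ tsupport χ := by
        rw [χ.tsupport_eq]
        simp only [Metric.mem_ball, not_lt] at hϑ
        simp only [Metric.mem_closedBall, not_le]
        exact lt_of_lt_of_le (by change 3 * δ / 4 < δ; linarith) hϑ
      have h2 : (fun ϑ => Kt ϑ i j) =ᶠ[𝓝 ϑ] fun _ => 0 := by
        filter_upwards [(notMem_tsupport_iff_eventuallyEq.1 h1)] with y hy
        simp [hKt, hy]
      exact contDiffAt_const.congr_of_eventuallyEq h2
  choose LK hLK0 hLK using fun i j => exists_lipschitz ((hKsm i j).of_le (by norm_num)) (hKsupp i j)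
  have hdK : ∀ i j l, ∃ L : ℝ, 0 ≤ L ∧ ∀ x y,
      |fderiv ℝ (fun ϑ => Kt ϑ i j) x (EuclideanSpace.single l 1)
        - fderiv ℝ (fun ϑ => Kt ϑ i j) y (EuclideanSpace.single l 1)| ≤ L * dist x y :=
    fun i j l => by
      refine exists_lipschitz (f := fun x => fderiv ℝ (fun ϑ => Kt ϑ i j) x
        (EuclideanSpace.single l 1)) ?_ ?_
      · exact ((hKsm i j).fderiv_right (m := 1) (by norm_num)).clm_apply contDiff_const
      · exact (hKsupp i j).fderiv_apply (𝕜 := ℝ) _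
  choose LD hLD0 hLD using hdK
  have hL0 : L ≤ |L| := le_abs_self L
  set cP : ℝ := dx * (‖ψ θ‖ + 1) with hcP
  set cH : ℝ := du * (‖S.hess θ (ψ θ)‖ + 1) with hcH
  set cB : ℝ := dx * du * (‖S.B θ‖ + 1) ^ 2 with hcB
  set cL : ℝ := du * |L| / cR with hcL
  set cK : ℝ := ∑ i, ∑ j, LK i j ^ 2 with hcK
  set cD : ℝ := ∑ i, ∑ j, ∑ l, LD i j l with hcD
  have p1 : 0 ≤ cP := by positivity
  have p2 : 0 ≤ cH := by positivity
  have p3 : 0 ≤ cB := by positivity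
  have p4 : 0 ≤ cL := by positivity
  have p5 : 0 ≤ cK := by positivity
  have p6 : 0 ≤ cD := Finset.sum_nonneg fun i _ => Finset.sum_nonneg fun j _ =>
    Finset.sum_nonneg fun l _ => hLD0 i j l
  have p7 : 0 ≤ frob S.A := frob_nonneg _
  have p8 : 0 ≤ cQ⁻¹ := by positivity
  have p9 : 0 ≤ cR⁻¹ := by positivity
  -- A single constant dominating all the individual ones.
  set c : ℝ := 1 + cP + cH + cB + cL + cK + cD + frob S.A + cQ⁻¹ + cR⁻¹ with hc
  have hmem : ∀ ϑ ∈ Metric.ball θ (δ / 2), ϑ ∈ Metric.ball θ δ := fun ϑ hϑ =>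
    Metric.ball_subset_ball (by linarith) hϑ
  -- From `Q ⪰ cQ` and `P ⪯ cP`; the added one avoids a division by zero.
  set q : ℝ := min (cQ / (cP + 1)) (1 / 2) with hq
  have hq0 : 0 < q := by positivity
  have hPle : ∀ ϑ ∈ Metric.ball θ (δ / 2), ∀ v, quad (S.P ϑ) v ≤ cP * ‖v‖ ^ 2 := by
    intro ϑ hϑ v
    have hb := hball ϑ (hmem ϑ hϑ)
    rw [hb.1.2.2]
    refine (le_abs_self _).trans ((abs_quad_le _ v).trans ?_)
    have := hb.2.2.2.1.le
    rw [hcP]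
    gcongr
  have hHd : ∀ ϑ ∈ Metric.ball θ (δ / 2), (S.hess ϑ (S.P ϑ)).PosSemidef ∧
      ∀ u, quad S.R u ≤ quad (S.hess ϑ (S.P ϑ)) u := by
    intro ϑ hϑ
    have hb := hball ϑ (hmem ϑ hϑ)
    rw [hb.1.2.2]
    refine ⟨(System.hess_posDef hR hb.1.1).posSemidef, fun u => ?_⟩
    rw [System.hess, quad_add_left, quad_conj]
    linarith [hb.1.1.quad_nonneg (mv (S.B ϑ) u)]
  refine ⟨δ / 2, q, c, Kt, by positivity, hq0, (min_le_right _ _).trans_lt (by norm_num),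
    by linarith, ?_, ?_, ?_, ?_, ?_, ?_, ?_, ?_, ?_, ?_, ?_, hKsm, ?_, ?_⟩
  · intro ϑ hϑ
    have hb := hball ϑ (hmem ϑ hϑ)
    rw [hb.1.2.2]; exact hb.1.1
  · intro ϑ hϑ
    have hb := hball ϑ (hmem ϑ hϑ)
    rw [hb.1.2.2]; exact hb.1.2.1
  · intro ϑ hϑ v
    have h1 := hPle ϑ hϑ v
    have h2 : q ≤ cQ / (cP + 1) := min_le_left _ _
    calc q * quad (S.P ϑ) v ≤ q * ((cP + 1) * ‖v‖ ^ 2) := by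
          gcongr; nlinarith [sq_nonneg ‖v‖]
      _ ≤ cQ / (cP + 1) * ((cP + 1) * ‖v‖ ^ 2) := by gcongr
      _ = cQ * ‖v‖ ^ 2 := by field_simp
      _ ≤ _ := hQ' v
  · intro ϑ hϑ v
    refine (hPle ϑ hϑ v).trans ?_
    gcongr; linarith
  · intro ϑ hϑ u
    have hb := hball ϑ (hmem ϑ hϑ)
    rw [hb.1.2.2]
    refine (le_abs_self _).trans ((abs_quad_le _ u).trans ?_)
    have := hb.2.2.2.2.1.le
    have h1 : (du : ℝ) * ‖S.hess ϑ (ψ ϑ)‖ ≤ cH := by rw [hcH]; gcongr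
    gcongr
    linarith
  · intro ϑ hϑ u
    have hb := hball ϑ (hmem ϑ hϑ)
    have h1 := hb.2.2.1
    have h2 := abs_quad_le (S.hess ϑ (ψ ϑ) - S.hess θ (ψ θ)) u
    rw [quad_sub_left, abs_le] at h2
    have h3 := (hHd ϑ hϑ).2 u
    rw [hb.1.2.2] at h3 ⊢
    rw [hθ.2.2]
    have h4 := hR' u
    -- The Hessian dominates `R ⪰ cR`, which turns the Lipschitz estimate for the Hessian into a
    -- relative error.
    have h5 : ‖u‖ ^ 2 ≤ quad (S.hess ϑ (ψ ϑ)) u / cR := by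
      rw [le_div_iff₀ hcR]; linarith
    have h0 : 0 ≤ quad (S.hess ϑ (ψ ϑ)) u := (hR.posSemidef.quad_nonneg u).trans h3
    have h6 : ‖S.hess ϑ (ψ ϑ) - S.hess θ (ψ θ)‖ ≤ |L| * dist ϑ θ := by
      rw [dist_eq_norm]
      exact h1.trans (by gcongr)
    have h7 : (du : ℝ) * ‖S.hess ϑ (ψ ϑ) - S.hess θ (ψ θ)‖ * ‖u‖ ^ 2
        ≤ du * (|L| * dist ϑ θ) * (quad (S.hess ϑ (ψ ϑ)) u / cR) := by gcongr
    have h8 : (du : ℝ) * (|L| * dist ϑ θ) * (quad (S.hess ϑ (ψ ϑ)) u / cR)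
        = cL * dist ϑ θ * quad (S.hess ϑ (ψ ϑ)) u := by rw [hcL]; ring
    have h9 : cL * dist ϑ θ * quad (S.hess ϑ (ψ ϑ)) u
        ≤ c * dist ϑ θ * quad (S.hess ϑ (ψ ϑ)) u := by gcongr; linarith
    linarith [h2.1]
  · intro ϑ hϑ u
    have hb := hball ϑ (hmem ϑ hϑ)
    refine (norm_mv_sq_le (S.B ϑ) u).trans ?_
    have := hb.2.2.2.2.2.le
    have h1 : (dx * du : ℝ) * ‖S.B ϑ‖ ^ 2 ≤ cB := by rw [hcB]; gcongr
    gcongr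
    linarith
  · intro v
    refine (norm_mv_sq_le_frob S.A v).trans ?_
    gcongr; linarith
  · intro v
    have h1 : ‖v‖ ^ 2 ≤ cQ⁻¹ * quad S.Q v := by
      rw [inv_mul_eq_div, le_div_iff₀ hcQ]; linarith [hQ' v]
    refine h1.trans (mul_le_mul_of_nonneg_right (by linarith) (hQ.posSemidef.quad_nonneg v))
  · intro v
    have h1 : ‖v‖ ^ 2 ≤ cR⁻¹ * quad S.R v := by
      rw [inv_mul_eq_div, le_div_iff₀ hcR]; linarith [hR' v]
    refine h1.trans (mul_le_mul_of_nonneg_right (by linarith) (hR.posSemidef.quad_nonneg v))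
  · intro ϑ hϑ
    have hb := hball ϑ (hmem ϑ hϑ)
    have h1 : χ ϑ = 1 := χ.one_of_mem_closedBall
      (Metric.ball_subset_closedBall hϑ)
    rw [System.K, hb.1.2.2, hKt]
    simp [h1]
  · intro ϑ
    have h1 : frob (Kt ϑ - Kt θ) ≤ cK * dist ϑ θ ^ 2 := by
      rw [frob, hcK, Finset.sum_mul]
      refine Finset.sum_le_sum fun i _ => ?_
      rw [Finset.sum_mul]
      refine Finset.sum_le_sum fun j _ => ?_
      rw [← mul_pow]
      refine sq_le_sq.2 ?_
      exact (hLK i j ϑ θ).trans (le_abs_self _)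
    refine h1.trans ?_
    gcongr; linarith
  · intro ϑ i j l
    refine (hLD i j l ϑ θ).trans ?_
    have h1 : LD i j l ≤ cD := by
      calc LD i j l ≤ ∑ l, LD i j l :=
            Finset.single_le_sum (f := fun l => LD i j l) (fun l _ => hLD0 i j l)
              (Finset.mem_univ l)
        _ ≤ ∑ j, ∑ l, LD i j l :=
            Finset.single_le_sum (f := fun j => ∑ l, LD i j l)
              (fun j _ => Finset.sum_nonneg fun l _ => hLD0 i j l) (Finset.mem_univ j)
        _ ≤ cD := Finset.single_le_sum (f := fun i => ∑ j, ∑ l, LD i j l)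
              (fun i _ => Finset.sum_nonneg fun j _ => Finset.sum_nonneg fun l _ => hLD0 i j l)
              (Finset.mem_univ i)
    gcongr
    linarith

end LocalBounds

/-! ### Histories, measurability, and independence of the noise from the past -/

section Histories

variable {Ω Ξ : Type*} [MeasurableSpace Ω] [MeasurableSpace Ξ]

theorem measurable_snoc {n : ℕ} {E : Type*} [MeasurableSpace E] :
    Measurable fun z : (Fin n → E) × E => (Fin.snoc (α := fun _ => E) z.1 z.2 : Fin (n + 1) → E) := by
  refine measurable_pi_iff.2 fun i => ?_
  refine Fin.lastCases ?_ (fun i => ?_) i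
  · simpa using measurable_snd
  · simpa [Function.comp_def] using (measurable_pi_apply i).comp measurable_fst

theorem System.continuous_mv_B (S : System dx du dθ) :
    Continuous fun z : Euc dθ × Euc du => mv (S.B z.1) z.2 := by
  have : Continuous fun z : Euc dθ × Euc du => S.B z.1 *ᵥ z.2.ofLp := by
    refine continuous_pi fun i => ?_
    simp only [System.B, Matrix.mulVec, dotProduct, Matrix.of_apply]
    fun_prop
  exact (PiLp.continuous_toLp 2 _).comp this

namespace System

variable (S : System dx du dθ) {w : ℕ → Ω → Euc dx} {ξ : Ω → Ξ} (π : Policy dx du Ξ)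

theorem measurable_history_uncurry (hw : ∀ t, Measurable (w t)) (hξ : Measurable ξ) (t : ℕ) :
    Measurable fun z : Euc dθ × Ω => S.history w ξ π z.1 z.2 t := by
  induction t with
  | zero => exact measurable_const
  | succ t ih =>
      have hu : Measurable fun z : Euc dθ × Ω => π.act t (S.history w ξ π z.1 z.2 t) (ξ z.2) :=
        (π.measurable_act t).comp (ih.prodMk (hξ.comp measurable_snd))
      have hx : Measurable fun z : Euc dθ × Ω => S.history w ξ π z.1 z.2 t (Fin.last t) :=
        (measurable_pi_apply _).comp ih
      have h1 : Measurable fun z : Euc dθ × Ω =>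
          mv S.A (S.history w ξ π z.1 z.2 t (Fin.last t))
            + mv (S.B z.1) (π.act t (S.history w ξ π z.1 z.2 t) (ξ z.2)) + w t z.2 :=
        (((measurable_mv S.A).comp hx).add
          (S.continuous_mv_B.measurable.comp (measurable_fst.prodMk hu))).add
          ((hw t).comp measurable_snd)
      exact measurable_snoc.comp (ih.prodMk h1)

theorem measurable_history (hw : ∀ t, Measurable (w t)) (hξ : Measurable ξ) (θ : Euc dθ) (t : ℕ) :
    Measurable fun ω => S.history w ξ π θ ω t :=
  (S.measurable_history_uncurry π hw hξ t).comp measurable_prodMk_left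

theorem history_congr {Ω' : Type*} {w' : ℕ → Ω' → Euc dx} {ξ' : Ω' → Ξ}
    (θ : Euc dθ) {ω : Ω} {ω' : Ω'} (hξ : ξ ω = ξ' ω') (t : ℕ) (h : ∀ s < t, w s ω = w' s ω') :
    S.history w ξ π θ ω t = S.history w' ξ' π θ ω' t := by
  induction t with
  | zero => rfl
  | succ t ih =>
      simp only [history, ih fun s hs => h s (by omega), hξ, h t (by omega)]

/-- What the policy knows at time `t`: the randomization and the history of the states. -/
def past (w : ℕ → Ω → Euc dx) (ξ : Ω → Ξ) (θ : Euc dθ) (t : ℕ) (ω : Ω) :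
    Ξ × (Fin (t + 1) → Euc dx) :=
  (ξ ω, S.history w ξ π θ ω t)

theorem measurable_past (hw : ∀ t, Measurable (w t)) (hξ : Measurable ξ) (θ : Euc dθ) (t : ℕ) :
    Measurable (S.past π w ξ θ t) :=
  hξ.prodMk (S.measurable_history π hw hξ θ t)

theorem measurable_past_uncurry (hw : ∀ t, Measurable (w t)) (hξ : Measurable ξ) (t : ℕ) :
    Measurable fun z : Euc dθ × Ω => S.past π w ξ z.1 t z.2 :=
  (hξ.comp measurable_snd).prodMk (S.measurable_history_uncurry π hw hξ t)

/-- The history up to time `s`, as a function of the history up to time `t`. -/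
def restrictPast {s t : ℕ} (h : s ≤ t) (y : Ξ × (Fin (t + 1) → Euc dx)) :
    Ξ × (Fin (s + 1) → Euc dx) :=
  (y.1, fun i => y.2 (Fin.castLE (by omega) i))

theorem measurable_restrictPast {s t : ℕ} (h : s ≤ t) :
    Measurable (restrictPast (Ξ := Ξ) (dx := dx) h) := by
  refine measurable_fst.prodMk (measurable_pi_iff.2 fun i => ?_)
  exact (measurable_pi_apply _).comp measurable_snd

theorem restrictPast_past {s t : ℕ} (h : s ≤ t) (θ : Euc dθ) (ω : Ω) :
    restrictPast h (S.past π w ξ θ t ω) = S.past π w ξ θ s ω := by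
  induction t, h using Nat.le_induction with
  | base => rfl
  | succ t hst ih =>
      rw [← ih]
      refine Prod.ext rfl (funext fun i => ?_)
      have h1 : (Fin.castLE (by omega) i : Fin (t + 2)) = Fin.castSucc (Fin.castLE (by omega) i) := by
        ext; rfl
      simp only [restrictPast, past, history]
      rw [h1, Fin.snoc_castSucc]

/-- The state at time `s`, as a function of the history up to time `t`. -/
def pastState {t : ℕ} (s : ℕ) (y : Ξ × (Fin (t + 1) → Euc dx)) : Euc dx :=
  if h : s ≤ t then (restrictPast h y).2 (Fin.last s) else 0

variable {π} in
theorem measurable_pastState {t : ℕ} (s : ℕ) :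
    Measurable (pastState (Ξ := Ξ) (dx := dx) (t := t) s) := by
  unfold pastState
  split_ifs with h
  · exact (measurable_pi_apply _).comp (measurable_snd.comp (measurable_restrictPast h))
  · exact measurable_const

theorem pastState_past {s t : ℕ} (h : s ≤ t) (θ : Euc dθ) (ω : Ω) :
    pastState s (S.past π w ξ θ t ω) = S.state w ξ π θ s ω := by
  rw [pastState, dif_pos h, restrictPast_past]; rfl

/-- The input at time `s`, as a function of the history up to time `t`. -/
def pastInput {t : ℕ} (s : ℕ) (y : Ξ × (Fin (t + 1) → Euc dx)) : Euc du :=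
  if h : s ≤ t then π.act s (restrictPast h y).2 y.1 else 0

theorem measurable_pastInput {t : ℕ} (s : ℕ) : Measurable (pastInput π (t := t) s) := by
  unfold pastInput
  split_ifs with h
  · exact (π.measurable_act s).comp
      ((measurable_snd.comp (measurable_restrictPast h)).prodMk measurable_fst)
  · exact measurable_const

theorem pastInput_past {s t : ℕ} (h : s ≤ t) (θ : Euc dθ) (ω : Ω) :
    pastInput π s (S.past π w ξ θ t ω) = S.input w ξ π θ s ω := by
  rw [pastInput, dif_pos h, restrictPast_past]; rfl

variable {μ : Measure Ω} [IsProbabilityMeasure μ]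

/-- The noise at time `t` is independent of the past. -/
theorem indepFun_past (hw : IsNoise μ S.p w ξ) (θ : Euc dθ) (t : ℕ) :
    IndepFun (S.past π w ξ θ t) (w t) μ := by
  have hX := hw.measurable_ξ
  set Y : Ω → (Finset.range t → Euc dx) := fun ω s => w s ω with hY
  have hYm : Measurable Y := measurable_pi_iff.2 fun s => hw.measurable_w s
  have hZ := hw.measurable_w t
  have h1 : IndepFun Y (w t) μ := by
    have := hw.iIndep.indepFun_finset (Finset.range t) {t} (by simp) hw.measurable_w
    exact this.comp measurable_id (measurable_pi_apply (⟨t, by simp⟩ : ({t} : Finset ℕ)))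
  have h2 : IndepFun ξ (fun ω => (Y ω, w t ω)) μ := by
    refine hw.indep.comp (φ := id)
      (ψ := fun z : ℕ → Euc dx => ((fun s : Finset.range t => z s), z t)) measurable_id ?_
    exact (measurable_pi_iff.2 fun s => measurable_pi_apply _).prodMk (measurable_pi_apply _)
  have h3 : IndepFun ξ Y μ := h2.comp measurable_id measurable_fst
  have h4 : IndepFun (fun ω => (ξ ω, Y ω)) (w t) μ := by
    rw [indepFun_iff_map_prod_eq_prod_map_map (hX.prodMk hYm).aemeasurable hZ.aemeasurable]
    rw [(indepFun_iff_map_prod_eq_prod_map_map hX.aemeasurable hYm.aemeasurable).1 h3]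
    have h5 := (indepFun_iff_map_prod_eq_prod_map_map hX.aemeasurable
      (hYm.prodMk hZ).aemeasurable).1 h2
    rw [(indepFun_iff_map_prod_eq_prod_map_map hYm.aemeasurable hZ.aemeasurable).1 h1] at h5
    have : IsProbabilityMeasure (μ.map ξ) := Measure.isProbabilityMeasure_map hX.aemeasurable
    have : IsProbabilityMeasure (μ.map Y) := Measure.isProbabilityMeasure_map hYm.aemeasurable
    have : IsProbabilityMeasure (μ.map (w t)) := Measure.isProbabilityMeasure_map hZ.aemeasurable
    -- The joint law of `(ξ, (Y, w t))` is a triple product; regrouping it makes `(ξ, Y)`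
    -- independent of `w t`.
    rw [← Measure.prodAssoc_prod] at h5
    have h6 := congrArg (Measure.map MeasurableEquiv.prodAssoc.symm) h5
    rw [Measure.map_map (MeasurableEquiv.measurable _) (hX.prodMk (hYm.prodMk hZ)),
      MeasurableEquiv.map_symm_map] at h6
    exact h6
  -- A noise sequence living on the space of values of `(ξ, Y)`, zero from time `t` on. The history
  -- up to time `t` is the same for `w` and `w'`, hence a measurable function of `(ξ, Y)`.
  let w' : ℕ → Ξ × (Finset.range t → Euc dx) → Euc dx :=
    fun s z => if h : s ∈ Finset.range t then z.2 ⟨s, h⟩ else 0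
  have hw' : ∀ s, Measurable (w' s) := fun s => by
    by_cases h : s ∈ Finset.range t
    · simp only [w', h, dif_pos]; exact (measurable_pi_apply _).comp measurable_snd
    · simp only [w', h, dif_neg, not_false_eq_true]; exact measurable_const
  have h7 : S.past π w ξ θ t = S.past π w' Prod.fst θ t ∘ fun ω => (ξ ω, Y ω) := by
    funext ω
    refine Prod.ext rfl ?_
    refine S.history_congr π (w := w) (w' := w') θ rfl t fun s hs => ?_
    simp [w', hs, hY]
  rw [h7]
  exact h4.comp (S.measurable_past π hw' measurable_fst θ t) measurable_id

end System

end Histories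

/-! ### Square integrability and moments of the noise -/

section Moments

variable {Ω Ξ : Type*} [MeasurableSpace Ω] [MeasurableSpace Ξ] {μ : Measure Ω}

theorem memLp_mv {m n : ℕ} (M : Matrix (Fin m) (Fin n) ℝ) {f : Ω → Euc n} (hf : MemLp f 2 μ) :
    MemLp (fun ω => mv M (f ω)) 2 μ := by
  refine MemLp.of_le_mul (c := √(frob M)) hf
    ((continuous_mv M).comp_aestronglyMeasurable hf.1) (ae_of_all _ fun ω => ?_)
  refine abs_le_of_sq_le_sq' ?_ (by positivity) |>.2
  rw [mul_pow, Real.sq_sqrt (frob_nonneg M)]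
  exact norm_mv_sq_le_frob M _

theorem integrable_quad {n : ℕ} (M : Matrix (Fin n) (Fin n) ℝ) {f : Ω → Euc n}
    (hf : MemLp f 2 μ) : Integrable (fun ω => quad M (f ω)) μ := by
  obtain ⟨c, hc, h⟩ := quad_le_norm_sq M
  refine (((memLp_two_iff_integrable_sq_norm hf.1).1 hf).const_mul c).mono'
    ((continuous_quad M).comp_aestronglyMeasurable hf.1) (ae_of_all _ fun _ => h _)

theorem integrable_weight_mul {Y : Type*} [MeasurableSpace Y] {X : Ω → Y} {G : Y → ℝ} {b : ℝ}
    {f : Ω → ℝ} (hX : Measurable X) (hG : Measurable G) (hb : ∀ y, |G y| ≤ b)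
    (hf : Integrable f μ) : Integrable (fun ω => G (X ω) * f ω) μ :=
  hf.bdd_mul (c := b) (hG.comp hX).aestronglyMeasurable (ae_of_all _ fun _ => hb _)

variable {S : System dx du dθ} {w : ℕ → Ω → Euc dx} {ξ : Ω → Ξ}

theorem IsNoise.integral_comp {p : Euc dx → ℝ} (hw : IsNoise μ p w ξ) (hp : IsNoiseDensity p)
    (t : ℕ) {F : Type*} [NormedAddCommGroup F] [NormedSpace ℝ F] {f : Euc dx → F}
    (hf : StronglyMeasurable f) : ∫ ω, f (w t ω) ∂μ = ∫ y, p y • f y := by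
  rw [← integral_map (hw.measurable_w t).aemeasurable hf.aestronglyMeasurable, hw.law t,
    integral_withDensity_eq_integral_toReal_smul
      hp.contDiff.continuous.measurable.ennreal_ofReal (ae_of_all _ fun _ => ENNReal.ofReal_lt_top)]
  simp [ENNReal.toReal_ofReal (hp.nonneg _)]

theorem IsNoise.integrable_comp_iff {p : Euc dx → ℝ} (hw : IsNoise μ p w ξ)
    (hp : IsNoiseDensity p)
    (t : ℕ) {F : Type*} [NormedAddCommGroup F] [NormedSpace ℝ F] {f : Euc dx → F}
    (hf : StronglyMeasurable f) :
    Integrable (fun ω => f (w t ω)) μ ↔ Integrable fun y => p y • f y := by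
  have h1 := integrable_map_measure (f := w t) (g := f) (μ := μ) hf.aestronglyMeasurable
    (hw.measurable_w t).aemeasurable
  have h2 : (f ∘ w t) = fun ω => f (w t ω) := rfl
  rw [← h2, ← h1, hw.law t,
    integrable_withDensity_iff_integrable_smul' hp.contDiff.continuous.measurable.ennreal_ofReal
      (ae_of_all _ fun _ => ENNReal.ofReal_lt_top)]
  simp [ENNReal.toReal_ofReal (hp.nonneg _)]

theorem IsNoise.memLp {p : Euc dx → ℝ} (hw : IsNoise μ p w ξ) (hp : IsNoiseDensity p) (t : ℕ) :
    MemLp (w t) 2 μ := by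
  rw [memLp_two_iff_integrable_sq_norm (hw.measurable_w t).aestronglyMeasurable]
  rw [hw.integrable_comp_iff hp t (f := fun y => ‖y‖ ^ 2) (by fun_prop)]
  exact hp.moment.congr (ae_of_all _ fun y => by simp [mul_comm])

theorem IsNoise.integral_eq_zero {p : Euc dx → ℝ} (hw : IsNoise μ p w ξ)
    (hp : IsNoiseDensity p) (t : ℕ) : ∫ ω, w t ω ∂μ = 0 := by
  rw [hw.integral_comp hp t (f := fun y => y) (by fun_prop), hp.centered]

theorem IsNoise.integrable [IsFiniteMeasure μ] {p : Euc dx → ℝ} (hw : IsNoise μ p w ξ)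
    (hp : IsNoiseDensity p) (t : ℕ) : Integrable (w t) μ :=
  (hw.memLp hp t).integrable (by norm_num)

theorem integrable_coord {n : ℕ} {f : Ω → Euc n} (hf : Integrable f μ) (i : Fin n) :
    Integrable (fun ω => f ω i) μ :=
  (EuclideanSpace.proj (𝕜 := ℝ) i).integrable_comp hf

theorem integral_coord {n : ℕ} {f : Ω → Euc n} (hf : Integrable f μ) (i : Fin n) :
    ∫ ω, f ω i ∂μ = (∫ ω, f ω ∂μ) i :=
  (EuclideanSpace.proj (𝕜 := ℝ) i).integral_comp_comm hf

/-- Cross terms between a past quantity and the noise vanish by independence and centering. The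
computation is done in coordinates, so that only a first moment of `Y` is needed. -/
theorem IsNoise.integral_inner [IsProbabilityMeasure μ] {p : Euc dx → ℝ} (hw : IsNoise μ p w ξ)
    (hp : IsNoiseDensity p) {t : ℕ} {Y : Ω → Euc dx} (hY : Integrable Y μ)
    (hind : IndepFun Y (w t) μ) (M : Matrix (Fin dx) (Fin dx) ℝ) :
    Integrable (fun ω => inner ℝ (Y ω) (mv M (w t ω))) μ ∧
      ∫ ω, inner ℝ (Y ω) (mv M (w t ω)) ∂μ = 0 := by
  have hZ : Integrable (fun ω => mv M (w t ω)) μ := (memLp_mv M (hw.memLp hp t)).integrable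
    (by norm_num)
  have hZ0 : ∀ i, ∫ ω, mv M (w t ω) i ∂μ = 0 := fun i => by
    simp only [mv_apply]
    rw [integral_finsetSum _ fun j _ => (integrable_coord (hw.integrable hp t) j).const_mul _]
    refine Finset.sum_eq_zero fun j _ => ?_
    rw [integral_const_mul, integral_coord (hw.integrable hp t), hw.integral_eq_zero hp]
    simp
  have hi : ∀ i, IndepFun (fun ω => Y ω i) (fun ω => mv M (w t ω) i) μ := fun i =>
    hind.comp (φ := fun v : Euc dx => v i) (ψ := fun v => mv M v i) (by fun_prop)
      ((by fun_prop : Measurable fun v : Euc dx => v i).comp (measurable_mv M))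
  have hint : ∀ i, Integrable (fun ω => Y ω i * mv M (w t ω) i) μ := fun i =>
    (hi i).integrable_mul (integrable_coord hY i) (integrable_coord hZ i)
  have he : ∀ ω, inner ℝ (Y ω) (mv M (w t ω)) = ∑ i, Y ω i * mv M (w t ω) i := fun ω => by
    rw [inner_eq_dotProduct]; rfl
  simp only [he]
  refine ⟨integrable_finsetSum _ fun i _ => hint i, ?_⟩
  rw [integral_finsetSum _ fun i _ => hint i]
  refine Finset.sum_eq_zero fun i _ => ?_
  rw [(hi i).integral_fun_mul_eq_mul_integral (integrable_coord hY i).1 (integrable_coord hZ i).1,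
    hZ0, mul_zero]

end Moments

namespace System

/-! ### The cost identity in expectation, and dynamic programming -/

section OneStep

variable {Ω Ξ : Type*} [MeasurableSpace Ω] [MeasurableSpace Ξ] {μ : Measure Ω}
  [IsProbabilityMeasure μ] {S : System dx du dθ} {w : ℕ → Ω → Euc dx} {ξ : Ω → Ξ}
  {π : Policy dx du Ξ} {θ : Euc dθ}

/-- The cost `E wᵀ P w` of one noise term. -/
def noiseCost (S : System dx du dθ) (P : Matrix (Fin dx) (Fin dx) ℝ) : ℝ :=
  ∫ y, S.p y * quad P y

theorem integral_quad_noise (hw : IsNoise μ S.p w ξ) (hp : IsNoiseDensity S.p) (t : ℕ)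
    (P : Matrix (Fin dx) (Fin dx) ℝ) : ∫ ω, quad P (w t ω) ∂μ = S.noiseCost P := by
  rw [hw.integral_comp hp t (continuous_quad P).stronglyMeasurable]
  rfl

theorem integrable_density_quad (hp : IsNoiseDensity S.p) (P : Matrix (Fin dx) (Fin dx) ℝ) :
    Integrable fun y => S.p y * quad P y := by
  obtain ⟨c, hc, h⟩ := quad_le_norm_sq P
  refine (hp.moment.const_mul c).mono'
    (hp.contDiff.continuous.mul (continuous_quad P)).aestronglyMeasurable
    (ae_of_all _ fun y => ?_)
  rw [Real.norm_eq_abs, abs_mul, abs_of_nonneg (hp.nonneg y)]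
  calc S.p y * |quad P y| ≤ S.p y * (c * ‖y‖ ^ 2) := by
        gcongr
        · exact hp.nonneg y
        · exact h y
    _ = _ := by ring

theorem noiseCost_mono (hp : IsNoiseDensity S.p) {P P' : Matrix (Fin dx) (Fin dx) ℝ}
    (h : ∀ v, quad P v ≤ quad P' v) : S.noiseCost P ≤ S.noiseCost P' := by
  refine integral_mono (integrable_density_quad hp P) (integrable_density_quad hp P') fun y => ?_
  exact mul_le_mul_of_nonneg_left (h y) (hp.nonneg y)

theorem noiseCost_nonneg (hp : IsNoiseDensity S.p) {P : Matrix (Fin dx) (Fin dx) ℝ}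
    (h : P.PosSemidef) : 0 ≤ S.noiseCost P :=
  integral_nonneg fun y => mul_nonneg (hp.nonneg y) (h.quad_nonneg y)

theorem measurable_state (hw : IsNoise μ S.p w ξ) (t : ℕ) : Measurable (S.state w ξ π θ t) :=
  (measurable_pi_apply _).comp (S.measurable_history π hw.measurable_w hw.measurable_ξ θ t)

theorem measurable_input (hw : IsNoise μ S.p w ξ) (t : ℕ) : Measurable (S.input w ξ π θ t) :=
  (π.measurable_act t).comp
    ((S.measurable_history π hw.measurable_w hw.measurable_ξ θ t).prodMk hw.measurable_ξ)

theorem memLp_state_succ (hw : IsNoise μ S.p w ξ) (hp : IsNoiseDensity S.p) {t : ℕ}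
    (hx : MemLp (S.state w ξ π θ t) 2 μ) (hu : MemLp (S.input w ξ π θ t) 2 μ) :
    MemLp (S.state w ξ π θ (t + 1)) 2 μ := by
  have h := ((memLp_mv S.A hx).add (memLp_mv (S.B θ) hu)).add (hw.memLp hp t)
  refine h.ae_eq (ae_of_all _ fun ω => ?_)
  rw [S.state_succ]
  rfl

theorem memLp_state (hw : IsNoise μ S.p w ξ) (hp : IsNoiseDensity S.p) {t : ℕ}
    (hu : ∀ s < t, MemLp (S.input w ξ π θ s) 2 μ) : MemLp (S.state w ξ π θ t) 2 μ := by
  induction t with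
  | zero => exact MemLp.zero
  | succ t ih => exact memLp_state_succ hw hp (ih fun s hs => hu s (by omega)) (hu t (by omega))

/-- The one-step cost identity in expectation, weighted by a bounded function of the past. -/
theorem weighted_one_step (hw : IsNoise μ S.p w ξ) (hp : IsNoiseDensity S.p) (hR : S.R.PosDef)
    {P : Matrix (Fin dx) (Fin dx) ℝ} (hP : P.PosSemidef) {t : ℕ}
    (hx : MemLp (S.state w ξ π θ t) 2 μ) (hu : MemLp (S.input w ξ π θ t) 2 μ)
    {G : Ξ × (Fin (t + 1) → Euc dx) → ℝ} (hG : Measurable G) {b : ℝ} (hb : ∀ y, |G y| ≤ b) :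
    ∫ ω, G (S.past π w ξ θ t ω) * (quad S.Q (S.state w ξ π θ t ω)
        + quad S.R (S.input w ξ π θ t ω)) ∂μ
      + ∫ ω, G (S.past π w ξ θ t ω) * quad P (S.state w ξ π θ (t + 1) ω) ∂μ
      = ∫ ω, G (S.past π w ξ θ t ω) * quad (S.riccati θ P) (S.state w ξ π θ t ω) ∂μ
        + ∫ ω, G (S.past π w ξ θ t ω) * quad (S.hess θ P) (S.input w ξ π θ t ω
            - mv (S.gain θ P) (S.state w ξ π θ t ω)) ∂μ
        + (∫ ω, G (S.past π w ξ θ t ω) ∂μ) * S.noiseCost P := by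
  have hpast := S.measurable_past π hw.measurable_w hw.measurable_ξ θ t
  have hind := S.indepFun_past π hw θ t
  set g : Ω → ℝ := fun ω => G (S.past π w ξ θ t ω) with hg
  set x := S.state w ξ π θ t with hxdef
  set u := S.input w ξ π θ t with hudef
  have hi : ∀ {f : Ω → ℝ}, Integrable f μ → Integrable (fun ω => g ω * f ω) μ := fun hf =>
    integrable_weight_mul (G := G) hpast hG hb hf
  set y : Ω → Euc dx := fun ω => mv S.A (x ω) + mv (S.B θ) (u ω) with hydef
  have hy : MemLp y 2 μ := (memLp_mv S.A hx).add (memLp_mv (S.B θ) hu)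
  have hsucc : ∀ ω, S.state w ξ π θ (t + 1) ω = y ω + w t ω := fun ω => S.state_succ w ξ π θ t ω
  have hdev : MemLp (fun ω => u ω - mv (S.gain θ P) (x ω)) 2 μ := hu.sub (memLp_mv _ hx)
  have hgy : Integrable (fun ω => g ω • y ω) μ :=
    (hy.integrable (by norm_num)).bdd_smul b (hG.comp hpast).aestronglyMeasurable
      (ae_of_all _ fun _ => hb _)
  have hgyind : IndepFun (fun ω => g ω • y ω) (w t) μ := by
    have hm : Measurable fun z : Ξ × (Fin (t + 1) → Euc dx) =>
        G z • (mv S.A (z.2 (Fin.last t)) + mv (S.B θ) (π.act t z.2 z.1)) := by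
      have h1 : Measurable fun z : Ξ × (Fin (t + 1) → Euc dx) => mv S.A (z.2 (Fin.last t)) :=
        (measurable_mv _).comp ((measurable_pi_apply _).comp measurable_snd)
      have h2 : Measurable fun z : Ξ × (Fin (t + 1) → Euc dx) => mv (S.B θ) (π.act t z.2 z.1) :=
        (measurable_mv _).comp ((π.measurable_act t).comp (measurable_snd.prodMk measurable_fst))
      exact hG.smul (h1.add h2)
    exact hind.comp hm measurable_id
  have hcross := hw.integral_inner hp hgy hgyind P
  have hgw : IndepFun g (fun ω => quad P (w t ω)) μ := hind.comp hG (measurable_quad P)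
  have hw2 := integrable_quad P (hw.memLp hp t)
  have hgint : Integrable g μ := by
    have := hi (integrable_const (1 : ℝ))
    simpa using this
  -- Expansion around the conditional mean `y` of the next state; the cross term disappears, and the
  -- noise contributes its cost times the mean of the weight.
  have e1 : ∫ ω, g ω * quad P (S.state w ξ π θ (t + 1) ω) ∂μ
      = ∫ ω, g ω * quad P (y ω) ∂μ + (∫ ω, g ω ∂μ) * S.noiseCost P := by
    have h1 : ∀ ω, g ω * quad P (S.state w ξ π θ (t + 1) ω)
        = g ω * quad P (y ω) + 2 * inner ℝ (g ω • y ω) (mv P (w t ω)) + g ω * quad P (w t ω) := by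
      intro ω
      rw [hsucc, quad_add_right hP.transpose_eq, inner_smul_left]
      simp only [conj_trivial]
      ring
    simp only [h1]
    have h2 : Integrable (fun ω => g ω * quad P (y ω)
        + 2 * inner ℝ (g ω • y ω) (mv P (w t ω))) μ :=
      (hi (integrable_quad P hy)).add (hcross.1.const_mul 2)
    rw [integral_add h2 (hi hw2), integral_add (hi (integrable_quad P hy)) (hcross.1.const_mul 2), integral_const_mul, hcross.2,
      hgw.integral_fun_mul_eq_mul_integral hgint.1 hw2.1, integral_quad_noise hw hp]
    ring
  change ∫ ω, g ω * (quad S.Q (x ω) + quad S.R (u ω)) ∂μ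
    + ∫ ω, g ω * quad P (S.state w ξ π θ (t + 1) ω) ∂μ = ∫ ω, g ω * quad (S.riccati θ P) (x ω) ∂μ
    + ∫ ω, g ω * quad (S.hess θ P) (u ω - mv (S.gain θ P) (x ω)) ∂μ + _
  rw [e1, ← add_assoc]
  congr 1
  have h3 : Integrable (fun ω => g ω * (quad S.Q (x ω) + quad S.R (u ω))) μ :=
    hi ((integrable_quad _ hx).add (integrable_quad _ hu))
  rw [← integral_add h3 (hi (integrable_quad P hy)),
    ← integral_add (hi (integrable_quad _ hx)) (hi (integrable_quad _ hdev))]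
  congr 1
  funext ω
  have := one_step_identity (θ := θ) hR hP (x ω) (u ω)
  rw [← mul_add, ← mul_add, ← this]

variable (S μ w ξ π θ)

/-- The expected cost of stage `t`. -/
def stageCost (t : ℕ) : ℝ :=
  ∫ ω, quad S.Q (S.state w ξ π θ t ω) + quad S.R (S.input w ξ π θ t ω) ∂μ

/-- The expected value of a quadratic form of the state. -/
def stateForm (M : Matrix (Fin dx) (Fin dx) ℝ) (t : ℕ) : ℝ :=
  ∫ ω, quad M (S.state w ξ π θ t ω) ∂μ

/-- The expected cost of deviating from the feedback of `P` at stage `t`. -/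
def deviation (P : Matrix (Fin dx) (Fin dx) ℝ) (t : ℕ) : ℝ :=
  ∫ ω, quad (S.hess θ P) (S.input w ξ π θ t ω - mv (S.gain θ P) (S.state w ξ π θ t ω)) ∂μ

variable {S μ w ξ π θ}

theorem one_step (hw : IsNoise μ S.p w ξ) (hp : IsNoiseDensity S.p) (hR : S.R.PosDef)
    {P : Matrix (Fin dx) (Fin dx) ℝ} (hP : P.PosSemidef) {t : ℕ}
    (hx : MemLp (S.state w ξ π θ t) 2 μ) (hu : MemLp (S.input w ξ π θ t) 2 μ) :
    S.stageCost μ w ξ π θ t + S.stateForm μ w ξ π θ P (t + 1)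
      = S.stateForm μ w ξ π θ (S.riccati θ P) t + S.deviation μ w ξ π θ P t + S.noiseCost P := by
  have := weighted_one_step hw hp hR hP hx hu (G := fun _ => 1) measurable_const (b := 1) (by simp)
  simpa [stageCost, stateForm, deviation] using this

theorem deviation_nonneg (hR : S.R.PosDef) {P : Matrix (Fin dx) (Fin dx) ℝ} (hP : P.PosSemidef)
    (t : ℕ) : 0 ≤ S.deviation μ w ξ π θ P t :=
  integral_nonneg fun _ => (hess_posDef hR hP).posSemidef.quad_nonneg _

theorem stateForm_nonneg {P : Matrix (Fin dx) (Fin dx) ℝ} (hP : P.PosSemidef) (t : ℕ) :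
    0 ≤ S.stateForm μ w ξ π θ P t :=
  integral_nonneg fun _ => hP.quad_nonneg _

theorem stageCost_nonneg (hQ : S.Q.PosDef) (hR : S.R.PosDef) (t : ℕ) :
    0 ≤ S.stageCost μ w ξ π θ t :=
  integral_nonneg fun _ => add_nonneg (hQ.posSemidef.quad_nonneg _) (hR.posSemidef.quad_nonneg _)

theorem stateForm_zero (M : Matrix (Fin dx) (Fin dx) ℝ) : S.stateForm μ w ξ π θ M 0 = 0 := by
  simp [stateForm, state_zero, quad_zero_right]

/-- Summing the one-step identity for a solution of the Riccati equation. -/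
theorem sum_stageCost_eq (hw : IsNoise μ S.p w ξ) (hp : IsNoiseDensity S.p) (hR : S.R.PosDef)
    {P : Matrix (Fin dx) (Fin dx) ℝ} (hP : P.PosSemidef) (hfix : S.riccati θ P = P) {n : ℕ}
    (hu : ∀ s < n, MemLp (S.input w ξ π θ s) 2 μ) :
    ∑ t ∈ Finset.range n, S.stageCost μ w ξ π θ t + S.stateForm μ w ξ π θ P n
      = ∑ t ∈ Finset.range n, S.deviation μ w ξ π θ P t + n * S.noiseCost P := by
  induction n with
  | zero => simp [stateForm_zero]
  | succ n ih =>
      have h1 := ih fun s hs => hu s (by omega)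
      have h2 := one_step hw hp hR hP (memLp_state hw hp fun s hs => hu s (by omega))
        (hu n (by omega))
      rw [hfix] at h2
      rw [Finset.sum_range_succ, Finset.sum_range_succ]
      push_cast
      linarith

/-- The dynamic programming lower bound. -/
theorem le_sum_stageCost (hw : IsNoise μ S.p w ξ) (hp : IsNoiseDensity S.p) (hR : S.R.PosDef)
    (hQ : S.Q.PosDef) (n s : ℕ) (hu : ∀ i < s + n, MemLp (S.input w ξ π θ i) 2 μ) :
    S.stateForm μ w ξ π θ (S.riccatiIter θ n) s
        + ∑ j ∈ Finset.range n, S.noiseCost (S.riccatiIter θ j)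
      ≤ ∑ i ∈ Finset.range n, S.stageCost μ w ξ π θ (s + i) := by
  induction n generalizing s with
  | zero => simp [riccatiIter, stateForm, quad_zero_left]
  | succ n ih =>
      have hpsd := riccatiIter_posSemidef (θ := θ) hR hQ n
      have h1 := ih (s + 1) fun i hi => hu i (by omega)
      have h2 := one_step hw hp hR hpsd (memLp_state hw hp fun i hi => hu i (by omega))
        (hu s (by omega))
      have h3 := deviation_nonneg (μ := μ) (w := w) (ξ := ξ) (π := π) (θ := θ) hR hpsd s
      rw [Finset.sum_range_succ, Finset.sum_range_succ']
      simp only [add_zero, riccatiIter]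
      have h4 : ∑ i ∈ Finset.range n, S.stageCost μ w ξ π θ (s + (i + 1))
          = ∑ i ∈ Finset.range n, S.stageCost μ w ξ π θ (s + 1 + i) :=
        Finset.sum_congr rfl fun i _ => by congr 1; omega
      rw [h4]
      linarith

/-- Equality holds in the dynamic programming bound for the optimal feedback. -/
theorem sum_stageCost_of_optimal (hw : IsNoise μ S.p w ξ) (hp : IsNoiseDensity S.p)
    (hR : S.R.PosDef) (hQ : S.Q.PosDef) (n s : ℕ)
    (hu : ∀ i < s + n, MemLp (S.input w ξ π θ i) 2 μ)
    (hopt : ∀ i < n, ∀ ω, S.input w ξ π θ (s + i) ω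
      = mv (S.gain θ (S.riccatiIter θ (n - i - 1))) (S.state w ξ π θ (s + i) ω)) :
    ∑ i ∈ Finset.range n, S.stageCost μ w ξ π θ (s + i)
      = S.stateForm μ w ξ π θ (S.riccatiIter θ n) s
        + ∑ j ∈ Finset.range n, S.noiseCost (S.riccatiIter θ j) := by
  induction n generalizing s with
  | zero => simp [riccatiIter, stateForm, quad_zero_left]
  | succ n ih =>
      have hpsd := riccatiIter_posSemidef (θ := θ) hR hQ n
      have h1 := ih (s + 1) (fun i hi => hu i (by omega)) fun i hi ω => by
        have := hopt (i + 1) (by omega) ω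
        rw [show s + (i + 1) = s + 1 + i by omega, show n + 1 - (i + 1) - 1 = n - i - 1 by omega]
          at this
        exact this
      have h2 := one_step hw hp hR hpsd (memLp_state hw hp fun i hi => hu i (by omega))
        (hu s (by omega))
      have h3 : S.deviation μ w ξ π θ (S.riccatiIter θ n) s = 0 := by
        have h5 := hopt 0 (by omega)
        simp only [add_zero, tsub_zero, Nat.add_sub_cancel] at h5
        simp [deviation, h5, quad_zero_right]
      rw [Finset.sum_range_succ' (fun i => S.stageCost μ w ξ π θ (s + i)),
        Finset.sum_range_succ (fun j => S.noiseCost (S.riccatiIter θ j))]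
      simp only [add_zero, riccatiIter]
      have h4 : ∑ i ∈ Finset.range n, S.stageCost μ w ξ π θ (s + (i + 1))
          = ∑ i ∈ Finset.range n, S.stageCost μ w ξ π θ (s + 1 + i) :=
        Finset.sum_congr rfl fun i _ => by congr 1; omega
      rw [h4]
      linarith

theorem lintegral_stage_eq (hQ : S.Q.PosDef) (hR : S.R.PosDef) {t : ℕ}
    (hx : MemLp (S.state w ξ π θ t) 2 μ) (hu : MemLp (S.input w ξ π θ t) 2 μ) :
    ∫⁻ ω, ENNReal.ofReal (quad S.Q (S.state w ξ π θ t ω) + quad S.R (S.input w ξ π θ t ω)) ∂μ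
      = ENNReal.ofReal (S.stageCost μ w ξ π θ t) := by
  have h := (integrable_quad S.Q hx).add (integrable_quad S.R hu)
  refine (ofReal_integral_eq_lintegral_ofReal h ?_).symm
  exact ae_of_all _ fun ω => add_nonneg (hQ.posSemidef.quad_nonneg _)
    (hR.posSemidef.quad_nonneg _)

theorem cost_eq_ofReal (hw : IsNoise μ S.p w ξ) (hp : IsNoiseDensity S.p) (hQ : S.Q.PosDef)
    (hR : S.R.PosDef) {T : ℕ} (hu : ∀ i < T, MemLp (S.input w ξ π θ i) 2 μ) :
    S.cost μ w ξ π T θ = ENNReal.ofReal (∑ t ∈ Finset.range T, S.stageCost μ w ξ π θ t) := by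
  rw [cost, ENNReal.ofReal_sum_of_nonneg fun t _ => stageCost_nonneg hQ hR t]
  refine Finset.sum_congr rfl fun t ht => ?_
  have ht := Finset.mem_range.1 ht
  exact lintegral_stage_eq hQ hR (memLp_state hw hp fun s hs => hu s (by omega)) (hu t ht)

/-- Positive definiteness of `R` makes a finite cost control the second moments of the inputs. -/
theorem memLp_input_of_cost_ne_top (hw : IsNoise μ S.p w ξ) (hQ : S.Q.PosDef)
    (hR : S.R.PosDef) {T : ℕ} (h : S.cost μ w ξ π T θ ≠ ⊤) {t : ℕ} (ht : t < T) :
    MemLp (S.input w ξ π θ t) 2 μ := by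
  obtain ⟨c, hc, hcR⟩ := hR.exists_norm_sq_le
  have hm := measurable_input (S := S) (π := π) (θ := θ) hw t
  rw [memLp_two_iff_integrable_sq_norm hm.aestronglyMeasurable]
  have h1 : ∫⁻ ω, ENNReal.ofReal (quad S.Q (S.state w ξ π θ t ω)
      + quad S.R (S.input w ξ π θ t ω)) ∂μ ≠ ⊤ := by
    rw [cost, ENNReal.sum_ne_top] at h
    exact h t (Finset.mem_range.2 ht)
  have h2 : Integrable (fun ω => quad S.Q (S.state w ξ π θ t ω)
      + quad S.R (S.input w ξ π θ t ω)) μ := by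
    have hm2 : Measurable fun ω => quad S.Q (S.state w ξ π θ t ω)
      + quad S.R (S.input w ξ π θ t ω) :=
      ((measurable_quad _).comp (measurable_state hw t)).add ((measurable_quad _).comp hm)
    refine ⟨hm2.aestronglyMeasurable, ?_⟩
    rw [hasFiniteIntegral_iff_ofReal]
    · exact h1.lt_top
    · exact ae_of_all _ fun ω => add_nonneg (hQ.posSemidef.quad_nonneg _)
        (hR.posSemidef.quad_nonneg _)
  refine (h2.const_mul c⁻¹).mono' (by fun_prop) (ae_of_all _ fun ω => ?_)
  rw [Real.norm_eq_abs, abs_of_nonneg (by positivity), inv_mul_eq_div, le_div_iff₀ hc]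
  linarith [hcR (S.input w ξ π θ t ω), hQ.posSemidef.quad_nonneg (S.state w ξ π θ t ω)]

/-- The dynamic programming bound is attained, and the initial state is zero, so only the noise
costs of the cost-to-go matrices remain. -/
theorem cost_optPolicy (hw : IsNoise μ S.p w ξ) (hp : IsNoiseDensity S.p) (hQ : S.Q.PosDef)
    (hR : S.R.PosDef) (T : ℕ) :
    S.cost μ w ξ (S.optPolicy Ξ T θ) T θ
      = ENNReal.ofReal (∑ j ∈ Finset.range T, S.noiseCost (S.riccatiIter θ j)) := by
  have hin : ∀ t ω, S.input w ξ (S.optPolicy Ξ T θ) θ t ω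
      = mv (S.gain θ (S.riccatiIter θ (T - t - 1)))
        (S.state w ξ (S.optPolicy Ξ T θ) θ t ω) := fun t ω => rfl
  have hx : ∀ t, MemLp (S.state w ξ (S.optPolicy Ξ T θ) θ t) 2 μ := by
    intro t
    induction t with
    | zero => exact MemLp.zero
    | succ t ih => exact memLp_state_succ hw hp ih (memLp_mv _ ih)
  have hu : ∀ t, MemLp (S.input w ξ (S.optPolicy Ξ T θ) θ t) 2 μ := fun t => memLp_mv _ (hx t)
  rw [cost_eq_ofReal hw hp hQ hR fun i _ => hu i]
  have := sum_stageCost_of_optimal hw hp hR hQ T 0 (fun i _ => hu i)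
    fun i hi ω => by rw [zero_add]; exact hin i ω
  simp only [zero_add, stateForm_zero] at this
  rw [this]

end OneStep

end System

/-! ### Deviations from the stationary gain are controlled by the regret -/

section RegretBounds

/-- An affine recursion with contraction rate `1 - q`. -/
theorem le_of_contraction {z a : ℕ → ℝ} {q b : ℝ} (hq : 0 < q) (hq1 : q < 1) (hb : 0 ≤ b)
    {s n : ℕ} (hsn : s ≤ n) (ha : ∀ t, 0 ≤ a t)
    (h : ∀ t, s ≤ t → t < n → z (t + 1) ≤ (1 - q) * z t + a t + b) :
    z n ≤ (1 - q) ^ (n - s) * z s + ∑ t ∈ Finset.Ico s n, a t + b / q := by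
  induction n, hsn using Nat.le_induction with
  | base => simp; positivity
  | succ n hsn ih =>
      have h1 := ih fun t ht htn => h t ht (by omega)
      have h2 := h n hsn (by omega)
      have h3 : 0 ≤ ∑ t ∈ Finset.Ico s n, a t := Finset.sum_nonneg fun t _ => ha t
      rw [Finset.sum_Ico_succ_top hsn, show n + 1 - s = (n - s) + 1 by omega, pow_succ]
      have h4 : (1 - q) * z n ≤ (1 - q) * ((1 - q) ^ (n - s) * z s
          + ∑ t ∈ Finset.Ico s n, a t + b / q) := mul_le_mul_of_nonneg_left h1 (by linarith)
      have h5 : (1 - q) * (b / q) = b / q - b := by field_simp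
      nlinarith

/-- The number of final stages in which the finite-horizon gains are not yet stationary. -/
def tailLength (q ε : ℝ) : ℕ := 1 + ⌈1 / (q ^ 2 * ε)⌉₊

/-- Bernoulli's inequality for `(1 + q)^j`, together with `(1 - q)(1 + q) ≤ 1`. -/
theorem pow_le_inv_mul {q : ℝ} (hq : 0 < q) (hq1 : q < 1) (j : ℕ) :
    (1 - q) ^ j * (q * j) ≤ 1 := by
  have h1 : 1 + (j : ℝ) * q ≤ (1 + q) ^ j := one_add_mul_le_pow (by linarith) j
  have h2 : (1 - q) ^ j * (1 + q) ^ j ≤ 1 := by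
    rw [← mul_pow]
    exact pow_le_one₀ (by nlinarith) (by nlinarith)
  have h3 : 0 ≤ (1 - q) ^ j := pow_nonneg (by linarith) j
  nlinarith

/-- Since `(1 - q)^j ≤ 1 / (q j)`, the number `j = ⌈1 / (q² ε)⌉` suffices. A logarithmic length
would do; length `O(1/ε)` is enough, as tails are always met with a weight `ε²`. -/
theorem rate_tailLength_le {q ε : ℝ} (hq : 0 < q) (hq1 : q < 1) (hε : 0 < ε) :
    q⁻¹ * (1 - q) ^ (tailLength q ε - 1) ≤ ε := by
  set j := ⌈1 / (q ^ 2 * ε)⌉₊ with hj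
  have h1 : tailLength q ε - 1 = j := by simp [tailLength, hj]
  rw [h1]
  have h2 : 1 / (q ^ 2 * ε) ≤ j := Nat.le_ceil _
  have h3 := pow_le_inv_mul hq hq1 j
  have h4 : 0 ≤ (1 - q) ^ j := pow_nonneg (by linarith) j
  rw [div_le_iff₀ (by positivity)] at h2
  rw [inv_mul_le_iff₀ hq]
  have h5 : (1 - q) ^ j ≤ (1 - q) ^ j * (j * (q ^ 2 * ε)) := by nlinarith
  calc (1 - q) ^ j ≤ (1 - q) ^ j * (j * (q ^ 2 * ε)) := h5
    _ = (1 - q) ^ j * (q * j) * (q * ε) := by ring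
    _ ≤ 1 * (q * ε) := by gcongr
    _ = q * ε := one_mul _

theorem tailLength_le {q ε : ℝ} (hq : 0 < q) (hq1 : q < 1) (hε : 0 < ε) (hε1 : ε ≤ 1) :
    (tailLength q ε : ℝ) ≤ 3 / (q ^ 2 * ε) := by
  have h1 := Nat.ceil_lt_add_one (a := 1 / (q ^ 2 * ε)) (by positivity)
  have h2 : 1 ≤ 1 / (q ^ 2 * ε) := by
    rw [le_div_iff₀ (by positivity)]
    nlinarith [mul_pos hq hq]
  rw [tailLength]
  push_cast
  have h3 : 3 / (q ^ 2 * ε) = 3 * (1 / (q ^ 2 * ε)) := by ring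
  linarith

variable {Ω Ξ : Type*} [MeasurableSpace Ω] [MeasurableSpace Ξ] {μ : Measure Ω}
  [IsProbabilityMeasure μ] {S : System dx du dθ} {w : ℕ → Ω → Euc dx} {ξ : Ω → Ξ}
  {π : Policy dx du Ξ} {θ ϑ : Euc dθ} {ε₀ q c : ℝ} {Kt : Euc dθ → Matrix (Fin du) (Fin dx) ℝ}

/-- Under `ϑ` the policy has square integrable inputs, and regret at most `M`. -/
structure Controlled (S : System dx du dθ) (μ : Measure Ω) (w : ℕ → Ω → Euc dx) (ξ : Ω → Ξ)
    (π : Policy dx du Ξ) (ϑ : Euc dθ) (T : ℕ) (M : ℝ) : Prop where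
  noise : IsNoise μ S.p w ξ
  dens : IsNoiseDensity S.p
  Q_posDef : S.Q.PosDef
  R_posDef : S.R.PosDef
  memLp : ∀ t < T, MemLp (S.input w ξ π ϑ t) 2 μ
  nonneg : 0 ≤ M
  budget : ∑ t ∈ Finset.range T, S.stageCost μ w ξ π ϑ t
    ≤ M + ∑ j ∈ Finset.range T, S.noiseCost (S.riccatiIter ϑ j)

namespace Controlled

variable {T : ℕ} {M : ℝ}

theorem memLp_state (h : Controlled S μ w ξ π ϑ T M) {t : ℕ} (ht : t ≤ T) :
    MemLp (S.state w ξ π ϑ t) 2 μ :=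
  System.memLp_state h.noise h.dens fun s hs => h.memLp s (by omega)

/-- Weighted Lyapunov inequality for the closed loop. -/
theorem weighted_lyapunov (h : Controlled S μ w ξ π ϑ T M) (hL : LocalBounds S θ ε₀ q c Kt)
    (hϑ : ϑ ∈ Metric.ball θ ε₀) {t : ℕ} (ht : t < T) {G : Ξ × (Fin (t + 1) → Euc dx) → ℝ}
    (hG : Measurable G) {b : ℝ} (hG0 : ∀ y, 0 ≤ G y) (hb : ∀ y, G y ≤ b) :
    ∫ ω, G (S.past π w ξ ϑ t ω) * quad (S.P ϑ) (S.state w ξ π ϑ (t + 1) ω) ∂μ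
      ≤ (1 - q) * ∫ ω, G (S.past π w ξ ϑ t ω) * quad (S.P ϑ) (S.state w ξ π ϑ t ω) ∂μ
        + b * S.deviation μ w ξ π ϑ (S.P ϑ) t
        + (∫ ω, G (S.past π w ξ ϑ t ω) ∂μ) * S.noiseCost (S.P ϑ) := by
  have hP := hL.P_psd ϑ hϑ
  have hx := h.memLp_state ht.le
  have hu := h.memLp t ht
  have hbd : ∀ y, |G y| ≤ b := fun y => by rw [abs_of_nonneg (hG0 y)]; exact hb y
  have hpast := S.measurable_past π h.noise.measurable_w h.noise.measurable_ξ ϑ t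
  have hi : ∀ {f : Ω → ℝ}, Integrable f μ → Integrable (fun ω => G (S.past π w ξ ϑ t ω) * f ω) μ :=
    fun hf => integrable_weight_mul hpast hG hbd hf
  have h1 := System.weighted_one_step h.noise h.dens h.R_posDef hP hx hu hG hbd
  rw [hL.P_fix ϑ hϑ] at h1
  have hdev : Integrable (fun ω => quad (S.hess ϑ (S.P ϑ)) (S.input w ξ π ϑ t ω
      - mv (S.gain ϑ (S.P ϑ)) (S.state w ξ π ϑ t ω))) μ :=
    integrable_quad _ (hu.sub (memLp_mv _ hx))
  have h2 : ∫ ω, G (S.past π w ξ ϑ t ω) * quad (S.hess ϑ (S.P ϑ)) (S.input w ξ π ϑ t ω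
      - mv (S.gain ϑ (S.P ϑ)) (S.state w ξ π ϑ t ω)) ∂μ ≤ b * S.deviation μ w ξ π ϑ (S.P ϑ) t := by
    rw [System.deviation, ← integral_const_mul]
    refine integral_mono (hi hdev) (hdev.const_mul b) fun ω => ?_
    exact mul_le_mul_of_nonneg_right (hb _)
      ((System.hess_posDef h.R_posDef hP).posSemidef.quad_nonneg _)
  -- The stage cost is at least `q` times the form of `P`; this is the contraction.
  have h3 : q * ∫ ω, G (S.past π w ξ ϑ t ω) * quad (S.P ϑ) (S.state w ξ π ϑ t ω) ∂μ
      ≤ ∫ ω, G (S.past π w ξ ϑ t ω) * (quad S.Q (S.state w ξ π ϑ t ω)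
        + quad S.R (S.input w ξ π ϑ t ω)) ∂μ := by
    rw [← integral_const_mul]
    refine integral_mono ((hi (integrable_quad _ hx)).const_mul q)
      (hi ((integrable_quad _ hx).add (integrable_quad _ hu))) fun ω => ?_
    have h4 := hL.rate ϑ hϑ (S.state w ξ π ϑ t ω)
    have h5 := h.R_posDef.posSemidef.quad_nonneg (S.input w ξ π ϑ t ω)
    have h6 := hG0 (S.past π w ξ ϑ t ω)
    simp only
    nlinarith
  linarith

theorem noiseCost_P_le (h : Controlled S μ w ξ π ϑ T M) (hL : LocalBounds S θ ε₀ q c Kt)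
    (hϑ : ϑ ∈ Metric.ball θ ε₀) : S.noiseCost (S.P ϑ) ≤ c * S.noiseCost 1 := by
  have h1 := System.noiseCost_mono (S := S) h.dens (P := S.P ϑ) (P' := c • 1) fun v => by
    rw [quad_smul_left, quad_one]; exact hL.P_le ϑ hϑ v
  refine h1.trans (le_of_eq ?_)
  simp only [System.noiseCost, quad_smul_left]
  rw [← integral_const_mul]
  congr 1; funext y; ring

theorem noiseCost_P_nonneg (h : Controlled S μ w ξ π ϑ T M) (hL : LocalBounds S θ ε₀ q c Kt)
    (hϑ : ϑ ∈ Metric.ball θ ε₀) : 0 ≤ S.noiseCost (S.P ϑ) :=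
  System.noiseCost_nonneg h.dens (hL.P_psd ϑ hϑ)

theorem deviation_nonneg (h : Controlled S μ w ξ π ϑ T M) (hL : LocalBounds S θ ε₀ q c Kt)
    (hϑ : ϑ ∈ Metric.ball θ ε₀) (t : ℕ) : 0 ≤ S.deviation μ w ξ π ϑ (S.P ϑ) t :=
  System.deviation_nonneg h.R_posDef (hL.P_psd ϑ hϑ) t

/-- The Lyapunov recursion with weight one, started from the zero state. -/
theorem stateForm_le (h : Controlled S μ w ξ π ϑ T M) (hL : LocalBounds S θ ε₀ q c Kt)
    (hϑ : ϑ ∈ Metric.ball θ ε₀) {n : ℕ} (hn : n ≤ T) :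
    S.stateForm μ w ξ π ϑ (S.P ϑ) n
      ≤ ∑ t ∈ Finset.range n, S.deviation μ w ξ π ϑ (S.P ϑ) t + S.noiseCost (S.P ϑ) / q := by
  have h1 := le_of_contraction (z := S.stateForm μ w ξ π ϑ (S.P ϑ))
    (a := S.deviation μ w ξ π ϑ (S.P ϑ)) hL.q_pos hL.q_lt (h.noiseCost_P_nonneg hL hϑ)
    (Nat.zero_le n) (h.deviation_nonneg hL hϑ) fun t _ ht => by
      have := h.weighted_lyapunov hL hϑ (t := t) (by omega) (G := fun _ => 1) measurable_const
        (b := 1) (by simp) (by simp)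
      simpa [System.stateForm] using this
  rw [System.stateForm_zero, mul_zero, zero_add, ← Finset.range_eq_Ico] at h1
  exact h1

/-- Up to a small relative error, the deviations from the stationary gain are bounded by the
regret, except in the last few stages. -/
theorem sum_deviation_le (h : Controlled S μ w ξ π ϑ T M) (hL : LocalBounds S θ ε₀ q c Kt)
    (hϑ : ϑ ∈ Metric.ball θ ε₀) {ε : ℝ} (hε : 0 < ε) :
    ∑ t ∈ Finset.range (T - tailLength q ε), S.deviation μ w ξ π ϑ (S.P ϑ) t
        ≤ M + ε * S.stateForm μ w ξ π ϑ (S.P ϑ) (T - tailLength q ε) ∧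
      ∑ t ∈ Finset.Ico (T - tailLength q ε) T, S.stageCost μ w ξ π ϑ t
        ≤ M + tailLength q ε * S.noiseCost (S.P ϑ)
          + S.stateForm μ w ξ π ϑ (S.P ϑ) (T - tailLength q ε) := by
  set l := tailLength q ε with hl
  set n := T - l with hn
  have hP := hL.P_psd ϑ hϑ
  have hfix := hL.P_fix ϑ hϑ
  have hR := h.R_posDef
  have hQ := h.Q_posDef
  set ν := S.noiseCost (S.P ϑ) with hν
  have hν0 := h.noiseCost_P_nonneg hL hϑ
  have hPle := System.riccatiIter_le (θ := ϑ) hR hQ hP hfix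
  have hνj : ∀ j, S.noiseCost (S.riccatiIter ϑ j) ≤ ν := fun j =>
    System.noiseCost_mono h.dens (hPle j)
  have e1 := System.sum_stageCost_eq (n := n) h.noise h.dens hR hP hfix
    fun s hs => h.memLp s (by omega)
  have e2 := System.le_sum_stageCost h.noise h.dens hR hQ (T - n) n
    (π := π) (θ := ϑ) fun i hi => h.memLp i (by omega)
  have e3 : ∑ t ∈ Finset.range n, S.stageCost μ w ξ π ϑ t
      + ∑ i ∈ Finset.range (T - n), S.stageCost μ w ξ π ϑ (n + i)
      = ∑ t ∈ Finset.range T, S.stageCost μ w ξ π ϑ t := by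
    rw [← Finset.sum_range_add, show n + (T - n) = T by omega]
  have e4 : ∑ t ∈ Finset.Ico n T, S.stageCost μ w ξ π ϑ t
      = ∑ i ∈ Finset.range (T - n), S.stageCost μ w ξ π ϑ (n + i) := by
    rw [Finset.sum_Ico_eq_sum_range]
  -- The optimal cost charges at most the stationary noise cost in `n` stages. After subtraction
  -- from the budget, the first `n` stages leave the deviations and the gap, at time `n`, between
  -- `P` and the iterate of the remaining horizon.
  have e5 : ∑ j ∈ Finset.range T, S.noiseCost (S.riccatiIter ϑ j)
      ≤ ∑ j ∈ Finset.range (T - n), S.noiseCost (S.riccatiIter ϑ j) + n * ν := by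
    have h1 : ∑ j ∈ Finset.range T, S.noiseCost (S.riccatiIter ϑ j)
        = ∑ j ∈ Finset.range (T - n), S.noiseCost (S.riccatiIter ϑ j)
          + ∑ j ∈ Finset.range n, S.noiseCost (S.riccatiIter ϑ (T - n + j)) := by
      rw [← Finset.sum_range_add, show T - n + n = T by omega]
    have h2 : ∑ j ∈ Finset.range n, S.noiseCost (S.riccatiIter ϑ (T - n + j)) ≤ n * ν := by
      calc _ ≤ ∑ _j ∈ Finset.range n, ν := Finset.sum_le_sum fun j _ => hνj _
        _ = n * ν := by simp
    linarith
  have e6 : ∑ j ∈ Finset.range (T - n), S.noiseCost (S.riccatiIter ϑ j) ≤ l * ν := by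
    calc _ ≤ ∑ _j ∈ Finset.range (T - n), ν := Finset.sum_le_sum fun j _ => hνj _
      _ = ((T - n : ℕ) : ℝ) * ν := by simp
      _ ≤ l * ν := by
        gcongr
        omega
  have e7 := h.budget
  have hxn := h.memLp_state (t := n) (by omega)
  have hsf0 := System.stateForm_nonneg (S := S) (μ := μ) (w := w) (ξ := ξ) (π := π) (θ := ϑ) hP n
  have hdev0 : 0 ≤ ∑ t ∈ Finset.range n, S.deviation μ w ξ π ϑ (S.P ϑ) t :=
    Finset.sum_nonneg fun t _ => h.deviation_nonneg hL hϑ t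
  constructor
  -- If `T ≤ l`, the truncated subtraction gives `n = 0` and the sum of deviations is empty;
  -- otherwise exactly `l` stages remain.
  · rcases Nat.eq_zero_or_pos n with h0 | hpos
    · rw [h0] at hsf0 ⊢
      simp only [Finset.range_zero, Finset.sum_empty]
      have := h.nonneg
      positivity
    · have hTn : T - n = l := by omega
      -- Geometric convergence of the Riccati recursion, with `tailLength` chosen to make the
      -- relative gap at most `ε`.
      have h8 : S.stateForm μ w ξ π ϑ (S.P ϑ) n - S.stateForm μ w ξ π ϑ (S.riccatiIter ϑ l) n
          ≤ ε * S.stateForm μ w ξ π ϑ (S.P ϑ) n := by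
        rw [System.stateForm, System.stateForm, ← integral_sub (integrable_quad _ hxn)
          (integrable_quad _ hxn), ← integral_const_mul]
        refine integral_mono ((integrable_quad _ hxn).sub (integrable_quad _ hxn))
          ((integrable_quad _ hxn).const_mul _) fun ω => ?_
        have h9 := System.quad_sub_riccatiIter_le (θ := ϑ) hR hQ hP hfix hL.q_pos hL.q_lt
          (hL.rate ϑ hϑ) (l - 1) (S.state w ξ π ϑ n ω)
        have hl1 : l - 1 + 1 = l := by rw [hl, tailLength]; omega
        rw [hl1] at h9
        have h10 := rate_tailLength_le hL.q_pos hL.q_lt hε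
        have h11 := (System.riccatiIter_posSemidef (θ := ϑ) hR hQ l).quad_nonneg
          (S.state w ξ π ϑ n ω)
        have h12 := hPle l (S.state w ξ π ϑ n ω)
        simp only
        calc _ ≤ q⁻¹ * (1 - q) ^ (l - 1) * quad (S.riccatiIter ϑ l) (S.state w ξ π ϑ n ω) := h9
          _ ≤ ε * quad (S.riccatiIter ϑ l) (S.state w ξ π ϑ n ω) := by gcongr
          _ ≤ ε * quad (S.P ϑ) (S.state w ξ π ϑ n ω) := by gcongr
      rw [hTn] at e2 e3 e5
      linarith
  · rw [e4]
    linarith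

end Controlled

end RegretBounds

/-! ### Orthogonality of martingale differences -/

section MartingaleSums

variable {Ω Ξ : Type*} [MeasurableSpace Ω] [MeasurableSpace Ξ] {μ : Measure Ω}
  [IsProbabilityMeasure μ] {S : System dx du dθ} {w : ℕ → Ω → Euc dx} {ξ : Ω → Ξ}
  {π : Policy dx du Ξ} {ϑ : Euc dθ}

/-- The events known at time `t`. -/
abbrev System.known (S : System dx du dθ) (π : Policy dx du Ξ) (w : ℕ → Ω → Euc dx) (ξ : Ω → Ξ)
    (ϑ : Euc dθ) (t : ℕ) : MeasurableSpace Ω :=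
  MeasurableSpace.comap (S.past π w ξ ϑ t) inferInstance

namespace System

theorem measurable_known_past (t : ℕ) : Measurable[S.known π w ξ ϑ t] (S.past π w ξ ϑ t) :=
  comap_measurable _

theorem known_mono {s t : ℕ} (h : s ≤ t) : S.known π w ξ ϑ s ≤ S.known π w ξ ϑ t := by
  refine Measurable.comap_le ?_
  have : S.past π w ξ ϑ s = restrictPast h ∘ S.past π w ξ ϑ t :=
    funext fun ω => (S.restrictPast_past π h ϑ ω).symm
  rw [this]
  exact (measurable_restrictPast h).comp (measurable_known_past t)

theorem measurable_known_state {s t : ℕ} (h : s ≤ t) :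
    Measurable[S.known π w ξ ϑ t] (S.state w ξ π ϑ s) := by
  have : S.state w ξ π ϑ s = pastState s ∘ S.past π w ξ ϑ t :=
    funext fun ω => (S.pastState_past π h ϑ ω).symm
  rw [this]
  exact (measurable_pastState s).comp (measurable_known_past t)

theorem measurable_known_input {s t : ℕ} (h : s ≤ t) :
    Measurable[S.known π w ξ ϑ t] (S.input w ξ π ϑ s) := by
  have : S.input w ξ π ϑ s = pastInput π s ∘ S.past π w ξ ϑ t :=
    funext fun ω => (S.pastInput_past π h ϑ ω).symm
  rw [this]
  exact (measurable_pastInput π s).comp (measurable_known_past t)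

theorem measurable_known_noise {s t : ℕ} (h : s < t) :
    Measurable[S.known π w ξ ϑ t] (w s) := by
  have : w s = fun ω => S.state w ξ π ϑ (s + 1) ω - mv S.A (S.state w ξ π ϑ s ω)
      - mv (S.B ϑ) (S.input w ξ π ϑ s ω) := by
    funext ω
    rw [S.state_succ]; abel
  rw [this]
  let _ := S.known π w ξ ϑ t
  exact (((measurable_known_state h).sub
    ((measurable_mv _).comp (measurable_known_state h.le))).sub
    ((measurable_mv _).comp (measurable_known_input h.le)))

theorem indepFun_known (hw : IsNoise μ S.p w ξ) {t : ℕ} {E F : Type*} [MeasurableSpace E]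
    [MeasurableSpace F] {X : Ω → E} (hX : Measurable[S.known π w ξ ϑ t] X) {f : Euc dx → F}
    (hf : Measurable f) : IndepFun X (fun ω => f (w t ω)) μ := by
  have h1 : IndepFun X (w t) μ := by
    have := S.indepFun_past π hw ϑ t
    rw [IndepFun_iff_Indep] at this ⊢
    exact indep_of_indep_of_le_left this hX.comap_le
  exact h1.comp measurable_id hf

/-- Orthogonality of martingale differences `a t * f (w t)`. -/
theorem integral_sq_sum_mul_noise (hw : IsNoise μ S.p w ξ) {f : Euc dx → ℝ} (hf : Measurable f)
    (hf2 : ∀ t, MemLp (fun ω => f (w t ω)) 2 μ) (hf0 : ∀ t, ∫ ω, f (w t ω) ∂μ = 0) {V : ℝ}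
    (hV : ∀ t, ∫ ω, f (w t ω) ^ 2 ∂μ ≤ V) {s n : ℕ} {a : ℕ → Ω → ℝ}
    (ha : ∀ t, s ≤ t → t < s + n → Measurable[S.known π w ξ ϑ t] (a t))
    (ha2 : ∀ t, s ≤ t → t < s + n → MemLp (a t) 2 μ) :
    MemLp (fun ω => ∑ i ∈ Finset.range n, a (s + i) ω * f (w (s + i) ω)) 2 μ ∧
      ∫ ω, (∑ i ∈ Finset.range n, a (s + i) ω * f (w (s + i) ω)) ^ 2 ∂μ
        ≤ V * ∑ i ∈ Finset.range n, ∫ ω, a (s + i) ω ^ 2 ∂μ := by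
  induction n with
  | zero => simp
  | succ n ih =>
      obtain ⟨ih1, ih2⟩ := ih (fun t h h' => ha t h (by omega)) (fun t h h' => ha2 t h (by omega))
      have hat := ha (s + n) (by omega) (by omega)
      have hat2 := ha2 (s + n) (by omega) (by omega)
      set t := s + n with ht
      set X : Ω → ℝ := fun ω => ∑ i ∈ Finset.range n, a (s + i) ω * f (w (s + i) ω) with hX
      have hXm : Measurable[S.known π w ξ ϑ t] X := by
        let _ := S.known π w ξ ϑ t
        refine Finset.measurable_sum _ fun i hi => ?_
        have hi' := Finset.mem_range.1 hi
        exact ((ha (s + i) (by omega) (by omega)).mono (known_mono (by omega)) le_rfl).mul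
          (hf.comp (measurable_known_noise (by omega)))
      have hsq : IndepFun (fun ω => a t ω ^ 2) (fun ω => f (w t ω) ^ 2) μ :=
        indepFun_known hw (hat.pow_const 2) (hf.pow_const 2)
      have hia2 : Integrable (fun ω => a t ω ^ 2) μ := hat2.integrable_sq
      have hif2 : Integrable (fun ω => f (w t ω) ^ 2) μ := (hf2 t).integrable_sq
      have hprod : Integrable (fun ω => (a t ω * f (w t ω)) ^ 2) μ := by
        simp only [mul_pow]
        exact hsq.integrable_mul hia2 hif2
      have hmeas : AEStronglyMeasurable (fun ω => a t ω * f (w t ω)) μ :=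
        (hat2.1).mul (hf2 t).1
      have hL2 : MemLp (fun ω => a t ω * f (w t ω)) 2 μ := (memLp_two_iff_integrable_sq hmeas).2 hprod
      have hXa : Integrable (fun ω => X ω * a t ω) μ := ih1.integrable_mul hat2
      have hind : IndepFun (fun ω => X ω * a t ω) (fun ω => f (w t ω)) μ :=
        indepFun_known hw (hXm.mul hat) hf
      -- The earlier sum and the coefficient are known at time `t`, whereas the factor `f (w t)` is
      -- independent of that knowledge and centered.
      have hcross : ∫ ω, X ω * a t ω * f (w t ω) ∂μ = 0 := by
        rw [hind.integral_fun_mul_eq_mul_integral hXa.1 (hf2 t).1, hf0, mul_zero]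
      have hcint : Integrable (fun ω => X ω * a t ω * f (w t ω)) μ :=
        hind.integrable_mul hXa ((hf2 t).integrable (by norm_num))
      simp only [Finset.sum_range_succ]
      refine ⟨ih1.add hL2, ?_⟩
      have hpint : Integrable (fun ω => a t ω ^ 2 * f (w t ω) ^ 2) μ := hsq.integrable_mul hia2 hif2
      have hsum : Integrable (fun ω => X ω ^ 2 + 2 * (X ω * a t ω * f (w t ω))) μ :=
        ih1.integrable_sq.add (hcint.const_mul 2)
      have e : ∀ ω, (X ω + a t ω * f (w t ω)) ^ 2
          = X ω ^ 2 + 2 * (X ω * a t ω * f (w t ω)) + a t ω ^ 2 * f (w t ω) ^ 2 := fun ω => by ring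
      have e' : ∫ ω, (X ω + a t ω * f (w t ω)) ^ 2 ∂μ
          = ∫ ω, X ω ^ 2 ∂μ + (∫ ω, a t ω ^ 2 ∂μ) * ∫ ω, f (w t ω) ^ 2 ∂μ := by
        simp only [e]
        rw [integral_add hsum hpint,
          integral_add ih1.integrable_sq (hcint.const_mul 2), integral_const_mul, hcross,
          hsq.integral_fun_mul_eq_mul_integral hia2.1 hif2.1]
        ring
      have h5 : (∫ ω, a t ω ^ 2 ∂μ) * ∫ ω, f (w t ω) ^ 2 ∂μ ≤ (∫ ω, a t ω ^ 2 ∂μ) * V :=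
        mul_le_mul_of_nonneg_left (hV t) (integral_nonneg fun ω => sq_nonneg _)
      refine e'.le.trans ?_
      linarith

end System

end MartingaleSums

/-! ### A lower bound for the covariance of the noise -/

section NoiseGram

variable {p : Euc dx → ℝ}

/-- A positive definite minorant of the covariance of the noise, with bounded integrands. -/
def noiseGram (p : Euc dx → ℝ) : Matrix (Fin dx) (Fin dx) ℝ :=
  Matrix.of fun i j => ∫ y, p y * (y i * y j / (1 + ‖y‖ ^ 2))

theorem abs_coord_mul_div_le {n : ℕ} (y : Euc n) (i j : Fin n) :
    |y i * y j / (1 + ‖y‖ ^ 2)| ≤ 1 := by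
  have hi : |y i| ≤ ‖y‖ := PiLp.norm_apply_le y i
  have hj : |y j| ≤ ‖y‖ := PiLp.norm_apply_le y j
  rw [abs_div, abs_of_pos (by positivity : (0 : ℝ) < 1 + ‖y‖ ^ 2), div_le_one (by positivity),
    abs_mul]
  nlinarith [abs_nonneg (y i), abs_nonneg (y j), norm_nonneg y]

theorem continuous_coord_mul_div {n : ℕ} (i j : Fin n) :
    Continuous fun y : Euc n => y i * y j / (1 + ‖y‖ ^ 2) := by
  refine Continuous.div (by fun_prop) (by fun_prop) fun y => by positivity

theorem IsNoiseDensity.integrable (hp : IsNoiseDensity p) : Integrable p := by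
  by_contra h
  have := hp.mass
  rw [integral_undef h] at this
  norm_num at this

theorem integrable_noiseGram (hp : IsNoiseDensity p) (i j : Fin dx) :
    Integrable fun y => p y * (y i * y j / (1 + ‖y‖ ^ 2)) := by
  have := hp.integrable.bdd_mul (c := 1) (continuous_coord_mul_div i j).aestronglyMeasurable
    (ae_of_all _ fun y => by rw [Real.norm_eq_abs]; exact abs_coord_mul_div_le y i j)
  simpa [mul_comm] using this

theorem abs_noiseGram_le (hp : IsNoiseDensity p) (i j : Fin dx) : |noiseGram p i j| ≤ 1 := by
  rw [noiseGram, Matrix.of_apply]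
  refine (abs_integral_le_integral_abs).trans (le_trans ?_ hp.mass.le)
  refine integral_mono (integrable_noiseGram hp i j).abs hp.integrable fun y => ?_
  simp only [abs_mul, abs_of_nonneg (hp.nonneg y)]
  exact mul_le_of_le_one_right (hp.nonneg y) (abs_coord_mul_div_le y i j)

theorem quad_noiseGram (hp : IsNoiseDensity p) (v : Euc dx) :
    quad (noiseGram p) v = ∫ y, p y * ((inner ℝ v y) ^ 2 / (1 + ‖y‖ ^ 2)) := by
  have h1 : ∀ y : Euc dx, p y * ((inner ℝ v y) ^ 2 / (1 + ‖y‖ ^ 2))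
      = ∑ i, ∑ j, v i * v j * (p y * (y i * y j / (1 + ‖y‖ ^ 2))) := fun y => by
    rw [inner_eq_dotProduct, dotProduct, sq, Finset.sum_mul_sum, Finset.sum_div, Finset.mul_sum]
    refine Finset.sum_congr rfl fun i _ => ?_
    rw [Finset.sum_div, Finset.mul_sum]
    refine Finset.sum_congr rfl fun j _ => ?_
    ring
  simp only [h1]
  rw [integral_finsetSum _ fun i _ => integrable_finsetSum _ fun j _ =>
    (integrable_noiseGram hp i j).const_mul _]
  simp only [quad, dotProduct, Matrix.mulVec, noiseGram, Matrix.of_apply, Finset.mul_sum]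
  refine Finset.sum_congr rfl fun i _ => ?_
  rw [integral_finsetSum _ fun j _ => (integrable_noiseGram hp i j).const_mul _]
  refine Finset.sum_congr rfl fun j _ => ?_
  rw [integral_const_mul]
  ring

/-- A null direction would force the density to vanish almost everywhere off a hyperplane, which is
Lebesgue null; the total mass would be zero. -/
theorem noiseGram_posDef (hp : IsNoiseDensity p) : (noiseGram p).PosDef := by
  have hsym : (noiseGram p)ᵀ = noiseGram p := by
    ext i j
    simp only [noiseGram, Matrix.transpose_apply, Matrix.of_apply, mul_comm]
  refine Matrix.PosDef.of_dotProduct_mulVec_pos (by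
    rw [Matrix.IsHermitian, Matrix.conjTranspose_eq_transpose_of_trivial, hsym]) fun {x} hx => ?_
  set v : Euc dx := WithLp.toLp 2 x with hv
  have hv0 : v ≠ 0 := fun h => hx (by simpa [hv] using h)
  change 0 < star x ⬝ᵥ _
  rw [star_trivial]
  change 0 < quad (noiseGram p) v
  have hnn : ∀ y, 0 ≤ p y * ((inner ℝ v y) ^ 2 / (1 + ‖y‖ ^ 2)) := fun y =>
    mul_nonneg (hp.nonneg y) (by positivity)
  have hint : Integrable fun y => p y * ((inner ℝ v y) ^ 2 / (1 + ‖y‖ ^ 2)) := by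
    have hb : ∀ y : Euc dx, ‖(inner ℝ v y) ^ 2 / (1 + ‖y‖ ^ 2)‖ ≤ ‖v‖ ^ 2 := fun y => by
      rw [Real.norm_eq_abs, abs_of_nonneg (by positivity), div_le_iff₀ (by positivity)]
      have h2 := abs_real_inner_le_norm v y
      have h3 : (inner ℝ v y) ^ 2 ≤ (‖v‖ * ‖y‖) ^ 2 := sq_le_sq' (by
        linarith [neg_abs_le (inner ℝ v y)]) ((le_abs_self _).trans h2)
      nlinarith [sq_nonneg ‖v‖]
    have hc : Continuous fun y : Euc dx => (inner ℝ v y) ^ 2 / (1 + ‖y‖ ^ 2) :=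
      Continuous.div (by fun_prop) (by fun_prop) fun y => by positivity
    have := hp.integrable.bdd_mul (c := ‖v‖ ^ 2) hc.aestronglyMeasurable (ae_of_all _ hb)
    simpa [mul_comm] using this
  rw [quad_noiseGram hp]
  refine lt_of_le_of_ne (integral_nonneg hnn) fun h0 => ?_
  have h1 := (integral_eq_zero_iff_of_nonneg (fun y => hnn y) hint).1 h0.symm
  have hplane : ∀ᵐ y : Euc dx, inner ℝ v y ≠ 0 := by
    have hs : (LinearMap.ker (innerSL ℝ v).toLinearMap) ≠ ⊤ := fun h => by
      have : v ∈ LinearMap.ker (innerSL ℝ v).toLinearMap := h ▸ Submodule.mem_top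
      have h4 : inner ℝ v v = 0 := by simpa using this
      exact hv0 (inner_self_eq_zero.1 h4)
    have := Measure.addHaar_submodule (volume : Measure (Euc dx)) _ hs
    rw [ae_iff]
    convert this using 2
    ext y
    simp
  have h2 : p =ᵐ[volume] 0 := by
    filter_upwards [h1, hplane] with y hy hy'
    have h5 : (inner ℝ v y) ^ 2 / (1 + ‖y‖ ^ 2) ≠ 0 := by positivity
    exact (mul_eq_zero.1 hy).resolve_right h5
  have := hp.mass
  rw [integral_congr_ae h2] at this
  simp at this

end NoiseGram

/-! ### Least squares fits and Gramians -/

section LeastSquares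

variable {ι : Type*}

/-- The Gramian `∑ x xᵀ` of a finite family of vectors. -/
def gramSum (s : Finset ι) (x : ι → Euc dx) : Matrix (Fin dx) (Fin dx) ℝ :=
  ∑ t ∈ s, vecMulVec (x t).ofLp (x t).ofLp

/-- The least squares fit of `v t = F x t`. -/
def lsFit (s : Finset ι) (v : ι → Euc du) (x : ι → Euc dx) : Matrix (Fin du) (Fin dx) ℝ :=
  (∑ t ∈ s, vecMulVec (v t).ofLp (x t).ofLp) * (gramSum s x)⁻¹

theorem quad_gramSum (s : Finset ι) (x : ι → Euc dx) (v : Euc dx) :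
    quad (gramSum s x) v = ∑ t ∈ s, (inner ℝ v (x t)) ^ 2 := by
  rw [quad, gramSum, Matrix.sum_mulVec, dotProduct_sum]
  refine Finset.sum_congr rfl fun t _ => ?_
  rw [Matrix.vecMulVec_mulVec, inner_eq_dotProduct, dotProduct_comm (x t).ofLp]
  simp [dotProduct_smul, sq]

theorem gramSum_transpose (s : Finset ι) (x : ι → Euc dx) : (gramSum s x)ᵀ = gramSum s x := by
  rw [gramSum, Matrix.transpose_sum]
  simp [Matrix.transpose_vecMulVec]

theorem lsFit_mul_gramSum {s : Finset ι} {v : ι → Euc du} {x : ι → Euc dx}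
    (h : (gramSum s x).det ≠ 0) :
    lsFit s v x * gramSum s x = ∑ t ∈ s, vecMulVec (v t).ofLp (x t).ofLp := by
  rw [lsFit, Matrix.mul_assoc, Matrix.nonsing_inv_mul _ (isUnit_iff_ne_zero.2 h), Matrix.mul_one]

/-- The normal equations make the residuals orthogonal to the regressors. The cross term then
vanishes for every weight `H` at once, and Pythagoras applies. -/
theorem sum_quad_lsFit_le {s : Finset ι} {v : ι → Euc du} {x : ι → Euc dx}
    (h : (gramSum s x).det ≠ 0) {H : Matrix (Fin du) (Fin du) ℝ} (hH : H.PosSemidef)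
    (K : Matrix (Fin du) (Fin dx) ℝ) :
    ∑ t ∈ s, quad H (mv (lsFit s v x - K) (x t)) ≤ ∑ t ∈ s, quad H (v t - mv K (x t)) := by
  set F := lsFit s v x with hF
  set D := F - K with hD
  have hres : ∑ t ∈ s, vecMulVec (v t - mv F (x t)).ofLp (x t).ofLp = 0 := by
    have h1 : ∀ t, vecMulVec (v t - mv F (x t)).ofLp (x t).ofLp
        = vecMulVec (v t).ofLp (x t).ofLp - F * vecMulVec (x t).ofLp (x t).ofLp := fun t => by
      rw [Matrix.mul_vecMulVec]
      ext i j
      simp [vecMulVec_apply, mv, sub_mul]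
    simp only [h1, Finset.sum_sub_distrib, ← Matrix.mul_sum]
    rw [← lsFit_mul_gramSum h, gramSum, sub_self]
  have hcross : ∑ t ∈ s, inner ℝ (v t - mv F (x t)) (mv H (mv D (x t))) = 0 := by
    have h2 : ∀ t, inner ℝ (v t - mv F (x t)) (mv H (mv D (x t)))
        = ∑ i, ∑ j, (H * D) i j * vecMulVec (v t - mv F (x t)).ofLp (x t).ofLp i j := fun t => by
      rw [mv_mv, inner_eq_dotProduct, dotProduct]
      refine Finset.sum_congr rfl fun i _ => ?_
      change _ * ((H * D) *ᵥ (x t).ofLp) i = _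
      rw [Matrix.mulVec, dotProduct, Finset.mul_sum]
      refine Finset.sum_congr rfl fun j _ => ?_
      rw [vecMulVec_apply]; ring
    simp only [h2]
    rw [Finset.sum_comm]
    refine Finset.sum_eq_zero fun i _ => ?_
    rw [Finset.sum_comm]
    refine Finset.sum_eq_zero fun j _ => ?_
    rw [← Finset.mul_sum]
    have := congrFun (congrFun hres i) j
    rw [Matrix.sum_apply] at this
    rw [this]; simp
  have h3 : ∀ t, quad H (v t - mv K (x t)) = quad H (v t - mv F (x t))
      + 2 * inner ℝ (v t - mv F (x t)) (mv H (mv D (x t))) + quad H (mv D (x t)) := fun t => by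
    rw [← quad_add_right hH.transpose_eq]
    congr 1
    rw [hD, sub_mv]; abel
  simp only [h3, Finset.sum_add_distrib, ← Finset.mul_sum, hcross]
  have := Finset.sum_nonneg fun t (_ : t ∈ s) => hH.quad_nonneg (v t - mv F (x t))
  linarith

theorem sum_quad_mv_eq (s : Finset ι) (x : ι → Euc dx) (H : Matrix (Fin du) (Fin du) ℝ)
    (D : Matrix (Fin du) (Fin dx) ℝ) :
    ∑ t ∈ s, quad H (mv D (x t)) = D.vec ⬝ᵥ ((gramSum s x ⊗ₖ H) *ᵥ D.vec) := by
  rw [Matrix.kronecker_mulVec_vec, gramSum_transpose, gramSum, Matrix.mul_sum]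
  have h1 : ∀ t, quad H (mv D (x t))
      = D.vec ⬝ᵥ (H * D * vecMulVec (x t).ofLp (x t).ofLp).vec := fun t => by
    rw [Matrix.mul_vecMulVec, quad, mv]
    simp only [dotProduct, Matrix.vec, Fintype.sum_prod_type, vecMulVec_apply]
    rw [Finset.sum_comm]
    refine Finset.sum_congr rfl fun i _ => ?_
    rw [Matrix.mulVec_mulVec]
    conv_lhs => rw [Matrix.mulVec, dotProduct]
    rw [Finset.sum_mul]
    refine Finset.sum_congr rfl fun j _ => ?_
    ring
  simp only [h1]
  rw [← dotProduct_sum]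
  congr 1
  ext ⟨i, j⟩
  simp [Matrix.vec, Matrix.sum_apply]

/-- The sum is the quadratic form of `gramSum ⊗ H`, and the Kronecker product of positive
semidefinite matrices is positive semidefinite. -/
theorem le_sum_quad_mv {s : Finset ι} {x : ι → Euc dx} {H : Matrix (Fin du) (Fin du) ℝ}
    (hH : H.PosSemidef) {a : ℝ} {Γ : Matrix (Fin dx) (Fin dx) ℝ}
    (hG : (gramSum s x - a • Γ).PosSemidef) (D : Matrix (Fin du) (Fin dx) ℝ) :
    a * (D.vec ⬝ᵥ ((Γ ⊗ₖ H) *ᵥ D.vec)) ≤ ∑ t ∈ s, quad H (mv D (x t)) := by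
  have h := (hG.kronecker hH).dotProduct_mulVec_nonneg D.vec
  rw [star_trivial] at h
  have h2 : (gramSum s x - a • Γ) ⊗ₖ H = gramSum s x ⊗ₖ H - a • (Γ ⊗ₖ H) := by
    ext ⟨i, j⟩ ⟨k, l⟩
    simp [Matrix.kroneckerMap_apply, sub_mul, mul_assoc]
  rw [h2, Matrix.sub_mulVec, Matrix.smul_mulVec, dotProduct_sub, dotProduct_smul,
    ← sum_quad_mv_eq, smul_eq_mul] at h
  linarith

theorem vec_dotProduct_vec (D : Matrix (Fin du) (Fin dx) ℝ) : D.vec ⬝ᵥ D.vec = frob D := by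
  simp only [dotProduct, Matrix.vec, Fintype.sum_prod_type, frob]
  rw [Finset.sum_comm]
  simp [sq]

theorem det_ne_zero_of_sub_posSemidef {M N : Matrix (Fin dx) (Fin dx) ℝ} (hN : N.PosDef)
    (h : (M - N).PosSemidef) : M.det ≠ 0 := by
  have : M.PosDef := by
    have := hN.add_posSemidef h
    simpa using this
  exact this.det_pos.ne'

/-- The error of the least squares fit, on the event that the Gramian is large. -/
theorem frob_lsFit_sub_le {s : Finset ι} {v : ι → Euc du} {x : ι → Euc dx} {a : ℝ} (ha : 0 < a)
    (hG : (gramSum s x - a • (1 : Matrix (Fin dx) (Fin dx) ℝ)).PosSemidef)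
    (K : Matrix (Fin du) (Fin dx) ℝ) :
    a * frob (lsFit s v x - K) ≤ ∑ t ∈ s, ‖v t - mv K (x t)‖ ^ 2 := by
  have hdet : (gramSum s x).det ≠ 0 :=
    det_ne_zero_of_sub_posSemidef (Matrix.PosDef.one.smul ha) hG
  have h1 := sum_quad_lsFit_le (v := v) hdet (Matrix.PosSemidef.one (n := Fin du) (R := ℝ)) K
  have h2 := le_sum_quad_mv (Matrix.PosSemidef.one (n := Fin du) (R := ℝ)) hG (lsFit s v x - K)
  rw [Matrix.one_kronecker_one, Matrix.one_mulVec, vec_dotProduct_vec] at h2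
  simp only [quad_one] at h1 h2
  exact h2.trans h1

theorem frob_sub_le {k l : ℕ} (M N : Matrix (Fin k) (Fin l) ℝ) :
    frob (M - N) ≤ 2 * frob M + 2 * frob N := by
  simp only [frob, Finset.mul_sum, ← Finset.sum_add_distrib]
  refine Finset.sum_le_sum fun i _ => Finset.sum_le_sum fun j _ => ?_
  rw [Matrix.sub_apply]
  nlinarith [sq_nonneg (M i j + N i j)]

theorem frob_neg {k l : ℕ} (M : Matrix (Fin k) (Fin l) ℝ) : frob (-M) = frob M := by
  simp [frob]

theorem frob_sub_comm {k l : ℕ} (M N : Matrix (Fin k) (Fin l) ℝ) : frob (M - N) = frob (N - M) := by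
  rw [← frob_neg, neg_sub]

theorem abs_quad_le_of_frob_le {k : ℕ} {M : Matrix (Fin k) (Fin k) ℝ} {a : ℝ} (ha : 0 ≤ a)
    (h : frob M ≤ a ^ 2) (v : Euc k) : |quad M v| ≤ a * ‖v‖ ^ 2 := by
  have h1 := norm_mv_sq_le_frob M v
  have h2 : ‖mv M v‖ ≤ a * ‖v‖ := by
    refine le_of_sq_le_sq ?_ (by positivity)
    calc ‖mv M v‖ ^ 2 ≤ frob M * ‖v‖ ^ 2 := h1
      _ ≤ a ^ 2 * ‖v‖ ^ 2 := by gcongr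
      _ = (a * ‖v‖) ^ 2 := by ring
  rw [quad_eq_inner]
  calc |inner ℝ v (mv M v)| ≤ ‖v‖ * ‖mv M v‖ := abs_real_inner_le_norm _ _
    _ ≤ ‖v‖ * (a * ‖v‖) := by gcongr
    _ = a * ‖v‖ ^ 2 := by ring

/-- A Gramian of vectors `y + w` is bounded below when the cross terms and the deviation of the
truncated noise Gramian from its mean are small. -/
theorem gramSum_sub_posSemidef {N : ℕ} {y w : ℕ → Euc dx} {M : Matrix (Fin dx) (Fin dx) ℝ} {a : ℝ}
    (ha : 0 ≤ a) (hM : ∀ v, 4 * a * ‖v‖ ^ 2 ≤ quad M v)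
    (h1 : frob (∑ i ∈ Finset.range N, vecMulVec (y i).ofLp (w i).ofLp) ≤ (a * N / 2) ^ 2)
    (h2 : frob (∑ i ∈ Finset.range N,
      ((1 + ‖w i‖ ^ 2)⁻¹ • vecMulVec (w i).ofLp (w i).ofLp - M)) ≤ (a * N) ^ 2) (v : Euc dx) :
    2 * a * N * ‖v‖ ^ 2 ≤ ∑ i ∈ Finset.range N, (inner ℝ v (y i + w i)) ^ 2 := by
  have e1 := (abs_le.1 (abs_quad_le_of_frob_le (by positivity) h1 v)).1
  have e2 := (abs_le.1 (abs_quad_le_of_frob_le (by positivity) h2 v)).1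
  have q1 : quad (∑ i ∈ Finset.range N, vecMulVec (y i).ofLp (w i).ofLp) v
      = ∑ i ∈ Finset.range N, inner ℝ v (y i) * inner ℝ v (w i) := by
    rw [quad, Matrix.sum_mulVec, dotProduct_sum]
    refine Finset.sum_congr rfl fun t _ => ?_
    rw [Matrix.vecMulVec_mulVec, inner_eq_dotProduct, inner_eq_dotProduct,
      dotProduct_comm (w t).ofLp]
    simp [dotProduct_smul, mul_comm]
  have q2 : quad (∑ i ∈ Finset.range N,
      ((1 + ‖w i‖ ^ 2)⁻¹ • vecMulVec (w i).ofLp (w i).ofLp - M)) v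
      = ∑ i ∈ Finset.range N, ((1 + ‖w i‖ ^ 2)⁻¹ * (inner ℝ v (w i)) ^ 2) - N * quad M v := by
    rw [quad, Matrix.sum_mulVec, dotProduct_sum]
    have : ∀ i, v.ofLp ⬝ᵥ (((1 + ‖w i‖ ^ 2)⁻¹ • vecMulVec (w i).ofLp (w i).ofLp - M) *ᵥ v.ofLp)
        = (1 + ‖w i‖ ^ 2)⁻¹ * (inner ℝ v (w i)) ^ 2 - quad M v := fun i => by
      rw [Matrix.sub_mulVec, dotProduct_sub, Matrix.smul_mulVec, dotProduct_smul,
        Matrix.vecMulVec_mulVec, inner_eq_dotProduct, dotProduct_comm (w i).ofLp]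
      simp [dotProduct_smul, sq, quad]
    simp only [this]
    rw [Finset.sum_sub_distrib]
    simp
  rw [q1] at e1
  rw [q2] at e2
  have e3 : (N : ℝ) * (4 * a * ‖v‖ ^ 2) ≤ N * quad M v := by gcongr; exact hM v
  -- The squares `⟨v, y i⟩²` are dropped, and those of the noise are multiplied by a truncation
  -- factor at most one.
  have e4 : 2 * ∑ i ∈ Finset.range N, inner ℝ v (y i) * inner ℝ v (w i)
      + ∑ i ∈ Finset.range N, ((1 + ‖w i‖ ^ 2)⁻¹ * (inner ℝ v (w i)) ^ 2)
      ≤ ∑ i ∈ Finset.range N, (inner ℝ v (y i + w i)) ^ 2 := by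
    rw [Finset.mul_sum, ← Finset.sum_add_distrib]
    refine Finset.sum_le_sum fun i _ => ?_
    have h5 : (1 + ‖w i‖ ^ 2)⁻¹ ≤ 1 := inv_le_one_of_one_le₀ (by nlinarith [sq_nonneg ‖w i‖])
    have h6 := mul_le_mul_of_nonneg_right h5 (sq_nonneg (inner ℝ v (w i)))
    rw [inner_add_right]
    nlinarith [sq_nonneg (inner ℝ v (y i))]
  -- The balance is `4 a N - a N - 2 · (a N / 2) = 2 a N`.
  nlinarith

end LeastSquares

/-! ### Clipped least squares estimates -/

section ClippedFit

variable {Y : Type*} [MeasurableSpace Y]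

/-- The positive semidefinite matrices are closed: symmetry and nonnegativity of the form at each
vector are closed conditions. -/
theorem measurableSet_posSemidef {n : ℕ} {f : Y → Matrix (Fin n) (Fin n) ℝ}
    (hf : ∀ i j, Measurable fun y => f y i j) : MeasurableSet {y | (f y).PosSemidef} := by
  have hc : IsClosed {M : Fin n → Fin n → ℝ | (Matrix.of M).PosSemidef} := by
    have : {M : Fin n → Fin n → ℝ | (Matrix.of M).PosSemidef}
        = {M | (Matrix.of M)ᵀ = Matrix.of M} ∩ ⋂ v : Euc n, {M | 0 ≤ quad (Matrix.of M) v} := by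
      ext M
      simp only [Set.mem_inter_iff, Set.mem_iInter, Set.mem_ofPred_eq]
      exact ⟨fun h => ⟨h.transpose_eq, fun v => h.quad_nonneg v⟩,
        fun h => posSemidef_of_quad_nonneg h.1 h.2⟩
    rw [this]
    refine IsClosed.inter (isClosed_eq (by fun_prop) (by fun_prop)) (isClosed_iInter fun v => ?_)
    refine isClosed_le continuous_const ?_
    simp only [quad, dotProduct, Matrix.mulVec, Matrix.of_apply]
    fun_prop
  have hm : Measurable fun y => (fun i j => f y i j : Fin n → Fin n → ℝ) :=
    measurable_pi_iff.2 fun i => measurable_pi_iff.2 fun j => hf i j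
  exact hm hc.measurableSet

theorem measurable_det {n : ℕ} {f : Y → Matrix (Fin n) (Fin n) ℝ}
    (hf : ∀ i j, Measurable fun y => f y i j) : Measurable fun y => (f y).det := by
  simp only [Matrix.det_apply]
  exact Finset.measurable_sum _ fun σ _ =>
    (Finset.measurable_prod _ fun i _ => hf _ _).const_smul _

theorem measurable_inv_apply {n : ℕ} {f : Y → Matrix (Fin n) (Fin n) ℝ}
    (hf : ∀ i j, Measurable fun y => f y i j) (i j : Fin n) :
    Measurable fun y => (f y)⁻¹ i j := by
  simp only [Matrix.inv_def, Matrix.smul_apply, smul_eq_mul, Ring.inverse_eq_inv',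
    Matrix.adjugate_apply]
  refine (measurable_det hf).inv.mul (measurable_det fun k l => ?_)
  by_cases h : k = j
  · subst h; simp
  · simpa [Matrix.updateRow_ne h] using hf k l

theorem measurable_mul_apply {k l n : ℕ} {f : Y → Matrix (Fin k) (Fin l) ℝ}
    {g : Y → Matrix (Fin l) (Fin n) ℝ} (hf : ∀ i j, Measurable fun y => f y i j)
    (hg : ∀ i j, Measurable fun y => g y i j) (i : Fin k) (j : Fin n) :
    Measurable fun y => (f y * g y) i j := by
  simp only [Matrix.mul_apply]
  exact Finset.measurable_sum _ fun r _ => (hf i r).mul (hg r j)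

theorem measurable_sum_vecMulVec {ι : Type*} (s : Finset ι) {v : Y → ι → Euc du}
    {x : Y → ι → Euc dx} (hv : ∀ t, Measurable fun y => v y t) (hx : ∀ t, Measurable fun y => x y t)
    (i : Fin du) (j : Fin dx) :
    Measurable fun y => (∑ t ∈ s, vecMulVec (v y t).ofLp (x y t).ofLp) i j := by
  simp only [Matrix.sum_apply, vecMulVec_apply]
  refine Finset.measurable_sum _ fun t _ => Measurable.mul ?_ ?_
  · exact (by fun_prop : Measurable fun z : Euc du => z i).comp (hv t)
  · exact (by fun_prop : Measurable fun z : Euc dx => z j).comp (hx t)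

theorem measurable_lsFit {ι : Type*} (s : Finset ι) {v : Y → ι → Euc du}
    {x : Y → ι → Euc dx} (hv : ∀ t, Measurable fun y => v y t) (hx : ∀ t, Measurable fun y => x y t)
    (i : Fin du) (j : Fin dx) : Measurable fun y => lsFit s (v y) (x y) i j :=
  measurable_mul_apply (measurable_sum_vecMulVec s hv hx)
    (measurable_inv_apply (measurable_sum_vecMulVec s hx hx)) i j

theorem measurable_frob {k l : ℕ} {f : Y → Matrix (Fin k) (Fin l) ℝ}
    (hf : ∀ i j, Measurable fun y => f y i j) : Measurable fun y => frob (f y) :=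
  Finset.measurable_sum _ fun i _ => Finset.measurable_sum _ fun j _ => (hf i j).pow_const 2

open Classical in
/-- The least squares fit, replaced by `K₀` when the Gramian is small or when the fit is far
from `K₀`. -/
def clippedFit {ι : Type*} (s : Finset ι) (a r : ℝ) (K₀ : Matrix (Fin du) (Fin dx) ℝ)
    (v : ι → Euc du) (x : ι → Euc dx) : Matrix (Fin du) (Fin dx) ℝ :=
  if (gramSum s x - a • (1 : Matrix (Fin dx) (Fin dx) ℝ)).PosSemidef ∧ frob (lsFit s v x - K₀) ≤ r
  then lsFit s v x else K₀

open Classical in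
theorem measurable_clippedFit {ι : Type*} (s : Finset ι) (a r : ℝ)
    (K₀ : Matrix (Fin du) (Fin dx) ℝ) {v : Y → ι → Euc du} {x : Y → ι → Euc dx}
    (hv : ∀ t, Measurable fun y => v y t) (hx : ∀ t, Measurable fun y => x y t)
    (i : Fin du) (j : Fin dx) : Measurable fun y => clippedFit s a r K₀ (v y) (x y) i j := by
  have h1 : MeasurableSet {y | (gramSum s (x y)
      - a • (1 : Matrix (Fin dx) (Fin dx) ℝ)).PosSemidef ∧ frob (lsFit s (v y) (x y) - K₀) ≤ r} :=
    (measurableSet_posSemidef fun i j =>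
      (measurable_sum_vecMulVec s hx hx i j).sub measurable_const).inter
    (measurableSet_le (measurable_frob fun i j => (measurable_lsFit s hv hx i j).sub
      measurable_const) measurable_const)
  have h2 : (fun y => clippedFit s a r K₀ (v y) (x y) i j) = fun y => if (gramSum s (x y)
      - a • (1 : Matrix (Fin dx) (Fin dx) ℝ)).PosSemidef ∧ frob (lsFit s (v y) (x y) - K₀) ≤ r
      then lsFit s (v y) (x y) i j else K₀ i j := by
    funext y
    rw [clippedFit]
    split_ifs <;> rfl
  rw [h2]
  exact Measurable.ite h1 (measurable_lsFit s hv hx i j) measurable_const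

/-- A deterministic bound on the error, which makes the estimate usable as a bounded weight. The
factor is `2 · 4 + 2 = 10`. -/
theorem frob_clippedFit_sub_le {ι : Type*} (s : Finset ι) (a : ℝ)
    {K₀ K : Matrix (Fin du) (Fin dx) ℝ} {r : ℝ} (hr : frob (K₀ - K) ≤ r) (v : ι → Euc du)
    (x : ι → Euc dx) : frob (clippedFit s a (4 * r) K₀ v x - K) ≤ 10 * r := by
  have hr0 := (frob_nonneg _).trans hr
  rw [clippedFit]
  split_ifs with h
  · have h1 := frob_sub_le (lsFit s v x - K₀) (K - K₀)
    rw [sub_sub_sub_cancel_right, frob_sub_comm K K₀] at h1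
    linarith [h.2]
  · linarith

/-- When the Gramian is large, clipping never hurts: a fit at squared distance more than `4 r` from
`K₀` has squared error above `r`, whereas `K₀` itself has error at most `r`. -/
theorem mul_frob_clippedFit_sub_le {ι : Type*} {s : Finset ι} {a : ℝ} (ha : 0 < a)
    {K₀ K : Matrix (Fin du) (Fin dx) ℝ} {r : ℝ} (hr : frob (K₀ - K) ≤ r) (v : ι → Euc du)
    {x : ι → Euc dx} (hG : (gramSum s x - a • (1 : Matrix (Fin dx) (Fin dx) ℝ)).PosSemidef) :
    a * frob (clippedFit s a (4 * r) K₀ v x - K) ≤ ∑ t ∈ s, ‖v t - mv K (x t)‖ ^ 2 := by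
  refine le_trans ?_ (frob_lsFit_sub_le (v := v) ha hG K)
  refine mul_le_mul_of_nonneg_left ?_ ha.le
  rw [clippedFit]
  split_ifs with h
  · exact le_rfl
  · have h1 : 4 * r < frob (lsFit s v x - K₀) := by
      by_contra hcon
      exact h ⟨hG, not_lt.1 hcon⟩
    have h2 := frob_sub_le (lsFit s v x - K) (K₀ - K)
    rw [sub_sub_sub_cancel_right] at h2
    linarith

end ClippedFit

/-! ### The noise makes small Gramians unlikely -/

section GramFailure

variable {Ω Ξ : Type*} [MeasurableSpace Ω] [MeasurableSpace Ξ] {μ : Measure Ω}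
  [IsProbabilityMeasure μ] {S : System dx du dθ} {w : ℕ → Ω → Euc dx} {ξ : Ω → Ξ}
  {π : Policy dx du Ξ} {ϑ : Euc dθ}

theorem measureReal_le_of_integral_sq {f : Ω → ℝ} (hf : Integrable f μ) (h0 : ∀ ω, 0 ≤ f ω)
    {b : ℝ} (hb : 0 < b) : μ.real {ω | b < f ω} ≤ (∫ ω, f ω ∂μ) / b := by
  have h1 := mul_meas_ge_le_integral_of_nonneg (ae_of_all _ h0) hf b
  have h2 : μ.real {ω | b < f ω} ≤ μ.real {ω | b ≤ f ω} :=
    measureReal_mono fun ω (h : b < f ω) => h.le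
  rw [le_div_iff₀ hb]
  change b * μ.real _ ≤ _ at h1
  nlinarith

theorem IsNoise.memLp_coord (hw : IsNoise μ S.p w ξ) (hp : IsNoiseDensity S.p) (t : ℕ)
    (j : Fin dx) : MemLp (fun ω => w t ω j) 2 μ :=
  (EuclideanSpace.proj (𝕜 := ℝ) j).comp_memLp' (hw.memLp hp t)

/-- The mean of the state at time `t + 1` given the past. -/
def System.drift (S : System dx du dθ) (w : ℕ → Ω → Euc dx) (ξ : Ω → Ξ) (π : Policy dx du Ξ)
    (ϑ : Euc dθ) (t : ℕ) (ω : Ω) : Euc dx :=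
  mv S.A (S.state w ξ π ϑ t ω) + mv (S.B ϑ) (S.input w ξ π ϑ t ω)

theorem System.memLp_drift {t : ℕ} (hx : MemLp (S.state w ξ π ϑ t) 2 μ)
    (hu : MemLp (S.input w ξ π ϑ t) 2 μ) : MemLp (S.drift w ξ π ϑ t) 2 μ :=
  (memLp_mv S.A hx).add (memLp_mv (S.B ϑ) hu)

theorem System.measurable_known_drift (t : ℕ) :
    Measurable[S.known π w ξ ϑ t] (S.drift w ξ π ϑ t) := by
  let _ := S.known π w ξ ϑ t
  exact ((measurable_mv _).comp (System.measurable_known_state le_rfl)).add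
    ((measurable_mv _).comp (System.measurable_known_input le_rfl))

/-- Each of the `dx ^ 2` entries is a sum of orthogonal martingale differences, so its second moment
is at most the noise variance times the energy of the drifts. -/
theorem System.integral_frob_cross_le (hw : IsNoise μ S.p w ξ) (hp : IsNoiseDensity S.p) (s N : ℕ)
    (hy : ∀ t < s + N, MemLp (S.drift w ξ π ϑ t) 2 μ) :
    Integrable (fun ω => frob (∑ i ∈ Finset.range N,
        vecMulVec (S.drift w ξ π ϑ (s + i) ω).ofLp (w (s + i) ω).ofLp)) μ ∧
      ∫ ω, frob (∑ i ∈ Finset.range N,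
        vecMulVec (S.drift w ξ π ϑ (s + i) ω).ofLp (w (s + i) ω).ofLp) ∂μ
      ≤ dx ^ 2 * S.noiseCost 1 * ∑ i ∈ Finset.range N, ∫ ω, ‖S.drift w ξ π ϑ (s + i) ω‖ ^ 2 ∂μ := by
  have key : ∀ k l : Fin dx, MemLp (fun ω => ∑ i ∈ Finset.range N,
      S.drift w ξ π ϑ (s + i) ω k * w (s + i) ω l) 2 μ ∧
      ∫ ω, (∑ i ∈ Finset.range N, S.drift w ξ π ϑ (s + i) ω k * w (s + i) ω l) ^ 2 ∂μ
        ≤ S.noiseCost 1 * ∑ i ∈ Finset.range N, ∫ ω, S.drift w ξ π ϑ (s + i) ω k ^ 2 ∂μ :=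
    fun k l => by
      have hm : ∀ {n : ℕ} (k : Fin n), Measurable fun z : Euc n => z k := fun k => by fun_prop
      refine System.integral_sq_sum_mul_noise (S := S) (π := π) (ξ := ξ) (ϑ := ϑ)
        (f := fun y => y l) (a := fun t ω => S.drift w ξ π ϑ t ω k) hw (hm l)
        (fun t => hw.memLp_coord hp t l) (fun t => ?_) (fun t => ?_) (fun t _ _ => ?_)
        fun t _ ht => ?_
      · rw [integral_coord (hw.integrable hp t), hw.integral_eq_zero hp]; rfl
      · rw [← System.integral_quad_noise hw hp t]
        simp only [quad_one]
        refine integral_mono (hw.memLp_coord hp t l).integrable_sq (by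
          simpa [quad_one] using integrable_quad 1 (hw.memLp hp t)) fun ω => ?_
        have := PiLp.norm_apply_le (w t ω) l
        simp only
        rw [← sq_abs]
        exact pow_le_pow_left₀ (abs_nonneg _) this 2
      · exact Measurable.comp (hm k) (System.measurable_known_drift t)
      · exact (EuclideanSpace.proj (𝕜 := ℝ) k).comp_memLp' (hy t ht)
  have he : ∀ ω, frob (∑ i ∈ Finset.range N,
      vecMulVec (S.drift w ξ π ϑ (s + i) ω).ofLp (w (s + i) ω).ofLp)
      = ∑ k, ∑ l, (∑ i ∈ Finset.range N, S.drift w ξ π ϑ (s + i) ω k * w (s + i) ω l) ^ 2 :=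
    fun ω => by simp only [frob, Matrix.sum_apply, vecMulVec_apply]
  simp only [he]
  have hσ : 0 ≤ S.noiseCost 1 := System.noiseCost_nonneg hp Matrix.PosSemidef.one
  refine ⟨integrable_finsetSum _ fun k _ => integrable_finsetSum _ fun l _ =>
    (key k l).1.integrable_sq, ?_⟩
  rw [integral_finsetSum _ fun k _ => integrable_finsetSum _ fun l _ => (key k l).1.integrable_sq]
  have h1 : ∀ k l, ∫ ω, (∑ i ∈ Finset.range N, S.drift w ξ π ϑ (s + i) ω k * w (s + i) ω l) ^ 2 ∂μ
      ≤ S.noiseCost 1 * ∑ i ∈ Finset.range N, ∫ ω, ‖S.drift w ξ π ϑ (s + i) ω‖ ^ 2 ∂μ :=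
    fun k l => (key k l).2.trans (mul_le_mul_of_nonneg_left (Finset.sum_le_sum fun i hi => by
      have hi' := Finset.mem_range.1 hi
      have hy' := hy (s + i) (by omega)
      refine integral_mono ((EuclideanSpace.proj (𝕜 := ℝ) k).comp_memLp' hy').integrable_sq
        (by simpa [quad_one] using integrable_quad 1 hy') fun ω => ?_
      have := PiLp.norm_apply_le (S.drift w ξ π ϑ (s + i) ω) k
      simp only
      rw [← sq_abs]
      exact pow_le_pow_left₀ (abs_nonneg _) this 2) hσ)
  calc _ ≤ ∑ _k : Fin dx, ∑ _l : Fin dx,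
        S.noiseCost 1 * ∑ i ∈ Finset.range N, ∫ ω, ‖S.drift w ξ π ϑ (s + i) ω‖ ^ 2 ∂μ := by
        refine Finset.sum_le_sum fun k _ => ?_
        rw [integral_finsetSum _ fun l _ => (key k l).1.integrable_sq]
        exact Finset.sum_le_sum fun l _ => h1 k l
    _ = _ := by simp; ring

/-- Only second moments of the noise are assumed. The truncated products are bounded, which gives a
variance of order `N` without fourth moments. -/
theorem System.integral_frob_noise_le (hw : IsNoise μ S.p w ξ) (hp : IsNoiseDensity S.p)
    (s N : ℕ) :
    Integrable (fun ω => frob (∑ i ∈ Finset.range N, ((1 + ‖w (s + i) ω‖ ^ 2)⁻¹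
        • vecMulVec (w (s + i) ω).ofLp (w (s + i) ω).ofLp - noiseGram S.p))) μ ∧
      ∫ ω, frob (∑ i ∈ Finset.range N, ((1 + ‖w (s + i) ω‖ ^ 2)⁻¹
        • vecMulVec (w (s + i) ω).ofLp (w (s + i) ω).ofLp - noiseGram S.p)) ∂μ
      ≤ dx ^ 2 * (4 * N) := by
  -- The quantity involves the noise only; the zero policy serves to invoke the orthogonality
  -- estimate with constant coefficients.
  let π₀ : Policy dx du Ξ := ⟨fun _ _ _ => 0, fun _ => measurable_const⟩
  set f : Fin dx → Fin dx → Euc dx → ℝ := fun k l y =>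
    y k * y l / (1 + ‖y‖ ^ 2) - noiseGram S.p k l with hf
  have hfc : ∀ k l, Continuous (f k l) := fun k l => (continuous_coord_mul_div k l).sub
    continuous_const
  have hfb : ∀ k l y, ‖f k l y‖ ≤ 2 := fun k l y => by
    have h1 := abs_coord_mul_div_le y k l
    have h2 := abs_noiseGram_le hp k l
    calc _ ≤ |y k * y l / (1 + ‖y‖ ^ 2)| + |noiseGram S.p k l| := abs_sub _ _
      _ ≤ 2 := by linarith
  have hfL : ∀ k l t, MemLp (fun ω => f k l (w t ω)) 2 μ := fun k l t =>
    MemLp.of_bound ((hfc k l).measurable.comp (hw.measurable_w t)).aestronglyMeasurable 2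
      (ae_of_all _ fun ω => hfb k l _)
  have key : ∀ k l : Fin dx, MemLp (fun ω => ∑ i ∈ Finset.range N,
      (1 : ℝ) * f k l (w (s + i) ω)) 2 μ ∧
      ∫ ω, (∑ i ∈ Finset.range N, (1 : ℝ) * f k l (w (s + i) ω)) ^ 2 ∂μ
        ≤ 4 * ∑ i ∈ Finset.range N, ∫ _ω, (1 : ℝ) ^ 2 ∂μ := fun k l => by
      refine System.integral_sq_sum_mul_noise (S := S) (π := π₀) (ξ := ξ) (ϑ := 0)
        (f := f k l) (a := fun _ _ => 1) hw (hfc k l).measurable (hfL k l) (fun t => ?_)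
        (fun t => ?_) (fun t _ _ => measurable_const) fun t _ ht => memLp_const _
      · rw [hw.integral_comp hp t (hfc k l).stronglyMeasurable]
        simp only [hf, smul_eq_mul, mul_sub]
        rw [integral_sub (integrable_noiseGram hp k l) (hp.integrable.mul_const _),
          integral_mul_const, hp.mass, one_mul]
        simp [noiseGram]
      · calc _ ≤ ∫ _ω, (4 : ℝ) ∂μ := integral_mono (hfL k l t).integrable_sq
              (integrable_const _) fun ω => by
                have := hfb k l (w t ω)
                simp only
                rw [← sq_abs]
                rw [Real.norm_eq_abs] at this
                nlinarith [abs_nonneg (f k l (w t ω))]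
          _ = 4 := by simp
  simp only [one_mul] at key
  have he : ∀ ω, frob (∑ i ∈ Finset.range N, ((1 + ‖w (s + i) ω‖ ^ 2)⁻¹
        • vecMulVec (w (s + i) ω).ofLp (w (s + i) ω).ofLp - noiseGram S.p))
      = ∑ k, ∑ l, (∑ i ∈ Finset.range N, f k l (w (s + i) ω)) ^ 2 := fun ω => by
    simp only [frob, Matrix.sum_apply, vecMulVec_apply, Matrix.sub_apply, Matrix.smul_apply,
      smul_eq_mul, hf]
    refine Finset.sum_congr rfl fun k _ => Finset.sum_congr rfl fun l _ => ?_
    congr 1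
    refine Finset.sum_congr rfl fun i _ => ?_
    ring
  simp only [he]
  refine ⟨integrable_finsetSum _ fun k _ => integrable_finsetSum _ fun l _ =>
    (key k l).1.integrable_sq, ?_⟩
  rw [integral_finsetSum _ fun k _ => integrable_finsetSum _ fun l _ => (key k l).1.integrable_sq]
  calc _ ≤ ∑ _k : Fin dx, ∑ _l : Fin dx, (4 * (N : ℝ)) := by
        refine Finset.sum_le_sum fun k _ => ?_
        rw [integral_finsetSum _ fun l _ => (key k l).1.integrable_sq]
        refine Finset.sum_le_sum fun l _ => (key k l).2.trans ?_
        simp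
    _ = _ := by simp; ring

/-- The Gramian of the states in a window of length `m` is rarely small. -/
theorem System.measureReal_gram_failure_le (hw : IsNoise μ S.p w ξ) (hp : IsNoiseDensity S.p)
    {a : ℝ} (ha : 0 < a) (hM : ∀ v, 4 * a * ‖v‖ ^ 2 ≤ quad (noiseGram S.p) v) (s : ℕ) {m : ℕ}
    (hm : 2 ≤ m) (hy : ∀ t < s + m, MemLp (S.drift w ξ π ϑ t) 2 μ) :
    μ.real {ω | ¬ (gramSum (Finset.Ico s (s + m)) (fun t => S.state w ξ π ϑ t ω)
        - (a * m) • (1 : Matrix (Fin dx) (Fin dx) ℝ)).PosSemidef}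
      ≤ 16 * dx ^ 2 / (a ^ 2 * m ^ 2) * (S.noiseCost 1
        * ∑ t ∈ Finset.Ico s (s + m), ∫ ω, ‖S.drift w ξ π ϑ t ω‖ ^ 2 ∂μ + m) := by
  -- The first state of the window is dropped. The other `N` states are drift plus noise, with drift
  -- and noise indexed inside the window.
  obtain ⟨N, rfl⟩ : ∃ N, m = N + 1 := ⟨m - 1, by omega⟩
  have hN : (1 : ℝ) ≤ N := by exact_mod_cast (by omega : 1 ≤ N)
  obtain ⟨i1, b1⟩ := System.integral_frob_cross_le (π := π) (ϑ := ϑ) hw hp s N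
    fun t ht => hy t (by omega)
  obtain ⟨i2, b2⟩ := System.integral_frob_noise_le (S := S) hw hp s N
  set F1 : Ω → ℝ := fun ω => frob (∑ i ∈ Finset.range N,
    vecMulVec (S.drift w ξ π ϑ (s + i) ω).ofLp (w (s + i) ω).ofLp) with hF1
  set F2 : Ω → ℝ := fun ω => frob (∑ i ∈ Finset.range N, ((1 + ‖w (s + i) ω‖ ^ 2)⁻¹
        • vecMulVec (w (s + i) ω).ofLp (w (s + i) ω).ofLp - noiseGram S.p)) with hF2
  -- If both fluctuations are small, the Gramian is at least `2 a N`, which exceeds `a (N + 1)`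
  -- because `N ≥ 1`. Markov's inequality handles the two exceptional events.
  have hsub : {ω | ¬ (gramSum (Finset.Ico s (s + (N + 1))) (fun t => S.state w ξ π ϑ t ω)
        - (a * (N + 1 : ℕ)) • (1 : Matrix (Fin dx) (Fin dx) ℝ)).PosSemidef}
      ⊆ {ω | (a * N / 2) ^ 2 < F1 ω} ∪ {ω | (a * N) ^ 2 < F2 ω} := by
    intro ω hω
    by_contra hcon
    simp only [Set.mem_union, Set.mem_ofPred_eq, not_or, not_lt] at hcon
    refine hω (posSemidef_of_quad_nonneg ?_ fun v => ?_)
    · rw [Matrix.transpose_sub, gramSum_transpose, Matrix.transpose_smul, Matrix.transpose_one]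
    · rw [quad_sub_left, quad_smul_left, quad_one, quad_gramSum]
      have h1 := gramSum_sub_posSemidef ha.le hM hcon.1 hcon.2 v
      have h2 : ∑ i ∈ Finset.range N, (inner ℝ v (S.drift w ξ π ϑ (s + i) ω + w (s + i) ω)) ^ 2
          ≤ ∑ t ∈ Finset.Ico s (s + (N + 1)), (inner ℝ v (S.state w ξ π ϑ t ω)) ^ 2 := by
        rw [Finset.sum_Ico_eq_sum_range, show s + (N + 1) - s = N + 1 by omega,
          Finset.sum_range_succ']
        have h3 : ∀ i, S.state w ξ π ϑ (s + (i + 1)) ω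
            = S.drift w ξ π ϑ (s + i) ω + w (s + i) ω := fun i => by
          rw [← add_assoc, S.state_succ]; rfl
        simp only [h3]
        linarith [sq_nonneg (inner ℝ v (S.state w ξ π ϑ (s + 0) ω))]
      push_cast
      have h4 : 0 ≤ a * ‖v‖ ^ 2 := by positivity
      nlinarith
  have hpos : 0 < a * N := by positivity
  have p1 := measureReal_le_of_integral_sq i1 (fun ω => frob_nonneg _)
    (by positivity : 0 < (a * N / 2) ^ 2)
  have p2 := measureReal_le_of_integral_sq i2 (fun ω => frob_nonneg _)
    (by positivity : 0 < (a * N) ^ 2)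
  set Y := ∑ t ∈ Finset.Ico s (s + (N + 1)), ∫ ω, ‖S.drift w ξ π ϑ t ω‖ ^ 2 ∂μ with hY
  have hYle : ∑ i ∈ Finset.range N, ∫ ω, ‖S.drift w ξ π ϑ (s + i) ω‖ ^ 2 ∂μ ≤ Y := by
    rw [hY, Finset.sum_Ico_eq_sum_range, show s + (N + 1) - s = N + 1 by omega,
      Finset.sum_range_succ]
    have : 0 ≤ ∫ ω, ‖S.drift w ξ π ϑ (s + N) ω‖ ^ 2 ∂μ := integral_nonneg fun ω => by positivity
    linarith
  have hσ : 0 ≤ S.noiseCost 1 := System.noiseCost_nonneg hp Matrix.PosSemidef.one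
  have hY0 : 0 ≤ Y := Finset.sum_nonneg fun t _ => integral_nonneg fun ω => sq_nonneg _
  calc _ ≤ μ.real ({ω | (a * N / 2) ^ 2 < F1 ω} ∪ {ω | (a * N) ^ 2 < F2 ω}) := measureReal_mono hsub
    _ ≤ μ.real {ω | (a * N / 2) ^ 2 < F1 ω} + μ.real {ω | (a * N) ^ 2 < F2 ω} :=
        measureReal_union_le _ _
    _ ≤ (dx ^ 2 * S.noiseCost 1 * Y) / (a * N / 2) ^ 2 + (dx ^ 2 * (4 * N)) / (a * N) ^ 2 := by
        refine add_le_add (p1.trans ?_) (p2.trans ?_)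
        · gcongr
          exact b1.trans (by gcongr)
        · gcongr
    _ = 4 * dx ^ 2 * (S.noiseCost 1 * Y + N) / (a * N) ^ 2 := by
        field_simp
        ring
    _ ≤ 4 * dx ^ 2 * (S.noiseCost 1 * Y + (N + 1)) / ((a * (N + 1)) ^ 2 / 4) := by
        have h5 : (a * (N + 1)) ^ 2 / 4 ≤ (a * N) ^ 2 := by
          have h6 : a * (N + 1) / 2 ≤ a * N := by nlinarith
          calc (a * (N + 1)) ^ 2 / 4 = (a * (N + 1) / 2) ^ 2 := by ring
            _ ≤ _ := by gcongr
        gcongr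
        linarith
    _ = _ := by
        push_cast
        field_simp
        ring

end GramFailure

namespace Controlled

/-! ### Bounds over the whole horizon -/

section Horizon

variable {Ω Ξ : Type*} [MeasurableSpace Ω] [MeasurableSpace Ξ] {μ : Measure Ω}
  [IsProbabilityMeasure μ] {S : System dx du dθ} {w : ℕ → Ω → Euc dx} {ξ : Ω → Ξ}
  {π : Policy dx du Ξ} {θ ϑ : Euc dθ} {ε₀ q c : ℝ} {Kt : Euc dθ → Matrix (Fin du) (Fin dx) ℝ}
  {T : ℕ} {M : ℝ}

theorem noiseCost_one_nonneg (h : Controlled S μ w ξ π ϑ T M) : 0 ≤ S.noiseCost 1 :=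
  System.noiseCost_nonneg h.dens Matrix.PosSemidef.one

theorem stageCost_nonneg (h : Controlled S μ w ξ π ϑ T M) (t : ℕ) :
    0 ≤ S.stageCost μ w ξ π ϑ t := System.stageCost_nonneg h.Q_posDef h.R_posDef t

/-- Bounds up to the final stages. -/
theorem horizon_le (h : Controlled S μ w ξ π ϑ T M) (hL : LocalBounds S θ ε₀ q c Kt)
    (hϑ : ϑ ∈ Metric.ball θ ε₀) {ε : ℝ} (hε : 0 < ε) (hε2 : ε ≤ 1 / 2) :
    S.stateForm μ w ξ π ϑ (S.P ϑ) (T - tailLength q ε) ≤ 2 * (M + c * S.noiseCost 1 / q) ∧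
      ∑ t ∈ Finset.range (T - tailLength q ε), S.deviation μ w ξ π ϑ (S.P ϑ) t
        ≤ M + 2 * ε * (M + c * S.noiseCost 1 / q) ∧
      ∑ t ∈ Finset.Ico (T - tailLength q ε) T, S.stageCost μ w ξ π ϑ t
        ≤ 3 * M + tailLength q ε * (c * S.noiseCost 1) + 2 * (c * S.noiseCost 1 / q) := by
  obtain ⟨h1, h2⟩ := h.sum_deviation_le hL hϑ hε
  have h3 := h.stateForm_le hL hϑ (Nat.sub_le T (tailLength q ε))
  have hν := h.noiseCost_P_le hL hϑ
  have hq := hL.q_pos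
  have h4 : S.noiseCost (S.P ϑ) / q ≤ c * S.noiseCost 1 / q := by gcongr
  have h5 : 0 ≤ S.stateForm μ w ξ π ϑ (S.P ϑ) (T - tailLength q ε) :=
    System.stateForm_nonneg (hL.P_psd ϑ hϑ) _
  set X := S.stateForm μ w ξ π ϑ (S.P ϑ) (T - tailLength q ε)
  -- The state form at the cut-off time is bounded by the deviations, which are bounded by `M` plus
  -- `ε` times that form; `ε ≤ 1 / 2` allows absorption.
  have h6 : X ≤ 2 * (M + c * S.noiseCost 1 / q) := by nlinarith
  refine ⟨h6, by nlinarith, ?_⟩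
  have h7 : (tailLength q ε : ℝ) * S.noiseCost (S.P ϑ)
      ≤ tailLength q ε * (c * S.noiseCost 1) := by gcongr
  linarith

theorem integrable_norm_sq {n : ℕ} {f : Ω → Euc n} (hf : MemLp f 2 μ) :
    Integrable (fun ω => ‖f ω‖ ^ 2) μ := by simpa [quad_one] using integrable_quad 1 hf

theorem integral_norm_state_sq_le (h : Controlled S μ w ξ π ϑ T M)
    (hL : LocalBounds S θ ε₀ q c Kt) {t : ℕ} (ht : t < T) :
    ∫ ω, ‖S.state w ξ π ϑ t ω‖ ^ 2 ∂μ ≤ c * S.stageCost μ w ξ π ϑ t := by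
  have hc := hL.one_le
  have hx := h.memLp_state ht.le
  have hu := h.memLp t ht
  rw [System.stageCost, ← integral_const_mul]
  refine integral_mono (integrable_norm_sq hx)
    (((integrable_quad _ hx).add (integrable_quad _ hu)).const_mul c) fun ω => ?_
  have h1 := hL.le_Q (S.state w ξ π ϑ t ω)
  have h2 := h.R_posDef.posSemidef.quad_nonneg (S.input w ξ π ϑ t ω)
  simp only [mul_add]
  nlinarith

theorem norm_drift_sq_le (hL : LocalBounds S θ ε₀ q c Kt) (hϑ : ϑ ∈ Metric.ball θ ε₀) (x : Euc dx)
    (u : Euc du) : ‖mv S.A x + mv (S.B ϑ) u‖ ^ 2 ≤ 2 * c ^ 2 * (quad S.Q x + quad S.R u) := by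
  have hc := hL.one_le
  have h1 := hL.A_le x
  have h2 := hL.B_le ϑ hϑ u
  have h3 := mul_le_mul_of_nonneg_left (hL.le_Q x) (by linarith : 0 ≤ c)
  have h4 := mul_le_mul_of_nonneg_left (hL.le_R u) (by linarith : 0 ≤ c)
  have h5 := parallelogram_law_with_norm ℝ (mv S.A x) (mv (S.B ϑ) u)
  nlinarith [sq_nonneg ‖mv S.A x - mv (S.B ϑ) u‖]

theorem integral_norm_drift_sq_le (h : Controlled S μ w ξ π ϑ T M)
    (hL : LocalBounds S θ ε₀ q c Kt) (hϑ : ϑ ∈ Metric.ball θ ε₀) {t : ℕ} (ht : t < T) :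
    ∫ ω, ‖S.drift w ξ π ϑ t ω‖ ^ 2 ∂μ ≤ 2 * c ^ 2 * S.stageCost μ w ξ π ϑ t := by
  have hx := h.memLp_state ht.le
  have hu := h.memLp t ht
  rw [System.stageCost, ← integral_const_mul]
  exact integral_mono (integrable_norm_sq (System.memLp_drift hx hu))
    (((integrable_quad _ hx).add (integrable_quad _ hu)).const_mul _)
    fun ω => norm_drift_sq_le hL hϑ _ _

/-- By the one-step identity, the deviation is at most the stage cost plus the cost-to-go of the
drift. This crude bound serves in the last stages, where the regret does not control deviations. -/
theorem deviation_le (h : Controlled S μ w ξ π ϑ T M)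
    (hL : LocalBounds S θ ε₀ q c Kt) (hϑ : ϑ ∈ Metric.ball θ ε₀) {t : ℕ} (ht : t < T) :
    S.deviation μ w ξ π ϑ (S.P ϑ) t ≤ 3 * c ^ 3 * S.stageCost μ w ξ π ϑ t := by
  have hc := hL.one_le
  have hx := h.memLp_state ht.le
  have hu := h.memLp t ht
  rw [System.stageCost, System.deviation, ← integral_const_mul]
  refine integral_mono (integrable_quad _ (hu.sub (memLp_mv _ hx)))
    (((integrable_quad _ hx).add (integrable_quad _ hu)).const_mul _) fun ω => ?_
  have h1 := System.one_step_identity (θ := ϑ) h.R_posDef (hL.P_psd ϑ hϑ) (S.state w ξ π ϑ t ω)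
    (S.input w ξ π ϑ t ω)
  rw [hL.P_fix ϑ hϑ] at h1
  have h2 := (hL.P_psd ϑ hϑ).quad_nonneg (S.state w ξ π ϑ t ω)
  have h3 := hL.P_le ϑ hϑ (mv S.A (S.state w ξ π ϑ t ω) + mv (S.B ϑ) (S.input w ξ π ϑ t ω))
  have h4 := norm_drift_sq_le hL hϑ (S.state w ξ π ϑ t ω) (S.input w ξ π ϑ t ω)
  have h5 := h.Q_posDef.posSemidef.quad_nonneg (S.state w ξ π ϑ t ω)
  have h6 := h.R_posDef.posSemidef.quad_nonneg (S.input w ξ π ϑ t ω)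
  set s := quad S.Q (S.state w ξ π ϑ t ω) + quad S.R (S.input w ξ π ϑ t ω) with hs
  have h7 : 0 ≤ s := by positivity
  have h8 := mul_le_mul_of_nonneg_left h4 (by linarith : 0 ≤ c)
  have h9 : s ≤ c ^ 3 * s := le_mul_of_one_le_left h7 (one_le_pow₀ hc)
  simp only
  nlinarith

theorem integral_norm_residual_sq_le (h : Controlled S μ w ξ π ϑ T M)
    (hL : LocalBounds S θ ε₀ q c Kt) (hϑ : ϑ ∈ Metric.ball θ ε₀) {t : ℕ} (ht : t < T) :
    ∫ ω, ‖S.input w ξ π ϑ t ω - mv (S.K ϑ) (S.state w ξ π ϑ t ω)‖ ^ 2 ∂μ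
      ≤ c * S.deviation μ w ξ π ϑ (S.P ϑ) t := by
  have hc := hL.one_le
  have hr := (h.memLp t ht).sub (memLp_mv (S.K ϑ) (h.memLp_state ht.le))
  rw [System.deviation, ← integral_const_mul]
  refine integral_mono (integrable_norm_sq hr) ((integrable_quad _ hr).const_mul c) fun ω => ?_
  set v := S.input w ξ π ϑ t ω - mv (S.K ϑ) (S.state w ξ π ϑ t ω) with hv
  have h1 := hL.le_R v
  have h2 : quad S.R v ≤ quad (S.hess ϑ (S.P ϑ)) v := by
    rw [System.hess, quad_add_left, quad_conj]
    linarith [(hL.P_psd ϑ hϑ).quad_nonneg (mv (S.B ϑ) v)]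
  calc _ ≤ c * quad S.R v := h1
    _ ≤ c * quad (S.hess ϑ (S.P ϑ)) v := by gcongr

/-- The sum of all deviations, with the weight `ε ^ 2`. -/
theorem sq_mul_horizon_le (h : Controlled S μ w ξ π ϑ T M) (hL : LocalBounds S θ ε₀ q c Kt)
    (hϑ : ϑ ∈ Metric.ball θ ε₀) {ε : ℝ} (hε : 0 < ε) (hε2 : ε ≤ 1 / 2) :
    ε ^ 2 * ∑ t ∈ Finset.Ico (T - tailLength q ε) T, S.stageCost μ w ξ π ϑ t
        ≤ 3 * (ε * M) + 5 * (c * S.noiseCost 1 / q ^ 2) ∧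
      ε ^ 2 * ∑ t ∈ Finset.range T, S.deviation μ w ξ π ϑ (S.P ϑ) t
        ≤ 11 * c ^ 3 * (ε * M) + 17 * c ^ 3 * (c * S.noiseCost 1 / q ^ 2) := by
  obtain ⟨-, h2, h3⟩ := h.horizon_le hL hϑ hε hε2
  have hq := hL.q_pos
  have hq1 := hL.q_lt
  have hc := hL.one_le
  have hσ := h.noiseCost_one_nonneg
  have hM := h.nonneg
  have hl := tailLength_le hq hq1 hε (by linarith)
  set b := c * S.noiseCost 1 with hb
  have hb0 : 0 ≤ b := by positivity
  set l : ℝ := ((tailLength q ε : ℕ) : ℝ) with hldef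
  have hbq : b / q ≤ b / q ^ 2 := by
    apply div_le_div_of_nonneg_left hb0 (by positivity)
    nlinarith
  have hbq0 : 0 ≤ b / q := by positivity
  have he2 : ε ^ 2 ≤ ε := by nlinarith
  -- The tail has length `O(1/ε)`, so the weight `ε²` makes its noise cost bounded.
  have hl2 : ε ^ 2 * (l * b) ≤ 3 * (b / q ^ 2) := by
    calc ε ^ 2 * (l * b) ≤ ε ^ 2 * (3 / (q ^ 2 * ε) * b) := by gcongr
      _ = ε * (3 * (b / q ^ 2)) := by field_simp
      _ ≤ 1 * (3 * (b / q ^ 2)) := by gcongr; linarith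
      _ = _ := one_mul _
  have hεM : ε ^ 2 * M ≤ ε * M := by gcongr
  have hεb : ε ^ 2 * (b / q) ≤ b / q ^ 2 := by nlinarith
  set Tl := ∑ t ∈ Finset.Ico (T - tailLength q ε) T, S.stageCost μ w ξ π ϑ t with hTl
  have t1 : ε ^ 2 * Tl ≤ 3 * (ε * M) + 5 * (b / q ^ 2) := by
    calc ε ^ 2 * Tl ≤ ε ^ 2 * (3 * M + l * b + 2 * (b / q)) := by gcongr
      _ ≤ _ := by nlinarith
  refine ⟨t1, ?_⟩
  rw [← Finset.sum_range_add_sum_Ico _ (Nat.sub_le T (tailLength q ε)), mul_add]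
  have t2 : ε ^ 2 * ∑ t ∈ Finset.range (T - tailLength q ε), S.deviation μ w ξ π ϑ (S.P ϑ) t
      ≤ 2 * (ε * M) + 2 * (b / q ^ 2) := by
    calc _ ≤ ε ^ 2 * (M + 2 * ε * (M + b / q)) := by gcongr
      _ ≤ ε ^ 2 * (M + 1 * (M + b / q)) := by gcongr; linarith
      _ ≤ _ := by nlinarith
  have t3 : ∑ t ∈ Finset.Ico (T - tailLength q ε) T, S.deviation μ w ξ π ϑ (S.P ϑ) t
      ≤ 3 * c ^ 3 * Tl := by
    rw [hTl, Finset.mul_sum]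
    exact Finset.sum_le_sum fun t ht => h.deviation_le hL hϑ (Finset.mem_Ico.1 ht).2
  have hc3 : 1 ≤ c ^ 3 := one_le_pow₀ hc
  have t4 : ε ^ 2 * ∑ t ∈ Finset.Ico (T - tailLength q ε) T, S.deviation μ w ξ π ϑ (S.P ϑ) t
      ≤ 3 * c ^ 3 * (3 * (ε * M) + 5 * (b / q ^ 2)) := by
    calc _ ≤ ε ^ 2 * (3 * c ^ 3 * Tl) := by gcongr
      _ = 3 * c ^ 3 * (ε ^ 2 * Tl) := by ring
      _ ≤ _ := by gcongr
  have hεM0 : 0 ≤ ε * M := by positivity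
  have hbb : 0 ≤ b / q ^ 2 := by positivity
  nlinarith

end Horizon

end Controlled

/-! ### Estimating the gain from windows of length `⌊√T⌋` -/

section Estimation

variable {Ω Ξ : Type*} [MeasurableSpace Ω] [MeasurableSpace Ξ]

/-- The estimate of the gain from the `j`-th window of length `m`, as a function of the past. -/
def System.fitPast (π : Policy dx du Ξ) {t : ℕ} (m : ℕ) (a r : ℝ)
    (K₀ : Matrix (Fin du) (Fin dx) ℝ) (j : ℕ) (y : Ξ × (Fin (t + 1) → Euc dx)) :
    Matrix (Fin du) (Fin dx) ℝ :=
  clippedFit (Finset.Ico ((j - 1) * m) (j * m)) (a * m) r K₀ (fun s => System.pastInput π s y)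
    (fun s => System.pastState s y)

/-- The estimate of the gain from the `j`-th window of length `m`. -/
def System.fit (S : System dx du dθ) (w : ℕ → Ω → Euc dx) (ξ : Ω → Ξ) (π : Policy dx du Ξ)
    (ϑ : Euc dθ) (m : ℕ) (a r : ℝ) (K₀ : Matrix (Fin du) (Fin dx) ℝ) (j : ℕ) (ω : Ω) :
    Matrix (Fin du) (Fin dx) ℝ :=
  -- Estimate `j` uses the window `[(j - 1) m, j m)`, so that it is known at time `j m`. For `j = 0`
  -- the truncated subtraction makes the window empty.
  clippedFit (Finset.Ico ((j - 1) * m) (j * m)) (a * m) r K₀ (fun s => S.input w ξ π ϑ s ω)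
    (fun s => S.state w ξ π ϑ s ω)

theorem gramSum_congr {ι : Type*} {s : Finset ι} {x x' : ι → Euc dx} (hx : ∀ t ∈ s, x t = x' t) :
    gramSum s x = gramSum s x' :=
  Finset.sum_congr rfl fun t ht => by rw [hx t ht]

theorem lsFit_congr {ι : Type*} {s : Finset ι} {v v' : ι → Euc du} {x x' : ι → Euc dx}
    (hv : ∀ t ∈ s, v t = v' t) (hx : ∀ t ∈ s, x t = x' t) : lsFit s v x = lsFit s v' x' := by
  rw [lsFit, lsFit, gramSum_congr hx]
  congr 1
  exact Finset.sum_congr rfl fun t ht => by rw [hx t ht, hv t ht]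

theorem clippedFit_congr {ι : Type*} {s : Finset ι} {a r : ℝ} {K₀ : Matrix (Fin du) (Fin dx) ℝ}
    {v v' : ι → Euc du} {x x' : ι → Euc dx} (hv : ∀ t ∈ s, v t = v' t)
    (hx : ∀ t ∈ s, x t = x' t) : clippedFit s a r K₀ v x = clippedFit s a r K₀ v' x' := by
  rw [clippedFit, clippedFit, gramSum_congr hx, lsFit_congr hv hx]

theorem System.fitPast_past (S : System dx du dθ) {w : ℕ → Ω → Euc dx} {ξ : Ω → Ξ}
    (π : Policy dx du Ξ) (ϑ : Euc dθ) {t m : ℕ} (a r : ℝ) (K₀ : Matrix (Fin du) (Fin dx) ℝ) {j : ℕ}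
    (hj : j * m ≤ t) (ω : Ω) :
    System.fitPast π m a r K₀ j (S.past π w ξ ϑ t ω) = S.fit w ξ π ϑ m a r K₀ j ω := by
  refine clippedFit_congr (fun s hs => ?_) fun s hs => ?_
  · exact S.pastInput_past π (by have := (Finset.mem_Ico.1 hs).2; omega) ϑ ω
  · exact S.pastState_past π (by have := (Finset.mem_Ico.1 hs).2; omega) ϑ ω

theorem System.measurable_fitPast (π : Policy dx du Ξ) {t m : ℕ} (a r : ℝ)
    (K₀ : Matrix (Fin du) (Fin dx) ℝ) (j : ℕ) (k : Fin du) (l : Fin dx) :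
    Measurable fun y : Ξ × (Fin (t + 1) → Euc dx) => System.fitPast π m a r K₀ j y k l :=
  measurable_clippedFit _ _ _ _ (fun s => System.measurable_pastInput π s)
    (fun s => System.measurable_pastState s) k l

theorem sum_range_sum_Ico (f : ℕ → ℝ) (m N : ℕ) :
    ∑ j ∈ Finset.range N, ∑ t ∈ Finset.Ico (j * m) ((j + 1) * m), f t
      = ∑ t ∈ Finset.range (N * m), f t := by
  induction N with
  | zero => simp
  | succ N ih =>
      rw [Finset.sum_range_succ, ih, Finset.sum_range_add_sum_Ico _ (by nlinarith)]

/-- A constant in the bound for the estimation error of the gain. -/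
def estimationConst (q c a σ d : ℝ) : ℝ :=
  40 * c / q ^ 2 + 10 * c + c / a * (2 + c * σ / q)
    + 160 * d ^ 2 * c / a ^ 2 * (4 * c ^ 2 * σ + 2 * c ^ 2 * σ * (c * σ / q + 4 * (c * σ)) + 1)

/-- The windows have length `m ≥ 1 / ε`, which turns the accumulated deviations `M` into `ε M`. -/
theorem estimation_error_le {c a ε M B m X : ℝ} (hc : 1 ≤ c) (ha : 0 < a) (hε : 0 < ε)
    (hinv : m⁻¹ ≤ ε) (hM : 0 ≤ M) (hB : 0 ≤ B) (hm : 1 ≤ m) (hX : X ≤ 2 * M + B)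
    (hε2 : ε ≤ 1 / 2) : (a * m)⁻¹ * (c * X) ≤ c / a * (2 + B) * (1 + ε * M) := by
  calc _ ≤ (a * m)⁻¹ * (c * (2 * M + B)) := by gcongr
    _ = c / a * (m⁻¹ * (2 * M + B)) := by rw [mul_inv]; ring
    _ ≤ c / a * (ε * (2 * M + B)) := by gcongr
    _ ≤ c / a * ((2 + B) * (1 + ε * M)) := by
        refine mul_le_mul_of_nonneg_left ?_ (by positivity)
        have : 0 ≤ ε * M := by positivity
        nlinarith
    _ = _ := by ring

/-- When the Gramian fails, the clipped error is `O(ε²)`. The total stage cost is `O(M + m²)`, while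
the failure probability carries `m⁻²`. -/
theorem estimation_failure_le {σ c a ε M B b m n d X : ℝ} (hσ : 0 ≤ σ) (hc : 1 ≤ c) (ha : 0 < a)
    (hε : 0 < ε) (hε2 : ε ≤ 1 / 2) (hM : 0 ≤ M) (hB : 0 ≤ B) (hb : 0 ≤ b) (hm : 1 ≤ m)
    (hn : n ≤ m ^ 2) (hX : X ≤ 2 * M + B + m ^ 2 * b) :
    10 * (c * ε ^ 2) * (16 * d ^ 2 / (a ^ 2 * m ^ 2) * (σ * (2 * c ^ 2 * X) + n))
      ≤ 160 * d ^ 2 * c / a ^ 2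
        * (4 * c ^ 2 * σ + 2 * c ^ 2 * σ * (B + 4 * b) + 1) * (1 + ε * M) := by
  have hm2 : 1 ≤ m ^ 2 := one_le_pow₀ hm
  have h5 : 2 * M + B + m ^ 2 * b ≤ m ^ 2 * (2 * M + B + b) := by nlinarith
  have hεM : 0 ≤ ε * M := by positivity
  have hε1 : ε ^ 2 ≤ ε := by nlinarith
  calc _ ≤ 10 * (c * ε ^ 2) * (16 * d ^ 2 / (a ^ 2 * m ^ 2)
          * (σ * (2 * c ^ 2 * (m ^ 2 * (2 * M + B + b))) + m ^ 2)) := by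
        gcongr
        exact hX.trans h5
    _ = 160 * d ^ 2 * c / a ^ 2 * (ε ^ 2 * (σ * (2 * c ^ 2 * (2 * M + B + b)) + 1)) := by
        field_simp
        ring
    _ ≤ 160 * d ^ 2 * c / a ^ 2
          * ((4 * c ^ 2 * σ + 2 * c ^ 2 * σ * (B + 4 * b) + 1) * (1 + ε * M)) := by
        refine mul_le_mul_of_nonneg_left ?_ (by positivity)
        have hc2 : 0 ≤ c ^ 2 * σ := by positivity
        have h6 : ε ^ 2 * M ≤ ε * M := by gcongr
        have h7 : ε ^ 2 * (B + b) ≤ 1 * (B + 4 * b) := by gcongr <;> nlinarith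
        have h8 : c ^ 2 * σ * (ε ^ 2 * M) ≤ c ^ 2 * σ * (ε * M) := by gcongr
        have h9 : c ^ 2 * σ * (ε ^ 2 * (B + b)) ≤ c ^ 2 * σ * (1 * (B + 4 * b)) := by gcongr
        have h10 : 0 ≤ c ^ 2 * σ * (B + 4 * b) * (ε * M) := by positivity
        calc _ = 4 * (c ^ 2 * σ * (ε ^ 2 * M)) + 2 * (c ^ 2 * σ * (ε ^ 2 * (B + b)))
              + ε ^ 2 := by ring
          _ ≤ 4 * (c ^ 2 * σ * (ε * M)) + 2 * (c ^ 2 * σ * (1 * (B + 4 * b))) + 1 := by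
              gcongr
              nlinarith
          _ ≤ 4 * (c ^ 2 * σ * (ε * M)) + 2 * (c ^ 2 * σ * (1 * (B + 4 * b))) + 1
              + (4 * (c ^ 2 * σ) + 2 * (c ^ 2 * σ * (B + 4 * b) * (ε * M)) + ε * M) := by
              linarith
          _ = _ := by ring
    _ = _ := by ring

variable {μ : Measure Ω}
  [IsProbabilityMeasure μ] {S : System dx du dθ} {w : ℕ → Ω → Euc dx} {ξ : Ω → Ξ}
  {π : Policy dx du Ξ} {θ ϑ : Euc dθ} {ε₀ q c : ℝ} {Kt : Euc dθ → Matrix (Fin du) (Fin dx) ℝ}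
  {T : ℕ} {M : ℝ}

theorem System.measurable_fit (hw : IsNoise μ S.p w ξ) (m : ℕ) (a r : ℝ)
    (K₀ : Matrix (Fin du) (Fin dx) ℝ) (j : ℕ) (k : Fin du) (l : Fin dx) :
    Measurable fun ω => S.fit w ξ π ϑ m a r K₀ j ω k l :=
  measurable_clippedFit _ _ _ _ (fun s => System.measurable_input hw s)
    (fun s => System.measurable_state hw s) k l

theorem LocalBounds.frob_gain_sub_le (hL : LocalBounds S θ ε₀ q c Kt) {ε : ℝ} (hε : ε ≤ ε₀)
    (hϑ : ϑ ∈ Metric.ball θ ε) : frob (S.K θ - S.K ϑ) ≤ c * ε ^ 2 := by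
  have h1 := hL.K_eq ϑ (Metric.ball_subset_ball hε hϑ)
  have h2 := hL.K_eq θ (Metric.mem_ball_self hL.eps_pos)
  rw [frob_sub_comm, h1, h2]
  refine (hL.K_lip ϑ).trans ?_
  have := hL.one_le
  gcongr
  exact (Metric.mem_ball.1 hϑ).le

namespace Controlled

theorem frob_fit_sub_le (S : System dx du dθ) (w : ℕ → Ω → Euc dx) (ξ : Ω → Ξ)
    (π : Policy dx du Ξ) (ϑ : Euc dθ) (m : ℕ) (a : ℝ) {r : ℝ}
    {K₀ : Matrix (Fin du) (Fin dx) ℝ} (hr : frob (K₀ - S.K ϑ) ≤ r) (j : ℕ) (ω : Ω) :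
    frob (S.fit w ξ π ϑ m a (4 * r) K₀ j ω - S.K ϑ) ≤ 10 * r :=
  frob_clippedFit_sub_le _ _ hr _ _

theorem integrable_frob_fit (hw : IsNoise μ S.p w ξ) (m : ℕ) (a : ℝ) {r : ℝ}
    {K₀ : Matrix (Fin du) (Fin dx) ℝ} (hr : frob (K₀ - S.K ϑ) ≤ r) (j : ℕ) :
    Integrable (fun ω => frob (S.fit w ξ π ϑ m a (4 * r) K₀ j ω - S.K ϑ)) μ := by
  refine Integrable.of_bound (C := 10 * r) (measurable_frob fun k l =>
    (System.measurable_fit hw m a _ K₀ j k l).sub measurable_const).aestronglyMeasurable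
    (ae_of_all _ fun ω => ?_)
  rw [Real.norm_eq_abs, abs_of_nonneg (frob_nonneg _)]
  exact frob_fit_sub_le S w ξ π ϑ m a hr j ω

/-- On the event of a large Gramian the squared error is at most the sum of squared residuals
divided by `a m`; off it the deterministic bound `10 r` is multiplied by the failure probability. -/
theorem integral_frob_fit_le (h : Controlled S μ w ξ π ϑ T M) (hL : LocalBounds S θ ε₀ q c Kt)
    (hϑ : ϑ ∈ Metric.ball θ ε₀) {a : ℝ} (ha : 0 < a)
    (hN : ∀ v, 4 * a * ‖v‖ ^ 2 ≤ quad (noiseGram S.p) v) {r : ℝ}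
    {K₀ : Matrix (Fin du) (Fin dx) ℝ} (hr : frob (K₀ - S.K ϑ) ≤ r) {m j : ℕ} (hm : 2 ≤ m)
    (hj : (j + 1) * m ≤ T) :
    ∫ ω, frob (S.fit w ξ π ϑ m a (4 * r) K₀ (j + 1) ω - S.K ϑ) ∂μ
      ≤ (a * m)⁻¹ * (c * ∑ t ∈ Finset.Ico (j * m) ((j + 1) * m), S.deviation μ w ξ π ϑ (S.P ϑ) t)
        + 10 * r * (16 * dx ^ 2 / (a ^ 2 * m ^ 2) * (S.noiseCost 1
          * (2 * c ^ 2 * ∑ t ∈ Finset.Ico (j * m) ((j + 1) * m), S.stageCost μ w ξ π ϑ t) + m)) := by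
  have hm0 : (0 : ℝ) < m := by exact_mod_cast (by omega : 0 < m)
  have ham : 0 < a * m := by positivity
  have hr0 : 0 ≤ r := (frob_nonneg _).trans hr
  set W := Finset.Ico (j * m) ((j + 1) * m) with hW
  have hWT : ∀ t ∈ W, t < T := fun t ht => by have := (Finset.mem_Ico.1 ht).2; omega
  have hWeq : W = Finset.Ico (j * m) (j * m + m) := by rw [hW, add_mul, one_mul]
  set F : Set Ω := {ω | ¬ (gramSum W (fun t => S.state w ξ π ϑ t ω)
        - (a * m) • (1 : Matrix (Fin dx) (Fin dx) ℝ)).PosSemidef} with hF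
  have hFm : MeasurableSet F := (measurableSet_posSemidef fun k l =>
    (measurable_sum_vecMulVec W (fun t => System.measurable_state h.noise t)
      (fun t => System.measurable_state h.noise t) k l).sub measurable_const).compl
  have hres : ∀ t ∈ W, Integrable (fun ω =>
      ‖S.input w ξ π ϑ t ω - mv (S.K ϑ) (S.state w ξ π ϑ t ω)‖ ^ 2) μ := fun t ht =>
    integrable_norm_sq ((h.memLp t (hWT t ht)).sub (memLp_mv _ (h.memLp_state (hWT t ht).le)))
  have hpt : ∀ ω, frob (S.fit w ξ π ϑ m a (4 * r) K₀ (j + 1) ω - S.K ϑ)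
      ≤ (a * m)⁻¹ * ∑ t ∈ W, ‖S.input w ξ π ϑ t ω - mv (S.K ϑ) (S.state w ξ π ϑ t ω)‖ ^ 2
        + F.indicator (fun _ => 10 * r) ω := fun ω => by
    have hs : 0 ≤ ∑ t ∈ W, ‖S.input w ξ π ϑ t ω - mv (S.K ϑ) (S.state w ξ π ϑ t ω)‖ ^ 2 :=
      Finset.sum_nonneg fun t _ => sq_nonneg _
    by_cases hω : ω ∈ F
    · rw [Set.indicator_of_mem hω]
      have := frob_fit_sub_le S w ξ π ϑ m a hr (j + 1) ω
      have : 0 ≤ (a * m)⁻¹ * ∑ t ∈ W,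
        ‖S.input w ξ π ϑ t ω - mv (S.K ϑ) (S.state w ξ π ϑ t ω)‖ ^ 2 := by positivity
      linarith
    · rw [Set.indicator_of_notMem hω, add_zero, ← div_eq_inv_mul, le_div_iff₀ ham, mul_comm]
      have hG := not_not.1 hω
      exact mul_frob_clippedFit_sub_le ham hr _ hG
  have hI1 : Integrable (fun ω => (a * m)⁻¹ * ∑ t ∈ W,
      ‖S.input w ξ π ϑ t ω - mv (S.K ϑ) (S.state w ξ π ϑ t ω)‖ ^ 2) μ :=
    (integrable_finsetSum _ hres).const_mul _
  have hI2 : Integrable (F.indicator fun _ => 10 * r) μ := (integrable_const _).indicator hFm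
  have hfail := System.measureReal_gram_failure_le (π := π) (ϑ := ϑ) h.noise h.dens ha hN (j * m)
    hm fun t ht => System.memLp_drift (h.memLp_state (t := t) (by nlinarith))
      (h.memLp t (by nlinarith))
  rw [← hWeq] at hfail
  calc _ ≤ ∫ ω, ((a * m)⁻¹ * ∑ t ∈ W,
        ‖S.input w ξ π ϑ t ω - mv (S.K ϑ) (S.state w ξ π ϑ t ω)‖ ^ 2
        + F.indicator (fun _ => 10 * r) ω) ∂μ :=
        integral_mono (integrable_frob_fit h.noise m a hr _) (hI1.add hI2) hpt
    _ = (a * m)⁻¹ * ∑ t ∈ W,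
        ∫ ω, ‖S.input w ξ π ϑ t ω - mv (S.K ϑ) (S.state w ξ π ϑ t ω)‖ ^ 2 ∂μ
        + 10 * r * μ.real F := by
        rw [integral_add hI1 hI2, integral_const_mul, integral_finsetSum _ hres,
          integral_indicator_const _ hFm, smul_eq_mul]
        ring
    _ ≤ _ := by
        refine add_le_add ?_ ?_
        · rw [Finset.mul_sum (a := c)]
          gcongr with t ht
          exact h.integral_norm_residual_sq_le hL hϑ (hWT t ht)
        · refine mul_le_mul_of_nonneg_left (hfail.trans ?_) (by positivity)
          have := h.noiseCost_one_nonneg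
          rw [Finset.mul_sum (a := 2 * c ^ 2)]
          gcongr with t ht
          exact h.integral_norm_drift_sq_le hL hϑ (hWT t ht)

/-- The windows are at least as long as the tail, so the complete windows used lie before it, where
the regret controls the deviations. -/
theorem sum_integral_frob_fit_le_of_long (h : Controlled S μ w ξ π ϑ T M)
    (hL : LocalBounds S θ ε₀ q c Kt) {ε : ℝ} (hε : 0 < ε) (hε2 : ε ≤ 1 / 2) (hε₀ : ε ≤ ε₀)
    (hϑ : ϑ ∈ Metric.ball θ ε) {a : ℝ} (ha : 0 < a)
    (hN : ∀ v, 4 * a * ‖v‖ ^ 2 ≤ quad (noiseGram S.p) v) {m : ℕ} (hm1 : 1 ≤ m) (hmT : m * m ≤ T)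
    (hm2 : 2 ≤ m) (hlm : tailLength q ε ≤ m) :
    ∑ j ∈ Finset.range m,
        ∫ ω, frob (S.fit w ξ π ϑ m a (4 * (c * ε ^ 2)) (S.K θ) j ω - S.K ϑ) ∂μ
      ≤ estimationConst q c a (S.noiseCost 1) dx * (1 + ε * M) := by
  have hϑ₀ := Metric.ball_subset_ball hε₀ hϑ
  have hr := hL.frob_gain_sub_le hε₀ hϑ
  have hc := hL.one_le
  have hq := hL.q_pos
  have hq1 := hL.q_lt
  have hσ := h.noiseCost_one_nonneg
  have hM := h.nonneg
  have hεM : 0 ≤ ε * M := by positivity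
  obtain ⟨-, hS, -⟩ := h.horizon_le hL hϑ₀ hε hε2
  set σ := S.noiseCost 1 with hσdef
  set b := c * σ with hb
  have hb0 : 0 ≤ b := by positivity
  set r := c * ε ^ 2 with hrdef
  set e : ℕ → ℝ := fun j =>
    ∫ ω, frob (S.fit w ξ π ϑ m a (4 * r) (S.K θ) j ω - S.K ϑ) ∂μ with he
  have hej : ∀ j, e j ≤ 10 * r := fun j => by
    calc e j ≤ ∫ _ω, 10 * r ∂μ := integral_mono (integrable_frob_fit h.noise m a hr j)
          (integrable_const _) fun ω => frob_fit_sub_le S w ξ π ϑ m a hr j ω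
      _ = 10 * r := by simp
  have hε1 : ε ^ 2 ≤ ε := by nlinarith
  have hε11 : ε ^ 2 ≤ 1 := by nlinarith
  have hm0 : (1 : ℝ) ≤ m := by exact_mod_cast hm1
  change ∑ j ∈ Finset.range m, e j ≤ _
  have hpart : 0 ≤ c / a * (2 + b / q) := by positivity
  have hpart2 : 0 ≤ 160 * (dx : ℝ) ^ 2 * c / a ^ 2
      * (4 * c ^ 2 * σ + 2 * c ^ 2 * σ * (b / q + 4 * b) + 1) := by positivity
  have hCdef : estimationConst q c a σ dx = 40 * c / q ^ 2 + 10 * c + c / a * (2 + b / q)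
    + 160 * (dx : ℝ) ^ 2 * c / a ^ 2
      * (4 * c ^ 2 * σ + 2 * c ^ 2 * σ * (b / q + 4 * b) + 1) := rfl
  -- Estimate `0` has an empty window and is bounded by clipping alone. The `N` others use data up
  -- to `N m ≤ T - m`, hence before the tail.
  obtain ⟨N, rfl⟩ : ∃ N, m = N + 1 := ⟨m - 1, by omega⟩
  set m := N + 1 with hmdef
  have hNm : N * m ≤ T - tailLength q ε := by
    have : N * m + m ≤ T := by rw [hmdef] at hmT ⊢; linarith
    omega
  have hNT : N * m ≤ T := hNm.trans (Nat.sub_le _ _)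
  -- The tail has length at least `1 / (q² ε)`, hence at least `1 / ε`, and `m` is at least as
  -- large.
  have hinv : ((m : ℕ) : ℝ)⁻¹ ≤ ε := by
    have h1 : 1 / (q ^ 2 * ε) ≤ (m : ℕ) := by
      refine (Nat.le_ceil _).trans ?_
      have : ⌈1 / (q ^ 2 * ε)⌉₊ ≤ m := by rw [tailLength] at hlm; omega
      exact_mod_cast this
    rw [inv_le_iff_one_le_mul₀ (by positivity)]
    rw [div_le_iff₀ (by positivity)] at h1
    have : (m : ℝ) * (q ^ 2 * ε) ≤ m * (1 * ε) := by
      gcongr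
      nlinarith
    linarith
  have hdevsum : ∑ t ∈ Finset.range (N * m), S.deviation μ w ξ π ϑ (S.P ϑ) t ≤ 2 * M + b / q := by
    have h1 : ∑ t ∈ Finset.range (N * m), S.deviation μ w ξ π ϑ (S.P ϑ) t
        ≤ ∑ t ∈ Finset.range (T - tailLength q ε), S.deviation μ w ξ π ϑ (S.P ϑ) t :=
      Finset.sum_le_sum_of_subset_of_nonneg (by simpa using hNm)
        fun t _ _ => h.deviation_nonneg hL hϑ₀ t
    have h2 : 0 ≤ b / q := by positivity
    nlinarith
  have hstagesum : ∑ t ∈ Finset.range (N * m), S.stageCost μ w ξ π ϑ t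
      ≤ 2 * M + b / q + m ^ 2 * b := by
    have h1 := System.sum_stageCost_eq (n := N * m) h.noise h.dens h.R_posDef (hL.P_psd ϑ hϑ₀)
      (hL.P_fix ϑ hϑ₀) fun s hs => h.memLp s (by omega)
    have h2 := System.stateForm_nonneg (S := S) (μ := μ) (w := w) (ξ := ξ) (π := π) (θ := ϑ)
      (hL.P_psd ϑ hϑ₀) (N * m)
    have h3 : ((N * m : ℕ) : ℝ) * S.noiseCost (S.P ϑ) ≤ (m : ℝ) ^ 2 * b := by
      have h4 : ((N * m : ℕ) : ℝ) ≤ (m : ℝ) ^ 2 := by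
        rw [sq]; exact_mod_cast Nat.mul_le_mul_right m (by omega)
      exact mul_le_mul h4 (h.noiseCost_P_le hL hϑ₀) (h.noiseCost_P_nonneg hL hϑ₀) (by positivity)
    linarith
  have hbound : ∀ j ∈ Finset.range N, e (j + 1)
      ≤ (a * m)⁻¹ * (c * ∑ t ∈ Finset.Ico (j * m) ((j + 1) * m),
          S.deviation μ w ξ π ϑ (S.P ϑ) t)
        + 10 * r * (16 * dx ^ 2 / (a ^ 2 * m ^ 2) * (σ
          * (2 * c ^ 2 * ∑ t ∈ Finset.Ico (j * m) ((j + 1) * m), S.stageCost μ w ξ π ϑ t) + m)) :=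
    fun j hj => h.integral_frob_fit_le hL hϑ₀ ha hN hr hm2 (by
      have := Finset.mem_range.1 hj
      exact (Nat.mul_le_mul_right m (by omega : j + 1 ≤ N)).trans hNT)
  have hsum := Finset.sum_le_sum hbound
  rw [Finset.sum_add_distrib, ← Finset.mul_sum, ← Finset.mul_sum, sum_range_sum_Ico,
    ← Finset.mul_sum, ← Finset.mul_sum, Finset.sum_add_distrib, ← Finset.mul_sum,
    ← Finset.mul_sum, sum_range_sum_Ico, Finset.sum_const, Finset.card_range, nsmul_eq_mul] at hsum
  rw [Finset.sum_range_succ']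
  have e0 : e 0 ≤ 10 * c := (hej 0).trans (by
      rw [hrdef]
      exact mul_le_mul_of_nonneg_left (mul_le_of_le_one_right (by linarith) hε11) (by norm_num))
  have hNm2 : (N : ℝ) * m ≤ (m : ℝ) ^ 2 := by
    rw [sq]; exact_mod_cast Nat.mul_le_mul_right m (by omega)
  have p1 := estimation_error_le hc ha hε hinv hM (by positivity) hm0 hdevsum hε2
  have p2 := estimation_failure_le (d := dx) hσ hc ha hε hε2 hM (by positivity) hb0 hm0 hNm2
    hstagesum
  rw [hCdef]
  have p3 : 0 ≤ (40 * c / q ^ 2) * (1 + ε * M) := by positivity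
  have p4 : 10 * c ≤ 10 * c * (1 + ε * M) := le_mul_of_one_le_right (by positivity) (by linarith)
  linarith

/-- There are only `O(1/ε)` estimates, and clipping bounds each error by `10 c ε²`; no statistics is
needed. -/
theorem sum_integral_frob_fit_le_of_short (h : Controlled S μ w ξ π ϑ T M)
    (hL : LocalBounds S θ ε₀ q c Kt) {ε : ℝ} (hε : 0 < ε) (hε2 : ε ≤ 1 / 2) (hε₀ : ε ≤ ε₀)
    (hϑ : ϑ ∈ Metric.ball θ ε) {a : ℝ} (ha : 0 < a) {m : ℕ} (hm1 : 1 ≤ m)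
    (hreg : ¬ (2 ≤ m ∧ tailLength q ε ≤ m)) :
    ∑ j ∈ Finset.range m,
        ∫ ω, frob (S.fit w ξ π ϑ m a (4 * (c * ε ^ 2)) (S.K θ) j ω - S.K ϑ) ∂μ
      ≤ estimationConst q c a (S.noiseCost 1) dx * (1 + ε * M) := by
  have hϑ₀ := Metric.ball_subset_ball hε₀ hϑ
  have hr := hL.frob_gain_sub_le hε₀ hϑ
  have hc := hL.one_le
  have hq := hL.q_pos
  have hq1 := hL.q_lt
  have hσ := h.noiseCost_one_nonneg
  have hM := h.nonneg
  have hεM : 0 ≤ ε * M := by positivity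
  obtain ⟨-, hS, -⟩ := h.horizon_le hL hϑ₀ hε hε2
  set σ := S.noiseCost 1 with hσdef
  set b := c * σ with hb
  have hb0 : 0 ≤ b := by positivity
  set r := c * ε ^ 2 with hrdef
  set e : ℕ → ℝ := fun j =>
    ∫ ω, frob (S.fit w ξ π ϑ m a (4 * r) (S.K θ) j ω - S.K ϑ) ∂μ with he
  have hej : ∀ j, e j ≤ 10 * r := fun j => by
    calc e j ≤ ∫ _ω, 10 * r ∂μ := integral_mono (integrable_frob_fit h.noise m a hr j)
          (integrable_const _) fun ω => frob_fit_sub_le S w ξ π ϑ m a hr j ω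
      _ = 10 * r := by simp
  have hε1 : ε ^ 2 ≤ ε := by nlinarith
  have hε11 : ε ^ 2 ≤ 1 := by nlinarith
  have hm0 : (1 : ℝ) ≤ m := by exact_mod_cast hm1
  change ∑ j ∈ Finset.range m, e j ≤ _
  have hpart : 0 ≤ c / a * (2 + b / q) := by positivity
  have hpart2 : 0 ≤ 160 * (dx : ℝ) ^ 2 * c / a ^ 2
      * (4 * c ^ 2 * σ + 2 * c ^ 2 * σ * (b / q + 4 * b) + 1) := by positivity
  have hCdef : estimationConst q c a σ dx = 40 * c / q ^ 2 + 10 * c + c / a * (2 + b / q)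
    + 160 * (dx : ℝ) ^ 2 * c / a ^ 2
      * (4 * c ^ 2 * σ + 2 * c ^ 2 * σ * (b / q + 4 * b) + 1) := rfl
  have h1 : (m : ℝ) ≤ 1 + 3 / (q ^ 2 * ε) := by
    rcases not_and_or.1 hreg with hm2 | hlm
    · have : (m : ℝ) ≤ 1 := by exact_mod_cast (by omega : m ≤ 1)
      have : 0 ≤ 3 / (q ^ 2 * ε) := by positivity
      linarith
    · have h2 : (m : ℝ) ≤ tailLength q ε := by exact_mod_cast (by omega : m ≤ tailLength q ε)
      linarith [tailLength_le hq hq1 hε (by linarith)]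
  calc ∑ j ∈ Finset.range m, e j ≤ ∑ _j ∈ Finset.range m, 10 * r :=
        Finset.sum_le_sum fun j _ => hej j
    _ = m * (10 * r) := by simp
    _ ≤ (1 + 3 / (q ^ 2 * ε)) * (10 * (c * ε ^ 2)) := by gcongr
    _ = 10 * c * ε ^ 2 + 30 * c / q ^ 2 * ε := by field_simp; ring
    _ ≤ 10 * c * 1 + 30 * c / q ^ 2 * 1 := by gcongr; linarith
    _ ≤ 40 * c / q ^ 2 + 10 * c := by
        have : 0 ≤ 10 * c / q ^ 2 := by positivity
        have : 40 * c / q ^ 2 = 30 * c / q ^ 2 + 10 * c / q ^ 2 := by ring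
        linarith
    _ ≤ estimationConst q c a σ dx := by rw [hCdef]; linarith
    _ ≤ _ := le_mul_of_one_le_right (by rw [hCdef]; positivity) (by linarith)

/-- The total estimation error of the gain. -/
theorem sum_integral_frob_fit_le (h : Controlled S μ w ξ π ϑ T M)
    (hL : LocalBounds S θ ε₀ q c Kt) {ε : ℝ} (hε : 0 < ε) (hε2 : ε ≤ 1 / 2) (hε₀ : ε ≤ ε₀)
    (hϑ : ϑ ∈ Metric.ball θ ε) {a : ℝ} (ha : 0 < a)
    (hN : ∀ v, 4 * a * ‖v‖ ^ 2 ≤ quad (noiseGram S.p) v) {m : ℕ} (hm1 : 1 ≤ m) (hmT : m * m ≤ T) :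
    ∑ j ∈ Finset.range m,
        ∫ ω, frob (S.fit w ξ π ϑ m a (4 * (c * ε ^ 2)) (S.K θ) j ω - S.K ϑ) ∂μ
      ≤ estimationConst q c a (S.noiseCost 1) dx * (1 + ε * M) := by
  by_cases hreg : 2 ≤ m ∧ tailLength q ε ≤ m
  · exact h.sum_integral_frob_fit_le_of_long hL hε hε2 hε₀ hϑ ha hN hm1 hmT hreg.1 hreg.2
  · exact h.sum_integral_frob_fit_le_of_short hL hε hε2 hε₀ hϑ ha hm1 hreg

end Controlled

end Estimation

/-! ### Virtual inputs, and the total weighted deviation -/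

section VirtualInputs

variable {Ω Ξ : Type*} [MeasurableSpace Ω] [MeasurableSpace Ξ]

/-- The input at time `t`, replaced by a feedback: by the estimated gain at the end of the `k`-th
window, and by `K₀` from time `n` on. -/
def System.virtual (S : System dx du dθ) (w : ℕ → Ω → Euc dx) (ξ : Ω → Ξ) (π : Policy dx du Ξ)
    (ϑ : Euc dθ) (n m : ℕ) (a r : ℝ) (K₀ : Matrix (Fin du) (Fin dx) ℝ) (k t : ℕ) (ω : Ω) :
    Euc du :=
  -- At the right endpoint, also the left endpoint of the next closed window, the actual deviation
  -- is charged to the next window only. The estimate was complete at time `k m`, a whole window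
  -- earlier.
  if t = (k + 1) * m then mv (S.fit w ξ π ϑ m a r K₀ k ω) (S.state w ξ π ϑ t ω)
  else if t < n then S.input w ξ π ϑ t ω else mv K₀ (S.state w ξ π ϑ t ω)

/-- A constant in the bound for the loss at the ends of the windows. -/
def lossConst (q c a σ d : ℝ) : ℝ :=
  220 * c ^ 4 / q + 340 * c ^ 5 * σ / q ^ 3 + 10 * c ^ 2 * σ / q ^ 2
    + c * σ / q * estimationConst q c a σ d

/-- A constant in the bound for the virtual deviations. -/
def virtualConst (q c a σ d : ℝ) : ℝ :=
  8 * c ^ 3 + 9 * c ^ 4 * σ / q ^ 2 + c ^ 2 * lossConst q c a σ d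

variable {μ : Measure Ω}
  [IsProbabilityMeasure μ] {S : System dx du dθ} {w : ℕ → Ω → Euc dx} {ξ : Ω → Ξ}
  {π : Policy dx du Ξ} {θ ϑ : Euc dθ} {ε₀ q c : ℝ} {Kt : Euc dθ → Matrix (Fin du) (Fin dx) ℝ}
  {T : ℕ} {M : ℝ}

theorem estimationConst_nonneg {q c a σ d : ℝ} (hq : 0 < q) (hc : 1 ≤ c) (ha : 0 < a)
    (hσ : 0 ≤ σ) : 0 ≤ estimationConst q c a σ d := by
  unfold estimationConst; positivity

theorem lossConst_nonneg {q c a σ d : ℝ} (hq : 0 < q) (hc : 1 ≤ c) (ha : 0 < a)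
    (hσ : 0 ≤ σ) : 0 ≤ lossConst q c a σ d := by
  have := estimationConst_nonneg (d := d) hq hc ha hσ
  unfold lossConst; positivity

/-- The half-open windows are disjoint and lie inside the horizon. -/
theorem sum_Ico_shift_le {f : ℕ → ℝ} {m T : ℕ} (hf : ∀ t < T, 0 ≤ f t) (hm : m * m ≤ T) :
    ∑ k ∈ Finset.range (m - 1), ∑ t ∈ Finset.Ico ((k + 1) * m) ((k + 2) * m), f t
      ≤ ∑ t ∈ Finset.range T, f t := by
  rcases Nat.eq_zero_or_pos m with rfl | hpos
  · simp only [Nat.zero_le, Nat.sub_eq_zero_of_le, Finset.range_zero, Finset.sum_empty]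
    exact Finset.sum_nonneg fun t ht => hf t (Finset.mem_range.1 ht)
  · have h1 := sum_range_sum_Ico f m (m - 1 + 1)
    rw [Finset.sum_range_succ', Nat.sub_add_cancel hpos] at h1
    have h2 : 0 ≤ ∑ t ∈ Finset.Ico (0 * m) ((0 + 1) * m), f t :=
      Finset.sum_nonneg fun t ht => hf t (by have := (Finset.mem_Ico.1 ht).2; nlinarith)
    have h3 : ∑ t ∈ Finset.range (m * m), f t ≤ ∑ t ∈ Finset.range T, f t :=
      Finset.sum_le_sum_of_subset_of_nonneg (by simpa using hm)
        fun t ht _ => hf t (Finset.mem_range.1 ht)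
    change _ + _ = _ at h1
    have h4 : ∑ k ∈ Finset.range (m - 1), ∑ t ∈ Finset.Ico ((k + 1) * m) ((k + 2) * m), f t
        = ∑ k ∈ Finset.range (m - 1), ∑ t ∈ Finset.Ico ((k + 1) * m) ((k + 1 + 1) * m), f t := rfl
    linarith

namespace Controlled

theorem norm_sq_le_quad_P (h : Controlled S μ w ξ π ϑ T M) (hL : LocalBounds S θ ε₀ q c Kt)
    (hϑ : ϑ ∈ Metric.ball θ ε₀) (x : Euc dx) : ‖x‖ ^ 2 ≤ c * quad (S.P ϑ) x := by
  have hc := hL.one_le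
  have h1 := System.quad_Q_le_riccati (θ := ϑ) h.R_posDef (hL.P_psd ϑ hϑ) x
  rw [hL.P_fix ϑ hϑ] at h1
  exact (hL.le_Q x).trans (mul_le_mul_of_nonneg_left h1 (by linarith))

/-- The loss of the estimated feedback at the end of a window. -/
theorem integral_frob_mul_quad_le (h : Controlled S μ w ξ π ϑ T M)
    (hL : LocalBounds S θ ε₀ q c Kt) (hϑ : ϑ ∈ Metric.ball θ ε₀) {r a : ℝ}
    {K₀ : Matrix (Fin du) (Fin dx) ℝ} (hr : frob (K₀ - S.K ϑ) ≤ r) {m k : ℕ}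
    (hk : (k + 1) * m ≤ T) :
    ∫ ω, frob (S.fit w ξ π ϑ m a (4 * r) K₀ k ω - S.K ϑ)
        * quad (S.P ϑ) (S.state w ξ π ϑ ((k + 1) * m) ω) ∂μ
      ≤ (1 - q) ^ m * (10 * r * (∑ t ∈ Finset.range T, S.deviation μ w ξ π ϑ (S.P ϑ) t
            + c * S.noiseCost 1 / q))
        + ∑ t ∈ Finset.Ico (k * m) ((k + 1) * m), 10 * r * S.deviation μ w ξ π ϑ (S.P ϑ) t
        + (∫ ω, frob (S.fit w ξ π ϑ m a (4 * r) K₀ k ω - S.K ϑ) ∂μ)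
          * (c * S.noiseCost 1) / q := by
  have hr0 : 0 ≤ r := (frob_nonneg _).trans hr
  have hq := hL.q_pos
  have hσ := h.noiseCost_one_nonneg
  have hc := hL.one_le
  set D : Ω → ℝ := fun ω => frob (S.fit w ξ π ϑ m a (4 * r) K₀ k ω - S.K ϑ) with hD
  have hD0 : 0 ≤ ∫ ω, D ω ∂μ := integral_nonneg fun ω => frob_nonneg _
  have hstep : ∀ t, k * m ≤ t → t < (k + 1) * m →
      ∫ ω, D ω * quad (S.P ϑ) (S.state w ξ π ϑ (t + 1) ω) ∂μ
        ≤ (1 - q) * ∫ ω, D ω * quad (S.P ϑ) (S.state w ξ π ϑ t ω) ∂μ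
          + 10 * r * S.deviation μ w ξ π ϑ (S.P ϑ) t
          + (∫ ω, D ω ∂μ) * (c * S.noiseCost 1) := fun t hkt hte => by
    -- The weight is the estimation error, which is known from time `k m` on and bounded by `10 r`
    -- thanks to clipping.
    have h1 := h.weighted_lyapunov hL hϑ (t := t) (by omega) (b := 10 * r)
      (G := fun y => frob (System.fitPast π m a (4 * r) K₀ k y - S.K ϑ))
      (measurable_frob fun i j =>
        (System.measurable_fitPast π a (4 * r) K₀ k i j).sub measurable_const)
      (fun y => frob_nonneg _) fun y => frob_clippedFit_sub_le _ _ hr _ _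
    simp only [S.fitPast_past π ϑ a (4 * r) K₀ hkt] at h1
    refine h1.trans (add_le_add le_rfl ?_)
    exact mul_le_mul_of_nonneg_left (h.noiseCost_P_le hL hϑ) hD0
  have h2 := le_of_contraction (z := fun t => ∫ ω, D ω * quad (S.P ϑ) (S.state w ξ π ϑ t ω) ∂μ)
    (a := fun t => 10 * r * S.deviation μ w ξ π ϑ (S.P ϑ) t)
    (b := (∫ ω, D ω ∂μ) * (c * S.noiseCost 1)) hq hL.q_lt (by positivity)
    (s := k * m) (n := (k + 1) * m) (Nat.mul_le_mul_right m (by omega))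
    (fun t => mul_nonneg (by positivity) (h.deviation_nonneg hL hϑ t)) hstep
  refine h2.trans ?_
  have h3 : (k + 1) * m - k * m = m := by rw [add_mul, one_mul]; omega
  rw [h3]
  refine add_le_add (add_le_add (mul_le_mul_of_nonneg_left ?_
    (pow_nonneg (by linarith [hL.q_lt]) _)) le_rfl) le_rfl
  have hkm : k * m ≤ T := (Nat.mul_le_mul_right m (by omega)).trans hk
  have h4 := h.stateForm_le hL hϑ hkm
  have h5 : ∑ t ∈ Finset.range (k * m), S.deviation μ w ξ π ϑ (S.P ϑ) t
      ≤ ∑ t ∈ Finset.range T, S.deviation μ w ξ π ϑ (S.P ϑ) t :=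
    Finset.sum_le_sum_of_subset_of_nonneg (by simpa using hkm)
      fun t _ _ => h.deviation_nonneg hL hϑ t
  have h6 : S.noiseCost (S.P ϑ) / q ≤ c * S.noiseCost 1 / q := by
    have := h.noiseCost_P_le hL hϑ
    gcongr
  calc _ ≤ ∫ ω, 10 * r * quad (S.P ϑ) (S.state w ξ π ϑ (k * m) ω) ∂μ := by
        refine integral_mono_of_nonneg (ae_of_all _ fun ω =>
          mul_nonneg (frob_nonneg _) ((hL.P_psd ϑ hϑ).quad_nonneg _))
          ((integrable_quad _ (h.memLp_state hkm)).const_mul _) (ae_of_all _ fun ω => ?_)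
        exact mul_le_mul_of_nonneg_right (frob_fit_sub_le S w ξ π ϑ m a hr k ω)
          ((hL.P_psd ϑ hϑ).quad_nonneg _)
    _ = 10 * r * S.stateForm μ w ξ π ϑ (S.P ϑ) (k * m) := by
        rw [integral_const_mul]; rfl
    _ ≤ _ := by gcongr; linarith

/-- The total loss of the estimated feedbacks. -/
theorem sum_loss_le (h : Controlled S μ w ξ π ϑ T M)
    (hL : LocalBounds S θ ε₀ q c Kt) {ε : ℝ} (hε : 0 < ε) (hε2 : ε ≤ 1 / 2) (hε₀ : ε ≤ ε₀)
    (hϑ : ϑ ∈ Metric.ball θ ε) {a : ℝ} (ha : 0 < a)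
    (hN : ∀ v, 4 * a * ‖v‖ ^ 2 ≤ quad (noiseGram S.p) v) {m : ℕ} (hm1 : 1 ≤ m) (hmT : m * m ≤ T) :
    ∑ k ∈ Finset.range (m - 1),
        ∫ ω, frob (S.fit w ξ π ϑ m a (4 * (c * ε ^ 2)) (S.K θ) (k + 1) ω - S.K ϑ)
          * quad (S.P ϑ) (S.state w ξ π ϑ ((k + 1 + 1) * m) ω) ∂μ
      ≤ lossConst q c a (S.noiseCost 1) dx * (1 + ε * M) := by
  have hϑ₀ := Metric.ball_subset_ball hε₀ hϑ
  have hr := hL.frob_gain_sub_le hε₀ hϑ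
  have hc := hL.one_le
  have hq := hL.q_pos
  have hq1 := hL.q_lt
  have hσ := h.noiseCost_one_nonneg
  have hM := h.nonneg
  have hest := h.sum_integral_frob_fit_le hL hε hε2 hε₀ hϑ ha hN hm1 hmT
  have hall := (h.sq_mul_horizon_le hL hϑ₀ hε hε2).2
  set σ := S.noiseCost 1 with hσdef
  set r := c * ε ^ 2 with hrdef
  set Da := ∑ t ∈ Finset.range T, S.deviation μ w ξ π ϑ (S.P ϑ) t with hDa
  have hDa0 : 0 ≤ Da := Finset.sum_nonneg fun t _ => h.deviation_nonneg hL hϑ₀ t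
  set e : ℕ → ℝ := fun j =>
    ∫ ω, frob (S.fit w ξ π ϑ m a (4 * r) (S.K θ) j ω - S.K ϑ) ∂μ with he
  change ∑ j ∈ Finset.range m, e j ≤ _ at hest
  have hkT : ∀ k ∈ Finset.range (m - 1), (k + 1 + 1) * m ≤ T := fun k hk => by
    have := Finset.mem_range.1 hk
    exact (Nat.mul_le_mul_right m (by omega)).trans hmT
  have hsum := Finset.sum_le_sum fun k hk =>
    h.integral_frob_mul_quad_le hL hϑ₀ (a := a) hr (hkT k hk)
  refine hsum.trans ?_
  rw [Finset.sum_add_distrib, Finset.sum_add_distrib, Finset.sum_const, Finset.card_range,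
    nsmul_eq_mul]
  have hr0 : 0 ≤ r := by positivity
  have hbq : 0 ≤ c * σ / q := by positivity
  -- The sum of `m - 1` equal terms costs a factor below `m`, compensated by the contraction across
  -- one window: `m (1 - q)^m ≤ 1 / q`.
  have t1 : ((m - 1 : ℕ) : ℝ) * ((1 - q) ^ m * (10 * r * (Da + c * σ / q)))
      ≤ 10 * r * (Da + c * σ / q) / q := by
    have h1 := pow_le_inv_mul hq hq1 m
    have h2 : ((m - 1 : ℕ) : ℝ) ≤ m := by exact_mod_cast Nat.sub_le m 1
    have h3 : 0 ≤ (1 - q) ^ m := pow_nonneg (by linarith) m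
    rw [le_div_iff₀ hq]
    calc _ = ((1 - q) ^ m * (q * ((m - 1 : ℕ) : ℝ))) * (10 * r * (Da + c * σ / q)) := by ring
      _ ≤ ((1 - q) ^ m * (q * m)) * (10 * r * (Da + c * σ / q)) := by gcongr
      _ ≤ 1 * (10 * r * (Da + c * σ / q)) := by gcongr
      _ = _ := one_mul _
  have t2 : ∑ k ∈ Finset.range (m - 1), ∑ t ∈ Finset.Ico ((k + 1) * m) ((k + 1 + 1) * m),
      10 * r * S.deviation μ w ξ π ϑ (S.P ϑ) t ≤ 10 * r * Da := by
    rw [hDa, Finset.mul_sum]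
    exact sum_Ico_shift_le (fun t _ =>
      mul_nonneg (by positivity) (h.deviation_nonneg hL hϑ₀ t)) hmT
  have t3 : ∑ k ∈ Finset.range (m - 1), e (k + 1) * (c * σ) / q
      ≤ c * σ / q * (estimationConst q c a σ dx * (1 + ε * M)) := by
    have h1 : ∑ k ∈ Finset.range (m - 1), e (k + 1) ≤ ∑ j ∈ Finset.range m, e j := by
      obtain ⟨N, rfl⟩ : ∃ N, m = N + 1 := ⟨m - 1, by omega⟩
      rw [Finset.sum_range_succ', Nat.add_sub_cancel]
      linarith [show 0 ≤ e 0 from integral_nonneg fun ω => frob_nonneg _]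
    calc _ = c * σ / q * ∑ k ∈ Finset.range (m - 1), e (k + 1) := by
          rw [Finset.mul_sum]
          exact Finset.sum_congr rfl fun k _ => by ring
      _ ≤ _ := by gcongr; exact h1.trans hest
  refine (add_le_add (add_le_add t1 t2) t3).trans ?_
  have hεM : 0 ≤ ε * M := by positivity
  have h4 : 10 * r * Da ≤ 10 * r * Da / q := by
    rw [le_div_iff₀ hq]
    exact mul_le_of_le_one_right (by positivity) hq1.le
  have h5 : 10 * r * (Da + c * σ / q) / q + 10 * r * Da
      ≤ 20 * c / q * (ε ^ 2 * Da) + 10 * c ^ 2 * σ / q ^ 2 := by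
    have h6 : 10 * r * (Da + c * σ / q) / q
        = 10 * c / q * (ε ^ 2 * Da) + 10 * c ^ 2 * σ / q ^ 2 * ε ^ 2 := by
      rw [hrdef]; field_simp
    have h7 : 10 * r * Da / q = 10 * c / q * (ε ^ 2 * Da) := by rw [hrdef]; ring
    have h8 : 10 * c ^ 2 * σ / q ^ 2 * ε ^ 2 ≤ 10 * c ^ 2 * σ / q ^ 2 :=
      mul_le_of_le_one_right (by positivity) (by nlinarith)
    have h9 : 20 * c / q * (ε ^ 2 * Da) = 10 * c / q * (ε ^ 2 * Da)
      + 10 * c / q * (ε ^ 2 * Da) := by ring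
    linarith
  have h10 : 20 * c / q * (ε ^ 2 * Da)
      ≤ 220 * c ^ 4 / q * (ε * M) + 340 * c ^ 5 * σ / q ^ 3 := by
    calc _ ≤ 20 * c / q * (11 * c ^ 3 * (ε * M) + 17 * c ^ 3 * (c * σ / q ^ 2)) := by gcongr
      _ = _ := by field_simp; ring
  have h11 : 0 ≤ 220 * c ^ 4 / q := by positivity
  have h12 : 0 ≤ (340 * c ^ 5 * σ / q ^ 3 + 10 * c ^ 2 * σ / q ^ 2) * (ε * M) := by positivity
  calc _ ≤ 220 * c ^ 4 / q * (ε * M) + 340 * c ^ 5 * σ / q ^ 3 + 10 * c ^ 2 * σ / q ^ 2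
        + c * σ / q * (estimationConst q c a σ dx * (1 + ε * M)) := by linarith
    _ ≤ 220 * c ^ 4 / q * (ε * M) + 340 * c ^ 5 * σ / q ^ 3 + 10 * c ^ 2 * σ / q ^ 2
        + c * σ / q * (estimationConst q c a σ dx * (1 + ε * M)) + (220 * c ^ 4 / q
        + (340 * c ^ 5 * σ / q ^ 3 + 10 * c ^ 2 * σ / q ^ 2) * (ε * M)) := by linarith
    _ = _ := by rw [lossConst]; ring

theorem norm_mv_fit_sub_le (S : System dx du dθ) (w : ℕ → Ω → Euc dx) (ξ : Ω → Ξ)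
    (π : Policy dx du Ξ) (ϑ : Euc dθ) (m : ℕ) (a r : ℝ) (K₀ : Matrix (Fin du) (Fin dx) ℝ)
    (j : ℕ) (ω : Ω) (x : Euc dx) :
    ‖mv (S.fit w ξ π ϑ m a r K₀ j ω) x - mv (S.K ϑ) x‖ ^ 2
      ≤ frob (S.fit w ξ π ϑ m a r K₀ j ω - S.K ϑ) * ‖x‖ ^ 2 := by
  rw [← sub_mv]
  exact norm_mv_sq_le_frob _ _

theorem memLp_virtual (h : Controlled S μ w ξ π ϑ T M) (n m : ℕ) (a : ℝ) {r : ℝ}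
    {K₀ : Matrix (Fin du) (Fin dx) ℝ} (hr : frob (K₀ - S.K ϑ) ≤ r) (k : ℕ) (hn : n ≤ T) {t : ℕ}
    (ht : t ≤ T) : MemLp (S.virtual w ξ π ϑ n m a (4 * r) K₀ k t) 2 μ := by
  have hx := h.memLp_state ht
  by_cases h1 : t = (k + 1) * m
  · have hmeas : Measurable fun ω => mv (S.fit w ξ π ϑ m a (4 * r) K₀ k ω) (S.state w ξ π ϑ t ω)
        - mv (S.K ϑ) (S.state w ξ π ϑ t ω) := by
      refine Measurable.sub ?_ ((measurable_mv _).comp (System.measurable_state h.noise t))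
      refine (PiLp.continuous_toLp 2 _).measurable.comp (measurable_pi_iff.2 fun i => ?_)
      simp only [Matrix.mulVec, dotProduct]
      refine Finset.measurable_sum _ fun j _ => (System.measurable_fit h.noise m a _ K₀ k i j).mul ?_
      exact (by fun_prop : Measurable fun z : Euc dx => z j).comp
        (System.measurable_state h.noise t)
    have h2 : MemLp (fun ω => mv (S.fit w ξ π ϑ m a (4 * r) K₀ k ω) (S.state w ξ π ϑ t ω)
        - mv (S.K ϑ) (S.state w ξ π ϑ t ω)) 2 μ := by
      refine MemLp.of_le_mul (c := √(10 * r)) hx hmeas.aestronglyMeasurable (ae_of_all _ fun ω => ?_)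
      have h3 := norm_mv_fit_sub_le S w ξ π ϑ m a (4 * r) K₀ k ω (S.state w ξ π ϑ t ω)
      have h4 := frob_fit_sub_le S w ξ π ϑ m a hr k ω
      refine le_of_sq_le_sq ?_ (by positivity)
      have h5 : 0 ≤ 10 * r := (frob_nonneg _).trans h4
      rw [mul_pow, Real.sq_sqrt h5]
      exact h3.trans (mul_le_mul_of_nonneg_right h4 (sq_nonneg _))
    refine (h2.add (memLp_mv (S.K ϑ) hx)).ae_eq (ae_of_all _ fun ω => ?_)
    simp [System.virtual, h1]
  · by_cases h2 : t < n
    · refine (h.memLp t (by omega)).ae_eq (ae_of_all _ fun ω => ?_)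
      simp [System.virtual, h1, h2]
    · refine (memLp_mv K₀ hx).ae_eq (ae_of_all _ fun ω => ?_)
      simp [System.virtual, h1, h2]

/-- The virtual deviations, weighted by the nominal Hessian, are bounded by the regret up to a
small relative error. -/
theorem sum_virtual_le (h : Controlled S μ w ξ π ϑ T M)
    (hL : LocalBounds S θ ε₀ q c Kt) {ε : ℝ} (hε : 0 < ε) (hε2 : ε ≤ 1 / 2) (hε₀ : ε ≤ ε₀)
    (hϑ : ϑ ∈ Metric.ball θ ε) {a : ℝ} (ha : 0 < a)
    (hN : ∀ v, 4 * a * ‖v‖ ^ 2 ≤ quad (noiseGram S.p) v) {m : ℕ} (hm1 : 1 ≤ m) (hmT : m * m ≤ T) :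
    ∑ k ∈ Finset.range (m - 1), ∑ t ∈ Finset.Icc ((k + 1) * m) ((k + 2) * m),
        ∫ ω, quad (S.hess θ (S.P θ)) (S.virtual w ξ π ϑ (T - tailLength q ε) m a
          (4 * (c * ε ^ 2)) (S.K θ) (k + 1) t ω - mv (S.K ϑ) (S.state w ξ π ϑ t ω)) ∂μ
      ≤ M + virtualConst q c a (S.noiseCost 1) dx * (1 + ε * M) := by
  have hϑ₀ := Metric.ball_subset_ball hε₀ hϑ
  have hr := hL.frob_gain_sub_le hε₀ hϑ
  have hc := hL.one_le
  have hq := hL.q_pos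
  have hq1 := hL.q_lt
  have hσ := h.noiseCost_one_nonneg
  have hM := h.nonneg
  have hθ₀ := Metric.mem_ball_self (x := θ) hL.eps_pos
  have hloss := h.sum_loss_le hL hε hε2 hε₀ hϑ ha hN hm1 hmT
  obtain ⟨-, hS, -⟩ := h.horizon_le hL hϑ₀ hε hε2
  have htail := (h.sq_mul_horizon_le hL hϑ₀ hε hε2).1
  have hH0 : (S.hess θ (S.P θ)).PosSemidef :=
    (System.hess_posDef h.R_posDef (hL.P_psd θ hθ₀)).posSemidef
  set n := T - tailLength q ε with hn
  set σ := S.noiseCost 1 with hσdef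
  set r := c * ε ^ 2 with hrdef
  set V : ℕ → ℕ → ℝ := fun k t => ∫ ω, quad (S.hess θ (S.P θ)) (S.virtual w ξ π ϑ n m a
    (4 * r) (S.K θ) k t ω - mv (S.K ϑ) (S.state w ξ π ϑ t ω)) ∂μ with hV
  -- The charge for one time: the deviation at `ϑ` before the tail, with the relative error of the
  -- Hessian; in the tail, the `O(ε²)` mismatch of the nominal gain times the stage cost.
  set g : ℕ → ℝ := fun t => if t < n then (1 + c * ε) * S.deviation μ w ξ π ϑ (S.P ϑ) t
    else c ^ 2 * r * S.stageCost μ w ξ π ϑ t with hg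
  have hg0 : ∀ t, 0 ≤ g t := fun t => by
    have h1 := h.deviation_nonneg hL hϑ₀ t
    have h2 := h.stageCost_nonneg t
    simp only [hg]
    split_ifs <;> positivity
  have hVg : ∀ k t, t < T → t ≠ (k + 1) * m → V k t ≤ g t := fun k t htT hte => by
    have hx := h.memLp_state htT.le
    have hu := h.memLp t htT
    by_cases htn : t < n
    · simp only [hV, hg, if_pos htn, System.virtual, if_neg hte]
      rw [System.deviation, ← integral_const_mul]
      refine integral_mono (integrable_quad _ (hu.sub (memLp_mv _ hx)))
        ((integrable_quad _ (hu.sub (memLp_mv _ hx))).const_mul _) fun ω => ?_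
      refine (hL.hess_nominal_le ϑ hϑ₀ _).trans ?_
      have h1 := (System.hess_posDef (θ := ϑ) h.R_posDef (hL.P_psd ϑ hϑ₀)).posSemidef.quad_nonneg
        (S.input w ξ π ϑ t ω - mv (S.K ϑ) (S.state w ξ π ϑ t ω))
      refine mul_le_mul_of_nonneg_right ?_ h1
      have := (Metric.mem_ball.1 hϑ).le
      gcongr
    · simp only [hV, hg, if_neg htn, System.virtual, if_neg hte]
      calc _ ≤ ∫ ω, c * r * ‖S.state w ξ π ϑ t ω‖ ^ 2 ∂μ := by
            refine integral_mono (integrable_quad _ ((memLp_mv _ hx).sub (memLp_mv _ hx)))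
              ((integrable_norm_sq hx).const_mul _) fun ω => ?_
            refine (hL.hess_le θ hθ₀ _).trans ?_
            rw [← sub_mv, mul_assoc]
            gcongr
            exact (norm_mv_sq_le_frob _ _).trans (by gcongr)
        _ = c * r * ∫ ω, ‖S.state w ξ π ϑ t ω‖ ^ 2 ∂μ := integral_const_mul _ _
        _ ≤ c * r * (c * S.stageCost μ w ξ π ϑ t) := by
            gcongr
            exact h.integral_norm_state_sq_le hL htT
        _ = _ := by ring
  -- At the endpoint the loss is the squared error of the estimated gain times the energy of the
  -- state, the quantity bounded by `sum_loss_le`.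
  have hVe : ∀ k, (k + 1) * m ≤ T → V k ((k + 1) * m)
      ≤ c ^ 2 * ∫ ω, frob (S.fit w ξ π ϑ m a (4 * r) (S.K θ) k ω - S.K ϑ)
          * quad (S.P ϑ) (S.state w ξ π ϑ ((k + 1) * m) ω) ∂μ := fun k hk => by
    rw [← integral_const_mul]
    have hx := h.memLp_state hk
    have hint : Integrable (fun ω => frob (S.fit w ξ π ϑ m a (4 * r) (S.K θ) k ω - S.K ϑ)
          * quad (S.P ϑ) (S.state w ξ π ϑ ((k + 1) * m) ω)) μ := by
      refine (integrable_quad (S.P ϑ) hx).bdd_mul (c := 10 * r) (measurable_frob fun i j =>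
        (System.measurable_fit h.noise m a _ _ k i j).sub measurable_const).aestronglyMeasurable
        (ae_of_all _ fun ω => ?_)
      rw [Real.norm_eq_abs, abs_of_nonneg (frob_nonneg _)]
      exact frob_fit_sub_le S w ξ π ϑ m a hr k ω
    refine integral_mono_of_nonneg (ae_of_all _ fun ω => hH0.quad_nonneg _)
      (hint.const_mul _) (ae_of_all _ fun ω => ?_)
    simp only [System.virtual, if_true]
    refine (hL.hess_le θ hθ₀ _).trans ?_
    have h1 := norm_mv_fit_sub_le S w ξ π ϑ m a (4 * r) (S.K θ) k ω
      (S.state w ξ π ϑ ((k + 1) * m) ω)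
    have h2 := h.norm_sq_le_quad_P hL hϑ₀ (S.state w ξ π ϑ ((k + 1) * m) ω)
    calc _ ≤ c * (frob (S.fit w ξ π ϑ m a (4 * r) (S.K θ) k ω - S.K ϑ)
          * (c * quad (S.P ϑ) (S.state w ξ π ϑ ((k + 1) * m) ω))) := by
          gcongr
          exact h1.trans (mul_le_mul_of_nonneg_left h2 (frob_nonneg _))
      _ = _ := by ring
  have hkT : ∀ k ∈ Finset.range (m - 1), (k + 2) * m ≤ T := fun k hk => by
    have := Finset.mem_range.1 hk
    exact (Nat.mul_le_mul_right m (by omega)).trans hmT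
  -- Removing the right endpoint makes the windows disjoint.
  have hsplit : ∀ k ∈ Finset.range (m - 1),
      ∑ t ∈ Finset.Icc ((k + 1) * m) ((k + 2) * m), V (k + 1) t
      ≤ ∑ t ∈ Finset.Ico ((k + 1) * m) ((k + 2) * m), g t
        + c ^ 2 * ∫ ω, frob (S.fit w ξ π ϑ m a (4 * r) (S.K θ) (k + 1) ω - S.K ϑ)
          * quad (S.P ϑ) (S.state w ξ π ϑ ((k + 1 + 1) * m) ω) ∂μ := fun k hk => by
    rw [← Finset.Ico_insert_right (Nat.mul_le_mul_right m (by omega)),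
      Finset.sum_insert Finset.right_notMem_Ico, add_comm]
    refine add_le_add (Finset.sum_le_sum fun t ht => ?_) (hVe (k + 1) (hkT k hk))
    have h1 := (Finset.mem_Ico.1 ht).2
    exact hVg (k + 1) t (h1.trans_le (hkT k hk)) h1.ne
  refine (Finset.sum_le_sum hsplit).trans ?_
  rw [Finset.sum_add_distrib, ← Finset.mul_sum]
  have hsg : ∑ t ∈ Finset.range T, g t
      ≤ (1 + c * ε) * ∑ t ∈ Finset.range n, S.deviation μ w ξ π ϑ (S.P ϑ) t
        + c ^ 2 * r * ∑ t ∈ Finset.Ico n T, S.stageCost μ w ξ π ϑ t := by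
    rw [← Finset.sum_range_add_sum_Ico _ (Nat.sub_le T (tailLength q ε)), Finset.mul_sum,
      Finset.mul_sum]
    refine add_le_add (Finset.sum_le_sum fun t ht => ?_) (Finset.sum_le_sum fun t ht => ?_)
    · simp only [hg]
      rw [if_pos (Finset.mem_range.1 ht)]
    · simp only [hg]
      rw [if_neg (not_lt.2 (Finset.mem_Ico.1 ht).1)]
  have t1 := (sum_Ico_shift_le (fun t _ => hg0 t) hmT).trans hsg
  have t2 := mul_le_mul_of_nonneg_left hloss (by positivity : 0 ≤ c ^ 2)
  refine (add_le_add t1 t2).trans ?_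
  clear t1 t2 hsplit hVe hVg hsg
  set X := ∑ t ∈ Finset.range n, S.deviation μ w ξ π ϑ (S.P ϑ) t
  set Y := ∑ t ∈ Finset.Ico n T, S.stageCost μ w ξ π ϑ t
  have hεM : 0 ≤ ε * M := by positivity
  have hb : c * σ / q ≤ c * σ / q ^ 2 := by
    apply div_le_div_of_nonneg_left (by positivity) (by positivity)
    nlinarith
  have hb0 : 0 ≤ c * σ / q := by positivity
  -- The leading term `M` has coefficient exactly one; the remaining contributions are `O(ε M)` or
  -- bounded.
  have s1 : (1 + c * ε) * X ≤ M + 5 * c * (ε * M) + 4 * c * (c * σ / q ^ 2) := by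
    have h1 : (1 + c * ε) * X ≤ (1 + c * ε) * (M + 2 * ε * (M + c * σ / q)) := by gcongr
    have h2 : c * ε ≤ c / 2 := by nlinarith
    have h3 : (1 + c * ε) * (2 * ε * (M + c * σ / q)) ≤ 2 * c * (2 * ε * (M + c * σ / q)) := by
      refine mul_le_mul_of_nonneg_right (by linarith) (by positivity)
    have h4 : c * (ε * (c * σ / q)) ≤ c * (1 * (c * σ / q ^ 2)) := by gcongr; linarith
    calc _ ≤ _ := h1
      _ = M + c * (ε * M) + (1 + c * ε) * (2 * ε * (M + c * σ / q)) := by ring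
      _ ≤ M + c * (ε * M) + 2 * c * (2 * ε * (M + c * σ / q)) := by linarith
      _ = M + 5 * c * (ε * M) + 4 * (c * (ε * (c * σ / q))) := by ring
      _ ≤ M + 5 * c * (ε * M) + 4 * (c * (1 * (c * σ / q ^ 2))) := by linarith
      _ = _ := by ring
  have s2 : c ^ 2 * r * Y ≤ 3 * c ^ 3 * (ε * M) + 5 * c ^ 4 * σ / q ^ 2 := by
    calc c ^ 2 * r * Y = c ^ 3 * (ε ^ 2 * Y) := by rw [hrdef]; ring
      _ ≤ c ^ 3 * (3 * (ε * M) + 5 * (c * σ / q ^ 2)) := by gcongr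
      _ = _ := by ring
  have hc3 : c ≤ c ^ 3 := le_self_pow₀ hc (by norm_num)
  have hc4 : c ^ 2 ≤ c ^ 4 := pow_le_pow_right₀ hc (by norm_num)
  have s3 : 4 * c * (c * σ / q ^ 2) ≤ 4 * c ^ 4 * σ / q ^ 2 := by
    calc 4 * c * (c * σ / q ^ 2) = 4 * c ^ 2 * σ / q ^ 2 := by ring
      _ ≤ _ := by gcongr
  have s4 : 5 * c * (ε * M) ≤ 5 * c ^ 3 * (ε * M) := by gcongr
  have s5 : 0 ≤ 9 * c ^ 4 * σ / q ^ 2 * (ε * M) := by positivity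
  have s6 : 0 ≤ 8 * c ^ 3 := by positivity
  have s7 : 4 * c ^ 4 * σ / q ^ 2 + 5 * c ^ 4 * σ / q ^ 2 = 9 * c ^ 4 * σ / q ^ 2 := by ring
  calc _ ≤ M + 8 * c ^ 3 * (ε * M) + 9 * c ^ 4 * σ / q ^ 2
        + c ^ 2 * (lossConst q c a σ dx * (1 + ε * M)) := by linarith
    _ ≤ M + 8 * c ^ 3 * (ε * M) + 9 * c ^ 4 * σ / q ^ 2
        + c ^ 2 * (lossConst q c a σ dx * (1 + ε * M))
        + (8 * c ^ 3 + 9 * c ^ 4 * σ / q ^ 2 * (ε * M)) := by linarith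
    _ = _ := by rw [virtualConst]; ring

end Controlled

end VirtualInputs

/-! ### The van Trees inequality -/

section VanTrees

/-- The `j`-th partial derivative. -/
abbrev pderiv {d : ℕ} (j : Fin d) (f : Euc d → ℝ) (x : Euc d) : ℝ :=
  fderiv ℝ f x (EuclideanSpace.single j 1)

/-- The `j`-th partial derivative of the logarithm. -/
abbrev dlog {d : ℕ} (j : Fin d) (f : Euc d → ℝ) (x : Euc d) : ℝ :=
  pderiv j (fun z => Real.log (f z)) x

theorem gradient_coord {d : ℕ} (f : Euc d → ℝ) (x : Euc d) (j : Fin d) :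
    gradient f x j = pderiv j f x := by
  have h1 : inner ℝ (gradient f x) (EuclideanSpace.single j 1) = pderiv j f x := by
    rw [gradient, InnerProductSpace.toDual_symm_apply]
  rw [← h1, EuclideanSpace.inner_single_right]
  simp

/-- Also true where `f` vanishes, because of the default values: either `log ∘ f` is not
differentiable there, or it is identically zero nearby, and the quotient by zero is zero. -/
theorem fderiv_log_eq {E : Type*} [NormedAddCommGroup E] [NormedSpace ℝ E] {f : E → ℝ} {x : E}
    (hf : DifferentiableAt ℝ f x) (v : E) :
    fderiv ℝ (fun z => Real.log (f z)) x v = fderiv ℝ f x v / f x := by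
  by_cases h0 : f x = 0
  · rw [h0, div_zero]
    by_cases hd : DifferentiableAt ℝ (fun z => Real.log (f z)) x
    · have h1 : Tendsto (fun z => Real.log (f z)) (𝓝 x) (𝓝 0) := by
        simpa [h0] using hd.continuousAt.tendsto
      have h2 : Tendsto f (𝓝 x) (𝓝 0) := by simpa [h0] using hf.continuousAt.tendsto
      have h3 : (fun z => Real.log (f z)) =ᶠ[𝓝 x] fun _ => 0 := by
        have h4 : ∀ᶠ z in 𝓝 x, |f z| < 1 / 2 := by
          have := h2.abs.eventually (gt_mem_nhds (by simp : |(0 : ℝ)| < 1 / 2))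
          simpa using this
        have h5 : ∀ᶠ z in 𝓝 x, -(1 / 2) < Real.log (f z) :=
          h1.eventually (lt_mem_nhds (by norm_num))
        filter_upwards [h4, h5] with z hz4 hz5
        by_contra hne
        have hfz : f z ≠ 0 := fun h => hne (by simp [h])
        have h6 : Real.log |f z| ≤ |f z| - 1 := Real.log_le_sub_one_of_pos (abs_pos.2 hfz)
        rw [Real.log_abs] at h6
        linarith
      rw [h3.fderiv_eq]
      simp
    · rw [fderiv_zero_of_not_differentiableAt hd]
      simp
  · rw [fderiv.log hf h0]
    simp [div_eq_inv_mul]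

/-- At a zero of a nonnegative function the derivative vanishes, the point being a minimum. -/
theorem fderiv_log_mul {E : Type*} [NormedAddCommGroup E] [NormedSpace ℝ E] {f : E → ℝ} {x : E}
    (hf : DifferentiableAt ℝ f x) (h0 : ∀ z, 0 ≤ f z) (v : E) :
    fderiv ℝ (fun z => Real.log (f z)) x v * f x = fderiv ℝ f x v := by
  rw [fderiv_log_eq hf]
  by_cases hx : f x = 0
  · have : IsLocalMin f x := Eventually.of_forall fun z => by rw [hx]; exact h0 z
    rw [this.fderiv_eq_zero]
    simp
  · rw [div_mul_cancel₀ _ hx]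

/-- The derivative of a nonnegative function is controlled by its square root. -/
theorem sq_pderiv_le {d : ℕ} {f : Euc d → ℝ} (hf : ContDiff ℝ 2 f) (hc : HasCompactSupport f)
    (h0 : ∀ z, 0 ≤ f z) (j : Fin d) : ∃ M : ℝ, 0 ≤ M ∧ ∀ x, pderiv j f x ^ 2 ≤ M * f x := by
  set v : Euc d := EuclideanSpace.single j 1 with hv
  have hv1 : ‖v‖ = 1 := by simp [hv]
  have hD : ContDiff ℝ 1 fun x => fderiv ℝ f x v := by
    have := hf.fderiv_right (m := 1) (by norm_num)
    exact this.clm_apply contDiff_const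
  obtain ⟨L, hL0, hL⟩ := exists_lipschitz hD (hc.fderiv_apply (𝕜 := ℝ) v)
  set K := L + 1 with hK
  have hKpos : 0 < K := by positivity
  refine ⟨4 * K, by positivity, fun x => ?_⟩
  set D := fderiv ℝ f x v with hDdef
  -- Nonnegativity of `f` is tested at a step against the gradient, where the linear term beats the
  -- quadratic remainder.
  set t := -D / (2 * K) with ht
  have hdf : ∀ z, DifferentiableAt ℝ f z := fun z => (hf.differentiable (by norm_num)) z
  have hline : ∀ s : ℝ, HasDerivAt (fun s : ℝ => f (x + s • v) - D * s)
      (fderiv ℝ f (x + s • v) v - D) s := fun s => by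
    have h1 : HasDerivAt (fun s : ℝ => x + s • v) v s := by
      simpa using ((hasDerivAt_id s).smul_const v).const_add x
    have h2 := (hdf (x + s • v)).hasFDerivAt.comp_hasDerivAt s h1
    have h3 : HasDerivAt (fun s : ℝ => D * s) D s := by
      simpa using (hasDerivAt_id s).const_mul D
    exact h2.sub h3
  have hb : ∀ s ∈ Metric.closedBall (0 : ℝ) |t|,
      ‖deriv (fun s : ℝ => f (x + s • v) - D * s) s‖ ≤ K * |t| := fun s hs => by
    rw [(hline s).deriv, Real.norm_eq_abs]
    have h3 := hL (x + s • v) x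
    rw [dist_self_add_left, norm_smul, hv1, mul_one, Real.norm_eq_abs] at h3
    have h4 : |s| ≤ |t| := by simpa using hs
    calc _ ≤ L * |s| := h3
      _ ≤ K * |t| := by gcongr; linarith
  have hmv := (convex_closedBall (0 : ℝ) |t|).norm_image_sub_le_of_norm_deriv_le
    (fun s _ => (hline s).differentiableAt) hb (x := 0) (y := t) (by simp) (by simp)
  simp only [zero_smul, add_zero, mul_zero, sub_zero, Real.norm_eq_abs] at hmv
  have h5 := (abs_le.1 hmv).2
  have h6 := h0 (x + t • v)
  have h7 : K * |t| * |t| = D ^ 2 / (4 * K) := by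
    rw [mul_assoc, abs_mul_abs_self, ht]
    field_simp
    ring
  have h8 : D * t = -(D ^ 2 / (2 * K)) := by rw [ht]; ring
  have h9 : D ^ 2 / (2 * K) = 2 * (D ^ 2 / (4 * K)) := by field_simp; ring
  have h10 : D ^ 2 / (4 * K) ≤ f x := by linarith
  rw [div_le_iff₀ (by positivity)] at h10
  linarith

variable {d : ℕ} {Y : Type*} [MeasurableSpace Y]

/-- `f` is a statistical model: `f θ` is a density with respect to `ν`, and it is continuously
differentiable in `θ`. -/
structure IsLikelihood (ν : Measure Y) (f : Euc d → Y → ℝ) : Prop where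
  nonneg : ∀ θ y, 0 ≤ f θ y
  measurable : Measurable fun z : Euc d × Y => f z.1 z.2
  contDiff : ∀ y, ContDiff ℝ 1 fun θ => f θ y
  mass : ∀ θ, ∫⁻ y, ENNReal.ofReal (f θ y) ∂ν = 1

/-- The joint law of the parameter and the observation. -/
def jointLaw (ν : Measure Y) (lam : Euc d → ℝ) (f : Euc d → Y → ℝ) : Measure (Euc d × Y) :=
  ((volume : Measure (Euc d)).prod ν).withDensity fun z => ENNReal.ofReal (lam z.1 * f z.1 z.2)

namespace IsLikelihood

variable {ν : Measure Y} [SFinite ν] {f : Euc d → Y → ℝ} {U : Set (Euc d)} {lam : Euc d → ℝ}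

theorem integrable_apply (hf : IsLikelihood ν f) (θ : Euc d) :
    Integrable (f θ) ν ∧ ∫ y, f θ y ∂ν = 1 := by
  have hm : Measurable (f θ) := hf.measurable.comp measurable_prodMk_left
  have h1 : ∫⁻ y, ENNReal.ofReal (f θ y) ∂ν ≠ ⊤ := by rw [hf.mass]; simp
  refine ⟨(lintegral_ofReal_ne_top_iff_integrable hm.aestronglyMeasurable
    (ae_of_all _ (hf.nonneg θ))).1 h1, ?_⟩
  rw [integral_eq_lintegral_of_nonneg_ae (ae_of_all _ (hf.nonneg θ)) hm.aestronglyMeasurable,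
    hf.mass]
  simp

theorem integrable_mul (hf : IsLikelihood ν f) {h : Euc d → ℝ} (hm : Measurable h)
    (hh : Integrable h) :
    Integrable (fun z : Euc d × Y => h z.1 * f z.1 z.2) ((volume : Measure (Euc d)).prod ν) := by
  have hmeas : Measurable fun z : Euc d × Y => h z.1 * f z.1 z.2 :=
    (hm.comp measurable_fst).mul hf.measurable
  rw [integrable_prod_iff hmeas.aestronglyMeasurable]
  refine ⟨ae_of_all _ fun θ => (hf.integrable_apply θ).1.const_mul (h θ), ?_⟩
  refine hh.norm.congr (ae_of_all _ fun θ => ?_)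
  simp only [norm_mul, Real.norm_eq_abs, abs_of_nonneg (hf.nonneg _ _)]
  rw [integral_const_mul, (hf.integrable_apply θ).2, mul_one]

theorem integral_mul (hf : IsLikelihood ν f) {h : Euc d → ℝ} (hm : Measurable h)
    (hh : Integrable h) :
    ∫ z : Euc d × Y, h z.1 * f z.1 z.2 ∂((volume : Measure (Euc d)).prod ν) = ∫ θ, h θ := by
  rw [integral_prod _ (hf.integrable_mul hm hh)]
  refine integral_congr_ae (ae_of_all _ fun θ => ?_)
  simp only
  rw [integral_const_mul, (hf.integrable_apply θ).2, mul_one]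

theorem density_measurable (hf : IsLikelihood ν f) (hlam : IsPrior U lam) :
    Measurable fun z : Euc d × Y => lam z.1 * f z.1 z.2 :=
  (hlam.smooth.continuous.measurable.comp measurable_fst).mul hf.measurable

theorem integrable_jointLaw_iff (hf : IsLikelihood ν f) (hlam : IsPrior U lam)
    {G : Euc d × Y → ℝ} : Integrable G (jointLaw ν lam f)
      ↔ Integrable (fun z => G z * (lam z.1 * f z.1 z.2)) ((volume : Measure (Euc d)).prod ν) := by
  rw [jointLaw, integrable_withDensity_iff (hf.density_measurable hlam).ennreal_ofReal
    (ae_of_all _ fun z => ENNReal.ofReal_lt_top)]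
  simp only [ENNReal.toReal_ofReal (mul_nonneg (hlam.nonneg _) (hf.nonneg _ _))]

theorem integral_jointLaw (hf : IsLikelihood ν f) (hlam : IsPrior U lam) (G : Euc d × Y → ℝ) :
    ∫ z, G z ∂(jointLaw ν lam f)
      = ∫ z, G z * (lam z.1 * f z.1 z.2) ∂((volume : Measure (Euc d)).prod ν) := by
  rw [jointLaw, integral_withDensity_eq_integral_toReal_smul
    (hf.density_measurable hlam).ennreal_ofReal (ae_of_all _ fun z => ENNReal.ofReal_lt_top)]
  simp only [ENNReal.toReal_ofReal (mul_nonneg (hlam.nonneg _) (hf.nonneg _ _)), smul_eq_mul]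
  exact integral_congr_ae (ae_of_all _ fun z => mul_comm _ _)

theorem integrable_jointLaw_bdd (hf : IsLikelihood ν f) (hlam : IsPrior U lam)
    {φ : Y → ℝ} (hφ : Measurable φ) (hφ1 : ∀ y, |φ y| ≤ 1) {h : Euc d → ℝ} (hh : Continuous h) :
    Integrable (fun z => φ z.2 * h z.1) (jointLaw ν lam f) := by
  rw [hf.integrable_jointLaw_iff hlam]
  have hc : Continuous fun θ => h θ * lam θ := hh.mul hlam.smooth.continuous
  have h1 := hf.integrable_mul hc.measurable
    (hc.integrable_of_hasCompactSupport hlam.compact.mul_left)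
  have h2 := h1.bdd_mul (c := 1) (f := fun z : Euc d × Y => φ z.2)
    (hφ.comp measurable_snd).aestronglyMeasurable (ae_of_all _ fun z => hφ1 z.2)
  refine h2.congr (ae_of_all _ fun z => ?_)
  simp only
  ring

/-- The Bayesian score: the score of the likelihood plus the score of the prior. -/
def score (f : Euc d → Y → ℝ) (lam : Euc d → ℝ) (j : Fin d) (z : Euc d × Y) : ℝ :=
  dlog j (fun θ => f θ z.2) z.1 + dlog j lam z.1

theorem score_mul (hf : IsLikelihood ν f) (hlam : IsPrior U lam) (j : Fin d) (z : Euc d × Y) :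
    score f lam j z * (lam z.1 * f z.1 z.2) = pderiv j (fun θ => f θ z.2 * lam θ) z.1 := by
  have h1 : DifferentiableAt ℝ (fun θ => f θ z.2) z.1 :=
    (hf.contDiff z.2).differentiable (by norm_num) _
  have h2 : DifferentiableAt ℝ lam z.1 := hlam.smooth.differentiable (by norm_num) _
  have e1 := fderiv_log_mul h1 (fun θ => hf.nonneg θ z.2) (EuclideanSpace.single j 1)
  have e2 := fderiv_log_mul h2 hlam.nonneg (EuclideanSpace.single j 1)
  rw [pderiv, fderiv_fun_mul h1 h2]
  simp only [_root_.add_apply, _root_.smul_apply, smul_eq_mul]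
  rw [← e1, ← e2, score]
  ring

/-- Integration by parts in the parameter. -/
theorem integral_error_mul_score (hf : IsLikelihood ν f) (hlam : IsPrior U lam) {φ Z : Y → ℝ}
    (hφ : Measurable φ) (hφ1 : ∀ y, |φ y| ≤ 1) {g : Euc d → ℝ} (hg : ContDiff ℝ 1 g) (j : Fin d)
    (hD : MemLp (fun z : Euc d × Y => φ z.2 * (Z z.2 - g z.1)) 2 (jointLaw ν lam f))
    (hs : MemLp (score f lam j) 2 (jointLaw ν lam f)) :
    ∫ z, φ z.2 * (Z z.2 - g z.1) * score f lam j z ∂(jointLaw ν lam f)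
      = ∫ z, φ z.2 * pderiv j g z.1 ∂(jointLaw ν lam f) := by
  have hg' : Continuous fun θ => pderiv j g θ := hg.continuous_fderiv_apply (by norm_num)
    |>.comp (continuous_id.prodMk continuous_const)
  have hi0 : Integrable (fun z => φ z.2 * (Z z.2 - g z.1) * score f lam j z) (jointLaw ν lam f) :=
    hD.integrable_mul hs
  have hi1 := (hf.integrable_jointLaw_iff hlam).1 hi0
  have hi2 := (hf.integrable_jointLaw_iff hlam).1 (hf.integrable_jointLaw_bdd hlam hφ hφ1 hg')
  rw [hf.integral_jointLaw hlam, hf.integral_jointLaw hlam]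
  rw [integral_prod_symm _ hi1, integral_prod_symm _ hi2]
  refine integral_congr_ae (ae_of_all _ fun y => ?_)
  simp only
  have hv : ContDiff ℝ 1 fun θ => f θ y * lam θ := (hf.contDiff y).mul (hlam.smooth.of_le (by simp))
  have hvc : HasCompactSupport fun θ => f θ y * lam θ := hlam.compact.mul_left
  have hu : ContDiff ℝ 1 fun θ => Z y - g θ := contDiff_const.sub hg
  have hv' : Continuous fun θ => pderiv j (fun θ => f θ y * lam θ) θ :=
    hv.continuous_fderiv_apply (by norm_num) |>.comp (continuous_id.prodMk continuous_const)
  have hu' : ∀ θ, pderiv j (fun θ => Z y - g θ) θ = -pderiv j g θ := fun θ => by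
    rw [pderiv, fderiv_const_sub]; simp
  -- For each fixed observation, the compact support of the prior removes the boundary terms.
  have ibp := integral_mul_fderiv_eq_neg_fderiv_mul_of_integrable (μ := (volume : Measure (Euc d)))
    (f := fun θ => Z y - g θ) (g := fun θ => f θ y * lam θ) (v := EuclideanSpace.single j 1)
    (by
      change Integrable fun θ => pderiv j (fun θ => Z y - g θ) θ * _
      simp only [hu']
      exact (hg'.neg.mul hv.continuous).integrable_of_hasCompactSupport hvc.mul_left)
    ((hu.continuous.mul hv').integrable_of_hasCompactSupport
      (hvc.fderiv_apply (𝕜 := ℝ) _).mul_left)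
    ((hu.continuous.mul hv.continuous).integrable_of_hasCompactSupport hvc.mul_left)
    (fun x _ => hu.differentiable (by norm_num) x) fun x _ => hv.differentiable (by norm_num) x
  have e1 : ∀ θ, φ y * (Z y - g θ) * score f lam j (θ, y) * (lam θ * f θ y)
      = φ y * ((Z y - g θ) * pderiv j (fun θ => f θ y * lam θ) θ) := fun θ => by
    rw [mul_assoc (φ y * _), hf.score_mul hlam j (θ, y), mul_assoc]
  have e2 : ∀ θ, φ y * pderiv j g θ * (lam θ * f θ y)
      = φ y * (pderiv j g θ * (f θ y * lam θ)) := fun θ => by ring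
  simp only [e1, e2, integral_const_mul]
  congr 1
  rw [ibp, ← integral_neg]
  refine integral_congr_ae (ae_of_all _ fun θ => ?_)
  change -(pderiv j (fun θ => Z y - g θ) θ * _) = _
  rw [hu']
  ring

theorem continuous_pderiv_prior (hlam : IsPrior U lam) (j : Fin d) : Continuous (pderiv j lam) :=
  hlam.smooth.continuous_fderiv_apply (by norm_num)
    |>.comp (continuous_id.prodMk continuous_const)

theorem measurable_dlog_prior (hlam : IsPrior U lam) (j : Fin d) : Measurable (dlog j lam) := by
  have : dlog j lam = fun x => pderiv j lam x / lam x := funext fun x =>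
    fderiv_log_eq (hlam.smooth.differentiable (by norm_num) x) _
  rw [this]
  exact (continuous_pderiv_prior hlam j).measurable.div hlam.smooth.continuous.measurable

/-- Since `|∇λ|² ≤ M λ`, the integrand is bounded on the compact support; the prior therefore has
finite information. -/
theorem integrable_sq_dlog_prior (hlam : IsPrior U lam) (j : Fin d) :
    Integrable fun θ => dlog j lam θ ^ 2 * lam θ := by
  obtain ⟨M, hM0, hM⟩ := sq_pderiv_le (contDiff_infty.1 hlam.smooth 2) hlam.compact hlam.nonneg j
  have hi : Integrable ((tsupport lam).indicator fun _ => M) :=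
    (integrable_indicator_iff (isClosed_tsupport lam).measurableSet).2
      (integrableOn_const hlam.compact.isCompact.measure_lt_top.ne)
  refine hi.mono' (((measurable_dlog_prior hlam j).pow_const 2).mul
    hlam.smooth.continuous.measurable).aestronglyMeasurable (ae_of_all _ fun θ => ?_)
  rw [Real.norm_eq_abs, abs_of_nonneg (mul_nonneg (sq_nonneg _) (hlam.nonneg _))]
  by_cases hz : lam θ = 0
  · rw [hz, mul_zero]
    exact Set.indicator_nonneg (fun _ _ => hM0) _
  · rw [Set.indicator_of_mem (subset_tsupport _ hz)]
    have h1 := fderiv_log_mul (hlam.smooth.differentiable (by norm_num) θ) hlam.nonneg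
      (EuclideanSpace.single j 1)
    have hpos : 0 < lam θ := lt_of_le_of_ne (hlam.nonneg θ) (Ne.symm hz)
    have h2 := hM θ
    rw [pderiv, ← h1] at h2
    have h3 : (dlog j lam θ ^ 2 * lam θ) * lam θ ≤ M * lam θ := by
      calc _ = (dlog j lam θ * lam θ) ^ 2 := by ring
        _ ≤ _ := h2
    exact le_of_mul_le_mul_right h3 hpos

theorem memLp_dlog_prior (hf : IsLikelihood ν f) (hlam : IsPrior U lam) (j : Fin d) :
    MemLp (fun z : Euc d × Y => dlog j lam z.1) 2 (jointLaw ν lam f) := by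
  have hm := measurable_dlog_prior hlam j
  have hm' : Measurable fun z : Euc d × Y => dlog j lam z.1 := hm.comp measurable_fst
  rw [memLp_two_iff_integrable_sq hm'.aestronglyMeasurable, hf.integrable_jointLaw_iff hlam]
  have := hf.integrable_mul ((hm.pow_const 2).mul hlam.smooth.continuous.measurable)
    (integrable_sq_dlog_prior hlam j)
  exact this.congr (ae_of_all _ fun z => by simp only [Pi.mul_apply]; ring)

theorem integral_dlog_prior_mul (hf : IsLikelihood ν f) (hlam : IsPrior U lam) (i j : Fin d) :
    ∫ z, dlog i lam z.1 * dlog j lam z.1 ∂(jointLaw ν lam f) = locationInfo lam i j := by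
  have hm := fun i => measurable_dlog_prior hlam i
  have hmm : Measurable fun θ => dlog i lam θ * dlog j lam θ * lam θ :=
    ((hm i).mul (hm j)).mul hlam.smooth.continuous.measurable
  have hint2 : Integrable fun θ => dlog i lam θ * dlog j lam θ * lam θ := by
    refine ((integrable_sq_dlog_prior hlam i).add (integrable_sq_dlog_prior hlam j)).mono'
      hmm.aestronglyMeasurable
      (ae_of_all _ fun θ => ?_)
    rw [Real.norm_eq_abs, abs_mul, abs_of_nonneg (hlam.nonneg θ), Pi.add_apply, ← add_mul]
    refine mul_le_mul_of_nonneg_right ?_ (hlam.nonneg θ)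
    rw [abs_mul]
    nlinarith [sq_nonneg (|dlog i lam θ| - |dlog j lam θ|), sq_abs (dlog i lam θ),
      sq_abs (dlog j lam θ)]
  rw [hf.integral_jointLaw hlam]
  have e : ∀ z : Euc d × Y, dlog i lam z.1 * dlog j lam z.1 * (lam z.1 * f z.1 z.2)
      = dlog i lam z.1 * dlog j lam z.1 * lam z.1 * f z.1 z.2 := fun z => by ring
  simp only [e]
  rw [hf.integral_mul (h := fun θ => dlog i lam θ * dlog j lam θ * lam θ) hmm hint2,
    locationInfo, Matrix.of_apply]
  simp only [gradient_coord]

/-- The score of the likelihood is uncorrelated with the score of the prior. -/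
theorem integral_score_mul_dlog_prior (hf : IsLikelihood ν f) (hlam : IsPrior U lam) (i j : Fin d)
    (hs : MemLp (fun z : Euc d × Y => dlog i (fun θ => f θ z.2) z.1) 2 (jointLaw ν lam f)) :
    ∫ z, dlog i (fun θ => f θ z.2) z.1 * dlog j lam z.1 ∂(jointLaw ν lam f) = 0 := by
  have hi0 : Integrable (fun z : Euc d × Y =>
      dlog i (fun θ => f θ z.2) z.1 * dlog j lam z.1) (jointLaw ν lam f) :=
    hs.integrable_mul (hf.memLp_dlog_prior hlam j)
  have hi1 := (hf.integrable_jointLaw_iff hlam).1 hi0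
  have hw : ContDiff ℝ 1 (pderiv j lam) :=
    ((contDiff_infty.1 hlam.smooth 2).fderiv_right (n := 2) (m := 1) (by norm_num)).clm_apply
      contDiff_const
  have hwc : HasCompactSupport (pderiv j lam) := hlam.compact.fderiv_apply (𝕜 := ℝ) _
  have hw' : Continuous fun θ => pderiv i (pderiv j lam) θ :=
    hw.continuous_fderiv_apply (by norm_num) |>.comp (continuous_id.prodMk continuous_const)
  have hw'c : HasCompactSupport fun θ => pderiv i (pderiv j lam) θ := hwc.fderiv_apply (𝕜 := ℝ) _
  have hw'i := hw'.integrable_of_hasCompactSupport (μ := volume) hw'c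
  have hi2 := hf.integrable_mul hw'.measurable hw'i
  rw [hf.integral_jointLaw hlam, integral_prod_symm _ hi1]
  -- The integrand is `∂_i f · ∂_j λ`. The derivative is moved to the prior, the observation is
  -- integrated out, and the integral of `∂_i ∂_j λ` is zero.
  have key : ∀ y, ∫ θ, dlog i (fun θ => f θ y) θ * dlog j lam θ * (lam θ * f θ y)
      = -∫ θ, pderiv i (pderiv j lam) θ * f θ y := fun y => by
    have hfy := hf.contDiff y
    have hfd : Continuous fun θ => pderiv i (fun θ => f θ y) θ :=
      hfy.continuous_fderiv_apply (by norm_num) |>.comp (continuous_id.prodMk continuous_const)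
    have ibp := integral_mul_fderiv_eq_neg_fderiv_mul_of_integrable
      (μ := (volume : Measure (Euc d)))
      (f := pderiv j lam) (g := fun θ => f θ y) (v := EuclideanSpace.single i 1)
      ((hw'.mul hfy.continuous).integrable_of_hasCompactSupport hw'c.mul_right)
      ((hw.continuous.mul hfd).integrable_of_hasCompactSupport hwc.mul_right)
      ((hw.continuous.mul hfy.continuous).integrable_of_hasCompactSupport hwc.mul_right)
      (fun x _ => hw.differentiable (by norm_num) x) fun x _ => hfy.differentiable (by norm_num) x
    refine Eq.trans (integral_congr_ae (ae_of_all _ fun θ => ?_)) ibp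
    have e1 := fderiv_log_mul (hfy.differentiable (by norm_num) θ) (fun θ => hf.nonneg θ y)
      (EuclideanSpace.single i 1)
    have e2 := fderiv_log_mul (hlam.smooth.differentiable (by norm_num) θ) hlam.nonneg
      (EuclideanSpace.single j 1)
    simp only
    rw [← e1]
    change _ = fderiv ℝ lam θ (EuclideanSpace.single j 1) * _
    rw [← e2]
    ring
  simp only [key]
  rw [integral_neg, ← integral_prod_symm _ hi2, hf.integral_mul hw'.measurable hw'i]
  have ibp := integral_mul_fderiv_eq_neg_fderiv_mul_of_integrable
    (μ := (volume : Measure (Euc d)))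
    (f := fun _ => (1 : ℝ)) (g := pderiv j lam) (v := EuclideanSpace.single i 1)
    (by simp) (by simpa using hw'i)
    (by simpa using hw.continuous.integrable_of_hasCompactSupport (μ := volume) hwc)
    (fun x _ => differentiableAt_const _) fun x _ => hw.differentiable (by norm_num) x
  simp only [one_mul, fderiv_fun_const, Pi.zero_apply, _root_.zero_apply, zero_mul,
    integral_zero, neg_zero] at ibp
  rw [neg_eq_zero]
  exact ibp

/-- The two scores are uncorrelated, so the informations of the observation and of the prior add up.
-/
theorem integral_score_mul_score (hf : IsLikelihood ν f) (hlam : IsPrior U lam)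
    (hs : ∀ j, MemLp (fun z : Euc d × Y => dlog j (fun θ => f θ z.2) z.1) 2 (jointLaw ν lam f))
    (i j : Fin d) :
    ∫ z, score f lam i z * score f lam j z ∂(jointLaw ν lam f)
      = ∫ z, dlog i (fun θ => f θ z.2) z.1 * dlog j (fun θ => f θ z.2) z.1 ∂(jointLaw ν lam f)
        + locationInfo lam i j := by
  have hl := fun j => hf.memLp_dlog_prior hlam j
  have e : ∀ z : Euc d × Y, score f lam i z * score f lam j z
      = (dlog i (fun θ => f θ z.2) z.1 * dlog j (fun θ => f θ z.2) z.1
        + dlog i lam z.1 * dlog j lam z.1)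
        + (dlog i (fun θ => f θ z.2) z.1 * dlog j lam z.1
        + dlog j (fun θ => f θ z.2) z.1 * dlog i lam z.1) := fun z => by
    simp only [score]; ring
  have i1 : Integrable (fun z : Euc d × Y =>
      dlog i (fun θ => f θ z.2) z.1 * dlog j (fun θ => f θ z.2) z.1) (jointLaw ν lam f) :=
    (hs i).integrable_mul (hs j)
  have i2 : Integrable (fun z : Euc d × Y => dlog i lam z.1 * dlog j lam z.1)
      (jointLaw ν lam f) := (hl i).integrable_mul (hl j)
  have i3 : ∀ i j, Integrable (fun z : Euc d × Y =>
      dlog i (fun θ => f θ z.2) z.1 * dlog j lam z.1) (jointLaw ν lam f) := fun i j =>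
    (hs i).integrable_mul (hl j)
  have i12 : Integrable (fun z : Euc d × Y =>
      dlog i (fun θ => f θ z.2) z.1 * dlog j (fun θ => f θ z.2) z.1
        + dlog i lam z.1 * dlog j lam z.1) (jointLaw ν lam f) := i1.add i2
  have i33 : Integrable (fun z : Euc d × Y => dlog i (fun θ => f θ z.2) z.1 * dlog j lam z.1
        + dlog j (fun θ => f θ z.2) z.1 * dlog i lam z.1) (jointLaw ν lam f) :=
    (i3 i j).add (i3 j i)
  simp only [e]
  rw [integral_add i12 i33, integral_add i1 i2,
    integral_add (i3 i j) (i3 j i), hf.integral_score_mul_dlog_prior hlam i j (hs i),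
    hf.integral_score_mul_dlog_prior hlam j i (hs j), hf.integral_dlog_prior_mul hlam]
  ring

end IsLikelihood

theorem integral_double_sum {X : Type*} [MeasurableSpace X] {ρ : Measure X} {ι κ : Type*}
    [Fintype ι] [Fintype κ] (c : ι → κ → ℝ) {h : ι → κ → X → ℝ}
    (hh : ∀ i j, Integrable (h i j) ρ) :
    Integrable (fun z => ∑ i, ∑ j, c i j * h i j z) ρ
      ∧ ∫ z, ∑ i, ∑ j, c i j * h i j z ∂ρ = ∑ i, ∑ j, c i j * ∫ z, h i j z ∂ρ := by
  have h1 : ∀ i, Integrable (fun z => ∑ j, c i j * h i j z) ρ := fun i =>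
    integrable_finsetSum _ fun j _ => (hh i j).const_mul _
  refine ⟨integrable_finsetSum _ fun i _ => h1 i, ?_⟩
  rw [integral_finsetSum _ fun i _ => h1 i]
  refine Finset.sum_congr rfl fun i _ => ?_
  rw [integral_finsetSum _ fun j _ => (hh i j).const_mul _]
  exact Finset.sum_congr rfl fun j _ => integral_const_mul _ _

/-- The Cauchy–Schwarz inequality behind the van Trees inequality. -/
theorem trace_covariance_le {X : Type*} [MeasurableSpace X] {ρ : Measure X} {ι κ : Type*}
    [Fintype ι] [Fintype κ] [DecidableEq κ] {D : X → ι → ℝ} {s : X → κ → ℝ}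
    (hD : ∀ i, MemLp (fun z => D z i) 2 ρ) (hs : ∀ j, MemLp (fun z => s z j) 2 ρ)
    {W : Matrix ι ι ℝ} (hW : W.PosSemidef) {Ψ I₀ : Matrix κ κ ℝ} (hΨ : Ψ.PosSemidef)
    (hI : ∀ i j, I₀ i j = ∫ z, s z i * s z j ∂ρ) {N : Matrix ι κ ℝ}
    (hN : ∀ i j, N i j = ∫ z, D z i * s z j ∂ρ) :
    (W * N * (I₀ + Ψ)⁻¹ * Nᵀ).trace ≤ ∫ z, D z ⬝ᵥ (W *ᵥ D z) ∂ρ := by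
  have hnn : 0 ≤ ∫ z, D z ⬝ᵥ (W *ᵥ D z) ∂ρ := integral_nonneg fun z => by
    have := hW.dotProduct_mulVec_nonneg (D z)
    rwa [star_trivial] at this
  -- The inverse of a singular matrix is zero by convention, and the claim reduces to nonnegativity.
  by_cases hdet : (I₀ + Ψ).det = 0
  · rw [Matrix.inv_def, hdet]
    simpa using hnn
  have hsym : (I₀ + Ψ)ᵀ = I₀ + Ψ := by
    rw [Matrix.transpose_add, hΨ.transpose_eq]
    congr 1
    ext i j
    rw [Matrix.transpose_apply, hI, hI]
    simp only [mul_comm]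
  set Sg := I₀ + Ψ with hSg
  have hinv : Sg⁻¹ᵀ = Sg⁻¹ := by rw [Matrix.transpose_nonsing_inv, hsym]
  -- The coefficient of the linear regression of the error on the score, with the information
  -- increased by `Ψ`.
  set G := N * Sg⁻¹ with hG
  have hGT : Gᵀ = Sg⁻¹ * Nᵀ := by rw [hG, Matrix.transpose_mul, hinv]
  set F : X → ι → ℝ := fun z => D z - G *ᵥ s z with hF
  have hexp : ∀ z, F z ⬝ᵥ (W *ᵥ F z) = D z ⬝ᵥ (W *ᵥ D z)
      - 2 * ∑ i, ∑ j, (W * G) i j * (D z i * s z j)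
      + ∑ i, ∑ j, (Gᵀ * W * G) i j * (s z i * s z j) := fun z => by
    have h1 : D z ⬝ᵥ (W *ᵥ (G *ᵥ s z)) = ∑ i, ∑ j, (W * G) i j * (D z i * s z j) := by
      rw [Matrix.mulVec_mulVec, dotProduct]
      refine Finset.sum_congr rfl fun i _ => ?_
      rw [Matrix.mulVec, dotProduct, Finset.mul_sum]
      exact Finset.sum_congr rfl fun j _ => by ring
    have h2 : (G *ᵥ s z) ⬝ᵥ (W *ᵥ D z) = D z ⬝ᵥ (W *ᵥ (G *ᵥ s z)) := by
      rw [Matrix.dotProduct_mulVec, ← Matrix.mulVec_transpose, hW.transpose_eq, dotProduct_comm]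
    have h3 : (G *ᵥ s z) ⬝ᵥ (W *ᵥ (G *ᵥ s z))
        = ∑ i, ∑ j, (Gᵀ * W * G) i j * (s z i * s z j) := by
      rw [Matrix.mulVec_mulVec, dotProduct_comm, Matrix.dotProduct_mulVec, ← Matrix.mulVec_transpose,
        Matrix.mulVec_mulVec, dotProduct_comm, dotProduct, Matrix.mul_assoc]
      refine Finset.sum_congr rfl fun i _ => ?_
      rw [Matrix.mulVec, dotProduct, Finset.mul_sum]
      exact Finset.sum_congr rfl fun j _ => by ring
    rw [hF]
    simp only
    rw [Matrix.mulVec_sub, dotProduct_sub, sub_dotProduct, sub_dotProduct, h2, h1, h3]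
    ring
  have hDD : Integrable (fun z => D z ⬝ᵥ (W *ᵥ D z)) ρ := by
    simp only [dotProduct, Matrix.mulVec, Finset.mul_sum]
    refine integrable_finsetSum _ fun i _ => integrable_finsetSum _ fun j _ => ?_
    have : Integrable (fun z => D z i * D z j) ρ := (hD i).integrable_mul (hD j)
    exact (this.const_mul (W i j)).congr (ae_of_all _ fun z => by simp only; ring)
  have hDs : ∀ i j, Integrable (fun z => D z i * s z j) ρ := fun i j =>
    (hD i).integrable_mul (hs j)
  have hss : ∀ i j, Integrable (fun z => s z i * s z j) ρ := fun i j =>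
    (hs i).integrable_mul (hs j)
  have hFint : 0 ≤ ∫ z, F z ⬝ᵥ (W *ᵥ F z) ∂ρ := integral_nonneg fun z => by
    have := hW.dotProduct_mulVec_nonneg (F z)
    rwa [star_trivial] at this
  obtain ⟨hA, hAv⟩ := integral_double_sum (fun i j => (W * G) i j) hDs
  obtain ⟨hB, hBv⟩ := integral_double_sum (fun i j => (Gᵀ * W * G) i j) hss
  have hAv' : ∑ i, ∑ j, (W * G) i j * ∫ z, D z i * s z j ∂ρ = (W * G * Nᵀ).trace := by
    refine Finset.sum_congr rfl fun i _ => ?_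
    rw [Matrix.diag_apply, Matrix.mul_apply]
    refine Finset.sum_congr rfl fun j _ => ?_
    rw [← hN, Matrix.transpose_apply]
  have hBv' : ∑ i, ∑ j, (Gᵀ * W * G) i j * ∫ z, s z i * s z j ∂ρ
      = (Gᵀ * W * G * I₀).trace := by
    refine Finset.sum_congr rfl fun i _ => ?_
    rw [Matrix.diag_apply, Matrix.mul_apply]
    refine Finset.sum_congr rfl fun j _ => ?_
    rw [hI]
    simp only [mul_comm (s _ i)]
  have hmain : ∫ z, F z ⬝ᵥ (W *ᵥ F z) ∂ρ = ∫ z, D z ⬝ᵥ (W *ᵥ D z) ∂ρ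
      - 2 * (W * G * Nᵀ).trace + (Gᵀ * W * G * I₀).trace := by
    have hA2 : Integrable (fun z => 2 * ∑ i, ∑ j, (W * G) i j * (D z i * s z j)) ρ :=
      hA.const_mul 2
    have hDA : Integrable (fun z => D z ⬝ᵥ (W *ᵥ D z)
        - 2 * ∑ i, ∑ j, (W * G) i j * (D z i * s z j)) ρ := hDD.sub hA2
    simp only [hexp]
    rw [integral_add hDA hB, integral_sub hDD hA2, integral_const_mul, hAv, hBv, hAv', hBv']
  -- `Ψ` is a sum of rank-one terms, each contributing a value of a positive semidefinite form.
  -- Increasing the information only weakens the bound.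
  have hΨtr : 0 ≤ (Gᵀ * W * G * Ψ).trace := by
    have hconj : (Gᵀ * W * G).PosSemidef := by
      have := hW.conjTranspose_mul_mul_same G
      rwa [Matrix.conjTranspose_eq_transpose_of_trivial] at this
    obtain ⟨m, v, rfl⟩ := Matrix.posSemidef_iff_eq_sum_vecMulVec.1 hΨ
    rw [Matrix.mul_sum, Matrix.trace_sum]
    refine Finset.sum_nonneg fun i _ => ?_
    rw [Matrix.mul_vecMulVec, Matrix.trace_vecMulVec, star_trivial, dotProduct_comm]
    simpa using hconj.dotProduct_mulVec_nonneg (v i)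
  have hsum : (Gᵀ * W * G * I₀).trace + (Gᵀ * W * G * Ψ).trace = (W * G * Nᵀ).trace := by
    rw [← Matrix.trace_add, ← Matrix.mul_add, ← hSg]
    have h5 : G * Sg = N := by
      rw [hG, Matrix.mul_assoc, Matrix.nonsing_inv_mul _ (isUnit_iff_ne_zero.2 hdet),
        Matrix.mul_one]
    rw [Matrix.mul_assoc (Gᵀ * W), h5, Matrix.mul_assoc, Matrix.trace_mul_comm, hGT,
      hG]
    rw [← Matrix.trace_transpose]
    simp only [Matrix.transpose_mul, Matrix.transpose_transpose, hinv, hW.transpose_eq]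
    rw [← Matrix.trace_transpose]
    simp only [Matrix.transpose_mul, Matrix.transpose_transpose, hinv, hW.transpose_eq,
      Matrix.mul_assoc]
  have hgoal : W * N * Sg⁻¹ * Nᵀ = W * G * Nᵀ := by rw [hG]; simp only [Matrix.mul_assoc]
  rw [hgoal]
  linarith

end VanTrees

/-! ### The likelihood of a history -/

section Likelihood

variable {Ω Ξ : Type*} [MeasurableSpace Ω] [MeasurableSpace Ξ]

/-- Extend a history by a state. -/
def snocPast {t : ℕ} (z : (Ξ × (Fin (t + 1) → Euc dx)) × Euc dx) : Ξ × (Fin (t + 2) → Euc dx) :=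
  (z.1.1, Fin.snoc (α := fun _ => Euc dx) z.1.2 z.2)

theorem measurable_snocPast {t : ℕ} : Measurable (snocPast (Ξ := Ξ) (dx := dx) (t := t)) :=
  (measurable_fst.comp measurable_fst).prodMk
    (measurable_snoc.comp ((measurable_snd.comp measurable_fst).prodMk measurable_snd))

/-- The law of the randomization, times Lebesgue measure for the states `x_1, …, x_t`. -/
def refLaw (dx : ℕ) (κ : Measure Ξ) : (t : ℕ) → Measure (Ξ × (Fin (t + 1) → Euc dx))
  | 0 => κ.map fun x => (x, fun _ => 0)
  | t + 1 => ((refLaw dx κ t).prod volume).map snocPast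

instance sFinite_refLaw (κ : Measure Ξ) [SFinite κ] (t : ℕ) : SFinite (refLaw dx κ t) := by
  induction t with
  | zero => unfold refLaw; infer_instance
  | succ t ih => unfold refLaw; infer_instance

namespace System

theorem restrictPast_snocPast {s t : ℕ} (h : s ≤ t) (y : Ξ × (Fin (t + 1) → Euc dx)) (x : Euc dx) :
    restrictPast (show s ≤ t + 1 by omega) (snocPast (y, x)) = restrictPast h y := by
  refine Prod.ext rfl (funext fun i => ?_)
  have h1 : (Fin.castLE (by omega) i : Fin (t + 2)) = Fin.castSucc (Fin.castLE (by omega) i) := by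
    ext; rfl
  simp only [restrictPast, snocPast]
  rw [h1, Fin.snoc_castSucc]

theorem pastState_snocPast {s t : ℕ} (h : s ≤ t) (y : Ξ × (Fin (t + 1) → Euc dx)) (x : Euc dx) :
    pastState s (snocPast (y, x)) = pastState s y := by
  rw [pastState, pastState, dif_pos h, dif_pos (show s ≤ t + 1 by omega), restrictPast_snocPast h]

theorem pastInput_snocPast (π : Policy dx du Ξ) {s t : ℕ} (h : s ≤ t)
    (y : Ξ × (Fin (t + 1) → Euc dx)) (x : Euc dx) :
    pastInput π s (snocPast (y, x)) = pastInput π s y := by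
  rw [pastInput, pastInput, dif_pos h, dif_pos (show s ≤ t + 1 by omega), restrictPast_snocPast h]
  rfl

theorem pastState_last_snocPast {t : ℕ} (y : Ξ × (Fin (t + 1) → Euc dx)) (x : Euc dx) :
    pastState (t + 1) (snocPast (y, x)) = x := by
  rw [pastState, dif_pos le_rfl]
  exact Fin.snoc_last (α := fun _ => Euc dx) x y.2

variable (S : System dx du dθ) (π : Policy dx du Ξ)

/-- The noise at time `s`, computed from a history and the parameter. -/
def residual {t : ℕ} (s : ℕ) (ϑ : Euc dθ) (y : Ξ × (Fin (t + 1) → Euc dx)) : Euc dx :=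
  pastState (s + 1) y - mv S.A (pastState s y) - mv (S.B ϑ) (pastInput π s y)

/-- The likelihood of a history of length `t`. -/
def lik (t : ℕ) (ϑ : Euc dθ) (y : Ξ × (Fin (t + 1) → Euc dx)) : ℝ :=
  ∏ s ∈ Finset.range t, S.p (S.residual π s ϑ y)

theorem measurable_mv_B {Y : Type*} [MeasurableSpace Y] {f : Y → Euc dθ} {g : Y → Euc du}
    (hf : Measurable f) (hg : Measurable g) : Measurable fun y => mv (S.B (f y)) (g y) := by
  have hB := S.continuous_mv_B.measurable
  have h := hB.comp (hf.prodMk hg)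
  exact h

theorem measurable_residual {t : ℕ} (s : ℕ) :
    Measurable fun z : Euc dθ × (Ξ × (Fin (t + 1) → Euc dx)) => S.residual π s z.1 z.2 := by
  have h1 : ∀ s, Measurable fun z : Euc dθ × (Ξ × (Fin (t + 1) → Euc dx)) => pastState s z.2 :=
    fun s => (measurable_pastState s).comp measurable_snd
  have h3 := S.measurable_mv_B (Y := Euc dθ × (Ξ × (Fin (t + 1) → Euc dx))) measurable_fst
    ((measurable_pastInput π s).comp measurable_snd)
  have h4 : Measurable fun z : Euc dθ × (Ξ × (Fin (t + 1) → Euc dx)) => mv S.A (pastState s z.2) :=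
    (measurable_mv S.A).comp (h1 s)
  unfold residual
  exact ((h1 (s + 1)).fun_sub h4).fun_sub h3

theorem residual_past {w : ℕ → Ω → Euc dx} {ξ : Ω → Ξ} {s t : ℕ} (h : s < t) (ϑ θ : Euc dθ)
    (ω : Ω) : S.residual π s ϑ (S.past π w ξ θ t ω) = S.state w ξ π θ (s + 1) ω
      - mv S.A (S.state w ξ π θ s ω) - mv (S.B ϑ) (S.input w ξ π θ s ω) := by
  rw [residual, pastState_past S π (by omega), pastState_past S π (by omega),
    pastInput_past S π (by omega)]

theorem residual_past_self {w : ℕ → Ω → Euc dx} {ξ : Ω → Ξ} {s t : ℕ} (h : s < t) (θ : Euc dθ)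
    (ω : Ω) : S.residual π s θ (S.past π w ξ θ t ω) = w s ω := by
  rw [residual_past S π h, state_succ]
  abel

theorem lik_snocPast (t : ℕ) (ϑ : Euc dθ) (y : Ξ × (Fin (t + 1) → Euc dx)) (x : Euc dx) :
    S.lik π (t + 1) ϑ (snocPast (y, x)) = S.lik π t ϑ y
      * S.p (x - (mv S.A (pastState t y) + mv (S.B ϑ) (pastInput π t y))) := by
  rw [lik, Finset.prod_range_succ]
  congr 1
  · refine Finset.prod_congr rfl fun s hs => ?_
    rw [Finset.mem_range] at hs
    rw [residual, residual, pastState_snocPast (by omega), pastState_snocPast (by omega),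
      pastInput_snocPast π (by omega)]
  · rw [residual, pastState_last_snocPast, pastState_snocPast le_rfl, pastInput_snocPast π le_rfl,
      sub_sub]

theorem past_succ {w : ℕ → Ω → Euc dx} {ξ : Ω → Ξ} (θ : Euc dθ) (t : ℕ) (ω : Ω) :
    S.past π w ξ θ (t + 1) ω = snocPast (S.past π w ξ θ t ω,
      mv S.A (pastState t (S.past π w ξ θ t ω)) + mv (S.B θ) (pastInput π t (S.past π w ξ θ t ω))
        + w t ω) := by
  rw [pastState_past S π le_rfl, pastInput_past S π le_rfl]
  rfl

variable {S π}

theorem measurable_lik (hp : IsNoiseDensity S.p) (t : ℕ) :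
    Measurable fun z : Euc dθ × (Ξ × (Fin (t + 1) → Euc dx)) => S.lik π t z.1 z.2 := by
  unfold lik
  exact Finset.measurable_fun_prod _ fun s _ =>
    hp.contDiff.continuous.measurable.comp (S.measurable_residual π s)

theorem measurable_lik_apply (hp : IsNoiseDensity S.p) (t : ℕ) (θ : Euc dθ) :
    Measurable (S.lik π t θ) := by
  have := (measurable_lik (π := π) hp t).comp (measurable_prodMk_left (x := θ))
  exact this

theorem lik_nonneg (hp : IsNoiseDensity S.p) (t : ℕ) (ϑ : Euc dθ)
    (y : Ξ × (Fin (t + 1) → Euc dx)) : 0 ≤ S.lik π t ϑ y :=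
  Finset.prod_nonneg fun _ _ => hp.nonneg _

variable {μ : Measure Ω} [IsProbabilityMeasure μ] {w : ℕ → Ω → Euc dx} {ξ : Ω → Ξ}

/-- The likelihood is the density of the history. -/
theorem lintegral_past (hw : IsNoise μ S.p w ξ) (hp : IsNoiseDensity S.p) (θ : Euc dθ) (t : ℕ)
    {g : Ξ × (Fin (t + 1) → Euc dx) → ℝ≥0∞} (hg : Measurable g) :
    ∫⁻ ω, g (S.past π w ξ θ t ω) ∂μ
      = ∫⁻ y, g y * ENNReal.ofReal (S.lik π t θ y) ∂(refLaw dx (μ.map ξ) t) := by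
  have : IsProbabilityMeasure (μ.map ξ) :=
    Measure.isProbabilityMeasure_map hw.measurable_ξ.aemeasurable
  induction t with
  | zero =>
      have h1 : Measurable fun x : Ξ => (x, fun _ : Fin 1 => (0 : Euc dx)) :=
        measurable_id.prodMk measurable_const
      rw [refLaw, lintegral_map (by simpa [lik] using hg) h1]
      simp only [lik, Finset.range_zero, Finset.prod_empty, ENNReal.ofReal_one, mul_one]
      exact (lintegral_map (hg.comp h1) hw.measurable_ξ).symm
  | succ t ih =>
      set f : Ξ × (Fin (t + 1) → Euc dx) → Euc dx := fun y =>
        mv S.A (pastState t y) + mv (S.B θ) (pastInput π t y) with hf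
      have hfm : Measurable f := ((measurable_mv _).comp (measurable_pastState t)).add
        ((measurable_mv _).comp (measurable_pastInput π t))
      have hpm : Measurable fun v => ENNReal.ofReal (S.p v) :=
        hp.contDiff.continuous.measurable.ennreal_ofReal
      have hga : Measurable fun z : (Ξ × (Fin (t + 1) → Euc dx)) × Euc dx =>
          g (snocPast (z.1, f z.1 + z.2)) :=
        hg.comp (measurable_snocPast.comp
          (measurable_fst.prodMk ((hfm.comp measurable_fst).add measurable_snd)))
      have hgb : Measurable fun z : (Ξ × (Fin (t + 1) → Euc dx)) × Euc dx =>
          g (snocPast z) * ENNReal.ofReal (S.p (z.2 - f z.1)) :=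
        (hg.comp measurable_snocPast).mul
          (hpm.comp (measurable_snd.sub (hfm.comp measurable_fst)))
      have hlm' : Measurable (S.lik π (t + 1) θ) := measurable_lik_apply hp (t + 1) θ
      have hpast := S.measurable_past π hw.measurable_w hw.measurable_ξ θ t
      have : IsProbabilityMeasure (μ.map (w t)) :=
        Measure.isProbabilityMeasure_map (hw.measurable_w t).aemeasurable
      calc ∫⁻ ω, g (S.past π w ξ θ (t + 1) ω) ∂μ
          = ∫⁻ ω, g (snocPast (S.past π w ξ θ t ω, f (S.past π w ξ θ t ω) + w t ω)) ∂μ := by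
            simp only [past_succ, hf]
        _ = ∫⁻ z, g (snocPast (z.1, f z.1 + z.2))
              ∂(μ.map fun ω => (S.past π w ξ θ t ω, w t ω)) :=
            (lintegral_map hga (hpast.prodMk (hw.measurable_w t))).symm
        _ = ∫⁻ y, ∫⁻ v, g (snocPast (y, f y + v)) ∂(μ.map (w t)) ∂(μ.map (S.past π w ξ θ t)) := by
            rw [(indepFun_iff_map_prod_eq_prod_map_map hpast.aemeasurable
              (hw.measurable_w t).aemeasurable).1 (S.indepFun_past π hw θ t),
              lintegral_prod _ hga.aemeasurable]
        _ = ∫⁻ y, (∫⁻ x : Euc dx, g (snocPast (y, x)) * ENNReal.ofReal (S.p (x - f y)))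
              ∂(μ.map (S.past π w ξ θ t)) := by
            refine lintegral_congr fun y => ?_
            have hgy : Measurable fun v => g (snocPast (y, f y + v)) :=
              hga.comp measurable_prodMk_left
            rw [hw.law t, lintegral_withDensity_eq_lintegral_mul _ hpm hgy]
            -- Translation invariance of Lebesgue measure replaces the noise by the next state as
            -- the variable of integration.
            rw [← lintegral_add_left_eq_self (μ := volume)
              (fun x => g (snocPast (y, x)) * ENNReal.ofReal (S.p (x - f y))) (f y)]
            refine lintegral_congr fun v => ?_
            simp only [Pi.mul_apply, add_sub_cancel_left]
            rw [mul_comm]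
        _ = ∫⁻ y, (∫⁻ x : Euc dx, g (snocPast (y, x)) * ENNReal.ofReal (S.p (x - f y)))
              * ENNReal.ofReal (S.lik π t θ y) ∂(refLaw dx (μ.map ξ) t) := by
            rw [lintegral_map hgb.lintegral_prod_right' hpast]
            exact ih hgb.lintegral_prod_right'
        _ = ∫⁻ y, g y * ENNReal.ofReal (S.lik π (t + 1) θ y)
              ∂(refLaw dx (μ.map ξ) (t + 1)) := by
            have hgl : Measurable fun y => g y * ENNReal.ofReal (S.lik π (t + 1) θ y) :=
              hg.mul hlm'.ennreal_ofReal
            rw [refLaw, lintegral_map hgl measurable_snocPast,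
              lintegral_prod (fun z => g (snocPast z) * ENNReal.ofReal
                (S.lik π (t + 1) θ (snocPast z))) (hgl.comp measurable_snocPast).aemeasurable]
            refine lintegral_congr fun y => ?_
            have hgy : Measurable fun x : Euc dx =>
                g (snocPast (y, x)) * ENNReal.ofReal (S.p (x - f y)) :=
              hgb.comp measurable_prodMk_left
            rw [← lintegral_mul_const _ hgy]
            refine lintegral_congr fun x => ?_
            rw [lik_snocPast, mul_comm (S.lik π t θ y), ENNReal.ofReal_mul (hp.nonneg _), mul_assoc]

theorem contDiff_mv_B (u : Euc du) : ContDiff ℝ 1 fun ϑ : Euc dθ => mv (S.B ϑ) u := by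
  have : ContDiff ℝ 1 fun ϑ : Euc dθ => S.B ϑ *ᵥ u.ofLp := by
    refine contDiff_pi.2 fun i => ?_
    simp only [System.B, Matrix.mulVec, dotProduct, Matrix.of_apply]
    fun_prop
  exact (PiLp.contDiff_toLp (p := 2)).comp this

theorem contDiff_density_residual (hp : IsNoiseDensity S.p) {t : ℕ} (s : ℕ)
    (y : Ξ × (Fin (t + 1) → Euc dx)) : ContDiff ℝ 1 fun ϑ => S.p (S.residual π s ϑ y) :=
  hp.contDiff.comp (contDiff_const.sub (contDiff_mv_B _))

theorem isLikelihood (hw : IsNoise μ S.p w ξ) (hp : IsNoiseDensity S.p) (t : ℕ) :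
    IsLikelihood (refLaw dx (μ.map ξ) t) (S.lik π t) where
  nonneg := lik_nonneg hp t
  measurable := measurable_lik hp t
  contDiff y := contDiff_prod fun s _ => contDiff_density_residual hp s y
  mass θ := by
    have := lintegral_past (π := π) hw hp θ t (g := fun _ => 1) measurable_const
    simpa using this.symm

/-- The score is the score of the likelihood. -/
theorem score_apply (N : ℕ) (θ : Euc dθ) (ω : Ω) (i : Fin dθ) :
    S.score w ξ π N θ ω i
      = dlog i (fun ϑ => S.lik π (N + 1) ϑ (S.past π w ξ θ (N + 1) ω)) θ := by
  rw [score, gradient_coord]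
  have h : ∀ ϑ, S.lik π (N + 1) ϑ (S.past π w ξ θ (N + 1) ω)
      = ∏ t ∈ Finset.range (N + 1), S.p (S.state w ξ π θ (t + 1) ω
        - mv S.A (S.state w ξ π θ t ω) - mv (S.B ϑ) (S.input w ξ π θ t ω)) := fun ϑ => by
    rw [lik]
    refine Finset.prod_congr rfl fun s hs => ?_
    rw [residual_past S π (Finset.mem_range.1 hs)]
  simp only [dlog, h]

end System

end Likelihood

/-! ### The joint law of the parameter and the history -/

section BayesLaw

/-- The derivative of the logarithm of a product is dominated by the sum of the derivatives. -/
theorem abs_fderiv_log_prod_le {E : Type*} [NormedAddCommGroup E] [NormedSpace ℝ E]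
    {f : ℕ → E → ℝ} {x : E} (hf : ∀ s, DifferentiableAt ℝ (f s) x) (v : E) (t : ℕ) :
    DifferentiableAt ℝ (fun z => ∏ s ∈ Finset.range t, f s z) x ∧
    |fderiv ℝ (fun z => Real.log (∏ s ∈ Finset.range t, f s z)) x v|
      ≤ ∑ s ∈ Finset.range t, |fderiv ℝ (fun z => Real.log (f s z)) x v| := by
  induction t with
  | zero => simp
  | succ t ih =>
      obtain ⟨hd, hle⟩ := ih
      simp only [Finset.prod_range_succ, Finset.sum_range_succ]
      have hd' := hd.fun_mul (hf t)
      refine ⟨hd', ?_⟩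
      rw [fderiv_log_eq hd']
      rw [fderiv_log_eq hd] at hle
      rw [fderiv_log_eq (hf t), fderiv_fun_mul hd (hf t)]
      simp only [_root_.add_apply, _root_.smul_apply, smul_eq_mul]
      set F := ∏ s ∈ Finset.range t, f s x
      -- Where the product vanishes, its logarithmic derivative is zero by the division convention;
      -- elsewhere the usual sum rule holds.
      by_cases hF : F = 0
      · rw [hF, zero_mul (f t x), div_zero, abs_zero]
        exact add_nonneg (Finset.sum_nonneg fun _ _ => abs_nonneg _) (abs_nonneg _)
      by_cases hft : f t x = 0
      · rw [hft, mul_zero F, div_zero, abs_zero]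
        exact add_nonneg (Finset.sum_nonneg fun _ _ => abs_nonneg _) (abs_nonneg _)
      have e : ∀ a b : ℝ, (F * a + f t x * b) / (F * f t x) = b / F + a / f t x := fun a b => by
        field_simp
        ring
      rw [e]
      exact (abs_add_le _ _).trans (add_le_add hle le_rfl)

/-- Partial derivatives in the parameter are jointly measurable. -/
theorem IsLikelihood.measurable_dlog {d : ℕ} {Y : Type*} [MeasurableSpace Y] {ν : Measure Y}
    {f : Euc d → Y → ℝ} (hf : IsLikelihood ν f) (j : Fin d) :
    Measurable fun z : Euc d × Y => dlog j (fun θ => f θ z.2) z.1 := by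
  have h1 : Measurable fun z : Euc d × Y => pderiv j (fun θ => f θ z.2) z.1 := by
    set e : Euc d := EuclideanSpace.single j 1
    -- The partial derivative is a pointwise limit of jointly measurable difference quotients.
    refine measurable_of_tendsto_metrizable (f := fun (n : ℕ) (z : Euc d × Y) =>
      ((n : ℝ) + 1) * (f (z.1 + ((n : ℝ) + 1)⁻¹ • e) z.2 - f z.1 z.2)) (fun n => ?_) ?_
    · have h2 : Measurable fun z : Euc d × Y => (z.1 + ((n : ℝ) + 1)⁻¹ • e, z.2) :=
        (measurable_fst.add_const _).prodMk measurable_snd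
      have h3 := hf.measurable.comp h2
      exact (h3.sub hf.measurable).const_mul _
    · rw [tendsto_pi_nhds]
      intro z
      have hd : HasFDerivAt (fun θ => f θ z.2) (fderiv ℝ (fun θ => f θ z.2) z.1) z.1 :=
        ((hf.contDiff z.2).differentiable (by norm_num) _).hasFDerivAt
      exact (hd.lim_real e).comp
        (tendsto_atTop_add_const_right _ _ tendsto_natCast_atTop_atTop)
  have h2 : (fun z : Euc d × Y => dlog j (fun θ => f θ z.2) z.1)
      = fun z => pderiv j (fun θ => f θ z.2) z.1 / f z.1 z.2 := funext fun z =>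
    fderiv_log_eq ((hf.contDiff z.2).differentiable (by norm_num) _) _
  rw [h2]
  exact h1.div hf.measurable

variable {Ω Ξ : Type*} [MeasurableSpace Ω] [MeasurableSpace Ξ] {μ : Measure Ω}
  [IsProbabilityMeasure μ] {S : System dx du dθ} {w : ℕ → Ω → Euc dx} {ξ : Ω → Ξ}
  {π : Policy dx du Ξ} {U : Set (Euc dθ)} {lam : Euc dθ → ℝ}

/-- The joint law of the parameter and the randomness. -/
def priorLaw (lam : Euc dθ → ℝ) (μ : Measure Ω) : Measure (Euc dθ × Ω) :=
  (volume.withDensity fun θ => ENNReal.ofReal (lam θ)).prod μ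

namespace IsPrior

theorem measurable (h : IsPrior U lam) : Measurable lam := h.smooth.continuous.measurable

theorem integrable (h : IsPrior U lam) : Integrable lam :=
  h.smooth.continuous.integrable_of_hasCompactSupport h.compact

theorem lintegral_eq_one (h : IsPrior U lam) : ∫⁻ θ, ENNReal.ofReal (lam θ) = 1 := by
  rw [← ofReal_integral_eq_lintegral_ofReal h.integrable (ae_of_all _ h.nonneg), h.mass]
  simp

theorem eq_zero (h : IsPrior U lam) {θ : Euc dθ} (hθ : θ ∉ U) : lam θ = 0 :=
  image_eq_zero_of_notMem_tsupport fun h' => hθ (h.support h')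

theorem isProbabilityMeasure (h : IsPrior U lam) :
    IsProbabilityMeasure (volume.withDensity fun θ => ENNReal.ofReal (lam θ)) :=
  ⟨by rw [withDensity_apply _ MeasurableSet.univ, setLIntegral_univ, h.lintegral_eq_one]⟩

theorem lintegral_priorLaw (h : IsPrior U lam) {F : Euc dθ × Ω → ℝ≥0∞} (hF : Measurable F) :
    ∫⁻ z, F z ∂(priorLaw lam μ) = ∫⁻ θ, ENNReal.ofReal (lam θ) * ∫⁻ ω, F (θ, ω) ∂μ := by
  have := h.isProbabilityMeasure
  rw [priorLaw, lintegral_prod _ hF.aemeasurable,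
    lintegral_withDensity_eq_lintegral_mul _ h.measurable.ennreal_ofReal hF.lintegral_prod_right']
  rfl

theorem integral_priorLaw (h : IsPrior U lam) {F : Euc dθ × Ω → ℝ}
    (hF : Integrable F (priorLaw lam μ)) :
    ∫ z, F z ∂(priorLaw lam μ) = ∫ θ, lam θ * ∫ ω, F (θ, ω) ∂μ := by
  have := h.isProbabilityMeasure
  rw [priorLaw, integral_prod _ hF, integral_withDensity_eq_integral_toReal_smul
    h.measurable.ennreal_ofReal (ae_of_all _ fun _ => ENNReal.ofReal_lt_top)]
  simp only [ENNReal.toReal_ofReal (h.nonneg _), smul_eq_mul]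

/-- Averages over the prior inherit bounds which hold for every parameter. -/
theorem integral_priorLaw_le (h : IsPrior U lam) {F : Euc dθ × Ω → ℝ} (hF : Measurable F)
    (h0 : ∀ z, 0 ≤ F z) {b : ℝ} (hi : ∀ θ ∈ U, Integrable (fun ω => F (θ, ω)) μ)
    (hb : ∀ θ ∈ U, ∫ ω, F (θ, ω) ∂μ ≤ b) :
    Integrable F (priorLaw lam μ) ∧ ∫ z, F z ∂(priorLaw lam μ) ≤ b := by
  have hle : ∫⁻ z, ENNReal.ofReal (F z) ∂(priorLaw lam μ) ≤ ENNReal.ofReal b := by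
    rw [h.lintegral_priorLaw hF.ennreal_ofReal]
    calc ∫⁻ θ, ENNReal.ofReal (lam θ) * ∫⁻ ω, ENNReal.ofReal (F (θ, ω)) ∂μ
        ≤ ∫⁻ θ, ENNReal.ofReal (lam θ) * ENNReal.ofReal b := by
          refine lintegral_mono fun θ => ?_
          by_cases hθ : θ ∈ U
          · refine mul_le_mul_right ?_ _
            rw [← ofReal_integral_eq_lintegral_ofReal (hi θ hθ) (ae_of_all _ fun ω => h0 _)]
            exact ENNReal.ofReal_le_ofReal (hb θ hθ)
          · simp [h.eq_zero hθ]
      _ = ENNReal.ofReal b := by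
          rw [lintegral_mul_const _ h.measurable.ennreal_ofReal, h.lintegral_eq_one, one_mul]
  have hint : Integrable F (priorLaw lam μ) :=
    (lintegral_ofReal_ne_top_iff_integrable hF.aestronglyMeasurable (ae_of_all _ h0)).1
      (ne_top_of_le_ne_top ENNReal.ofReal_ne_top hle)
  refine ⟨hint, ?_⟩
  -- With a negative bound no parameter could lie in `U`, and the prior would vanish identically.
  have hb0 : 0 ≤ b := by
    by_contra hneg
    have hU : ∀ θ, lam θ = 0 := fun θ => h.eq_zero fun hθ =>
      hneg ((integral_nonneg fun ω => h0 (θ, ω)).trans (hb θ hθ))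
    have := h.mass
    simp [hU] at this
  rw [← ofReal_integral_eq_lintegral_ofReal hint (ae_of_all _ h0)] at hle
  exact (ENNReal.ofReal_le_ofReal_iff hb0).1 hle

end IsPrior

namespace System

/-- The history, as a function of the parameter and the randomness, together with the parameter. -/
def observe (S : System dx du dθ) (π : Policy dx du Ξ) (w : ℕ → Ω → Euc dx) (ξ : Ω → Ξ) (t : ℕ)
    (z : Euc dθ × Ω) : Euc dθ × (Ξ × (Fin (t + 1) → Euc dx)) :=
  (z.1, S.past π w ξ z.1 t z.2)

theorem measurable_observe (hw : IsNoise μ S.p w ξ) (t : ℕ) : Measurable (S.observe π w ξ t) :=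
  measurable_fst.prodMk (S.measurable_past_uncurry π hw.measurable_w hw.measurable_ξ t)

/-- This transports the van Trees inequality from densities on histories to the given probability
space. -/
theorem jointLaw_eq_map (hlam : IsPrior U lam) (hw : IsNoise μ S.p w ξ) (hp : IsNoiseDensity S.p)
    (t : ℕ) : jointLaw (refLaw dx (μ.map ξ) t) lam (S.lik π t)
      = (priorLaw lam μ).map (S.observe π w ξ t) := by
  have : IsProbabilityMeasure (μ.map ξ) :=
    Measure.isProbabilityMeasure_map hw.measurable_ξ.aemeasurable
  have hf := isLikelihood (π := π) hw hp t
  have hobs := measurable_observe (π := π) hw t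
  refine Measure.ext_of_lintegral _ fun g hg => ?_
  have hgo : Measurable fun z => g (S.observe π w ξ t z) := hg.comp hobs
  have hd := (hf.density_measurable hlam).ennreal_ofReal
  rw [lintegral_map hg hobs, hlam.lintegral_priorLaw hgo, jointLaw,
    lintegral_withDensity_eq_lintegral_mul _ hd hg, lintegral_prod _ (hd.mul hg).aemeasurable]
  refine lintegral_congr fun θ => ?_
  have hgθ : Measurable fun y => g (θ, y) := hg.comp measurable_prodMk_left
  have e := lintegral_past (π := π) hw hp θ t hgθ
  have e' : ∫⁻ ω, g (S.observe π w ξ t (θ, ω)) ∂μ = ∫⁻ ω, g (θ, S.past π w ξ θ t ω) ∂μ := rfl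
  have hgl : Measurable fun y => g (θ, y) * ENNReal.ofReal (S.lik π t θ y) :=
    hgθ.mul (measurable_lik_apply hp t θ).ennreal_ofReal
  rw [e', e, ← lintegral_const_mul _ hgl]
  refine lintegral_congr fun y => ?_
  simp only [Pi.mul_apply]
  rw [ENNReal.ofReal_mul (hlam.nonneg θ)]
  ring

end System

end BayesLaw

/-! ### Square integrability of the score -/

section ScoreMoments

variable {Ω Ξ : Type*} [MeasurableSpace Ω] [MeasurableSpace Ξ] {μ : Measure Ω}
  [IsProbabilityMeasure μ] {S : System dx du dθ} {w : ℕ → Ω → Euc dx} {ξ : Ω → Ξ}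
  {π : Policy dx du Ξ} {U : Set (Euc dθ)} {lam : Euc dθ → ℝ}

theorem norm_gradient {d : ℕ} (f : Euc d → ℝ) (x : Euc d) : ‖gradient f x‖ = ‖fderiv ℝ f x‖ := by
  rw [gradient, LinearIsometryEquiv.norm_map]

theorem measurable_norm_gradient {d : ℕ} (f : Euc d → ℝ) :
    Measurable fun x => ‖gradient f x‖ := by
  simp only [norm_gradient]
  exact (measurable_fderiv ℝ f).norm

namespace System

theorem fderiv_mv_B_apply (u : Euc du) (θ v : Euc dθ) :
    fderiv ℝ (fun ϑ : Euc dθ => mv (S.B ϑ) u) θ v = mv (S.B v - S.B 0) u := by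
  have hd : DifferentiableAt ℝ (fun ϑ : Euc dθ => mv (S.B ϑ) u) θ :=
    (contDiff_mv_B u).differentiable (by norm_num) θ
  rw [← hd.lineDeriv_eq_fderiv, lineDeriv]
  have h1 : ∀ t : ℝ, mv (S.B (θ + t • v)) u = mv (S.B θ) u + t • mv (S.B v - S.B 0) u := fun t => by
    rw [← smul_mv, ← add_mv]
    congr 1
    ext i j
    simp [System.B, Matrix.mulVec_add, Matrix.mulVec_smul]
    ring
  simp only [h1]
  have h2 : HasDerivAt (fun t : ℝ => mv (S.B θ) u + t • mv (S.B v - S.B 0) u)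
      ((1 : ℝ) • mv (S.B v - S.B 0) u) 0 := ((hasDerivAt_id (0 : ℝ)).smul_const _).const_add _
  rw [h2.deriv, one_smul]

/-- Chain rule: `B` is affine, so the residual has the constant derivative `-(B(e) - B(0)) u` in the
direction `e`. The bound is uniform in time, parameter and history. -/
theorem abs_dlog_density_residual_le (hp : IsNoiseDensity S.p) (i : Fin dθ) : ∃ c : ℝ, 0 ≤ c ∧
    ∀ (t s : ℕ) (θ : Euc dθ) (y : Ξ × (Fin (t + 1) → Euc dx)),
      |dlog i (fun ϑ => S.p (S.residual π s ϑ y)) θ|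
        ≤ c * (‖gradient (fun z => Real.log (S.p z)) (S.residual π s θ y)‖ * ‖pastInput π s y‖) := by
  set e : Euc dθ := EuclideanSpace.single i 1 with he
  refine ⟨√(frob (S.B e - S.B 0)), Real.sqrt_nonneg _, fun t s θ y => ?_⟩
  have hres : HasFDerivAt (fun ϑ => S.residual π s ϑ y)
      (-fderiv ℝ (fun ϑ => mv (S.B ϑ) (pastInput π s y)) θ) θ :=
    (((contDiff_mv_B _).differentiable (by norm_num) θ).hasFDerivAt).const_sub _
  have hpd : DifferentiableAt ℝ S.p (S.residual π s θ y) :=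
    hp.contDiff.differentiable (by norm_num) _
  have hcomp := hpd.hasFDerivAt.comp θ hres
  have h1 : dlog i (fun ϑ => S.p (S.residual π s ϑ y)) θ
      = fderiv ℝ (fun z => Real.log (S.p z)) (S.residual π s θ y)
        (-mv (S.B e - S.B 0) (pastInput π s y)) := by
    rw [fderiv_log_eq hpd]
    refine (fderiv_log_eq (f := fun ϑ => S.p (S.residual π s ϑ y)) hcomp.differentiableAt e).trans ?_
    congr 1
    have h2 : fderiv ℝ (fun ϑ => S.p (S.residual π s ϑ y)) θ = _ := hcomp.fderiv
    rw [h2]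
    simp [fderiv_mv_B_apply]
  rw [h1, norm_gradient]
  refine ((fderiv ℝ (fun z => Real.log (S.p z)) (S.residual π s θ y)).le_opNorm
    (-mv (S.B e - S.B 0) (pastInput π s y))).trans ?_
  rw [norm_neg]
  have h3 : ‖mv (S.B e - S.B 0) (pastInput π s y)‖ ≤ √(frob (S.B e - S.B 0)) * ‖pastInput π s y‖ := by
    refine abs_le_of_sq_le_sq' ?_ (by positivity) |>.2
    rw [mul_pow, Real.sq_sqrt (frob_nonneg _)]
    exact norm_mv_sq_le_frob _ _
  calc _ ≤ ‖fderiv ℝ (fun z => Real.log (S.p z)) (S.residual π s θ y)‖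
        * (√(frob (S.B e - S.B 0)) * ‖pastInput π s y‖) :=
        mul_le_mul_of_nonneg_left h3 (norm_nonneg _)
    _ = _ := by ring

theorem lintegral_gradient_noise (hw : IsNoise μ S.p w ξ) (hp : IsNoiseDensity S.p) (s : ℕ) :
    ∫⁻ ω, ENNReal.ofReal (‖gradient (fun z => Real.log (S.p z)) (w s ω)‖ ^ 2) ∂μ < ⊤ := by
  have hm : Measurable fun x => ‖gradient (fun z => Real.log (S.p z)) x‖ ^ 2 :=
    (measurable_norm_gradient _).pow_const 2
  have h1 : Integrable (fun ω => ‖gradient (fun z => Real.log (S.p z)) (w s ω)‖ ^ 2) μ := by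
    rw [hw.integrable_comp_iff hp s
      (f := fun x => ‖gradient (fun z => Real.log (S.p z)) x‖ ^ 2) hm.stronglyMeasurable]
    exact hp.info.congr (ae_of_all _ fun y => by simp [mul_comm])
  exact h1.lintegral_lt_top

/-- The noise at time `s` is independent of the input at time `s`, so the second moment factors into
the information of `p` and the mean squared input. The assumption on the inputs enters here. -/
theorem memLp_score_bound (hlam : IsPrior U lam) (hw : IsNoise μ S.p w ξ)
    (hp : IsNoiseDensity S.p) (hfin : S.FiniteInputs μ w ξ π lam) {s t : ℕ} (hst : s < t) :
    MemLp (fun z : Euc dθ × (Ξ × (Fin (t + 1) → Euc dx)) =>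
      ‖gradient (fun z => Real.log (S.p z)) (S.residual π s z.1 z.2)‖ * ‖pastInput π s z.2‖) 2
      (jointLaw (refLaw dx (μ.map ξ) t) lam (S.lik π t)) := by
  have h1 := (measurable_norm_gradient (fun z => Real.log (S.p z))).comp
    (S.measurable_residual π (t := t) s)
  have h2 : Measurable fun z : Euc dθ × (Ξ × (Fin (t + 1) → Euc dx)) => ‖pastInput π s z.2‖ :=
    ((measurable_pastInput π s).comp measurable_snd).norm
  have hm : Measurable fun z : Euc dθ × (Ξ × (Fin (t + 1) → Euc dx)) =>
      ‖gradient (fun z => Real.log (S.p z)) (S.residual π s z.1 z.2)‖ * ‖pastInput π s z.2‖ :=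
    h1.mul h2
  have hobs := measurable_observe (π := π) hw t
  have hG : Measurable fun x => ‖gradient (fun z => Real.log (S.p z)) x‖ :=
    measurable_norm_gradient _
  rw [jointLaw_eq_map hlam hw hp, memLp_map_measure_iff hm.aestronglyMeasurable hobs.aemeasurable,
    memLp_two_iff_integrable_sq (hm.comp hobs).aestronglyMeasurable]
  have hm2 := (hm.comp hobs).pow_const 2
  refine (lintegral_ofReal_ne_top_iff_integrable hm2.aestronglyMeasurable
    (ae_of_all _ fun z => sq_nonneg _)).1 (ne_of_lt ?_)
  rw [hlam.lintegral_priorLaw hm2.ennreal_ofReal]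
  have h3 : ∀ θ, ∫⁻ ω, ENNReal.ofReal (((fun z : Euc dθ × (Ξ × (Fin (t + 1) → Euc dx)) =>
      ‖gradient (fun z => Real.log (S.p z)) (S.residual π s z.1 z.2)‖ * ‖pastInput π s z.2‖)
        ∘ S.observe π w ξ t) (θ, ω) ^ 2) ∂μ
      = (∫⁻ ω, ENNReal.ofReal (‖gradient (fun z => Real.log (S.p z)) (w s ω)‖ ^ 2) ∂μ)
        * ∫⁻ ω, ‖S.input w ξ π θ s ω‖ₑ ^ 2 ∂μ := fun θ => by
    have hind : IndepFun (fun ω => ENNReal.ofReal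
        (‖gradient (fun z => Real.log (S.p z)) (w s ω)‖ ^ 2))
        (fun ω => ‖S.input w ξ π θ s ω‖ₑ ^ 2) μ := by
      have h4 := (S.indepFun_past π hw θ s).symm.comp
        (φ := fun x => ENNReal.ofReal (‖gradient (fun z => Real.log (S.p z)) x‖ ^ 2))
        (ψ := fun y => ‖pastInput π s y‖ₑ ^ 2) (hG.pow_const 2).ennreal_ofReal
        ((measurable_pastInput π s).enorm.pow_const 2)
      refine h4.congr (ae_of_all _ fun ω => rfl) (ae_of_all _ fun ω => ?_)
      simp only [Function.comp]
      rw [pastInput_past S π le_rfl]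
    have hGw : Measurable fun ω => ENNReal.ofReal
        (‖gradient (fun z => Real.log (S.p z)) (w s ω)‖ ^ 2) :=
      ((hG.comp (hw.measurable_w s)).pow_const 2).ennreal_ofReal
    rw [← lintegral_mul_eq_lintegral_mul_lintegral_of_indepFun'' hGw.aemeasurable
      ((measurable_input hw s).enorm.pow_const 2).aemeasurable hind]
    refine lintegral_congr fun ω => ?_
    simp only [Function.comp, observe]
    rw [residual_past_self S π hst, pastInput_past S π hst.le, mul_pow,
      ENNReal.ofReal_mul (sq_nonneg _), ENNReal.ofReal_pow (norm_nonneg (S.input w ξ π θ s ω)),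
      ofReal_norm]
  simp only [h3]
  have h5 := lintegral_gradient_noise hw hp s
  simp only [mul_left_comm (ENNReal.ofReal (lam _))]
  rw [lintegral_const_mul' _ _ h5.ne]
  exact ENNReal.mul_lt_top h5 (hfin s)

/-- The score has a finite second moment. -/
theorem memLp_dlog_lik (hlam : IsPrior U lam) (hw : IsNoise μ S.p w ξ)
    (hp : IsNoiseDensity S.p) (hfin : S.FiniteInputs μ w ξ π lam) (t : ℕ) (i : Fin dθ) :
    MemLp (fun z : Euc dθ × (Ξ × (Fin (t + 1) → Euc dx)) =>
      dlog i (fun ϑ => S.lik π t ϑ z.2) z.1) 2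
      (jointLaw (refLaw dx (μ.map ξ) t) lam (S.lik π t)) := by
  have hf := isLikelihood (π := π) hw hp t
  obtain ⟨c, hc, hle⟩ := abs_dlog_density_residual_le (S := S) (π := π) hp i
  have hsum : MemLp (fun z : Euc dθ × (Ξ × (Fin (t + 1) → Euc dx)) => ∑ s ∈ Finset.range t,
      ‖gradient (fun z => Real.log (S.p z)) (S.residual π s z.1 z.2)‖ * ‖pastInput π s z.2‖) 2
      (jointLaw (refLaw dx (μ.map ξ) t) lam (S.lik π t)) :=
    memLp_finsetSum _ fun s hs => memLp_score_bound hlam hw hp hfin (Finset.mem_range.1 hs)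
  refine hsum.of_le_mul (c := c) (hf.measurable_dlog i).aestronglyMeasurable
    (ae_of_all _ fun z => ?_)
  have h1 := (abs_fderiv_log_prod_le (f := fun s ϑ => S.p (S.residual π s ϑ z.2)) (x := z.1)
    (fun s => (contDiff_density_residual hp s z.2).differentiable (by norm_num) _)
    (EuclideanSpace.single i 1) t).2
  rw [Real.norm_eq_abs, Real.norm_eq_abs]
  refine h1.trans ((Finset.sum_le_sum fun s _ => hle t s z.1 z.2).trans ?_)
  rw [← Finset.mul_sum]
  exact mul_le_mul_of_nonneg_left (le_abs_self _) hc

/-- Fubini, legitimate because the score is square integrable under the joint law. -/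
theorem bayesInfo_eq (hlam : IsPrior U lam) (hw : IsNoise μ S.p w ξ)
    (hp : IsNoiseDensity S.p) (hfin : S.FiniteInputs μ w ξ π lam) (N : ℕ) (i j : Fin dθ) :
    S.bayesInfo μ w ξ π lam N i j
      = ∫ z, dlog i (fun ϑ => S.lik π (N + 1) ϑ z.2) z.1 * dlog j (fun ϑ => S.lik π (N + 1) ϑ z.2) z.1
        ∂(jointLaw (refLaw dx (μ.map ξ) (N + 1)) lam (S.lik π (N + 1))) := by
  have hf := isLikelihood (π := π) hw hp (N + 1)
  have hobs := measurable_observe (π := π) hw (N + 1)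
  have hm : Measurable fun z : Euc dθ × (Ξ × (Fin (N + 1 + 1) → Euc dx)) =>
      dlog i (fun ϑ => S.lik π (N + 1) ϑ z.2) z.1 * dlog j (fun ϑ => S.lik π (N + 1) ϑ z.2) z.1 :=
    (hf.measurable_dlog i).mul (hf.measurable_dlog j)
  have hi : Integrable (fun z : Euc dθ × (Ξ × (Fin (N + 1 + 1) → Euc dx)) =>
      dlog i (fun ϑ => S.lik π (N + 1) ϑ z.2) z.1 * dlog j (fun ϑ => S.lik π (N + 1) ϑ z.2) z.1)
      (jointLaw (refLaw dx (μ.map ξ) (N + 1)) lam (S.lik π (N + 1))) :=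
    (memLp_dlog_lik hlam hw hp hfin (N + 1) i).integrable_mul
      (memLp_dlog_lik hlam hw hp hfin (N + 1) j)
  rw [jointLaw_eq_map hlam hw hp] at hi ⊢
  have hi' := (integrable_map_measure hm.aestronglyMeasurable hobs.aemeasurable).1 hi
  rw [integral_map hobs.aemeasurable hm.aestronglyMeasurable]
  refine Eq.trans ?_ (hlam.integral_priorLaw hi').symm
  rw [bayesInfo, Matrix.of_apply]
  refine integral_congr_ae (ae_of_all _ fun θ => ?_)
  simp only [fisherInfo, Matrix.of_apply, score_apply]
  rfl

end System

end ScoreMoments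

/-! ### The van Trees inequality for the controlled system -/

section SystemVanTrees

variable {Ω Ξ : Type*} [MeasurableSpace Ω] [MeasurableSpace Ξ] {μ : Measure Ω}
  [IsProbabilityMeasure μ] {S : System dx du dθ} {w : ℕ → Ω → Euc dx} {ξ : Ω → Ξ}
  {π : Policy dx du Ξ} {U : Set (Euc dθ)} {lam : Euc dθ → ℝ}

/-- The van Trees inequality for the estimation of a function `K` of the parameter by a statistic
`Z` of the history, on the event (or with the weight) `φ`. -/
theorem System.van_trees (hlam : IsPrior U lam) (hw : IsNoise μ S.p w ξ) (hp : IsNoiseDensity S.p)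
    (hfin : S.FiniteInputs μ w ξ π lam) (N : ℕ) {k l : ℕ}
    {W : Matrix (Fin l × Fin k) (Fin l × Fin k) ℝ} (hW : W.PosSemidef)
    {Ψ : Matrix (Fin dθ) (Fin dθ) ℝ} (hΨ : Ψ.PosSemidef) {K : Euc dθ → Matrix (Fin k) (Fin l) ℝ}
    (hK : ∀ i j, ContDiff ℝ 1 fun ϑ => K ϑ i j)
    {Z : Ξ × (Fin (N + 1 + 1) → Euc dx) → Matrix (Fin k) (Fin l) ℝ}
    (hZ : ∀ i j, Measurable fun y => Z y i j)
    {φ : Ξ × (Fin (N + 1 + 1) → Euc dx) → ℝ} (hφ : Measurable φ) (hφ1 : ∀ y, |φ y| ≤ 1)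
    (hD : ∀ i j, MemLp (fun z : Euc dθ × Ω => φ (S.past π w ξ z.1 (N + 1) z.2)
      * (Z (S.past π w ξ z.1 (N + 1) z.2) i j - K z.1 i j)) 2 (priorLaw lam μ))
    {G : Matrix (Fin l × Fin k) (Fin dθ) ℝ}
    (hG : ∀ i j, G (j, i) = fun r => ∫ z : Euc dθ × Ω, φ (S.past π w ξ z.1 (N + 1) z.2)
      * pderiv r (fun ϑ => K ϑ i j) z.1 ∂(priorLaw lam μ)) :
    (W * G * (S.bayesInfo μ w ξ π lam N + locationInfo lam + Ψ)⁻¹ * Gᵀ).trace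
      ≤ ∫ z : Euc dθ × Ω, φ (S.past π w ξ z.1 (N + 1) z.2) ^ 2
          * ((Z (S.past π w ξ z.1 (N + 1) z.2) - K z.1).vec
            ⬝ᵥ (W *ᵥ (Z (S.past π w ξ z.1 (N + 1) z.2) - K z.1).vec)) ∂(priorLaw lam μ) := by
  have : IsProbabilityMeasure (μ.map ξ) :=
    Measure.isProbabilityMeasure_map hw.measurable_ξ.aemeasurable
  have hf := isLikelihood (π := π) hw hp (N + 1)
  have hobs := measurable_observe (π := π) hw (N + 1)
  have hmap := jointLaw_eq_map (π := π) hlam hw hp (N + 1)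
  set ρ := jointLaw (refLaw dx (μ.map ξ) (N + 1)) lam (S.lik π (N + 1)) with hρ
  have hKm : ∀ i j, Measurable fun ϑ => K ϑ i j := fun i j => (hK i j).continuous.measurable
  set D : Euc dθ × (Ξ × (Fin (N + 1 + 1) → Euc dx)) → Fin l × Fin k → ℝ :=
    fun z a => φ z.2 * (Z z.2 a.2 a.1 - K z.1 a.2 a.1) with hDdef
  have hDm : ∀ a, Measurable fun z => D z a := fun a =>
    (hφ.comp measurable_snd).mul (((hZ _ _).comp measurable_snd).sub ((hKm _ _).comp measurable_fst))
  have hDL : ∀ a, MemLp (fun z => D z a) 2 ρ := fun a => by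
    rw [hmap, memLp_map_measure_iff (hDm a).aestronglyMeasurable hobs.aemeasurable]
    exact hD a.2 a.1
  have hsl := fun i => memLp_dlog_lik (π := π) hlam hw hp hfin (N + 1) i
  have hsL : ∀ r, MemLp (IsLikelihood.score (S.lik π (N + 1)) lam r) 2 ρ := fun r =>
    (hsl r).add (hf.memLp_dlog_prior hlam r)
  have hI : ∀ i j, (S.bayesInfo μ w ξ π lam N + locationInfo lam) i j
      = ∫ z, IsLikelihood.score (S.lik π (N + 1)) lam i z
        * IsLikelihood.score (S.lik π (N + 1)) lam j z ∂ρ := fun i j => by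
    rw [hf.integral_score_mul_score hlam hsl, Matrix.add_apply, bayesInfo_eq hlam hw hp hfin]
  have hpm : ∀ i j r, Measurable fun ϑ => pderiv r (fun ϑ => K ϑ i j) ϑ := fun i j r =>
    measurable_fderiv_apply_const ℝ _ _
  have hN : ∀ a r, G a r = ∫ z, D z a * IsLikelihood.score (S.lik π (N + 1)) lam r z ∂ρ :=
    fun a r => by
    have h1 := hf.integral_error_mul_score hlam hφ hφ1 (hK a.2 a.1) r
      (Z := fun y => Z y a.2 a.1) (hDL a) (hsL r)
    have hm : Measurable fun z : Euc dθ × (Ξ × (Fin (N + 1 + 1) → Euc dx)) =>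
        φ z.2 * pderiv r (fun ϑ => K ϑ a.2 a.1) z.1 :=
      (hφ.comp measurable_snd).mul ((hpm _ _ _).comp measurable_fst)
    refine Eq.trans ?_ h1.symm
    rw [← hρ, hmap, integral_map hobs.aemeasurable hm.aestronglyMeasurable]
    exact congrFun (hG a.2 a.1) r
  refine (trace_covariance_le hDL hsL hW hΨ hI hN).trans (le_of_eq ?_)
  have hm : Measurable fun z => D z ⬝ᵥ (W *ᵥ D z) := by
    simp only [dotProduct, Matrix.mulVec]
    exact Finset.measurable_fun_sum _ fun a _ => (hDm a).mul
      (Finset.measurable_fun_sum _ fun b _ => (hDm b).const_mul _)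
  rw [hmap, integral_map hobs.aemeasurable hm.aestronglyMeasurable]
  refine integral_congr_ae (ae_of_all _ fun z => ?_)
  have e : D (S.observe π w ξ (N + 1) z) = φ (S.past π w ξ z.1 (N + 1) z.2)
      • (Z (S.past π w ξ z.1 (N + 1) z.2) - K z.1).vec := by
    funext a
    rfl
  simp only [e, Matrix.mulVec_smul, dotProduct_smul, smul_dotProduct, smul_eq_mul]
  ring

end SystemVanTrees

/-! ### From bounds at each parameter to a bound on the sum of traces -/

section AveragedTraces

variable {Ω Ξ : Type*} [MeasurableSpace Ω] [MeasurableSpace Ξ] {μ : Measure Ω}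
  [IsProbabilityMeasure μ] {S : System dx du dθ} {w : ℕ → Ω → Euc dx} {ξ : Ω → Ξ}
  {π : Policy dx du Ξ} {U : Set (Euc dθ)} {lam : Euc dθ → ℝ}

theorem sq_entry_le_frob {k l : ℕ} (M : Matrix (Fin k) (Fin l) ℝ) (i : Fin k) (j : Fin l) :
    M i j ^ 2 ≤ frob M :=
  (Finset.single_le_sum (f := fun j => M i j ^ 2) (fun _ _ => sq_nonneg _)
    (Finset.mem_univ j)).trans (Finset.single_le_sum (f := fun i => ∑ j, M i j ^ 2)
      (fun _ _ => Finset.sum_nonneg fun _ _ => sq_nonneg _) (Finset.mem_univ i))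

theorem measurable_vec_dotProduct_mulVec {Y : Type*} [MeasurableSpace Y] {k l : ℕ}
    {f : Y → Matrix (Fin k) (Fin l) ℝ} (hf : ∀ i j, Measurable fun y => f y i j)
    (W : Matrix (Fin l × Fin k) (Fin l × Fin k) ℝ) :
    Measurable fun y => (f y).vec ⬝ᵥ (W *ᵥ (f y).vec) := by
  simp only [dotProduct, Matrix.mulVec]
  exact Finset.measurable_fun_sum _ fun a _ => (hf a.2 a.1).mul
    (Finset.measurable_fun_sum _ fun b _ => (hf b.2 b.1).const_mul _)

/-- A sum of van Trees bounds is controlled by a bound for every parameter on the sum of the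
estimation errors. -/
theorem System.sum_trace_le (hlam : IsPrior U lam) (hw : IsNoise μ S.p w ξ)
    (hp : IsNoiseDensity S.p) (hfin : S.FiniteInputs μ w ξ π lam) {ι : Type*} (s : Finset ι)
    (N : ι → ℕ) {k l : ℕ}
    {W : Matrix (Fin l × Fin k) (Fin l × Fin k) ℝ} (hW : W.PosSemidef)
    {Ψ : Matrix (Fin dθ) (Fin dθ) ℝ} (hΨ : Ψ.PosSemidef) {K : Euc dθ → Matrix (Fin k) (Fin l) ℝ}
    (hK : ∀ i j, ContDiff ℝ 1 fun ϑ => K ϑ i j)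
    {Z : ∀ n, Ξ × (Fin (N n + 1 + 1) → Euc dx) → Matrix (Fin k) (Fin l) ℝ}
    (hZ : ∀ n i j, Measurable fun y => Z n y i j)
    {φ : ∀ n, Ξ × (Fin (N n + 1 + 1) → Euc dx) → ℝ} (hφ : ∀ n, Measurable (φ n))
    (hφ1 : ∀ n y, |φ n y| ≤ 1) {G : ι → Matrix (Fin l × Fin k) (Fin dθ) ℝ}
    (hG : ∀ n i j r, G n (j, i) r = ∫ z : Euc dθ × Ω, φ n (S.past π w ξ z.1 (N n + 1) z.2)
      * pderiv r (fun ϑ => K ϑ i j) z.1 ∂(priorLaw lam μ))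
    {V : ι → Euc dθ → Ω → ℝ} {b c B : ℝ} (hc : 0 < c)
    (hV : ∀ n ∈ s, ∀ ϑ ∈ U, Integrable (V n ϑ) μ)
    (hVb : ∀ ϑ ∈ U, ∑ n ∈ s, ∫ ω, V n ϑ ω ∂μ ≤ B)
    (hb : ∀ n ∈ s, ∀ ϑ ∈ U, ∀ ω, b * (φ n (S.past π w ξ ϑ (N n + 1) ω) ^ 2
      * ((Z n (S.past π w ξ ϑ (N n + 1) ω) - K ϑ).vec
        ⬝ᵥ (W *ᵥ (Z n (S.past π w ξ ϑ (N n + 1) ω) - K ϑ).vec))) ≤ V n ϑ ω)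
    (hf : ∀ n ∈ s, ∀ ϑ ∈ U, ∀ ω, c * (φ n (S.past π w ξ ϑ (N n + 1) ω) ^ 2
      * frob (Z n (S.past π w ξ ϑ (N n + 1) ω) - K ϑ)) ≤ V n ϑ ω) (hb0 : 0 < b) :
    ∑ n ∈ s, b * (W * G n * (S.bayesInfo μ w ξ π lam (N n) + locationInfo lam + Ψ)⁻¹
      * (G n)ᵀ).trace ≤ B := by
  have hpast : ∀ t, Measurable fun z : Euc dθ × Ω => S.past π w ξ z.1 t z.2 := fun t =>
    S.measurable_past_uncurry π hw.measurable_w hw.measurable_ξ t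
  have hKm : ∀ i j, Measurable fun ϑ => K ϑ i j := fun i j => (hK i j).continuous.measurable
  have hV0 : ∀ n ∈ s, ∀ ϑ ∈ U, ∀ ω, 0 ≤ V n ϑ ω := fun n hn ϑ hϑ ω =>
    (mul_nonneg hc.le (mul_nonneg (sq_nonneg _) (frob_nonneg _))).trans (hf n hn ϑ hϑ ω)
  have hVn : ∀ n ∈ s, ∀ ϑ ∈ U, ∫ ω, V n ϑ ω ∂μ ≤ B := fun n hn ϑ hϑ =>
    (Finset.single_le_sum (f := fun n => ∫ ω, V n ϑ ω ∂μ)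
      (fun n hn => integral_nonneg (hV0 n hn ϑ hϑ)) hn).trans (hVb ϑ hϑ)
  set E : ι → Euc dθ × Ω → Matrix (Fin k) (Fin l) ℝ := fun n z =>
    Z n (S.past π w ξ z.1 (N n + 1) z.2) - K z.1 with hE
  set f : ι → Euc dθ × Ω → ℝ := fun n z => φ n (S.past π w ξ z.1 (N n + 1) z.2) with hfdef
  have hEm : ∀ n i j, Measurable fun z => E n z i j := fun n i j =>
    ((hZ n i j).comp (hpast _)).sub ((hKm i j).comp measurable_fst)
  have hfm : ∀ n, Measurable (f n) := fun n => (hφ n).comp (hpast _)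
  set F : ι → Euc dθ × Ω → ℝ := fun n z => f n z ^ 2 * ((E n z).vec ⬝ᵥ (W *ᵥ (E n z).vec)) with hF
  have hFm : ∀ n, Measurable (F n) := fun n =>
    ((hfm n).pow_const 2).mul (measurable_vec_dotProduct_mulVec (hEm n) W)
  have hF0 : ∀ n z, 0 ≤ F n z := fun n z => by
    refine mul_nonneg (sq_nonneg _) ?_
    have := hW.dotProduct_mulVec_nonneg (E n z).vec
    rwa [star_trivial] at this
  have hFi : ∀ n ∈ s, ∀ ϑ ∈ U, Integrable (fun ω => b * F n (ϑ, ω)) μ := fun n hn ϑ hϑ => by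
    refine (hV n hn ϑ hϑ).mono' ((hFm n).comp measurable_prodMk_left |>.const_mul b
      |>.aestronglyMeasurable) (ae_of_all _ fun ω => ?_)
    rw [Real.norm_eq_abs, abs_of_nonneg (mul_nonneg hb0.le (hF0 _ _))]
    exact hb n hn ϑ hϑ ω
  have hFint : ∀ n ∈ s, Integrable (fun z => b * F n z) (priorLaw lam μ) := fun n hn =>
    (hlam.integral_priorLaw_le ((hFm n).const_mul b) (fun z => mul_nonneg hb0.le (hF0 n z))
      (hFi n hn) fun ϑ hϑ => (integral_mono (hFi n hn ϑ hϑ) (hV n hn ϑ hϑ)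
        (hb n hn ϑ hϑ)).trans (hVn n hn ϑ hϑ)).1
  -- The Frobenius bound serves for integrability, and for the sign of `V`; its constant does not
  -- enter the result.
  have hDL : ∀ n ∈ s, ∀ i j, MemLp (fun z => f n z * E n z i j) 2 (priorLaw lam μ) :=
    fun n hn i j => by
    have hm : Measurable fun z => f n z * E n z i j := (hfm n).mul (hEm n i j)
    rw [memLp_two_iff_integrable_sq hm.aestronglyMeasurable]
    have hle : ∀ ϑ ∈ U, ∀ ω, (f n (ϑ, ω) * E n (ϑ, ω) i j) ^ 2 ≤ c⁻¹ * V n ϑ ω :=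
      fun ϑ hϑ ω => by
      rw [le_inv_mul_iff₀ hc]
      refine le_trans ?_ (hf n hn ϑ hϑ ω)
      refine mul_le_mul_of_nonneg_left ?_ hc.le
      rw [mul_pow]
      exact mul_le_mul_of_nonneg_left (sq_entry_le_frob _ i j) (sq_nonneg _)
    have hi : ∀ ϑ ∈ U, Integrable (fun ω => (f n (ϑ, ω) * E n (ϑ, ω) i j) ^ 2) μ :=
      fun ϑ hϑ => ((hV n hn ϑ hϑ).const_mul c⁻¹).mono'
        ((hm.comp measurable_prodMk_left).pow_const 2).aestronglyMeasurable
        (ae_of_all _ fun ω => by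
          rw [Real.norm_eq_abs, abs_of_nonneg (sq_nonneg _)]
          exact hle ϑ hϑ ω)
    refine (hlam.integral_priorLaw_le (hm.pow_const 2) (fun z => sq_nonneg _) hi (b := c⁻¹ * B)
      fun ϑ hϑ => (integral_mono (hi ϑ hϑ) ((hV n hn ϑ hϑ).const_mul c⁻¹) (hle ϑ hϑ)).trans ?_).1
    rw [integral_const_mul]
    exact mul_le_mul_of_nonneg_left (hVn n hn ϑ hϑ) (inv_nonneg.2 hc.le)
  calc ∑ n ∈ s, b * (W * G n * (S.bayesInfo μ w ξ π lam (N n) + locationInfo lam + Ψ)⁻¹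
        * (G n)ᵀ).trace
      ≤ ∑ n ∈ s, ∫ z, b * F n z ∂(priorLaw lam μ) := by
        refine Finset.sum_le_sum fun n hn => ?_
        rw [integral_const_mul]
        refine mul_le_mul_of_nonneg_left ?_ hb0.le
        exact S.van_trees hlam hw hp hfin (N n) hW hΨ hK (hZ n) (hφ n) (hφ1 n) (hDL n hn)
          fun i j => funext fun r => hG n i j r
    _ = ∫ z, ∑ n ∈ s, b * F n z ∂(priorLaw lam μ) := (integral_finsetSum _ hFint).symm
    _ ≤ B := by
        refine (hlam.integral_priorLaw_le (F := fun z => ∑ n ∈ s, b * F n z)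
          (Finset.measurable_fun_sum _ fun n _ => (hFm n).const_mul b)
          (fun z => Finset.sum_nonneg fun n _ => mul_nonneg hb0.le (hF0 n z))
          (fun ϑ hϑ => integrable_finsetSum _ fun n hn => hFi n hn ϑ hϑ) fun ϑ hϑ => ?_).2
        rw [integral_finsetSum _ fun n hn => hFi n hn ϑ hϑ]
        exact (Finset.sum_le_sum fun n hn => integral_mono (hFi n hn ϑ hϑ) (hV n hn ϑ hϑ)
          (hb n hn ϑ hϑ)).trans (hVb ϑ hϑ)

end AveragedTraces

/-! ### Window estimators as functions of the history -/

section WindowEstimators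

/-- The estimation error of the least squares fit when the Gramian is large. -/
theorem window_error_le {ι : Type*} {s : Finset ι} {v : ι → Euc du} {x : ι → Euc dx}
    {H : Matrix (Fin du) (Fin du) ℝ} (hH : H.PosSemidef) {Γ : Matrix (Fin dx) (Fin dx) ℝ}
    (hΓ : Γ.PosDef) {b : ℝ} (hb : 0 < b) (hG : (gramSum s x - b • Γ).PosSemidef)
    (K : Matrix (Fin du) (Fin dx) ℝ) :
    b * ((lsFit s v x - K).vec ⬝ᵥ ((Γ ⊗ₖ H) *ᵥ (lsFit s v x - K).vec))
      ≤ ∑ t ∈ s, quad H (v t - mv K (x t)) :=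
  (le_sum_quad_mv hH hG _).trans
    (sum_quad_lsFit_le (det_ne_zero_of_sub_posSemidef (hΓ.smul hb) hG) hH K)

/-- The qualitative companion of the weighted bound, giving square integrability of each entry of
the weighted error. -/
theorem frob_window_error_le {ι : Type*} {s : Finset ι} {v : ι → Euc du} {x : ι → Euc dx}
    {H : Matrix (Fin du) (Fin du) ℝ} {a c : ℝ} (ha : 0 < a) (hc : 0 < c)
    (hH : ∀ u, c * ‖u‖ ^ 2 ≤ quad H u) {Γ : Matrix (Fin dx) (Fin dx) ℝ}
    (hΓ : ∀ v, a * ‖v‖ ^ 2 ≤ quad Γ v) {b : ℝ} (hb : 0 < b)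
    (hG : (gramSum s x - b • Γ).PosSemidef) (K : Matrix (Fin du) (Fin dx) ℝ) :
    b * a * c * frob (lsFit s v x - K) ≤ ∑ t ∈ s, quad H (v t - mv K (x t)) := by
  have h1 : (gramSum s x - (b * a) • (1 : Matrix (Fin dx) (Fin dx) ℝ)).PosSemidef := by
    refine posSemidef_of_quad_nonneg (by simp [gramSum_transpose]) fun v => ?_
    have h2 := hG.quad_nonneg v
    rw [quad_sub_left, quad_smul_left] at h2 ⊢
    rw [quad_one]
    have := mul_le_mul_of_nonneg_left (hΓ v) hb.le
    linarith
  have h3 := frob_lsFit_sub_le (v := v) (mul_pos hb ha) h1 K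
  have h4 : c * ∑ t ∈ s, ‖v t - mv K (x t)‖ ^ 2 ≤ ∑ t ∈ s, quad H (v t - mv K (x t)) := by
    rw [Finset.mul_sum]
    exact Finset.sum_le_sum fun t _ => hH _
  have h5 := mul_le_mul_of_nonneg_left h3 hc.le
  linarith

theorem exists_kronecker_le (Γ : Matrix (Fin dx) (Fin dx) ℝ) (H : Matrix (Fin du) (Fin du) ℝ) :
    ∃ c : ℝ, 0 ≤ c ∧ ∀ D : Matrix (Fin du) (Fin dx) ℝ,
      D.vec ⬝ᵥ ((Γ ⊗ₖ H) *ᵥ D.vec) ≤ c * frob D := by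
  refine ⟨∑ a, ∑ b, |(Γ ⊗ₖ H) a b|, by positivity, fun D => ?_⟩
  simp only [dotProduct, Matrix.mulVec, Finset.mul_sum, Finset.sum_mul]
  refine Finset.sum_le_sum fun a _ => Finset.sum_le_sum fun b _ => ?_
  have h1 := sq_entry_le_frob D a.2 a.1
  have h2 := sq_entry_le_frob D b.2 b.1
  have h3 : |D.vec a * D.vec b| ≤ frob D := by
    rw [abs_mul]
    have : ∀ p : Fin dx × Fin du, D.vec p = D p.2 p.1 := fun _ => rfl
    rw [this, this]
    nlinarith [sq_nonneg (|D a.2 a.1| - |D b.2 b.1|), sq_abs (D a.2 a.1), sq_abs (D b.2 b.1)]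
  calc D.vec a * ((Γ ⊗ₖ H) a b * D.vec b) = (Γ ⊗ₖ H) a b * (D.vec a * D.vec b) := by ring
    _ ≤ |(Γ ⊗ₖ H) a b| * |D.vec a * D.vec b| := by rw [← abs_mul]; exact le_abs_self _
    _ ≤ |(Γ ⊗ₖ H) a b| * frob D := mul_le_mul_of_nonneg_left h3 (abs_nonneg _)

variable {Ω Ξ : Type*} [MeasurableSpace Ω] [MeasurableSpace Ξ]

namespace System

/-- The virtual inputs, as functions of the history. -/
def virtualPast (π : Policy dx du Ξ) {T : ℕ} (n m : ℕ) (a r : ℝ) (K₀ : Matrix (Fin du) (Fin dx) ℝ)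
    (k t : ℕ) (y : Ξ × (Fin (T + 1) → Euc dx)) : Euc du :=
  if t = (k + 1) * m then mv (fitPast π m a r K₀ k y) (pastState t y)
  else if t < n then pastInput π t y else mv K₀ (pastState t y)

theorem virtualPast_past (S : System dx du dθ) {w : ℕ → Ω → Euc dx} {ξ : Ω → Ξ}
    (π : Policy dx du Ξ) (ϑ : Euc dθ) {T n m : ℕ} (a r : ℝ) (K₀ : Matrix (Fin du) (Fin dx) ℝ)
    {k t : ℕ} (hk : k * m ≤ T) (ht : t ≤ T) (ω : Ω) :
    virtualPast π n m a r K₀ k t (S.past π w ξ ϑ T ω) = S.virtual w ξ π ϑ n m a r K₀ k t ω := by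
  rw [virtualPast, virtual, S.fitPast_past π ϑ a r K₀ hk, S.pastState_past π ht,
    S.pastInput_past π ht]

theorem measurable_virtualPast (π : Policy dx du Ξ) {T : ℕ} (n m : ℕ) (a r : ℝ)
    (K₀ : Matrix (Fin du) (Fin dx) ℝ) (k t : ℕ) :
    Measurable (virtualPast (T := T) π n m a r K₀ k t) := by
  have hx : Measurable (pastState (Ξ := Ξ) (dx := dx) (t := T) t) := measurable_pastState t
  unfold virtualPast
  split_ifs
  · refine (PiLp.continuous_toLp 2 _).measurable.comp (measurable_pi_iff.2 fun i => ?_)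
    simp only [Matrix.mulVec, dotProduct]
    exact Finset.measurable_fun_sum _ fun j _ => (measurable_fitPast π a r K₀ k i j).mul
      ((by fun_prop : Measurable fun z : Euc dx => z j).comp hx)
  · exact measurable_pastInput π t
  · exact (measurable_mv K₀).comp hx

open Classical in
/-- The indicator function of a large Gramian. -/
def gramIndicator {T : ℕ} (s : Finset ℕ) (M : Matrix (Fin dx) (Fin dx) ℝ)
    (y : Ξ × (Fin (T + 1) → Euc dx)) : ℝ :=
  if (gramSum s (fun t => pastState t y) - M).PosSemidef then 1 else 0

theorem measurable_gramIndicator {T : ℕ} (s : Finset ℕ) (M : Matrix (Fin dx) (Fin dx) ℝ) :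
    Measurable (gramIndicator (Ξ := Ξ) (T := T) s M) := by
  unfold gramIndicator
  refine Measurable.ite (measurableSet_posSemidef fun i j => ?_) measurable_const measurable_const
  exact (measurable_sum_vecMulVec s (fun t => measurable_pastState t)
    (fun t => measurable_pastState t) i j).sub measurable_const

theorem abs_gramIndicator_le {T : ℕ} (s : Finset ℕ) (M : Matrix (Fin dx) (Fin dx) ℝ)
    (y : Ξ × (Fin (T + 1) → Euc dx)) : |gramIndicator s M y| ≤ 1 := by
  unfold gramIndicator
  split_ifs <;> simp

/-- The least squares fit of the virtual inputs. -/
def windowFit (π : Policy dx du Ξ) {T : ℕ} (s : Finset ℕ) (n m : ℕ) (a r : ℝ)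
    (K₀ : Matrix (Fin du) (Fin dx) ℝ) (k : ℕ) (y : Ξ × (Fin (T + 1) → Euc dx)) :
    Matrix (Fin du) (Fin dx) ℝ :=
  lsFit s (fun t => virtualPast π n m a r K₀ k t y) fun t => pastState t y

theorem measurable_windowFit (π : Policy dx du Ξ) {T : ℕ} (s : Finset ℕ) (n m : ℕ) (a r : ℝ)
    (K₀ : Matrix (Fin du) (Fin dx) ℝ) (k : ℕ) (i : Fin du) (j : Fin dx) :
    Measurable fun y : Ξ × (Fin (T + 1) → Euc dx) => windowFit π s n m a r K₀ k y i j :=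
  measurable_lsFit s (fun t => measurable_virtualPast π n m a r K₀ k t)
    (fun t => measurable_pastState t) i j

/-- Off the event the left side is zero. On it, the least squares bound over the actual window is
enlarged to the longer window `s'` by adding nonnegative terms. -/
theorem gramIndicator_windowFit_le (S : System dx du dθ) {w : ℕ → Ω → Euc dx} {ξ : Ω → Ξ}
    (π : Policy dx du Ξ) (ϑ : Euc dθ) {T n m k : ℕ} (a r : ℝ) (K₀ K : Matrix (Fin du) (Fin dx) ℝ)
    {s s' : Finset ℕ} (hs : ∀ t ∈ s, t ≤ T) (hss : s ⊆ s') (hk : k * m ≤ T)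
    {H : Matrix (Fin du) (Fin du) ℝ} (hH : H.PosSemidef) {Γ : Matrix (Fin dx) (Fin dx) ℝ} {b : ℝ}
    {f : Matrix (Fin du) (Fin dx) ℝ → ℝ}
    (hf : ∀ {v : ℕ → Euc du} {x : ℕ → Euc dx}, (gramSum s x - b • Γ).PosSemidef →
      f (lsFit s v x - K) ≤ ∑ t ∈ s, quad H (v t - mv K (x t)))
    (ω : Ω) :
    gramIndicator s (b • Γ) (S.past π w ξ ϑ T ω) ^ 2
        * f (windowFit π s n m a r K₀ k (S.past π w ξ ϑ T ω) - K)
      ≤ ∑ t ∈ s', quad H (S.virtual w ξ π ϑ n m a r K₀ k t ω - mv K (S.state w ξ π ϑ t ω)) := by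
  have h0 : ∀ t, 0 ≤ quad H (S.virtual w ξ π ϑ n m a r K₀ k t ω - mv K (S.state w ξ π ϑ t ω)) :=
    fun t => hH.quad_nonneg _
  unfold gramIndicator
  split_ifs with hG
  · rw [one_pow, one_mul]
    refine (hf hG).trans ?_
    refine le_trans (le_of_eq (Finset.sum_congr rfl fun t ht => ?_))
      (Finset.sum_le_sum_of_subset_of_nonneg hss fun t _ _ => h0 t)
    rw [S.virtualPast_past π ϑ a r K₀ hk (hs t ht), S.pastState_past π (hs t ht)]
  · rw [zero_pow two_ne_zero, zero_mul]
    exact Finset.sum_nonneg fun t _ => h0 t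

end System

end WindowEstimators

/-! ### The trace bounds inside the horizon and at its end -/

section TraceSums

variable {Ω Ξ : Type*} [MeasurableSpace Ω] [MeasurableSpace Ξ] {μ : Measure Ω}
  [IsProbabilityMeasure μ] {S : System dx du dθ} {w : ℕ → Ω → Euc dx} {ξ : Ω → Ξ}
  {π : Policy dx du Ξ} {lam : Euc dθ → ℝ} {θ : Euc dθ} {ε₀ q c ε a M : ℝ}
  {Kt : Euc dθ → Matrix (Fin du) (Fin dx) ℝ} {T m : ℕ}

theorem LocalBounds.hess_posDef (hL : LocalBounds S θ ε₀ q c Kt) (hR : S.R.PosDef) :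
    (S.hess θ (S.P θ)).PosDef :=
  S.hess_posDef hR (hL.P_psd θ (Metric.mem_ball_self hL.eps_pos))

/-- The van Trees bounds for the windows which end before the horizon. -/
theorem sum_window_trace_le (hlam : IsPrior (Metric.ball θ ε) lam)
    (hw : IsNoise μ S.p w ξ) (hp : IsNoiseDensity S.p) (hR : S.R.PosDef)
    (hfin : S.FiniteInputs μ w ξ π lam) (hL : LocalBounds S θ ε₀ q c Kt) (hε : 0 < ε)
    (hε2 : ε ≤ 1 / 2) (hε₀ : ε ≤ ε₀) (ha : 0 < a)
    (hN : ∀ v, 4 * a * ‖v‖ ^ 2 ≤ quad (noiseGram S.p) v) (hm1 : 1 ≤ m) (hmT : m * m ≤ T)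
    (hC : ∀ ϑ ∈ Metric.ball θ ε, Controlled S μ w ξ π ϑ T M)
    {Γ : Matrix (Fin dx) (Fin dx) ℝ} (hΓ : Γ.PosDef)
    {Ψ : Matrix (Fin dθ) (Fin dθ) ℝ} (hΨ : Ψ.PosSemidef) {b : ℝ} (hb : 0 < b)
    {s : ℕ → Finset ℕ} (hs : ∀ n, s n ⊆ Finset.Icc ((n + 1) * m) ((n + 2) * m))
    {G : ℕ → Matrix (Fin dx × Fin du) (Fin dθ) ℝ}
    (hG : ∀ n i j r, G n (j, i) r = ∫ z : Euc dθ × Ω, System.gramIndicator (s n) (b • Γ)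
      (S.past π w ξ z.1 ((n + 2) * m + 1) z.2) * pderiv r (fun ϑ => Kt ϑ i j) z.1
        ∂(priorLaw lam μ)) :
    ∑ n ∈ Finset.range (m - 1), b * ((Γ ⊗ₖ S.hess θ (S.P θ)) * G n
      * (S.bayesInfo μ w ξ π lam ((n + 2) * m) + locationInfo lam + Ψ)⁻¹ * (G n)ᵀ).trace
      ≤ M + virtualConst q c a (S.noiseCost 1) dx * (1 + ε * M) := by
  set H := S.hess θ (S.P θ) with hHdef
  have hH : H.PosDef := hL.hess_posDef hR
  obtain ⟨g, hg, hgΓ⟩ := hΓ.exists_norm_sq_le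
  obtain ⟨h, hh, hhH⟩ := hH.exists_norm_sq_le
  set V : ℕ → Euc dθ → Ω → ℝ := fun n ϑ ω => ∑ t ∈ Finset.Icc ((n + 1) * m) ((n + 2) * m),
    quad H (S.virtual w ξ π ϑ (T - tailLength q ε) m a (4 * (c * ε ^ 2)) (S.K θ) (n + 1) t ω
      - mv (S.K ϑ) (S.state w ξ π ϑ t ω)) with hV
  have hle : ∀ n ∈ Finset.range (m - 1), ∀ t ∈ Finset.Icc ((n + 1) * m) ((n + 2) * m), t ≤ T :=
    fun n hn t ht => by
    have h1 := (Finset.mem_Icc.1 ht).2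
    have h2 : n + 2 ≤ m := by have := Finset.mem_range.1 hn; omega
    exact h1.trans ((Nat.mul_le_mul_right m h2).trans hmT)
  have hi : ∀ n ∈ Finset.range (m - 1), ∀ ϑ ∈ Metric.ball θ ε,
      ∀ t ∈ Finset.Icc ((n + 1) * m) ((n + 2) * m), Integrable (fun ω =>
        quad H (S.virtual w ξ π ϑ (T - tailLength q ε) m a (4 * (c * ε ^ 2)) (S.K θ) (n + 1) t ω
          - mv (S.K ϑ) (S.state w ξ π ϑ t ω))) μ := fun n hn ϑ hϑ t ht => by
    have hCϑ := hC ϑ hϑ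
    have htT := hle n hn t ht
    refine integrable_quad H (MemLp.sub (hCϑ.memLp_virtual _ m a
      (hL.frob_gain_sub_le hε₀ hϑ) (n + 1) (Nat.sub_le _ _) htT) (memLp_mv _ ?_))
    exact System.memLp_state hw hp fun s hs => hCϑ.memLp s (by omega)
  have hKeq : ∀ ϑ ∈ Metric.ball θ ε, Kt ϑ = S.K ϑ := fun ϑ hϑ =>
    (hL.K_eq ϑ (Metric.ball_subset_ball hε₀ hϑ)).symm
  refine System.sum_trace_le (b := b) (c := b * g * h) (V := V) hlam hw hp hfin _
    (fun n => (n + 2) * m)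
    (hΓ.posSemidef.kronecker hH.posSemidef) hΨ (fun i j => (hL.K_smooth i j).of_le (by norm_num))
    (Z := fun n => System.windowFit π (s n) (T - tailLength q ε) m a (4 * (c * ε ^ 2)) (S.K θ)
      (n + 1))
    (fun n => System.measurable_windowFit π _ _ _ _ _ _ _)
    (φ := fun n => System.gramIndicator (s n) (b • Γ))
    (fun n => System.measurable_gramIndicator _ _) (fun n => System.abs_gramIndicator_le _ _)
    hG (by positivity) (fun n hn ϑ hϑ => integrable_finsetSum _ (hi n hn ϑ hϑ))
    (fun ϑ hϑ => ?_) (fun n hn ϑ hϑ ω => ?_) (fun n hn ϑ hϑ ω => ?_) hb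
  -- The budget for every parameter is the total virtual deviation.
  · refine le_trans (le_of_eq (Finset.sum_congr rfl fun n hn => ?_))
      ((hC ϑ hϑ).sum_virtual_le hL hε hε2 hε₀ hϑ ha hN hm1 hmT)
    exact integral_finsetSum _ (hi n hn ϑ hϑ)
  · rw [hKeq ϑ hϑ, mul_left_comm]
    refine System.gramIndicator_windowFit_le S π ϑ a _ _ _ (b := b) (Γ := Γ)
      (fun t ht => ?_) (hs n) ?_ hH.posSemidef
      (f := fun D => b * (D.vec ⬝ᵥ ((Γ ⊗ₖ H) *ᵥ D.vec)))
      (fun hGr => window_error_le hH.posSemidef hΓ hb hGr _) ω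
    · have := (Finset.mem_Icc.1 (hs n ht)).2
      omega
    · exact (Nat.mul_le_mul_right m (by omega)).trans (Nat.le_succ _)
  · rw [hKeq ϑ hϑ, mul_left_comm]
    refine System.gramIndicator_windowFit_le S π ϑ a _ _ _ (b := b) (Γ := Γ)
      (fun t ht => ?_) (hs n) ?_ hH.posSemidef
      (f := fun D => b * g * h * frob D)
      (fun hGr => frob_window_error_le hg hh hhH hgΓ hb hGr _) ω
    · have := (Finset.mem_Icc.1 (hs n ht)).2
      omega
    · exact (Nat.mul_le_mul_right m (by omega)).trans (Nat.le_succ _)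

/-- The van Trees bound for the estimation of the gain over the whole horizon. -/
theorem trace_terminal_le (hlam : IsPrior (Metric.ball θ ε) lam)
    (hw : IsNoise μ S.p w ξ) (hp : IsNoiseDensity S.p) (hR : S.R.PosDef)
    (hfin : S.FiniteInputs μ w ξ π lam) (hL : LocalBounds S θ ε₀ q c Kt) (hε : 0 < ε)
    (hε2 : ε ≤ 1 / 2) (hε₀ : ε ≤ ε₀) (ha : 0 < a)
    (hN : ∀ v, 4 * a * ‖v‖ ^ 2 ≤ quad (noiseGram S.p) v) (hm1 : 1 ≤ m) (hmT : m * m ≤ T)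
    (hC : ∀ ϑ ∈ Metric.ball θ ε, Controlled S μ w ξ π ϑ T M)
    {Γ : Matrix (Fin dx) (Fin dx) ℝ} (hΓ : Γ.PosDef)
    {Ψ : Matrix (Fin dθ) (Fin dθ) ℝ} (hΨ : Ψ.PosSemidef) {h : ℝ} (h0 : 0 ≤ h)
    (hh : ∀ D : Matrix (Fin du) (Fin dx) ℝ,
      D.vec ⬝ᵥ ((Γ ⊗ₖ S.hess θ (S.P θ)) *ᵥ D.vec) ≤ h * frob D)
    {G : Matrix (Fin dx × Fin du) (Fin dθ) ℝ}
    (hG : ∀ i j r, G (j, i) r = ∫ z : Euc dθ × Ω, pderiv r (fun ϑ => Kt ϑ i j) z.1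
        ∂(priorLaw lam μ)) :
    m * ((Γ ⊗ₖ S.hess θ (S.P θ)) * G
      * (S.bayesInfo μ w ξ π lam ((m + 1) * m) + locationInfo lam + Ψ)⁻¹ * Gᵀ).trace
      ≤ (h + 1) * (estimationConst q c a (S.noiseCost 1) dx * (1 + ε * M)) := by
  have hH : (S.hess θ (S.P θ)).PosDef := hL.hess_posDef hR
  have hKeq : ∀ ϑ ∈ Metric.ball θ ε, Kt ϑ = S.K ϑ := fun ϑ hϑ =>
    (hL.K_eq ϑ (Metric.ball_subset_ball hε₀ hϑ)).symm
  have hfit : ∀ j ∈ Finset.range m, ∀ ϑ ω, System.fitPast π m a (4 * (c * ε ^ 2)) (S.K θ) j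
      (S.past π w ξ ϑ ((m + 1) * m + 1) ω) = S.fit w ξ π ϑ m a (4 * (c * ε ^ 2)) (S.K θ) j ω :=
    fun j hj ϑ ω => S.fitPast_past π ϑ a _ _
      ((Nat.mul_le_mul_right m (by have := Finset.mem_range.1 hj; omega)).trans (Nat.le_succ _)) ω
  -- The same trace is obtained from each of the `m` estimates, all functions of the same history
  -- and with weight one. The factor `h + 1` dominates both the Kronecker form and the Frobenius
  -- norm.
  have key := System.sum_trace_le (μ := μ) (w := w) (ξ := ξ) (π := π) (b := 1) (c := 1)
    (B := (h + 1) * (estimationConst q c a (S.noiseCost 1) dx * (1 + ε * M)))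
    (V := fun j ϑ ω => (h + 1) * frob (S.fit w ξ π ϑ m a (4 * (c * ε ^ 2)) (S.K θ) j ω - S.K ϑ))
    hlam hw hp hfin (Finset.range m) (fun _ => (m + 1) * m)
    (hΓ.posSemidef.kronecker hH.posSemidef) hΨ (fun i j => (hL.K_smooth i j).of_le (by norm_num))
    (Z := fun j => System.fitPast π m a (4 * (c * ε ^ 2)) (S.K θ) j)
    (fun j => System.measurable_fitPast π _ _ _ _)
    (φ := fun _ _ => 1) (fun _ => measurable_const) (fun _ _ => by simp)
    (G := fun _ => G) (fun _ i j r => by simpa using hG i j r) one_pos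
    (fun j hj ϑ hϑ => (Controlled.integrable_frob_fit hw m a
      (hL.frob_gain_sub_le hε₀ hϑ) j).const_mul _)
    (fun ϑ hϑ => ?_) (fun j hj ϑ hϑ ω => ?_) (fun j hj ϑ hϑ ω => ?_) one_pos
  · simpa using key
  · simp only [integral_const_mul]
    rw [← Finset.mul_sum]
    exact mul_le_mul_of_nonneg_left
      ((hC ϑ hϑ).sum_integral_frob_fit_le hL hε hε2 hε₀ hϑ ha hN hm1 hmT) (by linarith)
  · rw [hKeq ϑ hϑ, hfit j hj, one_pow, one_mul, one_mul]
    refine (hh _).trans (mul_le_mul_of_nonneg_right (by linarith) (frob_nonneg _))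
  · rw [hKeq ϑ hϑ, hfit j hj, one_pow, one_mul, one_mul]
    have := frob_nonneg (S.fit w ξ π ϑ m a (4 * (c * ε ^ 2)) (S.K θ) j ω - S.K ϑ)
    nlinarith

end TraceSums

/-! ### From extended-real regret to real bounds -/

section RegretOfPolicy

variable {Ω Ξ : Type*} [MeasurableSpace Ω] [MeasurableSpace Ξ] {μ : Measure Ω}
  [IsProbabilityMeasure μ] {S : System dx du dθ} {w : ℕ → Ω → Euc dx} {ξ : Ω → Ξ}
  {π : Policy dx du Ξ} {T : ℕ} {ϑ : Euc dθ}

theorem System.regret_nonneg (hw : IsNoise μ S.p w ξ) (hp : IsNoiseDensity S.p)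
    (hQ : S.Q.PosDef) (hR : S.R.PosDef) : 0 ≤ S.regret μ w ξ π T ϑ := by
  rw [System.regret, System.cost_optPolicy hw hp hQ hR]
  refine EReal.sub_nonneg (by simp) (by simp) |>.2 ?_
  rw [EReal.coe_ennreal_le_coe_ennreal_iff]
  by_cases h : S.cost μ w ξ π T ϑ = ⊤
  · rw [h]; exact le_top
  have hu : ∀ i < T, MemLp (S.input w ξ π ϑ i) 2 μ := fun i hi =>
    System.memLp_input_of_cost_ne_top hw hQ hR h hi
  rw [System.cost_eq_ofReal hw hp hQ hR hu]
  refine ENNReal.ofReal_le_ofReal ?_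
  have h1 := System.le_sum_stageCost hw hp hR hQ T 0 (by simpa using hu)
  rw [System.stateForm_zero] at h1
  simpa using h1

/-- A finite regret forces a finite cost, hence square integrable inputs; all later computations can
be done with real numbers. -/
theorem Controlled.of_regret_le (hw : IsNoise μ S.p w ξ) (hp : IsNoiseDensity S.p)
    (hQ : S.Q.PosDef) (hR : S.R.PosDef) {M : ℝ} (hM : 0 ≤ M)
    (h : S.regret μ w ξ π T ϑ ≤ (M : EReal)) : Controlled S μ w ξ π ϑ T M := by
  set V := ∑ j ∈ Finset.range T, S.noiseCost (S.riccatiIter ϑ j) with hV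
  have hV0 : 0 ≤ V := Finset.sum_nonneg fun j _ =>
    System.noiseCost_nonneg hp (S.riccatiIter_posSemidef hR hQ j)
  rw [System.regret, System.cost_optPolicy hw hp hQ hR, ← hV] at h
  have hVe : ((ENNReal.ofReal V : ℝ≥0∞) : EReal) = ((V : ℝ) : EReal) := by
    rw [EReal.coe_ennreal_ofReal, max_eq_left hV0]
  rw [hVe] at h
  have h1 : (S.cost μ w ξ π T ϑ : EReal) ≤ ((M + V : ℝ) : EReal) := by
    rw [EReal.sub_le_iff_le_add (by simp) (by simp)] at h
    simpa using h
  have htop : S.cost μ w ξ π T ϑ ≠ ⊤ := fun ht => by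
    rw [ht, EReal.coe_ennreal_top] at h1
    exact absurd (top_le_iff.1 h1) (EReal.coe_ne_top _)
  have hu : ∀ i < T, MemLp (S.input w ξ π ϑ i) 2 μ := fun i hi =>
    System.memLp_input_of_cost_ne_top hw hQ hR htop hi
  refine ⟨hw, hp, hQ, hR, hu, hM, ?_⟩
  rw [System.cost_eq_ofReal hw hp hQ hR hu, EReal.coe_ennreal_ofReal, EReal.coe_le_coe_iff] at h1
  exact (le_max_left _ _).trans h1

end RegretOfPolicy

/-! ### Averages over the prior -/

section Averages

variable {Ω Ξ : Type*} [MeasurableSpace Ω] [MeasurableSpace Ξ] {μ : Measure Ω}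
  [IsProbabilityMeasure μ] {S : System dx du dθ} {w : ℕ → Ω → Euc dx} {ξ : Ω → Ξ}
  {π : Policy dx du Ξ} {U : Set (Euc dθ)} {lam : Euc dθ → ℝ}

theorem IsPrior.isProbabilityMeasure_priorLaw (h : IsPrior U lam) :
    IsProbabilityMeasure (priorLaw lam μ) := by
  have := h.isProbabilityMeasure
  unfold priorLaw
  infer_instance

theorem IsPrior.ae_mem (h : IsPrior U lam) (hU : MeasurableSet U) :
    ∀ᵐ z ∂(priorLaw lam μ), z.1 ∈ U := by
  have hm : MeasurableSet {z : Euc dθ × Ω | z.1 ∉ U} := measurable_fst hU.compl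
  rw [ae_iff, ← lintegral_indicator_one hm,
    h.lintegral_priorLaw (measurable_one.indicator hm), lintegral_eq_zero_iff']
  · refine ae_of_all _ fun θ => ?_
    by_cases hθ : θ ∈ U
    · simp [Set.indicator, hθ]
    · simp [h.eq_zero hθ]
  · exact (h.measurable.ennreal_ofReal.mul
      (measurable_one.indicator hm).lintegral_prod_right').aemeasurable

/-- The average of a function over the prior, when the function is almost constant. -/
theorem IsPrior.abs_integral_mul_sub_le (h : IsPrior U lam) (hU : MeasurableSet U)
    {φ : Euc dθ × Ω → ℝ} (hφ : Measurable φ) (h0 : ∀ z, 0 ≤ φ z) (h1 : ∀ z, |φ z| ≤ 1)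
    {g : Euc dθ → ℝ} (hg : Measurable g) {d κ : ℝ} (hgd : ∀ ϑ ∈ U, |g ϑ - d| ≤ κ) :
    |∫ z, φ z * g z.1 ∂(priorLaw lam μ) - (∫ z, φ z ∂(priorLaw lam μ)) * d|
      ≤ κ * ∫ z, φ z ∂(priorLaw lam μ) := by
  have := h.isProbabilityMeasure_priorLaw (μ := μ)
  have hφi : Integrable φ (priorLaw lam μ) :=
    Integrable.of_bound hφ.aestronglyMeasurable 1 (ae_of_all _ h1)
  have hae := h.ae_mem (μ := μ) hU
  have hb : ∀ᵐ z ∂(priorLaw lam μ), ‖φ z * (g z.1 - d)‖ ≤ κ * φ z := by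
    filter_upwards [hae] with z hz
    rw [Real.norm_eq_abs, abs_mul, abs_of_nonneg (h0 z), mul_comm]
    exact mul_le_mul_of_nonneg_right (hgd _ hz) (h0 z)
  have hm : Measurable fun z : Euc dθ × Ω => φ z * (g z.1 - d) :=
    hφ.mul ((hg.comp measurable_fst).sub_const d)
  have hi : Integrable (fun z : Euc dθ × Ω => φ z * (g z.1 - d)) (priorLaw lam μ) :=
    (hφi.const_mul κ).mono' hm.aestronglyMeasurable hb
  have hid : Integrable (fun z => φ z * d) (priorLaw lam μ) := hφi.mul_const d
  have e : ∫ z, φ z * g z.1 ∂(priorLaw lam μ) - (∫ z, φ z ∂(priorLaw lam μ)) * d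
      = ∫ z, φ z * (g z.1 - d) ∂(priorLaw lam μ) := by
    rw [← integral_mul_const, sub_eq_iff_eq_add, ← integral_add hi hid]
    refine integral_congr_ae (ae_of_all _ fun z => ?_)
    ring
  rw [e, ← integral_const_mul]
  exact norm_integral_le_of_norm_le (hφi.const_mul κ) hb

theorem System.gramIndicator_nonneg {T : ℕ} (s : Finset ℕ) (M : Matrix (Fin dx) (Fin dx) ℝ)
    (y : Ξ × (Fin (T + 1) → Euc dx)) : 0 ≤ gramIndicator s M y := by
  unfold gramIndicator
  split_ifs <;> simp

/-- The event involves the states up to `(k + 1) ⌊√T⌋` only, so its indicator is a function of the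
history entering the information. -/
theorem System.bayesProb_eq (hlam : IsPrior U lam) (hw : IsNoise μ S.p w ξ)
    (Γ : Matrix (Fin dx) (Fin dx) ℝ) (T k : ℕ) :
    S.bayesProb μ w ξ π lam Γ T k = ∫ z : Euc dθ × Ω, System.gramIndicator
      (Finset.Icc (k * ⌈√(T : ℝ)⌉₊) ((k + 1) * ⌊√(T : ℝ)⌋₊)) (√(T : ℝ) • Γ)
      (S.past π w ξ z.1 ((k + 1) * ⌊√(T : ℝ)⌋₊ + 1) z.2) ∂(priorLaw lam μ) := by
  set s := Finset.Icc (k * ⌈√(T : ℝ)⌉₊) ((k + 1) * ⌊√(T : ℝ)⌋₊) with hs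
  have := hlam.isProbabilityMeasure_priorLaw (μ := μ)
  have hm : Measurable fun z : Euc dθ × Ω => System.gramIndicator s (√(T : ℝ) • Γ)
      (S.past π w ξ z.1 ((k + 1) * ⌊√(T : ℝ)⌋₊ + 1) z.2) :=
    (System.measurable_gramIndicator s _).comp
      (S.measurable_past_uncurry π hw.measurable_w hw.measurable_ξ _)
  rw [hlam.integral_priorLaw (Integrable.of_bound hm.aestronglyMeasurable 1
    (ae_of_all _ fun z => System.abs_gramIndicator_le s _ _)), System.bayesProb]
  refine integral_congr_ae (ae_of_all _ fun θ => ?_)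
  have e : ∀ ω, System.gramIndicator s (√(T : ℝ) • Γ)
      (S.past π w ξ θ ((k + 1) * ⌊√(T : ℝ)⌋₊ + 1) ω)
      = (S.gramEvent w ξ π Γ T k θ).indicator 1 ω := fun ω => by
    have hgr : gramSum s (fun t => System.pastState t
        (S.past π w ξ θ ((k + 1) * ⌊√(T : ℝ)⌋₊ + 1) ω))
        = gramSum s fun t => S.state w ξ π θ t ω :=
      gramSum_congr fun t ht => S.pastState_past π
        (by have := (Finset.mem_Icc.1 ht).2; omega) θ ω
    rw [System.gramIndicator, hgr]
    simp only [Set.indicator, System.gramEvent, Set.mem_ofPred_eq, Pi.one_apply, gramSum]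
    rfl
  have hset : MeasurableSet (S.gramEvent w ξ π Γ T k θ) := by
    have h1 : Measurable fun ω => System.gramIndicator s (√(T : ℝ) • Γ)
      (S.past π w ξ θ ((k + 1) * ⌊√(T : ℝ)⌋₊ + 1) ω) :=
      (System.measurable_gramIndicator s _).comp
        (S.measurable_past π hw.measurable_w hw.measurable_ξ θ _)
    have h2 : S.gramEvent w ξ π Γ T k θ = {ω | System.gramIndicator s (√(T : ℝ) • Γ)
      (S.past π w ξ θ ((k + 1) * ⌊√(T : ℝ)⌋₊ + 1) ω) = 1} := by
      ext ω
      simp [e, Set.indicator]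
    rw [h2]
    exact h1 (measurableSet_singleton 1)
  simp only [e]
  rw [integral_indicator_one hset]

end Averages

/-! ### Rescaling the Jacobian -/

section Combination

/-- For `E₂ = f D - J` the perturbed Jacobian is `f D`, and the factor `f²` comes out of the trace.
-/
theorem trace_rescaled {ι κ : Type*} [Fintype ι] [Fintype κ] (W : Matrix ι ι ℝ)
    (J D : Matrix ι κ ℝ) (Y : Matrix κ κ ℝ) (f b : ℝ) :
    (W * (J + (f • D - J)) * (b • Y) * (J + (f • D - J))ᵀ).trace
      = f ^ 2 * (b * (W * D * Y * Dᵀ).trace) := by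
  rw [add_sub_cancel]
  simp only [Matrix.transpose_smul, Matrix.mul_smul, Matrix.smul_mul, Matrix.trace_smul,
    smul_eq_mul]
  ring

theorem trace_smul_conj {ι κ : Type*} [Fintype ι] [Fintype κ] (W : Matrix ι ι ℝ)
    (D : Matrix ι κ ℝ) (Y : Matrix κ κ ℝ) (f : ℝ) :
    (W * (f • D) * Y * (f • D)ᵀ).trace = f ^ 2 * (W * D * Y * Dᵀ).trace := by
  simp only [Matrix.transpose_smul, Matrix.mul_smul, Matrix.smul_mul, Matrix.trace_smul,
    smul_eq_mul]
  ring

/-- The square root of `1 / (1 + a ε)`. -/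
theorem exists_shrinkage {a ε : ℝ} (ha : 0 ≤ a) (hε : 0 < ε) :
    ∃ f : ℝ, 0 ≤ f ∧ f ≤ 1 ∧ 1 - f ≤ a * ε ∧ f ^ 2 * (1 + a * ε) = 1 := by
  have h1 : 0 < 1 + a * ε := by positivity
  have h2 : (√(1 / (1 + a * ε))) ^ 2 = 1 / (1 + a * ε) := Real.sq_sqrt (by positivity)
  set f := √(1 / (1 + a * ε)) with hf
  have h0 : 0 ≤ f := Real.sqrt_nonneg _
  have h3 : f ^ 2 * (1 + a * ε) = 1 := by rw [h2]; field_simp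
  have h4 : f ≤ 1 := by
    by_contra hlt
    push Not at hlt
    nlinarith [mul_nonneg ha hε.le]
  refine ⟨f, h0, h4, ?_, h3⟩
  have h5 : f ^ 2 ≤ f := by nlinarith
  nlinarith [mul_nonneg ha hε.le]

theorem abs_rescaled_sub_le {f x d κ a ε : ℝ} (hf0 : 0 ≤ f) (hf1 : f ≤ 1) (hf : 1 - f ≤ a * ε)
    (hx : |x - d| ≤ κ) : |f * x - d| ≤ κ + a * ε * |d| := by
  have e : f * x - d = f * (x - d) - (1 - f) * d := by ring
  rw [e]
  refine (abs_sub _ _).trans ?_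
  rw [abs_mul, abs_mul, abs_of_nonneg hf0, abs_of_nonneg (by linarith : 0 ≤ 1 - f)]
  exact add_le_add ((mul_le_of_le_one_left (abs_nonneg _) hf1).trans hx)
    (mul_le_mul_of_nonneg_right hf (abs_nonneg _))

end Combination

/-! ### Summing over all windows -/

section MainBound

variable {Ω Ξ : Type*} [MeasurableSpace Ω] [MeasurableSpace Ξ] {μ : Measure Ω}
  [IsProbabilityMeasure μ] {S : System dx du dθ} {w : ℕ → Ω → Euc dx} {ξ : Ω → Ξ}
  {π : Policy dx du Ξ} {lam : Euc dθ → ℝ} {θ : Euc dθ} {ε₀ q c ε a M : ℝ}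
  {Kt : Euc dθ → Matrix (Fin du) (Fin dx) ℝ} {T : ℕ}

/-- The number of windows is `⌊√T⌋ - 1` when `T` is a perfect square and `⌊√T⌋` otherwise; in the
second case the last window needs separate treatment. -/
theorem floor_sqrt_bounds (hT : 1 ≤ T) :
    1 ≤ ⌊√(T : ℝ)⌋₊ ∧ ⌊√(T : ℝ)⌋₊ * ⌊√(T : ℝ)⌋₊ ≤ T ∧ √(T : ℝ) ≤ 2 * (⌊√(T : ℝ)⌋₊ : ℝ) ∧
      (⌊√((T : ℝ) - 1)⌋₊ = ⌊√(T : ℝ)⌋₊ - 1 ∨ ⌊√((T : ℝ) - 1)⌋₊ = ⌊√(T : ℝ)⌋₊) := by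
  have hT' : (1 : ℝ) ≤ T := by exact_mod_cast hT
  set m := ⌊√(T : ℝ)⌋₊ with hm
  have h1 : 1 ≤ m := by
    rw [hm, Nat.one_le_floor_iff]
    exact Real.one_le_sqrt.2 hT'
  have h2 : (m : ℝ) ≤ √(T : ℝ) := Nat.floor_le (Real.sqrt_nonneg _)
  have h3 : √(T : ℝ) < m + 1 := Nat.lt_floor_add_one _
  have h1' : (1 : ℝ) ≤ m := by exact_mod_cast h1
  have h4 : (m : ℝ) * m ≤ T := by
    rw [← Real.mul_self_sqrt (by linarith : (0 : ℝ) ≤ T)]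
    exact mul_self_le_mul_self (by linarith) h2
  refine ⟨h1, by exact_mod_cast h4, by linarith, ?_⟩
  have h5 : ⌊√((T : ℝ) - 1)⌋₊ ≤ m := Nat.floor_le_floor (Real.sqrt_le_sqrt (by linarith))
  have h6 : m - 1 ≤ ⌊√((T : ℝ) - 1)⌋₊ := by
    refine Nat.le_floor ?_
    rw [Nat.cast_sub h1, Nat.cast_one]
    refine Real.le_sqrt_of_sq_le ?_
    nlinarith
  omega

theorem System.bayesProb_mem_Icc (hlam : IsPrior (Metric.ball θ ε) lam) (hw : IsNoise μ S.p w ξ)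
    (Γ : Matrix (Fin dx) (Fin dx) ℝ) (k : ℕ) :
    0 ≤ S.bayesProb μ w ξ π lam Γ T k ∧ S.bayesProb μ w ξ π lam Γ T k ≤ 1 := by
  have := hlam.isProbabilityMeasure_priorLaw (μ := μ)
  rw [System.bayesProb_eq hlam hw]
  refine ⟨integral_nonneg fun z => System.gramIndicator_nonneg _ _ _, ?_⟩
  have h := norm_integral_le_of_norm_le_const (μ := priorLaw lam μ) (C := 1)
    (f := fun z : Euc dθ × Ω => System.gramIndicator
      (Finset.Icc (k * ⌈√(T : ℝ)⌉₊) ((k + 1) * ⌊√(T : ℝ)⌋₊)) (√(T : ℝ) • Γ)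
      (S.past π w ξ z.1 ((k + 1) * ⌊√(T : ℝ)⌋₊ + 1) z.2))
    (ae_of_all _ fun z => System.abs_gramIndicator_le _ _ _)
  simp only [probReal_univ, mul_one] at h
  exact (le_abs_self _).trans h

variable (μ S w ξ π lam Kt) in
/-- The average over the prior of the Jacobian of the gain on the event of a large Gramian. -/
def windowJacobian (Γ : Matrix (Fin dx) (Fin dx) ℝ) (T k : ℕ) :
    Matrix (Fin dx × Fin du) (Fin dθ) ℝ :=
  Matrix.of fun p r => ∫ z : Euc dθ × Ω, System.gramIndicator
    (Finset.Icc (k * ⌈√(T : ℝ)⌉₊) ((k + 1) * ⌊√(T : ℝ)⌋₊)) (√(T : ℝ) • Γ)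
    (S.past π w ξ z.1 ((k + 1) * ⌊√(T : ℝ)⌋₊ + 1) z.2) * pderiv r (fun ϑ => Kt ϑ p.2 p.1) z.1
      ∂(priorLaw lam μ)

variable (μ lam Kt) in
/-- The average over the prior of the Jacobian of the gain. -/
def priorJacobian : Matrix (Fin dx × Fin du) (Fin dθ) ℝ :=
  Matrix.of fun p r => ∫ z : Euc dθ × Ω, pderiv r (fun ϑ => Kt ϑ p.2 p.1) z.1 ∂(priorLaw lam μ)

/-- The constant in the bound for the sum of the information terms. -/
def boundConst (q c a σ d h : ℝ) : ℝ :=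
  virtualConst q c a σ d + 2 * ((h + 1) * estimationConst q c a σ d)

theorem boundConst_nonneg {q c a σ d h : ℝ} (hq : 0 < q) (hc : 1 ≤ c) (ha : 0 < a) (hσ : 0 ≤ σ)
    (h0 : 0 ≤ h) : 0 ≤ boundConst q c a σ d h := by
  have h1 := estimationConst_nonneg (d := d) hq hc ha hσ
  have h2 := lossConst_nonneg (d := d) hq hc ha hσ
  unfold boundConst virtualConst
  positivity

/-- The windows with `k < ⌊√T⌋` end inside the horizon and share the regret budget. The term `k =
⌊√T⌋`, if present, is bounded by the terminal estimate with the Jacobian averaged over the whole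
prior. -/
theorem sum_trace_terms_le (hlam : IsPrior (Metric.ball θ ε) lam)
    (hw : IsNoise μ S.p w ξ) (hp : IsNoiseDensity S.p) (hR : S.R.PosDef)
    (hfin : S.FiniteInputs μ w ξ π lam) (hL : LocalBounds S θ ε₀ q c Kt) (hε : 0 < ε)
    (hε2 : ε ≤ 1 / 2) (hε₀ : ε ≤ ε₀) (ha : 0 < a)
    (hN : ∀ v, 4 * a * ‖v‖ ^ 2 ≤ quad (noiseGram S.p) v) (hT : 1 ≤ T)
    (hM : 0 ≤ M) (hC : ∀ ϑ ∈ Metric.ball θ ε, Controlled S μ w ξ π ϑ T M)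
    {Γ : Matrix (Fin dx) (Fin dx) ℝ} (hΓ : Γ.PosDef)
    {Ψ : Matrix (Fin dθ) (Fin dθ) ℝ} (hΨ : Ψ.PosSemidef) {h : ℝ} (h0 : 0 ≤ h)
    (hh : ∀ D : Matrix (Fin du) (Fin dx) ℝ,
      D.vec ⬝ᵥ ((Γ ⊗ₖ S.hess θ (S.P θ)) *ᵥ D.vec) ≤ h * frob D)
    {D : ℕ → Matrix (Fin dx × Fin du) (Fin dθ) ℝ}
    (hD : ∀ k, k ≠ ⌊√(T : ℝ)⌋₊ → S.bayesProb μ w ξ π lam Γ T k • D k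
      = windowJacobian μ S w ξ π lam Kt Γ T k)
    (hDm : D ⌊√(T : ℝ)⌋₊ = priorJacobian μ lam Kt) :
    ∑ k ∈ Finset.Icc 1 ⌊√((T : ℝ) - 1)⌋₊, S.bayesProb μ w ξ π lam Γ T k ^ 2
      * (√(T : ℝ) * ((Γ ⊗ₖ S.hess θ (S.P θ)) * D k
        * (S.bayesInfo μ w ξ π lam ((k + 1) * ⌊√(T : ℝ)⌋₊) + locationInfo lam + Ψ)⁻¹
        * (D k)ᵀ).trace) ≤ M + boundConst q c a (S.noiseCost 1) dx h * (1 + ε * M) := by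
  obtain ⟨hm1, hmT, hm2, hn⟩ := floor_sqrt_bounds hT
  set m := ⌊√(T : ℝ)⌋₊ with hm
  set b := √(T : ℝ) with hbdef
  have hb : 0 < b := Real.sqrt_pos.2 (by exact_mod_cast hT)
  set f : ℕ → ℝ := fun k => S.bayesProb μ w ξ π lam Γ T k ^ 2
      * (b * ((Γ ⊗ₖ S.hess θ (S.P θ)) * D k
        * (S.bayesInfo μ w ξ π lam ((k + 1) * m) + locationInfo lam + Ψ)⁻¹
        * (D k)ᵀ).trace) with hf
  have hwin : ∑ k ∈ Finset.Icc 1 (m - 1), f k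
      ≤ M + virtualConst q c a (S.noiseCost 1) dx * (1 + ε * M) := by
    have h1 := sum_window_trace_le (μ := μ) (w := w) (ξ := ξ) (π := π) (T := T) (M := M)
      (s := fun n => Finset.Icc ((n + 1) * ⌈b⌉₊) ((n + 1 + 1) * m))
      (G := fun n => windowJacobian μ S w ξ π lam Kt Γ T (n + 1)) hlam hw hp hR hfin hL hε hε2 hε₀
      ha hN hm1 hmT hC hΓ hΨ hb
      (fun n => Finset.Icc_subset_Icc_left (Nat.mul_le_mul_left _ (Nat.floor_le_ceil b)))
      (fun n i j r => rfl)
    refine le_trans (le_of_eq ?_) h1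
    rw [Finset.range_eq_Ico, Finset.sum_Ico_add' (fun k => b * ((Γ ⊗ₖ S.hess θ (S.P θ))
      * windowJacobian μ S w ξ π lam Kt Γ T k * (S.bayesInfo μ w ξ π lam ((k + 1) * m)
        + locationInfo lam + Ψ)⁻¹ * (windowJacobian μ S w ξ π lam Kt Γ T k)ᵀ).trace) 0 (m - 1) 1]
    have hI : Finset.Ico (0 + 1) (m - 1 + 1) = Finset.Icc 1 (m - 1) := by
      ext k
      simp only [Finset.mem_Ico, Finset.mem_Icc]
      omega
    rw [hI]
    refine Finset.sum_congr rfl fun k hk => ?_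
    have hkm : k ≠ m := by have := (Finset.mem_Icc.1 hk).2; omega
    rw [hf, ← hD k hkm, trace_smul_conj]
    ring
  have hest : 0 ≤ estimationConst q c a (S.noiseCost 1) dx :=
    estimationConst_nonneg hL.q_pos hL.one_le ha
      (System.noiseCost_nonneg hp Matrix.PosSemidef.one)
  set B := (h + 1) * (estimationConst q c a (S.noiseCost 1) dx * (1 + ε * M)) with hB
  have hB0 : 0 ≤ B := by positivity
  have hlast : f m ≤ 2 * B := by
    have h1 := trace_terminal_le (μ := μ) (w := w) (ξ := ξ) (π := π) (T := T) (M := M) (m := m)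
      (G := priorJacobian μ lam Kt) hlam hw hp hR hfin hL hε hε2 hε₀
      ha hN hm1 hmT hC hΓ hΨ h0 hh (fun i j r => rfl)
    obtain ⟨hP0, hP1⟩ := System.bayesProb_mem_Icc (π := π) (T := T) hlam hw Γ m
    simp only [hf]
    rw [hDm]
    set t := ((Γ ⊗ₖ S.hess θ (S.P θ)) * priorJacobian μ lam Kt
        * (S.bayesInfo μ w ξ π lam ((m + 1) * m) + locationInfo lam + Ψ)⁻¹
        * (priorJacobian μ lam Kt)ᵀ).trace with ht
    have hP2 : S.bayesProb μ w ξ π lam Γ T m ^ 2 ≤ 1 := pow_le_one₀ hP0 hP1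
    rcases le_total t 0 with ht0 | ht0
    · have : S.bayesProb μ w ξ π lam Γ T m ^ 2 * (b * t) ≤ 0 :=
        mul_nonpos_of_nonneg_of_nonpos (sq_nonneg _) (mul_nonpos_of_nonneg_of_nonpos hb.le ht0)
      linarith
    · calc S.bayesProb μ w ξ π lam Γ T m ^ 2 * (b * t) ≤ 1 * (b * t) :=
            mul_le_mul_of_nonneg_right hP2 (mul_nonneg hb.le ht0)
        -- The terminal estimate has the factor `m = ⌊√T⌋`, and `√T ≤ 2 m`.
        _ ≤ 2 * (m * t) := by nlinarith
        _ ≤ 2 * B := by linarith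
  have htot : M + boundConst q c a (S.noiseCost 1) dx h * (1 + ε * M)
      = M + virtualConst q c a (S.noiseCost 1) dx * (1 + ε * M) + 2 * B := by
    rw [hB, boundConst]; ring
  rw [htot]
  rcases hn with hn | hn
  · rw [hn]
    linarith
  · rw [hn]
    have hI : Finset.Icc 1 m = insert m (Finset.Icc 1 (m - 1)) := by
      ext k
      simp only [Finset.mem_insert, Finset.mem_Icc]
      omega
    rw [hI, Finset.sum_insert (by simp; omega)]
    linarith

end MainBound

/-! ### Choice of the perturbed Jacobians -/

section MainTheorem

variable {Ω Ξ : Type*} [MeasurableSpace Ω] [MeasurableSpace Ξ] {μ : Measure Ω}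
  [IsProbabilityMeasure μ] {S : System dx du dθ} {w : ℕ → Ω → Euc dx} {ξ : Ω → Ξ}
  {π : Policy dx du Ξ} {lam : Euc dθ → ℝ} {θ : Euc dθ} {ε₀ q c ε a M : ℝ}
  {Kt : Euc dθ → Matrix (Fin du) (Fin dx) ℝ} {T : ℕ}

theorem LocalBounds.jacobian_apply (hL : LocalBounds S θ ε₀ q c Kt) (p : Fin dx × Fin du)
    (r : Fin dθ) : jacobian (fun ϑ => (S.K ϑ).vec) θ p r
      = pderiv r (fun ϑ => Kt ϑ p.2 p.1) θ := by
  have h : (fun ϑ => (S.K ϑ).vec p) =ᶠ[𝓝 θ] fun ϑ => Kt ϑ p.2 p.1 := by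
    filter_upwards [Metric.ball_mem_nhds θ hL.eps_pos] with ϑ hϑ
    rw [hL.K_eq ϑ hϑ]
    rfl
  rw [jacobian, Matrix.of_apply, h.fderiv_eq]

/-- Dividing by the probability of the event turns the average on the event into a conditional mean
of a Jacobian that varies by at most `c ε` on the ball. If the probability is zero, so is the
average, and the nominal Jacobian may be taken. The index `m` belongs to the terminal window, where
no event is used. -/
theorem exists_averaged_jacobian (hlam : IsPrior (Metric.ball θ ε) lam)
    (hw : IsNoise μ S.p w ξ) (hL : LocalBounds S θ ε₀ q c Kt) (hε : 0 < ε)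
    (Γ : Matrix (Fin dx) (Fin dx) ℝ) (m : ℕ) :
    ∃ D : ℕ → Matrix (Fin dx × Fin du) (Fin dθ) ℝ,
      (∀ k, k ≠ m → S.bayesProb μ w ξ π lam Γ T k • D k = windowJacobian μ S w ξ π lam Kt Γ T k) ∧
      D m = priorJacobian μ lam Kt ∧
      ∀ k p r, |D k p r - jacobian (fun ϑ => (S.K ϑ).vec) θ p r| ≤ c * ε := by
  have := hlam.isProbabilityMeasure_priorLaw (μ := μ)
  have hball : MeasurableSet (Metric.ball θ ε) := measurableSet_ball
  have hpm : ∀ p : Fin dx × Fin du, ∀ r, Measurable fun ϑ => pderiv r (fun ϑ => Kt ϑ p.2 p.1) ϑ :=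
    fun p r => measurable_fderiv_apply_const ℝ _ _
  have hc : 0 ≤ c := by have := hL.one_le; linarith
  have hlip : ∀ p : Fin dx × Fin du, ∀ r, ∀ ϑ ∈ Metric.ball θ ε,
      |pderiv r (fun ϑ => Kt ϑ p.2 p.1) ϑ - jacobian (fun ϑ => (S.K ϑ).vec) θ p r| ≤ c * ε :=
    fun p r ϑ hϑ => by
    rw [hL.jacobian_apply]
    exact (hL.dK_lip ϑ p.2 p.1 r).trans
      (mul_le_mul_of_nonneg_left (Metric.mem_ball.1 hϑ).le hc)
  have hwin : ∀ k p r, |windowJacobian μ S w ξ π lam Kt Γ T k p r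
      - S.bayesProb μ w ξ π lam Γ T k * jacobian (fun ϑ => (S.K ϑ).vec) θ p r|
        ≤ c * ε * S.bayesProb μ w ξ π lam Γ T k := fun k p r => by
    rw [System.bayesProb_eq hlam hw]
    refine hlam.abs_integral_mul_sub_le hball ?_ (fun z => System.gramIndicator_nonneg _ _ _)
      (fun z => System.abs_gramIndicator_le _ _ _) (hpm p r) (hlip p r)
    exact (System.measurable_gramIndicator _ _).comp
      (S.measurable_past_uncurry π hw.measurable_w hw.measurable_ξ _)
  have hprior : ∀ p r, |priorJacobian μ lam Kt p r
      - jacobian (fun ϑ => (S.K ϑ).vec) θ p r| ≤ c * ε := fun p r => by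
    have h1 := hlam.abs_integral_mul_sub_le (μ := μ) hball (φ := fun _ => 1) measurable_const
      (fun _ => zero_le_one) (fun _ => by simp) (hpm p r) (hlip p r)
    simpa [priorJacobian] using h1
  refine ⟨fun k => if k = m then priorJacobian μ lam Kt
    else if S.bayesProb μ w ξ π lam Γ T k = 0 then jacobian (fun ϑ => (S.K ϑ).vec) θ
    else (S.bayesProb μ w ξ π lam Γ T k)⁻¹ • windowJacobian μ S w ξ π lam Kt Γ T k,
    fun k hk => ?_, by simp, fun k p r => ?_⟩
  · simp only
    rw [if_neg hk]
    split_ifs with h0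
    · ext p r
      have h1 := hwin k p r
      rw [h0, zero_mul, mul_zero, sub_zero] at h1
      rw [h0, zero_smul, Matrix.zero_apply, abs_nonpos_iff.1 h1]
    · rw [smul_smul, mul_inv_cancel₀ h0, one_smul]
  · simp only
    split_ifs with hk h0
    · exact hprior p r
    · rw [sub_self, abs_zero]
      positivity
    · have hP : 0 < S.bayesProb μ w ξ π lam Γ T k :=
        lt_of_le_of_ne (System.bayesProb_mem_Icc hlam hw Γ k).1 (Ne.symm h0)
      have h1 := hwin k p r
      rw [Matrix.smul_apply, smul_eq_mul]
      have e : (S.bayesProb μ w ξ π lam Γ T k)⁻¹ * windowJacobian μ S w ξ π lam Kt Γ T k p r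
          - jacobian (fun ϑ => (S.K ϑ).vec) θ p r = (S.bayesProb μ w ξ π lam Γ T k)⁻¹
          * (windowJacobian μ S w ξ π lam Kt Γ T k p r
            - S.bayesProb μ w ξ π lam Γ T k * jacobian (fun ϑ => (S.K ϑ).vec) θ p r) := by
        field_simp
      rw [e, abs_mul, abs_of_pos (inv_pos.2 hP), inv_mul_le_iff₀ hP]
      linarith

end MainTheorem

end LQR

end

/-! ### Assembly of the constants -/

theorem mainTheorem4 {dx du dθ : ℕ} (S : LQR.System dx du dθ)
    (θ : LQR.Euc dθ) (hS : S.IsInstance θ)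
    (Γ : Matrix (Fin dx) (Fin dx) ℝ) (hΓ : Γ.PosDef) :
    ∃ C : ℝ, 0 < C ∧
      ∀ (ε : ℝ), 0 < ε →
      ∀ (lam : LQR.Euc dθ → ℝ), LQR.IsPrior (Metric.ball θ ε) lam →
      ∀ (Ψ : Matrix (Fin dθ) (Fin dθ) ℝ), Ψ.PosSemidef →
      ∀ (Ω : Type*) [MeasurableSpace Ω] (μ : Measure Ω) [IsProbabilityMeasure μ]
        (Ξ : Type*) [MeasurableSpace Ξ] (w : ℕ → Ω → LQR.Euc dx) (ξ : Ω → Ξ),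
        LQR.IsNoise μ S.p w ξ →
      ∀ (π : LQR.Policy dx du Ξ), S.FiniteInputs μ w ξ π lam →
      ∀ (T : ℕ), 1 ≤ T →
      ∃ (E₁ : ℕ → Matrix (Fin du) (Fin du) ℝ) (E₂ : ℕ → Matrix (Fin dx × Fin du) (Fin dθ) ℝ),
        (∀ k i j, |E₁ k i j| ≤ C * ε) ∧ (∀ k i j, |E₂ k i j| ≤ C * ε) ∧
        (((∑ k ∈ Finset.Icc 1 ⌊√((T : ℝ) - 1)⌋₊,
            (S.bayesProb μ w ξ π lam Γ T k) ^ 2 *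
              Matrix.trace
                ((Γ ⊗ₖ (S.R + (S.B θ)ᵀ * S.P θ * S.B θ + E₁ k))
                  * (LQR.jacobian (fun ϑ => (S.K ϑ).vec) θ + E₂ k)
                  * (√(T : ℝ) • (S.bayesInfo μ w ξ π lam ((k + 1) * ⌊√(T : ℝ)⌋₊)
                      + LQR.locationInfo lam + Ψ)⁻¹)
                  * (LQR.jacobian (fun ϑ => (S.K ϑ).vec) θ + E₂ k)ᵀ)) - C : ℝ) : EReal)
          ≤ ⨆ θ' ∈ Metric.ball θ ε, S.regret μ w ξ π T θ' := by
  obtain ⟨ε₀, q, c, Kt, hL⟩ := LQR.exists_localBounds hS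
  obtain ⟨g, hg, hgN⟩ := (LQR.noiseGram_posDef hS.noise).exists_norm_sq_le
  obtain ⟨h, h0, hh⟩ := LQR.exists_kronecker_le Γ (S.hess θ (S.P θ))
  set a := g / 4 with ha_def
  have ha : 0 < a := by positivity
  have hN : ∀ v, 4 * a * ‖v‖ ^ 2 ≤ LQR.quad (LQR.noiseGram S.p) v := fun v => by
    rw [ha_def, mul_div_cancel₀ _ (by norm_num)]
    exact hgN v
  set J := LQR.jacobian (fun ϑ => (S.K ϑ).vec) θ with hJ
  set d := ∑ p, ∑ r, |J p r| with hd
  have hd0 : 0 ≤ d := Finset.sum_nonneg fun _ _ => Finset.sum_nonneg fun _ _ => abs_nonneg _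
  have hJd : ∀ p r, |J p r| ≤ d := fun p r =>
    (Finset.single_le_sum (f := fun r => |J p r|) (fun _ _ => abs_nonneg _)
      (Finset.mem_univ r)).trans (Finset.single_le_sum (f := fun p => ∑ r, |J p r|)
        (fun _ _ => Finset.sum_nonneg fun _ _ => abs_nonneg _) (Finset.mem_univ p))
  set b := LQR.boundConst q c a (S.noiseCost 1) dx h with hb
  have hσ : 0 ≤ S.noiseCost 1 := LQR.System.noiseCost_nonneg hS.noise Matrix.PosSemidef.one
  have hb0 : 0 ≤ b := LQR.boundConst_nonneg hL.q_pos hL.one_le ha hσ h0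
  have hc0 : 0 < c := one_pos.trans_le hL.one_le
  have hε₀ := hL.eps_pos
  -- The threshold below which the local analysis applies.
  set ε₁ := min (1 / 2) ε₀ with hε₁
  have hε₁0 : 0 < ε₁ := lt_min (by norm_num) hε₀
  have hdiv : 0 ≤ d / ε₁ := div_nonneg hd0 hε₁0.le
  -- `b` is the additive loss, `c + b d` bounds the perturbation of the Jacobian divided by `ε`, and
  -- `d / ε₁` serves the case of large `ε`.
  refine ⟨b + c + b * d + d / ε₁, by positivity, ?_⟩
  intro ε hε lam hlam Ψ hΨ Ω _ μ _ Ξ _ w ξ hw π hfin T hT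
  have hreg0 : (0 : EReal) ≤ ⨆ θ' ∈ Metric.ball θ ε, S.regret μ w ξ π T θ' :=
    (S.regret_nonneg hw hS.noise hS.Q_posDef hS.R_posDef (π := π) (T := T) (ϑ := θ)).trans
      (le_biSup (fun θ' => S.regret μ w ξ π T θ') (Metric.mem_ball_self hε))
  have hE1 : ∀ (k : ℕ) (i j : Fin du),
      |(fun _ => 0 : ℕ → Matrix (Fin du) (Fin du) ℝ) k i j| ≤ (b + c + b * d + d / ε₁) * ε :=
    fun k i j => by
      change |(0 : ℝ)| ≤ _
      rw [abs_zero]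
      positivity
  by_cases hlarge : ε₁ ≤ ε
  -- For large `ε` the perturbation may cancel the Jacobian; the bound then follows from
  -- nonnegativity of the regret.
  · refine ⟨fun _ => 0, fun _ => -J, hE1, fun k i j => ?_, ?_⟩
    · change |-(J i j)| ≤ _
      rw [abs_neg]
      calc |J i j| ≤ d := hJd i j
        _ = d / ε₁ * ε₁ := by field_simp
        _ ≤ d / ε₁ * ε := mul_le_mul_of_nonneg_left hlarge hdiv
        _ ≤ _ := mul_le_mul_of_nonneg_right (by nlinarith [mul_nonneg hb0 hd0]) hε.le
    · refine le_trans ?_ hreg0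
      have hneg : -(b + c + b * d + d / ε₁) ≤ 0 := by
        have := mul_nonneg hb0 hd0
        linarith
      rw [← EReal.coe_zero, EReal.coe_le_coe_iff]
      simp only [add_neg_cancel, Matrix.mul_zero, Matrix.zero_mul, Matrix.trace_zero, mul_zero,
        Finset.sum_const_zero, zero_sub]
      exact hneg
  push Not at hlarge
  have hε2 : ε ≤ 1 / 2 := hlarge.le.trans (min_le_left _ _)
  have hεε₀ : ε ≤ ε₀ := hlarge.le.trans (min_le_right _ _)
  -- Shrinking the Jacobians by `f = 1 - O(ε)` absorbs the relative error `b ε` of the regret.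
  obtain ⟨f, hf0, hf1, hf2, hf3⟩ := LQR.exists_shrinkage hb0 hε
  obtain ⟨D, hDk, hDm, hDJ⟩ := LQR.exists_averaged_jacobian (π := π) (T := T) hlam hw hL hε Γ
    ⌊√(T : ℝ)⌋₊
  refine ⟨fun _ => 0, fun k => f • D k - J, hE1, fun k p r => ?_, ?_⟩
  · change |f * D k p r - J p r| ≤ _
    refine (LQR.abs_rescaled_sub_le hf0 hf1 hf2 (hDJ k p r)).trans ?_
    have h1 : b * ε * |J p r| ≤ b * ε * d :=
      mul_le_mul_of_nonneg_left (hJd p r) (mul_nonneg hb0 hε.le)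
    have h2 : 0 ≤ (b + d / ε₁) * ε := by positivity
    nlinarith
  · by_cases htop : (⨆ θ' ∈ Metric.ball θ ε, S.regret μ w ξ π T θ') = ⊤
    · rw [htop]
      exact le_top
    -- The supremum itself serves as the regret bound for every parameter of the ball. The final
    -- inequality is `f² (M + b (1 + ε M)) ≤ M + b`.
    set M := (⨆ θ' ∈ Metric.ball θ ε, S.regret μ w ξ π T θ').toReal with hM
    have hMe : ((M : ℝ) : EReal) = ⨆ θ' ∈ Metric.ball θ ε, S.regret μ w ξ π T θ' :=
      EReal.coe_toReal htop (fun hbot => by rw [hbot] at hreg0; exact absurd hreg0 (by simp))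
    have hM0 : 0 ≤ M := EReal.toReal_nonneg hreg0
    have hC : ∀ ϑ ∈ Metric.ball θ ε, LQR.Controlled S μ w ξ π ϑ T M := fun ϑ hϑ =>
      LQR.Controlled.of_regret_le hw hS.noise hS.Q_posDef hS.R_posDef hM0
        ((le_biSup (fun θ' => S.regret μ w ξ π T θ') hϑ).trans hMe.ge)
    rw [← hMe, EReal.coe_le_coe_iff]
    have key := LQR.sum_trace_terms_le hlam hw hS.noise hS.R_posDef hfin hL hε hε2 hεε₀ ha hN hT
      hM0 hC hΓ hΨ h0 hh hDk hDm
    have hsum : ∑ k ∈ Finset.Icc 1 ⌊√((T : ℝ) - 1)⌋₊,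
            (S.bayesProb μ w ξ π lam Γ T k) ^ 2 *
              Matrix.trace
                ((Γ ⊗ₖ (S.R + (S.B θ)ᵀ * S.P θ * S.B θ + 0))
                  * (J + (f • D k - J))
                  * (√(T : ℝ) • (S.bayesInfo μ w ξ π lam ((k + 1) * ⌊√(T : ℝ)⌋₊)
                      + LQR.locationInfo lam + Ψ)⁻¹)
                  * (J + (f • D k - J))ᵀ)
        = f ^ 2 * ∑ k ∈ Finset.Icc 1 ⌊√((T : ℝ) - 1)⌋₊, S.bayesProb μ w ξ π lam Γ T k ^ 2
      * (√(T : ℝ) * ((Γ ⊗ₖ S.hess θ (S.P θ)) * D k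
        * (S.bayesInfo μ w ξ π lam ((k + 1) * ⌊√(T : ℝ)⌋₊) + LQR.locationInfo lam + Ψ)⁻¹
        * (D k)ᵀ).trace) := by
      rw [Finset.mul_sum]
      refine Finset.sum_congr rfl fun k _ => ?_
      rw [LQR.trace_rescaled, add_zero, LQR.System.hess]
      ring
    refine (sub_le_sub_right (le_of_eq hsum) _).trans ?_
    have h1 := mul_le_mul_of_nonneg_left key (sq_nonneg f)
    have h2 : f ^ 2 * (M + b * (1 + ε * M)) = f ^ 2 * (1 + b * ε) * M + f ^ 2 * b := by ring
    have h3 : f ^ 2 * b ≤ b := mul_le_of_le_one_left hb0 (pow_le_one₀ hf0 hf1)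
    have h4 := mul_nonneg hb0 hd0
    rw [h2, hf3, one_mul] at h1
    linarith
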